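/- **Notation.** For $f\in L^2(\mathbb R)$ put $(\mathsf Ff)(z)=\int f(x)e^{izx}\,dx$ (also for tempered distributions), $F^\sharp(z)=\overline{F(\bar z)}$, $\mathbb C_\pm=\{\pm\Im z>0\}$, and let $\mathsf P_t$ be multiplication by the indicator function of $(-\infty,t)$. Let $S(\mathbb R)$, $S'(\mathbb R)$ be the spaces of Schwartz functions and of tempered distributions. **The function $u$.** Let $u\in L^1_{\rm loc}(\mathbb R)$ with $|u|=1$ almost everywhere, such that (U1) after a change on a null set, $u(0)\neq0$ and $|u(z)-u(0)|\ll|z|^{\alpha}$ as $z\to0$ for some $1/2<\alpha\le1$; (U2) there are a domain $D\supset\mathbb R$ of $\mathbb C$, closed under complex conjugation, and a meromorphic function on $D\setminus\mathbb R$, again denoted by $u$, whose non-tangential limit at $x$ from both $\mathbb C_+$ and $\mathbb C_-$ is $u(x)$ for almost all $x\in\mathbb R$. Call $u$ symmetric if $\overline{u(x)}=u(-x)$ for almost all $x\in\mathbb R$. Let $\mathsf K$ be the antilinear isometric involution of $L^2(\mathbb R)$ with $(\mathsf F\mathsf Kf)(z)=u(z)\overline{(\mathsf Ff)(z)}$ for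 real $z$, and $\mathsf K[t]=\mathsf P_t\mathsf K\mathsf P_t$. For a locally square integrable $f$ outside $L^2(\mathbb R)$, $\mathsf Kf$ is the limit in $S'(\mathbb R)$ of $\mathsf K(\mathbf 1_{[-R,R]}f)$ as $R\to\infty$; the Dirac distribution $\delta_t$ at $t$ has $\mathsf K\delta_t=\mathsf F^{-1}(u(z)e^{-itz})$. **Assumptions.** Let $T\in\mathbb R$ be such that for all $t<T$: (K1) $\|\mathsf K[t]\|_{\rm op}<1$. Then the equations $\Phi+\mathsf K\mathsf P_t\Phi=1$ and $\Psi-\mathsf K\mathsf P_t\Psi=1$ have unique solutions $\Phi=\Phi(t,x)$, $\Psi=\Psi(t,x)$ among the functions that are tempered (integrable against some power $(1+|x|)^{-N}$) and differ from $1$ on $(-\infty,t)$ by a function in $L^2(-\infty,t)$. (K2) For $X\in\{\Phi,\Psi\}$ the derivatives $\partial X/\partial t$ and $\partial(\mathsf FX)/\partial t$ exist at $t$ as tempered distributions of the second variable (that is, tested against each $g\in S(\mathbb R)$), and $\partial(\mathsf FX)/\partial t=\mathsf F(\partial X/\partial t)$. (K3) For $X\in\{\Phi,\Psi\}$ the value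 $X(t,t)$ is well defined and non-zero: there is $X(t,t)\in\mathbb C\setminus\{0\}$ with $\frac1{2\varepsilon}\int_{s-\varepsilon}^{s+\varepsilon}|X(s,x)-X(t,t)|\,dx\to0$ as $s\to t$, $\varepsilon\to0+$. (K4) Either the restriction of $\mathsf K\delta_t$ to $(-\infty,t)$ is a function in $L^2(-\infty,t)$, or for both signs the equation $Y=\pm\mathsf K\mathsf P_tY$ has only the solution $Y=0$ in $S'(\mathbb R)$ (that is, $1\mp\mathsf K[t]$ has zero kernel). Here a solution is a limit $Y$ in $S'(\mathbb R)$ of functions $Y_n\in L^2(\mathbb R)$ with $Y_n=\pm\mathsf K(\mathsf P_{t-\varepsilon_n}Y_n+r_n)$, where $\varepsilon_n\to0+$, $r_n\in L^2(\mathbb R)$ vanishes for $|x-t|>\varepsilon_n$, and $\|r_n\|_{L^1}\to0$. **Theorem.** Put $$\tilde A(t,z)=-\tfrac{iz}2\,(\mathsf F(1-\mathsf P_t)\Psi)(z),\qquad -i\tilde B(t,z)=-\tfrac{iz}2\,(\mathsf F(1-\mathsf P_t)\Phi)(z).$$ Then: 1. For each $t<T$, $\tilde A(t,\cdot)$ and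 $\tilde B(t,\cdot)$ are well-defined tempered distributions on $\mathbb R$; they are given by functions $\tilde A(t,x)$, $\tilde B(t,x)$ of $x\in\mathbb R$ that are integrable against some power $(1+|x|)^{-N}$. 2. For each $t<T$ they extend to meromorphic functions on $(\mathbb C_+\cup D)\setminus\mathbb R$, holomorphic on $\mathbb C_+$, where they are given by the absolutely convergent integrals $(\mathsf F(1-\mathsf P_t)\Psi)(z)=\int_t^\infty\Psi(t,x)e^{izx}dx$ and $(\mathsf F(1-\mathsf P_t)\Phi)(z)=\int_t^\infty\Phi(t,x)e^{izx}dx$. They are analytic at each real point to a neighbourhood of which $u|_{D\setminus\mathbb R}$ continues analytically. 3. For each $t<T$ and almost all $x\in\mathbb R$, $\tilde A(t,z)\to\tilde A(t,x)$ and $\tilde B(t,z)\to\tilde B(t,x)$ as $z\to x$ non-tangentially in $\mathbb C_+$ or in $\mathbb C_-$. 4. $\tilde A(t,z)=u(z)\tilde A^\sharp(t,z)$ and $\tilde B(t,z)=u(z)\tilde B^\sharp(t,z)$ on $D$: at each $z\in D\setminus\mathbb R$ where the factors on the right are analytic, and for almost all $z\in\mathbb R$. 5. $\tilde A(t,z)$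 and $\tilde B(t,z)$ are continuous in $t<T$ for each fixed $z\in\mathbb C_+\cup D$ that is not a singularity (for real $z$: such that $u|_{D\setminus\mathbb R}$ continues analytically to a neighbourhood of $z$); as tempered distributions on $\mathbb R$ they are weakly continuous in $t<T$. 6. Let $H(t)=\begin{bmatrix}\alpha(t)&\beta(t)\\ \beta(t)&\gamma(t)\end{bmatrix}$, where, with $\Phi=\Phi(t,t)$ and $\Psi=\Psi(t,t)$, $$\alpha=\frac{|\Phi|^2}{\Re(\Phi\overline\Psi)}=\frac1{\Re(\Psi/\Phi)},\quad \beta=\frac{\Im(\Phi\overline\Psi)}{\Re(\Phi\overline\Psi)}=\frac{\Im(\Phi/\Psi)}{\Re(\Phi/\Psi)}=-\frac{\Im(\Psi/\Phi)}{\Re(\Psi/\Phi)},\quad \gamma=\frac{|\Psi|^2}{\Re(\Phi\overline\Psi)}=\frac1{\Re(\Phi/\Psi)},$$ and $\Re(\Phi\overline\Psi)\ne0$. Then $$-\frac{\partial}{\partial t}\begin{bmatrix}\tilde A(t,z)\\ \tilde B(t,z)\end{bmatrix}=z\begin{bmatrix}0&-1\\1&0\end{bmatrix}H(t)\begin{bmatrix}\tilde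 A(t,z)\\ \tilde B(t,z)\end{bmatrix}$$ for $t<T$ and each $z\in\mathbb C_+\cup D$ that is not a singularity in the sense of 5, and also in the sense of tempered distributions of $z\in\mathbb R$. 7. $H(t)\in{\rm SL}_2(\mathbb R)\cap{\rm Sym}_2(\mathbb R)$ for all $t<T$, and $H(t)$ is diagonal if $u$ is symmetric. -/

import Mathlib

open MeasureTheory Filter Topology Set
open scoped FourierTransform SchwartzMap ComplexConjugate

noncomputable section

namespace UniSys

/-! ### Function spaces and the Fourier transform `(F f)(z) = ∫ f(x) e^{izx} dx` -/

/-- The Hilbert space `L²(ℝ)`. -/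
abbrev L2 := Lp ℂ 2 (volume : Measure ℝ)

/-- The class in `L²(ℝ)` of a square integrable function (and `0` for all other functions). -/
def toL2 (f : ℝ → ℂ) : L2 :=
  open Classical in if h : MemLp f 2 (volume : Measure ℝ) then h.toLp f else 0

/-- The homeothety `z ↦ -z / (2π)` of the real line. -/
def freqScale : ℝ ≃L[ℝ] ℝ :=
  ContinuousLinearEquiv.unitsEquivAut ℝ
    (Units.mk0 (-(2 * Real.pi)⁻¹) (neg_ne_zero.mpr (inv_ne_zero Real.two_pi_pos.ne')))

/-- The Fourier transform `(F g)(z) = ∫ g(x) e^{izx} dx` of Schwartz functions. -/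
def fourierS : 𝓢(ℝ, ℂ) →L[ℂ] 𝓢(ℝ, ℂ) :=
  (SchwartzMap.compCLMOfContinuousLinearEquiv ℂ freqScale).comp
    (FourierTransform.fourierCLM ℂ 𝓢(ℝ, ℂ))

theorem fourierS_apply (g : 𝓢(ℝ, ℂ)) (z : ℝ) :
    fourierS g z = ∫ x : ℝ, g x * Complex.exp (Complex.I * z * x) := by
  have h : fourierS g z = (𝓕 g) (z * -(2 * Real.pi)⁻¹) := rfl
  rw [h, SchwartzMap.fourier_coe, Real.fourier_real_eq_integral_exp_smul]
  refine integral_congr_ae (Eventually.of_forall fun x => ?_)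
  simp only [smul_eq_mul]
  rw [mul_comm]
  congr 2
  have hp : (Real.pi : ℂ) ≠ 0 := by exact_mod_cast Real.pi_ne_zero
  push_cast
  field_simp

/-- Multiplication of a Schwartz function by a function of temperate growth. -/
def mulS (m : ℝ → ℂ) : 𝓢(ℝ, ℂ) →L[ℂ] 𝓢(ℝ, ℂ) := SchwartzMap.smulLeftCLM ℂ m

/-- `f` is a measurable function on `ℝ` such that `g ↦ ∫ f g` is a tempered distribution because
`f` is integrable against some negative power of `1 + |x|`. -/
def IsTempered (f : ℝ → ℂ) : Prop :=
  ∃ N : ℕ, Integrable (fun x : ℝ => ((1 + |x|) ^ N)⁻¹ • f x) volume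

/-! ### The conjugation `K` attached to a unimodular function -/

/-- The antilinear map `K = F⁻¹ M_u J F` of `L²(ℝ)`, that is `(F K f)(z) = u(z) * conj ((F f)(z))`
for real `z`. It is written here with the transform `(𝓕 f)(w) = ∫ f(x) e^{-2πiwx} dx`, for which
`(𝓕 f)(w) = (F f)(-2πw)`. -/
def K (u : ℝ → ℂ) (f : L2) : L2 :=
  𝓕⁻ (toL2 fun w : ℝ => u (-(2 * Real.pi * w)) * conj ((𝓕 f : L2) w))

/-- The orthogonal projection `P_t` of `L²(ℝ)` onto `L²(-∞, t)`. -/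
def P (t : ℝ) (f : L2) : L2 := toL2 ((Iio t).indicator f)

/-- The operator norm of the compression `K[t] = P_t K P_t`. -/
def compressionNorm (u : ℝ → ℂ) (t : ℝ) : ℝ :=
  sInf {c : ℝ | 0 ≤ c ∧ ∀ f : L2, ‖P t (K u (P t f))‖ ≤ c * ‖f‖}

/-- The extension of `K` beyond `L²(ℝ)`: for a locally square integrable `f`, the tempered
function `g` is `K f` if `K (1_{[-R,R]} f) → g` as tempered distributions for `R → ∞`. -/
def HasK (u : ℝ → ℂ) (f g : ℝ → ℂ) : Prop :=
  (∀ R : ℝ, MemLp ((Icc (-R) R).indicator f) 2 (volume : Measure ℝ)) ∧ IsTempered g ∧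
    ∀ φ : 𝓢(ℝ, ℂ),
      Tendsto (fun R : ℝ => ∫ x, (K u (toL2 ((Icc (-R) R).indicator f)) : L2) x * φ x) atTop
        (𝓝 (∫ x, g x * φ x))

/-! ### The class of unimodular functions -/

/-- `c` is the non-tangential limit of `F` at the real point `x`, from both half-planes: for each
aperture `M`, `F(w) → c` as `w → x` in the double cone `|Re w - x| < M |Im w|`. -/
def NTLim (F : ℂ → ℂ) (x : ℝ) (c : ℂ) : Prop :=
  ∀ M : ℝ, 0 < M → Tendsto F (𝓝[{w : ℂ | |w.re - x| < M * |w.im|}] (x : ℂ)) (𝓝 c)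

/-- `u` is a locally integrable unimodular function on `ℝ`, Hölder continuous at `0` with an
exponent larger than `1/2` (after a change on a null set), and almost everywhere the two-sided
non-tangential limit of a meromorphic function `U` on `D \ ℝ`, where `D` is a domain that contains
`ℝ` and is closed under complex conjugation. -/
structure IsUloc (u : ℝ → ℂ) (D : Set ℂ) (U : ℂ → ℂ) : Prop where
  locInt : LocallyIntegrable u volume
  unimodular : ∀ᵐ x : ℝ, ‖u x‖ = 1
  holder : ∃ c : ℂ, c ≠ 0 ∧ ∃ α : ℝ, 1 / 2 < α ∧ α ≤ 1 ∧ ∃ C δ : ℝ, 0 < δ ∧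
    ∀ᵐ x : ℝ, |x| < δ → ‖u x - c‖ ≤ C * |x| ^ α
  isOpen : IsOpen D
  connected : IsConnected D
  real_mem : ∀ x : ℝ, (x : ℂ) ∈ D
  conj_mem : ∀ z ∈ D, conj z ∈ D
  mero : MeromorphicOn U (D \ {z : ℂ | z.im = 0})
  ntlim : ∀ᵐ x : ℝ, NTLim U x (u x)

/-- `u` is symmetric: `conj (u(x)) = u(-x)` on the real line. -/
def IsSymmetricU (u : ℝ → ℂ) : Prop := ∀ᵐ x : ℝ, conj (u x) = u (-x)

/-! ### The functions `Φ` and `Ψ` -/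

/-- `f` solves `f + σ K P_t f = 1` (with `σ = ±1`) and `f - 1` is square integrable
on `(-∞, t)`. -/
def IsSolution (u : ℝ → ℂ) (σ : ℂ) (t : ℝ) (f : ℝ → ℂ) : Prop :=
  IsTempered f ∧ MemLp (fun x => f x - 1) 2 (volume.restrict (Iio t)) ∧
    HasK u ((Iio t).indicator f) (fun x => σ * (1 - f x))

/-- The solution `Φ(t, ·)` of `Φ + K P_t Φ = 1`. -/
def Phi (u : ℝ → ℂ) (t : ℝ) : ℝ → ℂ := Classical.epsilon (IsSolution u 1 t)

/-- The solution `Ψ(t, ·)` of `Ψ - K P_t Ψ = 1`. -/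
def Psi (u : ℝ → ℂ) (t : ℝ) : ℝ → ℂ := Classical.epsilon (IsSolution u (-1) t)

/-- The function `F(t, x)` of two variables has the value `c` at the diagonal point `(t, t)`: the
mean of `|F(s, x) - c|` over `|x - s| < ε` tends to `0` as `s → t` and `ε → 0+`. -/
def HasDiagValue (F : ℝ → ℝ → ℂ) (t : ℝ) (c : ℂ) : Prop :=
  Tendsto (fun p : ℝ × ℝ => (2 * p.2)⁻¹ * ∫ x in (p.1 - p.2)..(p.1 + p.2), ‖F p.1 x - c‖)
    (𝓝 t ×ˢ 𝓝[>] 0) (𝓝 0)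

/-- The value `F(t, t)`, as the limit of the means of `F(t, ·)` around `t`. -/
def diagVal (F : ℝ → ℝ → ℂ) (t : ℝ) : ℂ :=
  limUnder (𝓝[>] (0 : ℝ)) fun ε : ℝ => ((2 * ε)⁻¹ : ℝ) • ∫ x in (t - ε)..(t + ε), F t x

/-! ### The technical conditions at a given `t` -/

/-- `∂F/∂t` and `∂(𝖥F)/∂t` exist at `t` as tempered distributions in the second variable, and
`∂(𝖥F)/∂t = 𝖥(∂F/∂t)`, where `𝖥` is the Fourier transform in the second variable. -/
def HasTemperedDeriv (F : ℝ → ℝ → ℂ) (t : ℝ) : Prop :=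
  ∃ X Z : TemperedDistribution ℝ ℂ,
    (∀ g : 𝓢(ℝ, ℂ), HasDerivAt (fun s => ∫ x, F s x * g x) (X g) t) ∧
    (∀ g : 𝓢(ℝ, ℂ), HasDerivAt (fun s => ∫ x, F s x * fourierS g x) (Z g) t) ∧
    ∀ g : 𝓢(ℝ, ℂ), Z g = X (fourierS g)

/-- Condition (K2) at `t`. -/
def CondK2 (u : ℝ → ℂ) (t : ℝ) : Prop :=
  HasTemperedDeriv (Phi u) t ∧ HasTemperedDeriv (Psi u) t

/-- Condition (K3) at `t`. -/
def CondK3 (u : ℝ → ℂ) (t : ℝ) : Prop :=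
  (∃ c : ℂ, c ≠ 0 ∧ HasDiagValue (Phi u) t c) ∧ ∃ c : ℂ, c ≠ 0 ∧ HasDiagValue (Psi u) t c

/-- The tempered distribution `K δ_t = F⁻¹(u(z) e^{-itz})`, evaluated at `g`. -/
def KDelta (u : ℝ → ℂ) (t : ℝ) (g : 𝓢(ℝ, ℂ)) : ℂ :=
  (2 * Real.pi : ℂ)⁻¹ * ∫ z : ℝ, u z * Complex.exp (-(Complex.I * t * z)) * fourierS g (-z)

/-- The restriction of `K δ_t` to `(-∞, t)` is a square integrable function. -/
def KDeltaSqIntegrable (u : ℝ → ℂ) (t : ℝ) : Prop :=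
  ∃ w : L2, ∀ g : 𝓢(ℝ, ℂ), tsupport g ⊆ Iio t → KDelta u t g = ∫ x, w x * g x

/-- `Y` is a solution in the space of tempered distributions of `Y = σ K P_t Y`, equivalently
`f = P_t Y` satisfies `f = σ P_t K f` and `Y = σ K f`. Neither the multiplication by the indicator
function of `(-∞, t)` nor the one by `u` acts on all tempered distributions, so the equation is
understood as a limit of equations in `L²(ℝ)`: `Y_n → Y` as tempered distributions, where
`Y_n = σ K (P_{t - ε_n} Y_n + r_n)` with `ε_n → 0` and errors `r_n` that vanish
for `|x - t| > ε_n` and tend to `0` in `L¹`. -/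
def IsKernelElement (u : ℝ → ℂ) (σ : ℂ) (t : ℝ) (Y : TemperedDistribution ℝ ℂ) : Prop :=
  ∃ (ε : ℕ → ℝ) (y r : ℕ → L2),
    (∀ n, 0 < ε n) ∧ Tendsto ε atTop (𝓝 0) ∧
    (∀ n, ∀ᵐ x : ℝ, ε n < |x - t| → r n x = 0) ∧
    Tendsto (fun n => ∫ x, ‖r n x‖) atTop (𝓝 0) ∧
    (∀ n, y n = σ • K u (P (t - ε n) (y n) + r n)) ∧
    ∀ g : 𝓢(ℝ, ℂ), Tendsto (fun n => ∫ x, y n x * g x) atTop (𝓝 (Y g))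

/-- Condition (K4) at `t`: either `P_t K δ_t` is a function in `L²(-∞, t)`, or the kernels of
`1 ± K[t]` on tempered distributions are zero. -/
def CondK4 (u : ℝ → ℂ) (t : ℝ) : Prop :=
  KDeltaSqIntegrable u t ∨
    ((∀ Y, IsKernelElement u 1 t Y → Y = 0) ∧ ∀ Y, IsKernelElement u (-1) t Y → Y = 0)

/-! ### The Hamiltonian -/

/-- `α = |Φ|² / Re(Φ conj Ψ)` at the diagonal point `(t, t)`. -/
def hamAlpha (u : ℝ → ℂ) (t : ℝ) : ℝ :=
  ‖diagVal (Phi u) t‖ ^ 2 / (diagVal (Phi u) t * conj (diagVal (Psi u) t)).re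

/-- `β = Im(Φ conj Ψ) / Re(Φ conj Ψ)` at the diagonal point `(t, t)`. -/
def hamBeta (u : ℝ → ℂ) (t : ℝ) : ℝ :=
  (diagVal (Phi u) t * conj (diagVal (Psi u) t)).im /
    (diagVal (Phi u) t * conj (diagVal (Psi u) t)).re

/-- `γ = |Ψ|² / Re(Φ conj Ψ)` at the diagonal point `(t, t)`. -/
def hamGamma (u : ℝ → ℂ) (t : ℝ) : ℝ :=
  ‖diagVal (Psi u) t‖ ^ 2 / (diagVal (Phi u) t * conj (diagVal (Psi u) t)).re

/-- The Hamiltonian `H(t)`. -/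
def Ham (u : ℝ → ℂ) (t : ℝ) : Matrix (Fin 2) (Fin 2) ℝ :=
  !![hamAlpha u t, hamBeta u t; hamBeta u t, hamGamma u t]

/-- The coefficient matrix `J H(t)` of the first order system, with `J = [0, -1; 1, 0]`. -/
def coeffMat (u : ℝ → ℂ) (t : ℝ) : Matrix (Fin 2) (Fin 2) ℂ :=
  !![0, -1; 1, 0] * (Ham u t).map (fun r : ℝ => (r : ℂ))

/-! ### Regular points of the extended functions -/

/-- The open upper half-plane. -/
def upperHP : Set ℂ := {z : ℂ | 0 < z.im}

/-- The real line in the complex plane. -/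
def realLine : Set ℂ := {z : ℂ | z.im = 0}

/-- `U`, given off the real line, continues analytically to a neighbourhood of `z`. -/
def ContinuesAt (U : ℂ → ℂ) (z : ℂ) : Prop :=
  ∃ V : ℂ → ℂ, AnalyticAt ℂ V z ∧ ∀ᶠ w in 𝓝 z, w.im ≠ 0 → V w = U w

/-- `z` is not a singularity of the family `A(s, ·)` for `s` near `t`. For real `z` this is
expressed through the function `U`. -/
def NonSingular (U : ℂ → ℂ) (A : ℝ → ℂ → ℂ) (t : ℝ) (z : ℂ) : Prop :=
  (z.im ≠ 0 ∧ ∀ᶠ s in 𝓝 t, AnalyticAt ℂ (A s) z) ∨ (z.im = 0 ∧ ContinuesAt U z)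

end UniSys

end

open UniSys

noncomputable section

namespace UniSys

open Complex (I)
open Metric (ball closedBall sphere)

/-! ### Square integrable functions -/

theorem toL2_eq {f : ℝ → ℂ} (h : MemLp f 2 (volume : Measure ℝ)) : toL2 f = h.toLp f := by
  simp [toL2, h]

theorem coeFn_toL2 {f : ℝ → ℂ} (h : MemLp f 2 (volume : Measure ℝ)) : toL2 f =ᵐ[volume] f := by
  rw [toL2_eq h]; exact h.coeFn_toLp

theorem memLp_coe (f : L2) : MemLp f 2 (volume : Measure ℝ) := Lp.memLp f

theorem toL2_coe (f : L2) : toL2 f = f := by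
  rw [toL2_eq (memLp_coe f)]; exact Lp.toLp_coeFn f _

theorem toL2_congr {f g : ℝ → ℂ} (hf : MemLp f 2 (volume : Measure ℝ)) (h : f =ᵐ[volume] g) :
    toL2 f = toL2 g := by
  rw [toL2_eq hf, toL2_eq (hf.ae_eq h)]
  exact (MemLp.toLp_eq_toLp_iff _ _).2 h

theorem eq_toL2 {f : L2} {g : ℝ → ℂ} (h : f =ᵐ[volume] g) : f = toL2 g := by
  rw [← toL2_coe f]; exact toL2_congr (memLp_coe f) h

theorem memLp_indicator_Iio (t : ℝ) (f : L2) :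
    MemLp ((Iio t).indicator f) 2 (volume : Measure ℝ) := (memLp_coe f).indicator measurableSet_Iio

theorem P_coe (t : ℝ) (f : L2) : P t f =ᵐ[volume] (Iio t).indicator f :=
  coeFn_toL2 (memLp_indicator_Iio t f)

theorem P_add (t : ℝ) (f g : L2) : P t (f + g) = P t f + P t g := by
  apply Lp.ext
  filter_upwards [P_coe t (f + g), P_coe t f, P_coe t g, Lp.coeFn_add f g,
    Lp.coeFn_add (P t f) (P t g)] with x h1 h2 h3 h4 h5
  rw [h1, h5, Pi.add_apply, h2, h3]
  by_cases hx : x ∈ Iio t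
  · simp only [indicator_of_mem hx, h4, Pi.add_apply]
  · simp [hx]

theorem P_smul (t : ℝ) (c : ℂ) (f : L2) : P t (c • f) = c • P t f := by
  apply Lp.ext
  filter_upwards [P_coe t (c • f), P_coe t f, Lp.coeFn_smul c f,
    Lp.coeFn_smul c (P t f)] with x h1 h2 h3 h4
  rw [h1, h4, Pi.smul_apply, h2]
  by_cases hx : x ∈ Iio t
  · simp only [indicator_of_mem hx, h3, Pi.smul_apply]
  · simp [hx]

theorem norm_P_le (t : ℝ) (f : L2) : ‖P t f‖ ≤ ‖f‖ := by
  refine Lp.norm_le_norm_of_ae_le ?_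
  filter_upwards [P_coe t f] with x hx
  rw [hx]; exact norm_indicator_le_norm_self _ _

/-- The projection `P_t` as a continuous linear map. -/
def Pl (t : ℝ) : L2 →L[ℂ] L2 :=
  LinearMap.mkContinuous
    { toFun := P t, map_add' := P_add t, map_smul' := P_smul t } 1
    (fun f => by simpa using norm_P_le t f)

theorem P_sub (t : ℝ) (f g : L2) : P t (f - g) = P t f - P t g := map_sub (Pl t) f g

theorem P_eq_of_ae {t : ℝ} {f g : L2} (h : ∀ᵐ x : ℝ, x < t → f x = g x) : P t f = P t g := by
  apply Lp.ext
  filter_upwards [P_coe t f, P_coe t g, h] with x h1 h2 h3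
  rw [h1, h2]
  by_cases hx : x ∈ Iio t
  · simp [hx, h3 hx]
  · simp [hx]

theorem P_eq_self {t : ℝ} {f : L2} (h : ∀ᵐ x : ℝ, t ≤ x → f x = 0) : P t f = f := by
  apply Lp.ext
  filter_upwards [P_coe t f, h] with x h1 h3
  rw [h1]
  by_cases hx : x < t
  · simp [hx]
  · simp [hx, h3 (not_lt.1 hx)]

theorem P_ae_zero (t : ℝ) (f : L2) : ∀ᵐ x : ℝ, t ≤ x → P t f x = 0 := by
  filter_upwards [P_coe t f] with x h1 hx
  rw [h1]; simp [hx]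

theorem P_ae_eq (t : ℝ) (f : L2) : ∀ᵐ x : ℝ, x < t → P t f x = f x := by
  filter_upwards [P_coe t f] with x h1 hx
  rw [h1]; simp [hx]

theorem P_P {s t : ℝ} (h : s ≤ t) (f : L2) : P s (P t f) = P s f :=
  P_eq_of_ae (by filter_upwards [P_ae_eq t f] with x hx hxs using hx (hxs.trans_le h))

theorem P_P' {s t : ℝ} (h : s ≤ t) (f : L2) : P t (P s f) = P s f :=
  P_eq_self (by filter_upwards [P_ae_zero s f] with x hx hxs using hx (h.trans hxs))

theorem integrable_mul_L2 {f g : ℝ → ℂ} (hf : MemLp f 2 (volume : Measure ℝ))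
    (hg : MemLp g 2 (volume : Measure ℝ)) : Integrable (fun x => f x * g x) := by
  have := hf.integrable_mul hg
  exact this

theorem memLp_schwartz (g : 𝓢(ℝ, ℂ)) : MemLp g 2 (volume : Measure ℝ) := g.memLp 2 volume

theorem toL2_schwartz (g : 𝓢(ℝ, ℂ)) : toL2 g = g.toLp 2 volume := toL2_eq (memLp_schwartz g)

theorem inner_eq_integral (f g : L2) : inner ℂ f g = ∫ x, conj (f x) * g x := by
  rw [L2.inner_def]
  refine integral_congr_ae (Eventually.of_forall fun x => ?_)
  simp [mul_comm]

theorem integral_mul_eq_inner (f : L2) (g : ℝ → ℂ) (hg : MemLp g 2 (volume : Measure ℝ)) :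
    ∫ x, f x * g x = inner ℂ (toL2 fun x => conj (g x)) f := by
  have hg' : MemLp (fun x => conj (g x)) 2 (volume : Measure ℝ) := hg.star
  rw [inner_eq_integral]
  refine integral_congr_ae ?_
  filter_upwards [coeFn_toL2 hg'] with x hx
  rw [hx]; simp [mul_comm]

theorem norm_toL2_conj (g : ℝ → ℂ) (hg : MemLp g 2 (volume : Measure ℝ)) :
    ‖toL2 fun x => conj (g x)‖ = ‖toL2 g‖ := by
  have hg' : MemLp (fun x => conj (g x)) 2 (volume : Measure ℝ) := hg.star
  refine le_antisymm (Lp.norm_le_norm_of_ae_le ?_) (Lp.norm_le_norm_of_ae_le ?_) <;>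
  · filter_upwards [coeFn_toL2 hg', coeFn_toL2 hg] with x hx hy
    rw [hx, hy]; simp

theorem norm_integral_mul_le (f : L2) (g : ℝ → ℂ) (hg : MemLp g 2 (volume : Measure ℝ)) :
    ‖∫ x, f x * g x‖ ≤ ‖f‖ * ‖toL2 g‖ := by
  rw [integral_mul_eq_inner f g hg, ← norm_toL2_conj g hg, mul_comm]
  exact norm_inner_le_norm _ _

theorem tendsto_integral_mul {ι : Type*} {l : Filter ι} {F : ι → L2} {f : L2}
    (h : Tendsto F l (𝓝 f)) (g : ℝ → ℂ) (hg : MemLp g 2 (volume : Measure ℝ)) :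
    Tendsto (fun i => ∫ x, F i x * g x) l (𝓝 (∫ x, f x * g x)) := by
  simp_rw [integral_mul_eq_inner _ g hg]
  exact (continuous_const.inner continuous_id).continuousAt.tendsto.comp h

theorem norm_sq_eq_integral (f : L2) : ‖f‖ ^ 2 = ∫ x, ‖f x‖ ^ 2 := by
  have h : inner ℂ f f = ((‖f‖ : ℂ)) ^ 2 := inner_self_eq_norm_sq_to_K f
  rw [inner_eq_integral] at h
  have h2 : (∫ x, conj (f x) * f x) = ((∫ x, ‖f x‖ ^ 2 : ℝ) : ℂ) := by
    rw [← integral_complex_ofReal]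
    refine integral_congr_ae (Eventually.of_forall fun x => ?_)
    simp [Complex.conj_mul']
  rw [h2] at h
  exact_mod_cast h.symm

/-- Locally integrable functions with the same integrals against Schwartz functions agree. -/
theorem ae_eq_of_schwartz {f g : ℝ → ℂ} (hf : LocallyIntegrable f) (hg : LocallyIntegrable g)
    (h : ∀ φ : 𝓢(ℝ, ℂ), ∫ x, f x * φ x = ∫ x, g x * φ x) : f =ᵐ[volume] g := by
  refine ae_eq_of_integral_contDiff_smul_eq hf hg fun φ h1 h2 => ?_
  have hs : HasCompactSupport (fun x => (φ x : ℂ)) := h2.comp_left (g := fun x : ℝ => (x : ℂ)) rfl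
  have := h (hs.toSchwartzMap (Complex.ofRealCLM.contDiff.comp h1))
  simp only [Complex.real_smul, mul_comm (Complex.ofReal _)]
  exact this

theorem L2_locallyIntegrable (f : L2) : LocallyIntegrable f volume :=
  (memLp_coe f).locallyIntegrable (by norm_num)

/-! ### The Fourier transform of square integrable functions -/

theorem integral_fourier_mul (f : L2) (φ : 𝓢(ℝ, ℂ)) :
    ∫ x, (𝓕 f : L2) x * φ x = ∫ x, f x * (𝓕 φ) x := by
  have h := congrArg (fun X : TemperedDistribution ℝ ℂ => X φ)
    (Lp.fourier_toTemperedDistribution_eq f)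
  simp only [TemperedDistribution.fourier_apply, Lp.toTemperedDistribution_apply] at h
  simpa [mul_comm] using h.symm

theorem integral_fourierInv_mul (f : L2) (φ : 𝓢(ℝ, ℂ)) :
    ∫ x, (𝓕⁻ f : L2) x * φ x = ∫ x, f x * (𝓕⁻ φ) x := by
  have h := congrArg (fun X : TemperedDistribution ℝ ℂ => X φ)
    (Lp.fourierInv_toTemperedDistribution_eq f)
  simp only [TemperedDistribution.fourierInv_apply, Lp.toTemperedDistribution_apply] at h
  simpa [mul_comm] using h.symm

theorem locallyIntegrable_fourier {f : ℝ → ℂ} (hf : Integrable f) :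
    LocallyIntegrable (𝓕 f) volume := by
  have : Continuous (𝓕 f) :=
    VectorFourier.fourierIntegral_continuous Real.continuous_fourierChar
      (by exact continuous_inner) hf
  exact this.locallyIntegrable

theorem fourier_toL2_ae {f : ℝ → ℂ} (hf : MemLp f 2 (volume : Measure ℝ)) (h1 : Integrable f) :
    (𝓕 (toL2 f) : L2) =ᵐ[volume] 𝓕 f := by
  refine ae_eq_of_schwartz (L2_locallyIntegrable _) (locallyIntegrable_fourier h1) fun φ => ?_
  rw [integral_fourier_mul]
  have h2 := VectorFourier.integral_fourierIntegral_smul_eq_flip (L := innerₗ ℝ)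
    (μ := volume) (ν := volume) (e := Real.fourierChar) (f := f) (g := φ)
    Real.continuous_fourierChar continuous_inner h1 φ.integrable
  have h3 : ∫ x, 𝓕 f x * φ x = ∫ x, f x * (𝓕 (φ : ℝ → ℂ)) x := by
    rw [show (𝓕 (φ : ℝ → ℂ)) = VectorFourier.fourierIntegral Real.fourierChar volume
      (innerₗ ℝ).flip φ by rw [flip_innerₗ]; rfl]
    exact h2
  rw [h3]
  refine integral_congr_ae ?_
  filter_upwards [coeFn_toL2 hf] with x hx
  rw [hx, SchwartzMap.fourier_coe]

theorem fourierInv_toL2_ae {f : ℝ → ℂ} (hf : MemLp f 2 (volume : Measure ℝ)) (h1 : Integrable f) :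
    (𝓕⁻ (toL2 f) : L2) =ᵐ[volume] 𝓕⁻ f := by
  have hc : LocallyIntegrable (𝓕⁻ f) volume := by
    have : Continuous (𝓕 f) :=
      VectorFourier.fourierIntegral_continuous Real.continuous_fourierChar
        (by exact continuous_inner) h1
    have h2 : (𝓕⁻ f) = fun x => 𝓕 f (-x) := by
      ext x; exact Real.fourierInv_eq_fourier_neg f x
    rw [h2]
    exact (this.comp continuous_neg).locallyIntegrable
  refine ae_eq_of_schwartz (L2_locallyIntegrable _) hc fun φ => ?_
  rw [integral_fourierInv_mul]
  have h2 := VectorFourier.integral_fourierIntegral_smul_eq_flip (L := -innerₗ ℝ)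
    (μ := volume) (ν := volume) (e := Real.fourierChar) (f := f) (g := φ)
    Real.continuous_fourierChar (by simpa using! continuous_inner.neg) h1 φ.integrable
  have h3 : ∫ x, 𝓕⁻ f x * φ x = ∫ x, f x * (𝓕⁻ (φ : ℝ → ℂ)) x := by
    rw [show (𝓕⁻ (φ : ℝ → ℂ)) = VectorFourier.fourierIntegral Real.fourierChar volume
      (-innerₗ ℝ).flip φ by
        rw [show (-innerₗ ℝ).flip = -innerₗ ℝ by ext; simp]; rfl]
    exact h2
  rw [h3]
  refine integral_congr_ae ?_
  filter_upwards [coeFn_toL2 hf] with x hx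
  rw [hx, SchwartzMap.fourierInv_coe]

/-! ### Translations -/

theorem measurePreserving_add_const (h : ℝ) :
    MeasurePreserving (fun x : ℝ => x + h) volume volume := measurePreserving_add_right volume h

/-- The translation `f ↦ f(· + h)` of `L²(ℝ)`. -/
def tr (h : ℝ) : L2 →ₗᵢ[ℂ] L2 :=
  Lp.compMeasurePreservingₗᵢ ℂ (fun x : ℝ => x + h) (measurePreserving_add_const h)

theorem tr_coe (h : ℝ) (f : L2) : tr h f =ᵐ[volume] fun x => f (x + h) :=
  Lp.coeFn_compMeasurePreserving f (measurePreserving_add_const h)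

theorem ae_comp_add {p : ℝ → Prop} (hp : ∀ᵐ x : ℝ, p x) (h : ℝ) : ∀ᵐ x : ℝ, p (x + h) :=
  (measurePreserving_add_const h).quasiMeasurePreserving.ae hp

theorem memLp_comp_add {f : ℝ → ℂ} (hf : MemLp f 2 (volume : Measure ℝ)) (h : ℝ) :
    MemLp (fun x => f (x + h)) 2 (volume : Measure ℝ) :=
  hf.comp_measurePreserving (measurePreserving_add_const h)

theorem tr_toL2 {f : ℝ → ℂ} (hf : MemLp f 2 (volume : Measure ℝ)) (h : ℝ) :
    tr h (toL2 f) = toL2 fun x => f (x + h) := by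
  apply eq_toL2
  filter_upwards [tr_coe h (toL2 f), ae_comp_add (coeFn_toL2 hf) h] with x h1 h2
  rw [h1, h2]

theorem tr_tr (a b : ℝ) (f : L2) : tr a (tr b f) = tr (a + b) f := by
  apply Lp.ext
  filter_upwards [tr_coe a (tr b f), ae_comp_add (tr_coe b f) a, tr_coe (a + b) f] with x h1 h2 h3
  rw [h1, h2, h3, add_assoc]

theorem tr_zero (f : L2) : tr 0 f = f := by
  apply Lp.ext
  filter_upwards [tr_coe 0 f] with x h1
  rw [h1, add_zero]

theorem continuous_tr (f : L2) : Continuous fun h => tr h f := by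
  refine Continuous.compMeasurePreservingLp (p := 2) (f := fun _ : ℝ => f)
    (g := fun h : ℝ => ⟨fun x : ℝ => x + h, by fun_prop⟩) continuous_const ?_
    (fun h => measurePreserving_add_const h) (by norm_num)
  refine ContinuousMap.continuous_of_continuous_uncurry _ ?_
  exact continuous_snd.add continuous_fst

theorem norm_exp_real_mul_I {a : ℝ} {c : ℂ} (hc : c = a * I) : ‖Complex.exp c‖ = 1 := by
  rw [hc]; exact Complex.norm_exp_ofReal_mul_I a

theorem hasTemperateGrowth_exp (a : ℝ) :
    Function.HasTemperateGrowth fun w : ℝ => Complex.exp (a * w * I) := by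
  have h1 : ∀ n : ℕ, iteratedDeriv n (fun w : ℝ => Complex.exp (a * w * I)) =
      fun w : ℝ => (a * I) ^ n * Complex.exp (a * w * I) := by
    intro n
    induction n with
    | zero => simp
    | succ n ih =>
      rw [iteratedDeriv_succ, ih]
      ext w
      have h2 : HasDerivAt (fun w : ℝ => (a * w * I : ℂ)) (a * 1 * I) w :=
        ((Complex.ofRealCLM.hasDerivAt (x := w)).const_mul (a : ℂ)).mul_const I
      rw [(h2.cexp.const_mul _).deriv]
      ring
  refine ⟨((contDiff_const.mul Complex.ofRealCLM.contDiff).mul contDiff_const).cexp, fun n => ⟨0, |a| ^ n, fun w => ?_⟩⟩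
  rw [norm_iteratedFDeriv_eq_norm_iteratedDeriv, h1, norm_mul, norm_pow, norm_mul,
    norm_exp_real_mul_I (a := a * w) (by push_cast; ring)]
  simp

theorem fourier_tr (h : ℝ) (f : L2) :
    (𝓕 (tr h f) : L2) =ᵐ[volume]
      fun w : ℝ => Complex.exp (2 * Real.pi * h * w * I) * (𝓕 f : L2) w := by
  have hm : Continuous fun w : ℝ => Complex.exp (2 * Real.pi * h * w * I) := by fun_prop
  have hn : ∀ w : ℝ, ‖Complex.exp (2 * Real.pi * h * w * I)‖ = 1 := fun w => by
    exact norm_exp_real_mul_I (a := 2 * Real.pi * h * w) (by push_cast; ring)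
  have hmem : MemLp (fun w : ℝ => Complex.exp (2 * Real.pi * h * w * I) * (𝓕 f : L2) w) 2
      (volume : Measure ℝ) := by
    refine (memLp_coe (𝓕 f : L2)).of_le
      (hm.aestronglyMeasurable.mul (memLp_coe (𝓕 f : L2)).1) (Eventually.of_forall fun w => ?_)
    rw [norm_mul, hn, one_mul]
  refine ae_eq_of_schwartz (L2_locallyIntegrable _) (hmem.locallyIntegrable (by norm_num))
    fun φ => ?_
  rw [integral_fourier_mul]
  have hg : Function.HasTemperateGrowth
      fun w : ℝ => Complex.exp (2 * Real.pi * h * w * I) := by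
    simpa using hasTemperateGrowth_exp (2 * Real.pi * h)
  have h1 : ∀ x, (𝓕 φ) (x - h) =
      (𝓕 (SchwartzMap.smulLeftCLM ℂ (fun w : ℝ => Complex.exp (2 * Real.pi * h * w * I)) φ))
        x := by
    intro x
    rw [SchwartzMap.fourier_coe, SchwartzMap.fourier_coe, Real.fourier_real_eq_integral_exp_smul,
      Real.fourier_real_eq_integral_exp_smul]
    refine integral_congr_ae (Eventually.of_forall fun w => ?_)
    simp only [SchwartzMap.smulLeftCLM_apply_apply hg, smul_eq_mul]
    rw [← mul_assoc, ← Complex.exp_add]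
    congr 2
    push_cast; ring
  have h2 : ∫ x, (tr h f) x * (𝓕 φ) x = ∫ x, f (x + h) * (𝓕 φ) ((x + h) - h) := by
    refine integral_congr_ae ?_
    filter_upwards [tr_coe h f] with x hx
    rw [hx, add_sub_cancel_right]
  rw [h2]
  refine (integral_add_right_eq_self (μ := volume) (fun x => f x * (𝓕 φ) (x - h)) h).trans ?_
  simp_rw [h1]
  rw [← integral_fourier_mul]
  refine integral_congr_ae (Eventually.of_forall fun w => ?_)
  simp only [SchwartzMap.smulLeftCLM_apply_apply hg, smul_eq_mul]
  ring

/-! ### The conjugation `K` -/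

/-- A measurable function of modulus one almost everywhere. -/
structure IsUnimodular (u : ℝ → ℂ) : Prop where
  meas : AEStronglyMeasurable u volume
  norm : ∀ᵐ x : ℝ, ‖u x‖ = 1

theorem IsUloc.isUnimodular {u : ℝ → ℂ} {D : Set ℂ} {U : ℂ → ℂ} (hu : IsUloc u D U) :
    IsUnimodular u := ⟨hu.locInt.aestronglyMeasurable, hu.unimodular⟩

theorem quasiMeasurePreserving_mul {a : ℝ} (ha : a ≠ 0) :
    Measure.QuasiMeasurePreserving (fun w : ℝ => a * w) volume volume := by
  refine ⟨measurable_const_mul a, ?_⟩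
  rw [Real.map_volume_mul_left ha]
  exact Measure.smul_absolutelyContinuous

theorem ae_comp_mul {p : ℝ → Prop} (hp : ∀ᵐ x : ℝ, p x) {a : ℝ} (ha : a ≠ 0) :
    ∀ᵐ x : ℝ, p (a * x) := (quasiMeasurePreserving_mul ha).ae hp

theorem neg_two_pi_ne : -(2 * Real.pi) ≠ 0 := neg_ne_zero.2 Real.two_pi_pos.ne'

/-- The function `u` in the frequency variable `w = -z / (2π)`. -/
def uw (u : ℝ → ℂ) (w : ℝ) : ℂ := u (-(2 * Real.pi * w))

theorem uw_eq (u : ℝ → ℂ) (w : ℝ) : uw u w = u (-(2 * Real.pi) * w) := by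
  rw [uw, neg_mul]

section
variable {u : ℝ → ℂ} (hu : IsUnimodular u)
include hu

theorem IsUnimodular.norm_uw : ∀ᵐ w : ℝ, ‖uw u w‖ = 1 := by
  filter_upwards [ae_comp_mul hu.norm neg_two_pi_ne] with w hw
  rw [uw_eq, hw]

theorem IsUnimodular.meas_uw : AEStronglyMeasurable (uw u) volume := by
  have : uw u = u ∘ fun w => -(2 * Real.pi) * w := by ext w; exact uw_eq u w
  rw [this]
  exact hu.meas.comp_quasiMeasurePreserving (quasiMeasurePreserving_mul neg_two_pi_ne)

theorem memLp_uw_mul {f : ℝ → ℂ} (hf : MemLp f 2 (volume : Measure ℝ)) :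
    MemLp (fun w => uw u w * f w) 2 (volume : Measure ℝ) := by
  refine hf.of_le (hu.meas_uw.mul hf.1) ?_
  filter_upwards [hu.norm_uw] with w hw
  rw [norm_mul, hw, one_mul]

theorem memLp_uw_conj (f : L2) :
    MemLp (fun w : ℝ => uw u w * conj ((𝓕 f : L2) w)) 2 (volume : Measure ℝ) :=
  memLp_uw_mul hu (memLp_coe (𝓕 f : L2)).star

theorem fourier_K (f : L2) :
    (𝓕 (K u f) : L2) =ᵐ[volume] fun w => uw u w * conj ((𝓕 f : L2) w) := by
  rw [K, FourierTransform.fourier_fourierInv_eq]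
  exact coeFn_toL2 (memLp_uw_conj hu f)

omit hu in
theorem fourier_inj {f g : L2} (h : (𝓕 f : L2) = 𝓕 g) : f = g := by
  rw [← FourierTransform.fourierInv_fourier_eq (F := L2) f, h,
    FourierTransform.fourierInv_fourier_eq]

theorem K_add (f g : L2) : K u (f + g) = K u f + K u g := by
  apply fourier_inj
  rw [FourierTransform.fourier_add]
  apply Lp.ext
  filter_upwards [fourier_K hu (f + g), fourier_K hu f, fourier_K hu g,
    Lp.coeFn_add (𝓕 (K u f) : L2) (𝓕 (K u g)), Lp.coeFn_add (𝓕 f : L2) (𝓕 g)]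
    with w h1 h2 h3 h4 h5
  rw [h1, h4, Pi.add_apply, h2, h3, FourierTransform.fourier_add, h5, Pi.add_apply, map_add, mul_add]

theorem K_smul (c : ℂ) (f : L2) : K u (c • f) = conj c • K u f := by
  apply fourier_inj
  rw [FourierTransform.fourier_smul]
  apply Lp.ext
  filter_upwards [fourier_K hu (c • f), fourier_K hu f,
    Lp.coeFn_smul (conj c) (𝓕 (K u f) : L2), Lp.coeFn_smul c (𝓕 f : L2)]
    with w h1 h2 h3 h4
  rw [h1, h3, Pi.smul_apply, h2, FourierTransform.fourier_smul, h4, Pi.smul_apply]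
  simp only [smul_eq_mul, map_mul]
  ring

theorem norm_K (f : L2) : ‖K u f‖ = ‖f‖ := by
  rw [← Lp.norm_fourier_eq (K u f), ← Lp.norm_fourier_eq f]
  refine le_antisymm (Lp.norm_le_norm_of_ae_le ?_) (Lp.norm_le_norm_of_ae_le ?_) <;>
  · filter_upwards [fourier_K hu f, hu.norm_uw] with w h1 h2
    rw [h1, norm_mul, h2, one_mul, RCLike.norm_conj]

theorem K_K (f : L2) : K u (K u f) = f := by
  apply fourier_inj
  apply Lp.ext
  filter_upwards [fourier_K hu (K u f), fourier_K hu f, hu.norm_uw] with w h1 h2 h3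
  rw [h1, h2, map_mul, Complex.conj_conj, ← mul_assoc, Complex.mul_conj', h3]
  simp

theorem inner_K (f g : L2) : inner ℂ (K u f) g = inner ℂ (K u g) f := by
  rw [← Lp.inner_fourier_eq (K u f) g, ← Lp.inner_fourier_eq (K u g) f, inner_eq_integral,
    inner_eq_integral]
  refine integral_congr_ae ?_
  filter_upwards [fourier_K hu f, fourier_K hu g] with w h1 h2
  rw [h1, h2]
  simp only [map_mul, Complex.conj_conj]
  ring

theorem inner_K' (f g : L2) : inner ℂ f (K u g) = inner ℂ g (K u f) := by
  rw [← inner_conj_symm, inner_K hu, inner_conj_symm]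

theorem K_tr (h : ℝ) (f : L2) : K u (tr h f) = tr (-h) (K u f) := by
  apply fourier_inj
  apply Lp.ext
  filter_upwards [fourier_K hu (tr h f), fourier_tr h f, fourier_tr (-h) (K u f), fourier_K hu f]
    with w h1 h2 h3 h4
  rw [h1, h2, h3, h4, map_mul, ← Complex.exp_conj]
  simp only [map_mul, Complex.conj_ofReal, Complex.conj_I, map_ofNat]
  push_cast
  rw [mul_left_comm]
  congr 2
  ring

/-- The conjugation `K` as a real linear isometry. -/
def Kl : L2 →ₗᵢ[ℝ] L2 where
  toFun := K u
  map_add' := K_add hu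
  map_smul' r f := by
    have h : ∀ g : L2, r • g = (r : ℂ) • g := fun g => (Complex.coe_smul r g).symm
    rw [h, K_smul hu, Complex.conj_ofReal, RingHom.id_apply, h]
  norm_map' f := norm_K hu f

theorem K_sub (f g : L2) : K u (f - g) = K u f - K u g := map_sub (Kl hu) f g

theorem K_neg (f : L2) : K u (-f) = -K u f := map_neg (Kl hu) f

theorem continuous_K : Continuous (K u) := (Kl hu).continuous

theorem exists_compression_bound {t : ℝ} (h : compressionNorm u t < 1) :
    ∃ κ : ℝ, 0 ≤ κ ∧ κ < 1 ∧ ∀ s ≤ t, ∀ f : L2, ‖P s (K u (P s f))‖ ≤ κ * ‖P s f‖ := by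
  have hne : {c : ℝ | 0 ≤ c ∧ ∀ f : L2, ‖P t (K u (P t f))‖ ≤ c * ‖f‖}.Nonempty :=
    ⟨1, zero_le_one, fun f => by
      rw [one_mul]
      exact (norm_P_le _ _).trans ((norm_K hu _).le.trans (norm_P_le _ _))⟩
  obtain ⟨κ, ⟨h0, hb⟩, h1⟩ := exists_lt_of_csInf_lt hne h
  refine ⟨κ, h0, h1, fun s hs f => ?_⟩
  calc ‖P s (K u (P s f))‖ = ‖P s (P t (K u (P t (P s f))))‖ := by rw [P_P hs, P_P' hs]
    _ ≤ ‖P t (K u (P t (P s f)))‖ := norm_P_le _ _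
    _ ≤ κ * ‖P s f‖ := hb _

end

/-! ### The action of `K` on indicator functions -/

theorem tendsto_toL2_of_dominated {ι : Type*} {l : Filter ι} [l.IsCountablyGenerated]
    {F : ι → ℝ → ℂ} {f g : ℝ → ℂ} (hg : MemLp g 2 (volume : Measure ℝ))
    (hF : ∀ i, AEStronglyMeasurable (F i) volume) (hf : AEStronglyMeasurable f volume)
    (hb : ∀ i, ∀ᵐ x, ‖F i x‖ ≤ ‖g x‖) (hfb : ∀ᵐ x, ‖f x‖ ≤ ‖g x‖)
    (hlim : ∀ᵐ x, Tendsto (fun i => F i x) l (𝓝 (f x))) :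
    Tendsto (fun i => toL2 (F i)) l (𝓝 (toL2 f)) := by
  have hFm : ∀ i, MemLp (F i) 2 (volume : Measure ℝ) := fun i => hg.of_le (hF i) (hb i)
  have hfm : MemLp f 2 (volume : Measure ℝ) := hg.of_le hf hfb
  rw [tendsto_iff_norm_sub_tendsto_zero]
  have h1 : Tendsto (fun i => ∫ x, ‖F i x - f x‖ ^ 2) l (𝓝 (∫ _x : ℝ, (0 : ℝ))) := by
    refine tendsto_integral_filter_of_dominated_convergence (fun x => 4 * ‖g x‖ ^ 2)
      (Eventually.of_forall fun i => ((hF i).sub hf).norm.pow 2) (Eventually.of_forall fun i => ?_)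
      (hg.integrable_norm_pow (by norm_num) |>.const_mul 4) ?_
    · filter_upwards [hb i, hfb] with x h2 h3
      rw [Real.norm_of_nonneg (by positivity)]
      have h4 : ‖F i x - f x‖ ≤ 2 * ‖g x‖ := (norm_sub_le _ _).trans (by linarith)
      nlinarith [norm_nonneg (F i x - f x)]
    · filter_upwards [hlim] with x hx
      have : Tendsto (fun i => ‖F i x - f x‖ ^ 2) l (𝓝 (‖f x - f x‖ ^ 2)) :=
        ((hx.sub_const _).norm).pow 2
      simpa using this
  have h2 : ∀ i, ‖toL2 (F i) - toL2 f‖ ^ 2 = ∫ x, ‖F i x - f x‖ ^ 2 := fun i => by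
    rw [norm_sq_eq_integral]
    refine integral_congr_ae ?_
    filter_upwards [Lp.coeFn_sub (toL2 (F i)) (toL2 f), coeFn_toL2 (hFm i), coeFn_toL2 hfm]
      with x h3 h4 h5
    rw [h3, Pi.sub_apply, h4, h5]
  have h3 : Tendsto (fun i => Real.sqrt (‖toL2 (F i) - toL2 f‖ ^ 2)) l (𝓝 (Real.sqrt 0)) := by
    refine (Real.continuous_sqrt.tendsto 0).comp ?_
    simp_rw [h2]
    simpa using h1
  simpa using h3

theorem tendsto_P (f : L2) (t : ℝ) : Tendsto (fun s => P s f) (𝓝 t) (𝓝 (P t f)) := by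
  refine tendsto_toL2_of_dominated (memLp_coe f)
    (fun s => (memLp_indicator_Iio s f).1) (memLp_indicator_Iio t f).1
    (fun s => Eventually.of_forall fun x => norm_indicator_le_norm_self _ _)
    (Eventually.of_forall fun x => norm_indicator_le_norm_self _ _) ?_
  have h0 : ∀ᵐ x : ℝ, x ≠ t := Measure.ae_ne volume t
  filter_upwards [h0] with x hx
  rcases lt_or_gt_of_ne hx with h | h
  · refine tendsto_const_nhds.congr' ?_
    filter_upwards [Ioi_mem_nhds h] with s hs
    rw [indicator_of_mem (show x ∈ Iio t from h), indicator_of_mem (show x ∈ Iio s from hs)]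
  · refine tendsto_const_nhds.congr' ?_
    filter_upwards [Iio_mem_nhds h] with s hs
    rw [indicator_of_notMem (show x ∉ Iio t from not_lt.2 h.le),
      indicator_of_notMem (notMem_Iio.2 (le_of_lt hs) : x ∉ Iio s)]

theorem tendsto_P_of_tendsto {t : ℝ} {F : ℝ → L2} {f : L2} (h : Tendsto F (𝓝 t) (𝓝 f)) :
    Tendsto (fun s => P s (F s)) (𝓝 t) (𝓝 (P t f)) := by
  have h1 : Tendsto (fun s => P s (F s - f)) (𝓝 t) (𝓝 0) := by
    rw [tendsto_zero_iff_norm_tendsto_zero]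
    refine squeeze_zero (fun s => norm_nonneg _) (fun s => norm_P_le s _) ?_
    exact tendsto_iff_norm_sub_tendsto_zero.1 h
  have h2 := h1.add (tendsto_P f t)
  rw [zero_add] at h2
  refine h2.congr fun s => ?_
  rw [← P_add, sub_add_cancel]

/-- The indicator function of a set as an element of `L²`. -/
def ind (s : Set ℝ) : L2 := toL2 (s.indicator fun _ => 1)

theorem memLp_indicator_one {s : Set ℝ} (hs : MeasurableSet s) (hv : volume s ≠ ⊤) :
    MemLp (s.indicator fun _ => (1 : ℂ)) 2 (volume : Measure ℝ) :=
  memLp_indicator_const 2 hs 1 (Or.inr hv)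

theorem ind_coe {s : Set ℝ} (hs : MeasurableSet s) (hv : volume s ≠ ⊤) :
    ind s =ᵐ[volume] s.indicator fun _ => 1 := coeFn_toL2 (memLp_indicator_one hs hv)

theorem ind_Ico_coe (a b : ℝ) : ind (Ico a b) =ᵐ[volume] (Ico a b).indicator fun _ => 1 :=
  ind_coe measurableSet_Ico (by simp)

theorem ind_Ioc_coe (a b : ℝ) : ind (Ioc a b) =ᵐ[volume] (Ioc a b).indicator fun _ => 1 :=
  ind_coe measurableSet_Ioc (by simp)

theorem ind_Ioc_eq_Ico (a b : ℝ) : ind (Ioc a b) = ind (Ico a b) := by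
  refine toL2_congr (memLp_indicator_one measurableSet_Ioc (by simp)) ?_
  exact indicator_ae_eq_of_ae_eq_set (Ioo_ae_eq_Ioc.symm.trans Ioo_ae_eq_Ico)

theorem fourier_ind_Ioc {a b : ℝ} (h : a ≤ b) :
    (𝓕 (ind (Ioc a b)) : L2) =ᵐ[volume] fun w : ℝ =>
      (Complex.exp (-(2 * Real.pi * a * w * I)) -
        Complex.exp (-(2 * Real.pi * b * w * I))) / (2 * Real.pi * I * w) := by
  have hm := memLp_indicator_one (s := Ioc a b) measurableSet_Ioc (by simp)
  have hi : Integrable ((Ioc a b).indicator fun _ => (1 : ℂ)) :=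
    (integrable_indicator_iff measurableSet_Ioc).2 (integrableOn_const (by simp))
  filter_upwards [fourier_toL2_ae hm hi, Measure.ae_ne volume (0 : ℝ)] with w hw hw0
  rw [ind, hw, Real.fourier_real_eq_integral_exp_smul]
  have hw0' : (w : ℂ) ≠ 0 := by exact_mod_cast hw0
  have hp : (Real.pi : ℂ) ≠ 0 := by exact_mod_cast Real.pi_ne_zero
  have h1 : ∀ x : ℝ, Complex.exp (↑(-2 * Real.pi * x * w) * I) •
      (Ioc a b).indicator (fun _ => (1 : ℂ)) x =
      (Ioc a b).indicator (fun x : ℝ => Complex.exp (-(2 * Real.pi * w * I) * x)) x := by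
    intro x
    by_cases hx : x ∈ Ioc a b
    · simp only [indicator_of_mem hx, smul_eq_mul, mul_one]
      congr 1; push_cast; ring
    · simp [hx]
  simp_rw [h1]
  rw [integral_indicator measurableSet_Ioc, ← intervalIntegral.integral_of_le h,
    integral_exp_mul_complex (by simp [hw0', hp])]
  rw [show -(2 * Real.pi * w * I : ℂ) * b = -(2 * Real.pi * b * w * I) by ring,
    show -(2 * Real.pi * w * I : ℂ) * a = -(2 * Real.pi * a * w * I) by ring,
    div_neg, ← neg_div, neg_sub]
  congr 1; ring

/-- `k` is the square integrable function with Fourier transform `i (u(z) - c) / z`. -/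
def IsKernelPart (u : ℝ → ℂ) (c : ℂ) (k : L2) : Prop :=
  (𝓕 k : L2) =ᵐ[volume] fun w : ℝ => (uw u w - c) / (2 * Real.pi * I * w)

theorem IsUloc.exists_kernelPart {u : ℝ → ℂ} {D : Set ℂ} {U : ℂ → ℂ} (hu : IsUloc u D U) :
    ∃ (c : ℂ) (k : L2), IsKernelPart u c k := by
  obtain ⟨c, -, α, hα, -, C, δ, hδ, hC⟩ := hu.holder
  have hun := hu.isUnimodular
  have hmeas : AEStronglyMeasurable
      (fun w : ℝ => (uw u w - c) / (2 * Real.pi * I * w)) volume := by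
    refine (hun.meas_uw.sub aestronglyMeasurable_const).div₀ ?_
    exact (by fun_prop : Continuous fun w : ℝ => (2 * Real.pi * I * w : ℂ)).aestronglyMeasurable
  suffices h : MemLp (fun w : ℝ => (uw u w - c) / (2 * Real.pi * I * w)) 2
      (volume : Measure ℝ) by
    refine ⟨c, 𝓕⁻ (toL2 fun w : ℝ => (uw u w - c) / (2 * Real.pi * I * w)), ?_⟩
    rw [IsKernelPart, FourierTransform.fourier_fourierInv_eq]
    exact coeFn_toL2 h
  rw [memLp_two_iff_integrable_sq_norm hmeas]
  have hpi := Real.pi_pos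
  set ε : ℝ := δ / (2 * Real.pi) with hε
  have hε0 : 0 < ε := by positivity
  have hn : ∀ w : ℝ, ‖(uw u w - c) / (2 * Real.pi * I * w)‖ =
      ‖uw u w - c‖ / (2 * Real.pi * |w|) := fun w => by
    simp [abs_of_pos hpi]
  set r : ℝ := 2 * α - 2
  have hr : -1 < r := by simp only [r]; linarith
  have hint1 : IntegrableOn (fun w : ℝ => |w| ^ r) (Ioc (-ε) ε) := by
    have : IntervalIntegrable (fun w : ℝ => |w| ^ r) volume (-ε) ε := by
      refine intervalIntegrable_of_even (fun x => by simp) (fun x hx => ?_)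
      refine (intervalIntegral.intervalIntegrable_rpow' (a := 0) (b := x) hr).congr ?_
      intro y hy
      rw [uIoc_of_le hx.le] at hy
      simp [abs_of_pos hy.1]
    rwa [intervalIntegrable_iff, uIoc_of_le (by linarith)] at this
  have hInt : Integrable (fun w : ℝ =>
      (Ioc (-ε) ε).indicator (fun w => (C * (2 * Real.pi) ^ α / (2 * Real.pi)) ^ 2 * |w| ^ r) w +
        ((1 + ‖c‖) / (2 * Real.pi)) ^ 2 * (1 + 1 / ε ^ 2) * (1 + w ^ 2)⁻¹) := by
    refine ((integrable_indicator_iff measurableSet_Ioc).2 (hint1.const_mul _)).add ?_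
    exact integrable_inv_one_add_sq.const_mul _
  refine hInt.mono' (hmeas.norm.pow 2) ?_
  filter_upwards [hun.norm_uw, ae_comp_mul hC neg_two_pi_ne, Measure.ae_ne volume (0 : ℝ),
    Measure.ae_ne volume ε] with w h1 h2 h0 h0'
  rw [Real.norm_of_nonneg (by positivity), hn]
  have hw : 0 < |w| := abs_pos.2 h0
  have hpos2 : 0 ≤ ((1 + ‖c‖) / (2 * Real.pi)) ^ 2 * (1 + 1 / ε ^ 2) * (1 + w ^ 2)⁻¹ := by
    positivity
  have habs : |-(2 * Real.pi) * w| = 2 * Real.pi * |w| := by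
    rw [abs_mul, abs_neg, abs_of_pos (by positivity)]
  by_cases hwe : |w| < ε
  · rw [indicator_of_mem (show w ∈ Ioc (-ε) ε from
      ⟨(abs_lt.1 hwe).1, (abs_lt.1 hwe).2.le⟩)]
    refine le_add_of_le_of_nonneg ?_ hpos2
    have h3 : ‖uw u w - c‖ ≤ C * (2 * Real.pi * |w|) ^ α := by
      rw [uw_eq, ← habs]
      apply h2
      rw [habs]
      rw [hε, lt_div_iff₀ (by positivity)] at hwe
      linarith
    have h4 : (2 * Real.pi * |w|) ^ α = (2 * Real.pi) ^ α * |w| ^ α :=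
      Real.mul_rpow (by positivity) hw.le
    have h5 : |w| ^ r = (|w| ^ α / |w|) ^ 2 := by
      rw [div_pow, ← Real.rpow_natCast (|w| ^ α), ← Real.rpow_mul hw.le,
        ← Real.rpow_natCast |w|, ← Real.rpow_sub hw]
      congr 1; push_cast; simp only [r]; ring
    rw [h5, ← mul_pow]
    refine pow_le_pow_left₀ (by positivity) ?_ 2
    calc ‖uw u w - c‖ / (2 * Real.pi * |w|) ≤ C * (2 * Real.pi * |w|) ^ α / (2 * Real.pi * |w|) := by
          gcongr
      _ = _ := by rw [h4]; field_simp
  · rw [not_lt] at hwe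
    have hind : 0 ≤ (Ioc (-ε) ε).indicator
        (fun w => (C * (2 * Real.pi) ^ α / (2 * Real.pi)) ^ 2 * |w| ^ r) w :=
      indicator_nonneg (fun w _ => by positivity) _
    refine le_add_of_nonneg_of_le hind ?_
    have h3 : ‖uw u w - c‖ ≤ 1 + ‖c‖ := (norm_sub_le _ _).trans (by rw [h1])
    have h4 : (‖uw u w - c‖ / (2 * Real.pi * |w|)) ^ 2 ≤
        ((1 + ‖c‖) / (2 * Real.pi * |w|)) ^ 2 := by gcongr
    refine h4.trans ?_
    have h5 : ((1 + ‖c‖) / (2 * Real.pi * |w|)) ^ 2 =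
        ((1 + ‖c‖) / (2 * Real.pi)) ^ 2 * (1 / w ^ 2) := by
      rw [← sq_abs w]; field_simp
    rw [h5, mul_assoc]
    refine mul_le_mul_of_nonneg_left ?_ (by positivity)
    have hw2 : ε ^ 2 ≤ w ^ 2 := by rw [← sq_abs w]; gcongr
    have hw2p : 0 < w ^ 2 := by positivity
    rw [← div_eq_mul_inv, div_le_div_iff₀ hw2p (by positivity)]
    have : 1 ≤ w ^ 2 / ε ^ 2 := by rw [le_div_iff₀ (by positivity)]; linarith
    calc 1 * (1 + w ^ 2) ≤ w ^ 2 / ε ^ 2 + w ^ 2 := by linarith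
      _ = (1 + 1 / ε ^ 2) * w ^ 2 := by ring

theorem fourier_sub' (f g : L2) : (𝓕 (f - g) : L2) = 𝓕 f - 𝓕 g :=
  (Lp.fourierTransformₗᵢ ℝ ℂ).map_sub f g

theorem K_ind {u : ℝ → ℂ} (hu : IsUnimodular u) {c : ℂ} {k : L2} (hk : IsKernelPart u c k)
    {a b : ℝ} (h : a ≤ b) :
    K u (ind (Ico a b)) = c • ind (Ioc (-b) (-a)) + tr b k - tr a k := by
  rw [← ind_Ioc_eq_Ico]
  apply fourier_inj
  have hsub : (𝓕 (c • ind (Ioc (-b) (-a)) + tr b k - tr a k) : L2) =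
      c • 𝓕 (ind (Ioc (-b) (-a))) + 𝓕 (tr b k) - 𝓕 (tr a k) := by
    rw [fourier_sub', FourierTransform.fourier_add, FourierTransform.fourier_smul]
  rw [hsub]
  apply Lp.ext
  filter_upwards [fourier_K hu (ind (Ioc a b)), fourier_ind_Ioc h,
    fourier_ind_Ioc (neg_le_neg h), fourier_tr b k, fourier_tr a k, hk,
    Lp.coeFn_sub (c • 𝓕 (ind (Ioc (-b) (-a))) + 𝓕 (tr b k) : L2) (𝓕 (tr a k)),
    Lp.coeFn_add (c • 𝓕 (ind (Ioc (-b) (-a))) : L2) (𝓕 (tr b k)),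
    Lp.coeFn_smul c (𝓕 (ind (Ioc (-b) (-a))) : L2)] with w h1 h2 h3 h4 h5 h6 h7 h8 h9
  rw [h1, h7, Pi.sub_apply, h8, Pi.add_apply, h9, Pi.smul_apply, h2, h3, h4, h5, h6]
  simp only [map_div₀, map_sub, map_mul, ← Complex.exp_conj, map_neg, Complex.conj_ofReal,
    Complex.conj_I, map_ofNat, smul_eq_mul]
  push_cast
  have e1 : -(2 * Real.pi * a * w * -I : ℂ) = 2 * Real.pi * a * w * I := by ring
  have e2 : -(2 * Real.pi * b * w * -I : ℂ) = 2 * Real.pi * b * w * I := by ring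
  have e3 : -(2 * Real.pi * -a * w * I : ℂ) = 2 * Real.pi * a * w * I := by ring
  have e4 : -(2 * Real.pi * -b * w * I : ℂ) = 2 * Real.pi * b * w * I := by ring
  rw [e1, e2, e3, e4]
  have e5 : (2 * Real.pi * -I * w : ℂ) = -(2 * Real.pi * I * w) := by ring
  rw [e5, div_neg]
  ring

/-! ### The equation `X = e + K P_t X` -/

/-- The function `K 1_{(-∞, t)}`. -/
def kap (c : ℂ) (k : L2) (t : ℝ) (x : ℝ) : ℂ := (Ioi (-t)).indicator (fun _ => c) x + tr t k x

/-- The restriction of `K 1_{(-∞, t)}` to `(-∞, t)`. -/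
def kapP (c : ℂ) (k : L2) (t : ℝ) : L2 := toL2 ((Iio t).indicator (kap c k t))

theorem memLp_kapP (c : ℂ) (k : L2) (t : ℝ) :
    MemLp ((Iio t).indicator (kap c k t)) 2 (volume : Measure ℝ) := by
  have h : (Iio t).indicator (kap c k t) = fun x =>
      (Ioo (-t) t).indicator (fun _ => c) x + (Iio t).indicator (tr t k) x := by
    ext x
    by_cases h1 : x < t <;> by_cases h2 : -t < x <;> simp [kap, indicator, h1, h2]
  rw [h]
  exact (memLp_indicator_const 2 measurableSet_Ioo c (Or.inr (by simp))).add
    (memLp_indicator_Iio t _)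

theorem P_kapP (c : ℂ) (k : L2) (t : ℝ) : P t (kapP c k t) = kapP c k t := by
  refine P_eq_self ?_
  filter_upwards [coeFn_toL2 (memLp_kapP c k t)] with x hx hxt
  rw [kapP, hx, indicator_of_notMem (by simpa using hxt)]

theorem continuous_weight (N : ℕ) : Continuous fun x : ℝ => ((1 + |x|) ^ N)⁻¹ :=
  Continuous.inv₀ (by fun_prop) fun x => by positivity

theorem schwartz_bound (φ : 𝓢(ℝ, ℂ)) (N : ℕ) : ∃ C : ℝ, ∀ x : ℝ, (1 + |x|) ^ N * ‖φ x‖ ≤ C := by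
  refine ⟨2 ^ N * ((Finset.Iic (N, 0)).sup fun m => SchwartzMap.seminorm ℝ m.1 m.2) φ, fun x => ?_⟩
  have := SchwartzMap.one_add_le_sup_seminorm_apply (𝕜 := ℝ) (m := (N, 0)) le_rfl le_rfl φ x
  simpa using this

theorem isTempered_of_bound {f : ℝ → ℂ} (hf : AEStronglyMeasurable f volume) {C : ℝ}
    (h : ∀ᵐ x, ‖f x‖ ≤ C) : IsTempered f := by
  refine ⟨2, ?_⟩
  refine ((integrable_inv_one_add_sq.const_mul C)).mono' ?_ ?_
  · exact (continuous_weight _).aestronglyMeasurable.smul hf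
  · filter_upwards [h] with x hx
    have hC : 0 ≤ C := (norm_nonneg _).trans hx
    rw [norm_smul, norm_inv, Real.norm_of_nonneg (by positivity), mul_comm]
    gcongr
    nlinarith [abs_nonneg x, sq_abs x]

theorem isTempered_L2 (f : L2) : IsTempered f := by
  refine ⟨1, ?_⟩
  have hm : AEStronglyMeasurable (fun x : ℝ => ((1 + |x|) ^ 1)⁻¹ • f x) volume :=
    (continuous_weight _).aestronglyMeasurable.smul
      (memLp_coe f).1
  refine (integrable_inv_one_add_sq.add ((memLp_coe f).integrable_norm_pow (by norm_num))).mono'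
    hm (Eventually.of_forall fun x => ?_)
  rw [norm_smul, norm_inv, Real.norm_of_nonneg (by positivity), pow_one]
  have h1 : ((1 + |x|)⁻¹) ^ 2 ≤ (1 + x ^ 2)⁻¹ := by
    rw [inv_pow]
    gcongr
    nlinarith [abs_nonneg x, sq_abs x]
  have h2 : (1 + |x|)⁻¹ * ‖f x‖ ≤ ((1 + |x|)⁻¹) ^ 2 + ‖f x‖ ^ 2 := by
    nlinarith [sq_nonneg ((1 + |x|)⁻¹ - ‖f x‖), sq_nonneg ((1 + |x|)⁻¹), sq_nonneg (‖f x‖)]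
  exact h2.trans (by simpa using h1)

theorem IsTempered.weight_mono {f : ℝ → ℂ} {N M : ℕ} (hNM : N ≤ M)
    (h : Integrable (fun x : ℝ => ((1 + |x|) ^ N)⁻¹ • f x) volume) :
    Integrable (fun x : ℝ => ((1 + |x|) ^ M)⁻¹ • f x) volume := by
  have : (fun x : ℝ => ((1 + |x|) ^ M)⁻¹ • f x) =
      fun x => ((1 + |x|) ^ (M - N))⁻¹ • (((1 + |x|) ^ N)⁻¹ • f x) := by
    ext x
    have : (1 + |x|) ≠ 0 := by positivity
    rw [smul_smul, ← mul_inv, ← pow_add, Nat.sub_add_cancel hNM]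
  rw [this]
  refine h.norm.mono' ?_ (Eventually.of_forall fun x => ?_)
  · exact (continuous_weight _).aestronglyMeasurable.smul h.1
  · rw [norm_smul]
    refine mul_le_of_le_one_left (norm_nonneg _) ?_
    rw [norm_inv, Real.norm_of_nonneg (by positivity)]
    exact inv_le_one_of_one_le₀ (one_le_pow₀ (by linarith [abs_nonneg x]))

theorem IsTempered.add {f g : ℝ → ℂ} (hf : IsTempered f) (hg : IsTempered g) :
    IsTempered fun x => f x + g x := by
  obtain ⟨N, hN⟩ := hf
  obtain ⟨M, hM⟩ := hg
  refine ⟨max N M, ?_⟩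
  simp_rw [smul_add]
  exact (IsTempered.weight_mono (le_max_left _ _) hN).add
    (IsTempered.weight_mono (le_max_right _ _) hM)

theorem IsTempered.const_mul {f : ℝ → ℂ} (hf : IsTempered f) (c : ℂ) :
    IsTempered fun x => c * f x := by
  obtain ⟨N, hN⟩ := hf
  refine ⟨N, ?_⟩
  convert! hN.const_mul c using 2 with x
  simp only [Complex.real_smul]; ring

theorem IsTempered.congr {f g : ℝ → ℂ} (hf : IsTempered f) (h : f =ᵐ[volume] g) :
    IsTempered g := by
  obtain ⟨N, hN⟩ := hf
  refine ⟨N, hN.congr ?_⟩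
  filter_upwards [h] with x hx
  rw [hx]

theorem IsTempered.integrable_mul {f : ℝ → ℂ} (hf : IsTempered f) (φ : 𝓢(ℝ, ℂ)) :
    Integrable fun x => f x * φ x := by
  obtain ⟨N, hN⟩ := hf
  obtain ⟨C, hC⟩ := schwartz_bound φ N
  have : (fun x => f x * φ x) =
      fun x => ((1 + |x|) ^ N * φ x) * (((1 + |x|) ^ N)⁻¹ • f x) := by
    ext x
    have : ((1 + |x| : ℝ) : ℂ) ≠ 0 := by exact_mod_cast (by positivity : (1 + |x|) ≠ 0)
    simp only [Complex.real_smul]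
    push_cast at this ⊢
    field_simp
  rw [this]
  refine hN.bdd_mul (c := C) ?_ (Eventually.of_forall fun x => ?_)
  · exact (Continuous.aestronglyMeasurable (by fun_prop))
  · rw [norm_mul, norm_pow]
    have : ‖(1 + |x| : ℂ)‖ = 1 + |x| := by
      rw [show (1 + |x| : ℂ) = ((1 + |x| : ℝ) : ℂ) by push_cast; rfl, Complex.norm_real,
        Real.norm_of_nonneg (by positivity)]
    rw [this]; exact hC x

theorem IsTempered.locallyIntegrable {f : ℝ → ℂ} (hf : IsTempered f) : LocallyIntegrable f := by
  obtain ⟨N, hN⟩ := hf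
  have h1 : LocallyIntegrable (fun x : ℝ => ((1 + |x|) ^ N) • (((1 + |x|) ^ N)⁻¹ • f x)) :=
    hN.locallyIntegrable.continuous_smul (by fun_prop)
  refine h1.congr (Eventually.of_forall fun x => ?_)
  have : (1 + |x|) ^ N ≠ 0 := by positivity
  simp only [smul_smul]
  rw [mul_inv_cancel₀ this, one_smul]

theorem tendsto_inner_tr (g k : L2) :
    Tendsto (fun R : ℝ => inner ℂ g (tr (-R) k)) atTop (𝓝 0) := by
  have h : ∀ R : ℝ, inner ℂ g (tr (-R) k) =
      𝓕 (fun w : ℝ => conj ((𝓕 g : L2) w) * (𝓕 k : L2) w) R := fun R => by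
    rw [← Lp.inner_fourier_eq, inner_eq_integral, Real.fourier_real_eq_integral_exp_smul]
    refine integral_congr_ae ?_
    filter_upwards [fourier_tr (-R) k] with w hw
    rw [hw, smul_eq_mul, mul_left_comm]
    congr 2
    push_cast; ring
  simp_rw [h]
  exact (Real.zero_at_infty_fourier _).mono_left atTop_le_cocompact

theorem isTempered_kap (c : ℂ) (k : L2) (t : ℝ) : IsTempered (kap c k t) := by
  refine IsTempered.add ?_ (isTempered_L2 _)
  refine isTempered_of_bound (C := ‖c‖) ?_ (Eventually.of_forall fun x => norm_indicator_le_norm_self _ _)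
  exact aestronglyMeasurable_const.indicator measurableSet_Ioi

theorem memLp_trunc (f : L2) (R : ℝ) :
    MemLp ((Icc (-R) R).indicator f) 2 (volume : Measure ℝ) :=
  (memLp_coe f).indicator measurableSet_Icc

theorem tendsto_trunc (f : L2) :
    Tendsto (fun R : ℝ => toL2 ((Icc (-R) R).indicator f)) atTop (𝓝 f) := by
  nth_rewrite 2 [← toL2_coe f]
  refine tendsto_toL2_of_dominated (memLp_coe f) (fun R => (memLp_trunc f R).1) (memLp_coe f).1
    (fun R => Eventually.of_forall fun x => norm_indicator_le_norm_self _ _)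
    (Eventually.of_forall fun x => le_rfl) (Eventually.of_forall fun x => ?_)
  refine tendsto_const_nhds.congr' ?_
  filter_upwards [eventually_ge_atTop |x|] with R hR
  rw [indicator_of_mem (show x ∈ Icc (-R) R from abs_le.1 hR)]

section
variable {u : ℝ → ℂ} (hu : IsUnimodular u) {c : ℂ} {k : L2} (hk : IsKernelPart u c k)
include hu hk

theorem tendsto_K_trunc {t : ℝ} {e : ℂ} {f : L2} (hf : P t f = f) (φ : 𝓢(ℝ, ℂ)) :
    Tendsto (fun R : ℝ => ∫ x, (K u (toL2 ((Icc (-R) R).indicator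
      ((Iio t).indicator fun x => e + f x))) : L2) x * φ x) atTop
      (𝓝 (∫ x, (conj e * kap c k t x + K u f x) * φ x)) := by
  have hfz : ∀ᵐ x : ℝ, t ≤ x → f x = 0 := by
    filter_upwards [P_ae_zero t f] with x hx
    rwa [hf] at hx
  have h1 : ∀ R : ℝ, |t| ≤ R → toL2 ((Icc (-R) R).indicator
      ((Iio t).indicator fun x => e + f x)) =
      e • ind (Ico (-R) t) + toL2 ((Icc (-R) R).indicator f) := fun R hR => by
    symm
    apply eq_toL2
    filter_upwards [Lp.coeFn_add (e • ind (Ico (-R) t)) (toL2 ((Icc (-R) R).indicator f)),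
      Lp.coeFn_smul e (ind (Ico (-R) t)), ind_Ico_coe (-R) t, coeFn_toL2 (memLp_trunc f R), hfz]
      with x h2 h3 h4 h5 h6
    rw [h2, Pi.add_apply, h3, Pi.smul_apply, h4, h5]
    by_cases hx : x < t
    · have hxR : x ≤ R := hx.le.trans ((le_abs_self t).trans hR)
      by_cases hx2 : -R ≤ x <;> simp [indicator, hx, hx2, hxR]
    · simp [indicator, hx, h6 (not_lt.1 hx)]
  have hphi := memLp_schwartz φ
  have h2 : ∀ R : ℝ, |t| ≤ R → ∫ x, (K u (toL2 ((Icc (-R) R).indicator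
      ((Iio t).indicator fun x => e + f x))) : L2) x * φ x =
      conj e * (c * (∫ x in Ioc (-t) R, φ x) + (∫ x, tr t k x * φ x) -
        ∫ x, tr (-R) k x * φ x) + ∫ x, (K u (toL2 ((Icc (-R) R).indicator f)) : L2) x * φ x := by
    intro R hR
    have hRt : -R ≤ t := (abs_le.1 hR).1
    rw [h1 R hR, K_add hu, K_smul hu, K_ind hu hk hRt, neg_neg]
    have hInt : ∫ x in Ioc (-t) R, φ x = ∫ x, ind (Ioc (-t) R) x * φ x := by
      rw [← integral_indicator measurableSet_Ioc]
      refine integral_congr_ae ?_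
      filter_upwards [ind_Ioc_coe (-t) R] with x hx
      rw [hx]
      by_cases h : x ∈ Ioc (-t) R <;> simp [h]
    rw [hInt, integral_mul_eq_inner _ _ hphi, integral_mul_eq_inner _ _ hphi,
      integral_mul_eq_inner _ _ hphi, integral_mul_eq_inner _ _ hphi, integral_mul_eq_inner _ _ hphi,
      inner_add_right, inner_smul_right, inner_sub_right, inner_add_right, inner_smul_right]
  refine Tendsto.congr' ((eventually_ge_atTop |t|).mono fun R hR => (h2 R hR).symm) ?_
  have hlim : ∫ x, (conj e * kap c k t x + K u f x) * φ x =
      conj e * (c * (∫ x in Ioi (-t), φ x) + (∫ x, tr t k x * φ x) - 0) +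
        ∫ x, K u f x * φ x := by
    have i1 : Integrable fun x => (Ioi (-t)).indicator (fun _ => c) x * φ x := by
      have := φ.integrable (μ := volume) |>.indicator (measurableSet_Ioi (a := -t)) |>.const_mul c
      refine this.congr (Eventually.of_forall fun x => ?_)
      by_cases h : x ∈ Ioi (-t) <;> simp [indicator, h]
    have i2 : Integrable fun x => tr t k x * φ x := integrable_mul_L2 (memLp_coe _) hphi
    have i3 : Integrable fun x => K u f x * φ x := integrable_mul_L2 (memLp_coe _) hphi
    have e1 : (fun x => (conj e * kap c k t x + K u f x) * φ x) = fun x =>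
        conj e * ((Ioi (-t)).indicator (fun _ => c) x * φ x + tr t k x * φ x) +
          K u f x * φ x := by
      ext x; simp only [kap]; ring
    have i12 : Integrable fun x => (Ioi (-t)).indicator (fun _ => c) x * φ x + tr t k x * φ x :=
      i1.add i2
    rw [e1, integral_add (i12.const_mul _) i3, integral_const_mul, integral_add i1 i2,
      sub_zero, ← integral_const_mul c, ← integral_indicator measurableSet_Ioi]
    congr 4
    ext x
    by_cases h : x ∈ Ioi (-t) <;> simp [indicator, h]
  rw [hlim]
  refine Tendsto.add (Tendsto.const_mul _ (Tendsto.sub (Tendsto.add (Tendsto.const_mul _ ?_)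
    tendsto_const_nhds) ?_)) ?_
  · have := intervalIntegral_tendsto_integral_Ioi (-t) (φ.integrable (μ := volume)).integrableOn
      tendsto_id
    refine this.congr' ?_
    filter_upwards [eventually_ge_atTop (-t)] with R hR
    rw [id, intervalIntegral.integral_of_le hR]
  · simp_rw [integral_mul_eq_inner _ _ hphi]
    exact tendsto_inner_tr _ _
  · exact tendsto_integral_mul (((continuous_K hu).tendsto f).comp (tendsto_trunc f)) φ hphi

end

/-- `X` solves `X = e + K P_t X`. -/
def IsSol (u : ℝ → ℂ) (e : ℂ) (t : ℝ) (X : ℝ → ℂ) : Prop :=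
  IsTempered X ∧ MemLp (fun x => X x - e) 2 (volume.restrict (Iio t)) ∧
    HasK u ((Iio t).indicator X) (fun x => X x - e)

/-- `f` is the square integrable part of the solution of `X = e + K P_t X`. -/
def IsPart (u : ℝ → ℂ) (c : ℂ) (k : L2) (e : ℂ) (t : ℝ) (f : L2) : Prop :=
  f = conj e • kapP c k t + P t (K u f)

theorem IsPart.P_eq {u : ℝ → ℂ} {c : ℂ} {k : L2} {e : ℂ} {t : ℝ} {f : L2}
    (h : IsPart u c k e t f) : P t f = f := by
  rw [h, P_add, P_smul, P_kapP, P_P le_rfl]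

/-- The solution of `X = e + K P_t X` with square integrable part `f`. -/
def solFun (u : ℝ → ℂ) (c : ℂ) (k : L2) (e : ℂ) (t : ℝ) (f : L2) (x : ℝ) : ℂ :=
  e + conj e * kap c k t x + K u f x

theorem isTempered_solFun (u : ℝ → ℂ) (c : ℂ) (k : L2) (e : ℂ) (t : ℝ) (f : L2) :
    IsTempered (solFun u c k e t f) := by
  refine IsTempered.add (IsTempered.add ?_ ((isTempered_kap c k t).const_mul _)) (isTempered_L2 _)
  exact isTempered_of_bound (C := ‖e‖) aestronglyMeasurable_const
    (Eventually.of_forall fun x => le_rfl)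

theorem IsPart.ae_eq {u : ℝ → ℂ} {c : ℂ} {k : L2} {e : ℂ} {t : ℝ} {f : L2}
    (h : IsPart u c k e t f) : ∀ᵐ x : ℝ, x < t → solFun u c k e t f x = e + f x := by
  have h' : f =ᵐ[volume] (conj e • kapP c k t + P t (K u f) : L2) := by
    exact Eventually.of_forall fun x => congrArg (fun g : L2 => g x) h
  filter_upwards [h', Lp.coeFn_add (conj e • kapP c k t) (P t (K u f)),
    Lp.coeFn_smul (conj e) (kapP c k t), coeFn_toL2 (memLp_kapP c k t), P_ae_eq t (K u f)]
    with x h1 h2 h3 h4 h5 hx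
  rw [solFun, h1, h2, Pi.add_apply, h3, Pi.smul_apply, h5 hx, kapP, h4,
    indicator_of_mem (show x ∈ Iio t from hx), smul_eq_mul]
  ring

section
variable {u : ℝ → ℂ} (hu : IsUnimodular u) {c : ℂ} {k : L2} (hk : IsKernelPart u c k)
include hu hk

theorem IsPart.isSol {e : ℂ} {t : ℝ} {f : L2} (h : IsPart u c k e t f) :
    IsSol u e t (solFun u c k e t f) := by
  have hind : (Iio t).indicator (solFun u c k e t f) =ᵐ[volume]
      (Iio t).indicator fun x => e + f x := by
    filter_upwards [h.ae_eq] with x hx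
    by_cases hxt : x < t
    · simp [indicator, hxt, hx hxt]
    · simp [indicator, hxt]
  have hindR : ∀ R : ℝ, (Icc (-R) R).indicator ((Iio t).indicator (solFun u c k e t f)) =ᵐ[volume]
      (Icc (-R) R).indicator ((Iio t).indicator fun x => e + f x) := fun R => by
    filter_upwards [hind] with x hx
    by_cases hxt : x ∈ Icc (-R) R
    · rw [indicator_of_mem hxt, indicator_of_mem hxt, hx]
    · rw [indicator_of_notMem hxt, indicator_of_notMem hxt]
  have hmem : ∀ R : ℝ, MemLp ((Icc (-R) R).indicator ((Iio t).indicator fun x => e + f x)) 2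
      (volume : Measure ℝ) := fun R => by
    have h1 : (Icc (-R) R).indicator ((Iio t).indicator fun x => e + f x) =
        (Iio t).indicator fun x => (Icc (-R) R).indicator (fun _ => e) x +
          (Icc (-R) R).indicator f x := by
      ext x
      by_cases h1 : x < t <;> by_cases h2 : x ∈ Icc (-R) R <;> simp only [indicator, h2, mem_Iio, h1] <;> simp
    rw [h1]
    exact ((memLp_indicator_const 2 measurableSet_Icc e (Or.inr (by simp))).add
      (memLp_trunc f R)).indicator measurableSet_Iio
  refine ⟨isTempered_solFun _ _ _ _ _ _, ?_, fun R => (hmem R).ae_eq (hindR R).symm, ?_, fun φ => ?_⟩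
  · refine ((memLp_coe f).restrict (Iio t)).ae_eq ?_
    rw [Filter.EventuallyEq, ae_restrict_iff' measurableSet_Iio]
    filter_upwards [h.ae_eq] with x hx hxt
    rw [hx hxt]; ring
  · have := ((isTempered_kap c k t).const_mul (conj e)).add (isTempered_L2 (K u f))
    refine this.congr (Eventually.of_forall fun x => ?_)
    simp only [solFun]; ring
  · have := tendsto_K_trunc hu hk (e := e) h.P_eq φ
    have h2 : ∫ x, (solFun u c k e t f x - e) * φ x =
        ∫ x, (conj e * kap c k t x + K u f x) * φ x := by
      congr 1; ext x; simp only [solFun]; ring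
    rw [h2]
    refine this.congr fun R => ?_
    rw [toL2_congr (hmem R) (hindR R).symm]

theorem IsSol.exists_part {e : ℂ} {t : ℝ} {X : ℝ → ℂ} (h : IsSol u e t X) :
    ∃ f : L2, IsPart u c k e t f ∧ X =ᵐ[volume] solFun u c k e t f := by
  obtain ⟨hT, hL, hR, hgT, hlim⟩ := h
  have hmem : MemLp ((Iio t).indicator fun x => X x - e) 2 (volume : Measure ℝ) :=
    (memLp_indicator_iff_restrict measurableSet_Iio).2 hL
  set f : L2 := toL2 ((Iio t).indicator fun x => X x - e) with hf
  have hfx := coeFn_toL2 hmem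
  have hPf : P t f = f := P_eq_self (by
    filter_upwards [hfx] with x hx hxt
    rw [hf, hx, indicator_of_notMem (by simpa using hxt)])
  have hind : ∀ R : ℝ, (Icc (-R) R).indicator ((Iio t).indicator X) =ᵐ[volume]
      (Icc (-R) R).indicator ((Iio t).indicator fun x => e + f x) := fun R => by
    filter_upwards [hfx] with x hx
    by_cases hxt : x < t
    · rw [indicator_of_mem (show x ∈ Iio t from hxt)] at hx
      rw [← hf] at hx
      by_cases h2 : x ∈ Icc (-R) R
      · rw [indicator_of_mem h2, indicator_of_mem h2, indicator_of_mem (show x ∈ Iio t from hxt),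
          indicator_of_mem (show x ∈ Iio t from hxt), hx]; ring
      · rw [indicator_of_notMem h2, indicator_of_notMem h2]
    · by_cases h2 : x ∈ Icc (-R) R
      · simp only [indicator, mem_Iio, hxt, if_false]
      · rw [indicator_of_notMem h2, indicator_of_notMem h2]
  have hX : (fun x => X x - e) =ᵐ[volume] fun x => conj e * kap c k t x + K u f x := by
    refine ae_eq_of_schwartz hgT.locallyIntegrable
      (((isTempered_kap c k t).const_mul (conj e)).add (isTempered_L2 (K u f))).locallyIntegrable
      fun φ => ?_
    refine tendsto_nhds_unique (hlim φ) ((tendsto_K_trunc hu hk hPf φ).congr fun R => ?_)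
    rw [toL2_congr (hR R) (hind R)]
  refine ⟨f, ?_, ?_⟩
  · apply Lp.ext
    filter_upwards [hfx, hX, Lp.coeFn_add (conj e • kapP c k t) (P t (K u f)),
      Lp.coeFn_smul (conj e) (kapP c k t), coeFn_toL2 (memLp_kapP c k t), P_coe t (K u f)]
      with x h1 h2 h3 h4 h5 h6
    rw [h3, Pi.add_apply, h4, Pi.smul_apply, h6, kapP, h5, hf, h1]
    by_cases hxt : x ∈ Iio t
    · simp only [indicator_of_mem hxt, smul_eq_mul]; exact h2
    · simp only [indicator_of_notMem hxt]; simp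
  · filter_upwards [hX] with x hx
    rw [solFun, add_assoc, ← hx]; ring

omit hu hk in
theorem norm_le_of_compression {t κ : ℝ} (hκ : κ < 1)
    (hb : ∀ f : L2, ‖P t (K u (P t f))‖ ≤ κ * ‖P t f‖) {f : L2} (hf : P t f = f) :
    ‖f‖ ≤ (1 - κ)⁻¹ * ‖f - P t (K u f)‖ := by
  have h1 := hb f
  rw [hf] at h1
  have h2 : ‖f‖ ≤ ‖f - P t (K u f)‖ + ‖P t (K u f)‖ := by
    simpa using norm_add_le (f - P t (K u f)) (P t (K u f))
  rw [inv_mul_eq_div, le_div_iff₀ (by linarith)]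
  nlinarith

omit hk in
theorem exists_isPart {t : ℝ} (ht : compressionNorm u t < 1) (e : ℂ) :
    ∃ f : L2, IsPart u c k e t f := by
  obtain ⟨κ, h0, h1, hb⟩ := exists_compression_bound hu ht
  have hc : ContractingWith ⟨κ, h0⟩ fun f : L2 => conj e • kapP c k t + P t (K u (P t f)) := by
    refine ⟨by exact_mod_cast h1, LipschitzWith.of_dist_le_mul fun f g => ?_⟩
    rw [dist_add_left, dist_eq_norm, dist_eq_norm, ← P_sub, ← K_sub hu, ← P_sub]
    exact (hb t le_rfl _).trans (mul_le_mul_of_nonneg_left (norm_P_le _ _) h0)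
  have h2 : ContractingWith.fixedPoint _ hc = _ := hc.fixedPoint_isFixedPt.symm
  set f := ContractingWith.fixedPoint _ hc
  refine ⟨f, ?_⟩
  have h3 : P t f = f := by
    rw [h2, P_add, P_smul, P_kapP, P_P le_rfl]
  have h4 : f = conj e • kapP c k t + P t (K u (P t f)) := h2
  rw [h3] at h4
  exact h4

omit hk in
theorem IsPart.unique {t : ℝ} (ht : compressionNorm u t < 1) {e : ℂ} {f g : L2}
    (hf : IsPart u c k e t f) (hg : IsPart u c k e t g) : f = g := by
  obtain ⟨κ, h0, h1, hb⟩ := exists_compression_bound hu ht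
  have h2 := norm_le_of_compression h1 (hb t le_rfl) (f := f - g)
    (by rw [P_sub, hf.P_eq, hg.P_eq])
  have h3 : f - g - P t (K u (f - g)) = 0 := by
    rw [K_sub hu, P_sub]
    nth_rewrite 1 [hf]
    nth_rewrite 1 [hg]
    abel
  rw [h3, norm_zero, mul_zero] at h2
  exact sub_eq_zero.1 (norm_le_zero_iff.1 h2)

theorem kapP_eq {a t : ℝ} (h1 : a ≤ t) (h2 : a ≤ -t) :
    kapP c k t = P t (tr a k + K u (ind (Ico a t))) := by
  rw [K_ind hu hk h1, add_sub_cancel]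
  symm
  apply eq_toL2
  filter_upwards [P_coe t (c • ind (Ioc (-t) (-a)) + tr t k),
    Lp.coeFn_add (c • ind (Ioc (-t) (-a))) (tr t k), Lp.coeFn_smul c (ind (Ioc (-t) (-a))),
    ind_Ioc_coe (-t) (-a)] with x e1 e2 e3 e4
  rw [e1]
  by_cases hx : x ∈ Iio t
  · rw [indicator_of_mem hx, indicator_of_mem hx, e2, Pi.add_apply, e3, Pi.smul_apply, e4, kap]
    have : x ≤ -a := by have := mem_Iio.1 hx; linarith
    simp [indicator, this]
  · rw [indicator_of_notMem hx, indicator_of_notMem hx]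

theorem continuous_kapP : Continuous (kapP c k) := by
  rw [continuous_iff_continuousAt]
  intro t
  have h1 : Tendsto (fun s => P s (tr (-|t| - 1) k + K u (P s (ind (Ico (-|t| - 1) (t + 1))))))
      (𝓝 t) (𝓝 (P t (tr (-|t| - 1) k + K u (P t (ind (Ico (-|t| - 1) (t + 1))))))) := by
    refine tendsto_P_of_tendsto (tendsto_const_nhds.add ?_)
    exact ((continuous_K hu).tendsto _).comp (tendsto_P _ _)
  have h2 : ∀ s ∈ Ioo (t - 1) (t + 1), P s (tr (-|t| - 1) k +
      K u (P s (ind (Ico (-|t| - 1) (t + 1))))) = kapP c k s := fun s hs => by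
    have e1 := neg_abs_le t
    have e2 := le_abs_self t
    rw [kapP_eq hu hk (a := -|t| - 1) (by linarith [hs.1]) (by linarith [hs.2])]
    congr 3
    apply eq_toL2
    filter_upwards [P_coe s (ind (Ico (-|t| - 1) (t + 1))), ind_Ico_coe (-|t| - 1) (t + 1)]
      with x e3 e4
    rw [e3]
    by_cases hx : x < s
    · have : x < t + 1 := hx.trans hs.2
      simp only [indicator, mem_Iio, hx, if_true, e4, mem_Ico, this, and_true]
    · simp [indicator, hx]
  have hmem : Ioo (t - 1) (t + 1) ∈ 𝓝 t := Ioo_mem_nhds (by linarith) (by linarith)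
  unfold ContinuousAt
  rw [← h2 t (mem_of_mem_nhds hmem)]
  exact h1.congr' (Filter.mem_of_superset hmem fun s hs => h2 s hs)

theorem IsPart.continuousAt {T : ℝ} (hT : ∀ t < T, compressionNorm u t < 1) {e : ℂ} {f : ℝ → L2}
    (hf : ∀ t < T, IsPart u c k e t (f t)) {t : ℝ} (ht : t < T) : ContinuousAt f t := by
  obtain ⟨t1, ht1, ht1T⟩ := exists_between ht
  obtain ⟨κ, h0, h1, hb⟩ := exists_compression_bound hu (hT t1 ht1T)
  have hg : Tendsto (fun s => P s (f t)) (𝓝 t) (𝓝 (f t)) := by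
    have := tendsto_P (f t) t
    rwa [(hf t ht).P_eq] at this
  have hr : Tendsto (fun s => P s (f t) - P s (K u (P s (f t))) - conj e • kapP c k s) (𝓝 t)
      (𝓝 (f t - P t (K u (f t)) - conj e • kapP c k t)) :=
    (hg.sub (tendsto_P_of_tendsto (((continuous_K hu).tendsto _).comp hg))).sub
      (((continuous_kapP hu hk).tendsto t).const_smul _)
  have h2 : f t - P t (K u (f t)) - conj e • kapP c k t = 0 := by
    nth_rewrite 1 [hf t ht]
    abel
  rw [h2] at hr
  have h3 : Tendsto (fun s => P s (f t) - f s) (𝓝 t) (𝓝 0) := by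
    rw [tendsto_zero_iff_norm_tendsto_zero]
    refine squeeze_zero' (Eventually.of_forall fun s => norm_nonneg _) ?_
      (by simpa using (tendsto_zero_iff_norm_tendsto_zero.1 hr).const_mul ((1 - κ)⁻¹))
    filter_upwards [Iio_mem_nhds ht1] with s hs
    have hsT : s < T := lt_trans hs ht1T
    refine (norm_le_of_compression h1 (hb s (le_of_lt hs)) (f := P s (f t) - f s)
      (by rw [P_sub, P_P le_rfl, (hf s hsT).P_eq])).trans (le_of_eq ?_)
    congr 2
    rw [K_sub hu, P_sub]
    nth_rewrite 1 [hf s hsT]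
    abel
  have h4 := hg.sub h3
  rw [sub_zero] at h4
  exact h4.congr fun s => by abel

end

/-! ### The resolvents of differentiation -/

/-- The Fourier multiplier operator with symbol `m`. -/
def FM (m : ℝ → ℂ) (f : L2) : L2 := 𝓕⁻ (toL2 fun w => m w * (𝓕 f : L2) w)

theorem memLp_mul_bdd {m f : ℝ → ℂ} (hm : Continuous m) (hb : ∀ w, ‖m w‖ ≤ 1)
    (hf : MemLp f 2 (volume : Measure ℝ)) : MemLp (fun w => m w * f w) 2 (volume : Measure ℝ) := by
  refine hf.of_le (hm.aestronglyMeasurable.mul hf.1) (Eventually.of_forall fun w => ?_)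
  rw [norm_mul]
  exact mul_le_of_le_one_left (norm_nonneg _) (hb w)

theorem fourier_FM {m : ℝ → ℂ} (hm : Continuous m) (hb : ∀ w, ‖m w‖ ≤ 1) (f : L2) :
    (𝓕 (FM m f) : L2) =ᵐ[volume] fun w => m w * (𝓕 f : L2) w := by
  rw [FM, FourierTransform.fourier_fourierInv_eq]
  exact coeFn_toL2 (memLp_mul_bdd hm hb (memLp_coe _))

/-- The symbol of `(1 + d/dx)⁻¹`. -/
def symA (w : ℝ) : ℂ := (1 + 2 * Real.pi * w * I)⁻¹

/-- The symbol of `(1 - d/dx)⁻¹`. -/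
def symB (w : ℝ) : ℂ := (1 - 2 * Real.pi * w * I)⁻¹

theorem symA_ne (w : ℝ) : (1 + 2 * Real.pi * w * I : ℂ) ≠ 0 := by
  intro h
  have := congrArg Complex.re h
  simp at this

theorem symB_ne (w : ℝ) : (1 - 2 * Real.pi * w * I : ℂ) ≠ 0 := by
  intro h
  have := congrArg Complex.re h
  simp at this

theorem conj_symA (w : ℝ) : conj (symA w) = symB w := by
  simp only [symA, symB, map_inv₀, map_add, map_one, map_mul, Complex.conj_ofReal, Complex.conj_I,
    map_ofNat, mul_neg, sub_eq_add_neg]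

theorem conj_symB (w : ℝ) : conj (symB w) = symA w := by
  rw [← conj_symA, Complex.conj_conj]

theorem continuous_symA : Continuous symA := by
  unfold symA
  exact Continuous.inv₀ (by fun_prop) symA_ne

theorem continuous_symB : Continuous symB := by
  unfold symB
  exact Continuous.inv₀ (by fun_prop) symB_ne

theorem norm_symA_le (w : ℝ) : ‖symA w‖ ≤ 1 := by
  rw [symA, norm_inv]
  refine inv_le_one_of_one_le₀ ?_
  refine le_trans ?_ (Complex.abs_re_le_norm _)
  simp

theorem norm_symB_le (w : ℝ) : ‖symB w‖ ≤ 1 := by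
  rw [← conj_symA, RCLike.norm_conj]; exact norm_symA_le w

theorem memLp_symA : MemLp symA 2 (volume : Measure ℝ) := by
  rw [memLp_two_iff_integrable_sq_norm continuous_symA.aestronglyMeasurable]
  refine integrable_inv_one_add_sq.mono' (continuous_symA.norm.pow 2).aestronglyMeasurable
    (Eventually.of_forall fun w => ?_)
  rw [Real.norm_of_nonneg (by positivity), symA, norm_inv, inv_pow]
  gcongr
  rw [← Complex.normSq_eq_norm_sq, Complex.normSq_apply]
  simp
  have : (1 : ℝ) ≤ 2 * Real.pi := by linarith [Real.pi_gt_three]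
  have h2 : (1 : ℝ) ≤ (2 * Real.pi) ^ 2 := one_le_pow₀ this
  nlinarith [sq_nonneg w, mul_le_mul_of_nonneg_right h2 (sq_nonneg w)]

/-- The operator `(1 + d/dx)⁻¹`, that is `f ↦ ∫_{y < x} e^{y - x} f(y) dy`. -/
def resA (f : L2) : L2 := FM symA f

/-- The operator `(1 - d/dx)⁻¹`. -/
def resB (f : L2) : L2 := FM symB f

theorem fourier_resA (f : L2) : (𝓕 (resA f) : L2) =ᵐ[volume] fun w => symA w * (𝓕 f : L2) w :=
  fourier_FM continuous_symA norm_symA_le f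

theorem fourier_resB (f : L2) : (𝓕 (resB f) : L2) =ᵐ[volume] fun w => symB w * (𝓕 f : L2) w :=
  fourier_FM continuous_symB norm_symB_le f

theorem resA_add (f g : L2) : resA (f + g) = resA f + resA g := by
  apply fourier_inj
  rw [FourierTransform.fourier_add]
  apply Lp.ext
  filter_upwards [fourier_resA (f + g), fourier_resA f, fourier_resA g,
    Lp.coeFn_add (𝓕 (resA f) : L2) (𝓕 (resA g)), Lp.coeFn_add (𝓕 f : L2) (𝓕 g)] with w h1 h2 h3 h4 h5
  rw [h1, h4, Pi.add_apply, h2, h3, FourierTransform.fourier_add, h5, Pi.add_apply, mul_add]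

theorem resB_smul (c : ℂ) (f : L2) : resB (c • f) = c • resB f := by
  apply fourier_inj
  rw [FourierTransform.fourier_smul]
  apply Lp.ext
  filter_upwards [fourier_resB (c • f), fourier_resB f,
    Lp.coeFn_smul c (𝓕 (resB f) : L2), Lp.coeFn_smul c (𝓕 f : L2)] with w h1 h2 h3 h4
  rw [h1, h3, Pi.smul_apply, h2, FourierTransform.fourier_smul, h4, Pi.smul_apply, smul_eq_mul,
    smul_eq_mul]
  ring

theorem resA_sub (f g : L2) : resA (f - g) = resA f - resA g := by
  rw [eq_sub_iff_add_eq, ← resA_add, sub_add_cancel]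

theorem norm_resA_le (f : L2) : ‖resA f‖ ≤ ‖f‖ := by
  rw [← Lp.norm_fourier_eq (resA f), ← Lp.norm_fourier_eq f]
  refine Lp.norm_le_norm_of_ae_le ?_
  filter_upwards [fourier_resA f] with w h
  rw [h, norm_mul]
  exact mul_le_of_le_one_left (norm_nonneg _) (norm_symA_le w)

theorem K_resB {u : ℝ → ℂ} (hu : IsUnimodular u) (f : L2) : K u (resB f) = resA (K u f) := by
  apply fourier_inj
  apply Lp.ext
  filter_upwards [fourier_K hu (resB f), fourier_resB f, fourier_resA (K u f), fourier_K hu f]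
    with w h1 h2 h3 h4
  rw [h1, h2, h3, h4, map_mul, conj_symB]
  ring

theorem inner_resB (f g : L2) : inner ℂ (resB f) g = inner ℂ f (resA g) := by
  rw [← Lp.inner_fourier_eq (resB f) g, ← Lp.inner_fourier_eq f (resA g), inner_eq_integral,
    inner_eq_integral]
  refine integral_congr_ae ?_
  filter_upwards [fourier_resB f, fourier_resA g] with w h1 h2
  rw [h1, h2, map_mul, conj_symB]
  ring

theorem inner_resA (f g : L2) : inner ℂ (resA f) g = inner ℂ f (resB g) := by
  rw [← inner_conj_symm, ← inner_resB, inner_conj_symm]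

theorem resA_eq (f : L2) : resA f = -resB f + (2 : ℂ) • resA (resB f) := by
  apply fourier_inj
  rw [FourierTransform.fourier_add, FourierTransform.fourier_smul,
    show (𝓕 (-resB f) : L2) = -𝓕 (resB f) from (Lp.fourierTransformₗᵢ ℝ ℂ).map_neg _]
  apply Lp.ext
  filter_upwards [fourier_resA f, fourier_resB f, fourier_resA (resB f),
    Lp.coeFn_add (-𝓕 (resB f) : L2) ((2 : ℂ) • 𝓕 (resA (resB f))), Lp.coeFn_neg (𝓕 (resB f) : L2),
    Lp.coeFn_smul (2 : ℂ) (𝓕 (resA (resB f)) : L2)] with w h1 h2 h3 h4 h5 h6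
  rw [h1, h4, Pi.add_apply, h5, Pi.neg_apply, h6, Pi.smul_apply, h3, h2, smul_eq_mul, symA, symB]
  have := symA_ne w
  have := symB_ne w
  field_simp
  ring

theorem norm_reflection (f : L2) : ‖-f + (2 : ℂ) • resA f‖ = ‖f‖ := by
  rw [← Lp.norm_fourier_eq, ← Lp.norm_fourier_eq f]
  have h : ∀ᵐ w : ℝ, ‖(𝓕 (-f + (2 : ℂ) • resA f) : L2) w‖ = ‖(𝓕 f : L2) w‖ := by
    rw [FourierTransform.fourier_add, FourierTransform.fourier_smul,
      show (𝓕 (-f) : L2) = -𝓕 f from (Lp.fourierTransformₗᵢ ℝ ℂ).map_neg _]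
    filter_upwards [fourier_resA f, Lp.coeFn_add (-𝓕 f : L2) ((2 : ℂ) • 𝓕 (resA f)),
      Lp.coeFn_neg (𝓕 f : L2), Lp.coeFn_smul (2 : ℂ) (𝓕 (resA f) : L2)] with w h1 h2 h3 h4
    rw [h2, Pi.add_apply, h3, Pi.neg_apply, h4, Pi.smul_apply, h1, smul_eq_mul]
    have e : -(𝓕 f : L2) w + 2 * (symA w * (𝓕 f : L2) w) =
        (symA w * (symB w)⁻¹) * (𝓕 f : L2) w := by
      have := symA_ne w
      rw [symA, symB, inv_inv]
      field_simp
      ring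
    rw [e, norm_mul, norm_mul, norm_inv, ← conj_symA, RCLike.norm_conj, mul_inv_cancel₀, one_mul]
    rw [norm_ne_zero_iff, symA]
    exact inv_ne_zero (symA_ne w)
  exact le_antisymm (Lp.norm_le_norm_of_ae_le (h.mono fun w hw => hw.le))
    (Lp.norm_le_norm_of_ae_le (h.mono fun w hw => hw.ge))

/-- The kernel `y ↦ e^{y - x} 1_{y ≤ x}` of `resA`. -/
def expTail (x : ℝ) (y : ℝ) : ℂ := (Iic x).indicator (fun y : ℝ => (Real.exp (y - x) : ℂ)) y

theorem norm_expTail (x y : ℝ) : ‖expTail x y‖ = (Iic x).indicator (fun y => Real.exp (y - x)) y := by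
  by_cases h : y ≤ x
  · simp only [expTail, indicator, mem_Iic, h, if_true, Complex.norm_real, Real.norm_eq_abs,
      Real.abs_exp]
  · simp [expTail, indicator, h]

theorem integrableOn_exp_sub (x : ℝ) : IntegrableOn (fun y => Real.exp (y - x)) (Iic x) := by
  simp_rw [Real.exp_sub, div_eq_mul_inv]
  exact (integrableOn_exp_Iic x).mul_const _

theorem aestronglyMeasurable_expTail (x : ℝ) : AEStronglyMeasurable (expTail x) volume :=
  (Continuous.aestronglyMeasurable (by fun_prop)).indicator measurableSet_Iic

theorem integrable_expTail (x : ℝ) : Integrable (expTail x) := by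
  rw [← integrable_norm_iff (aestronglyMeasurable_expTail x)]
  simp_rw [norm_expTail]
  exact (integrable_indicator_iff measurableSet_Iic).2 (integrableOn_exp_sub x)

theorem norm_expTail_le (x y : ℝ) : ‖expTail x y‖ ≤ 1 := by
  rw [norm_expTail]
  by_cases h : y ≤ x
  · simp [indicator, h]
  · simp [indicator, h]

theorem norm_sq_expTail_le (x y : ℝ) : ‖expTail x y‖ ^ 2 ≤ ‖expTail x y‖ := by
  have := norm_expTail_le x y
  nlinarith [norm_nonneg (expTail x y)]

theorem memLp_expTail (x : ℝ) : MemLp (expTail x) 2 (volume : Measure ℝ) := by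
  rw [memLp_two_iff_integrable_sq_norm (aestronglyMeasurable_expTail x)]
  refine (integrable_expTail x).norm.mono' ((aestronglyMeasurable_expTail x).norm.pow 2)
    (Eventually.of_forall fun y => ?_)
  rw [Real.norm_of_nonneg (by positivity)]
  exact norm_sq_expTail_le x y

theorem norm_toL2_expTail_le (x : ℝ) : ‖toL2 (expTail x)‖ ≤ 1 := by
  have h : ‖toL2 (expTail x)‖ ^ 2 ≤ 1 := by
    rw [norm_sq_eq_integral]
    calc ∫ y, ‖toL2 (expTail x) y‖ ^ 2 = ∫ y, ‖expTail x y‖ ^ 2 := by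
          refine integral_congr_ae ?_
          filter_upwards [coeFn_toL2 (memLp_expTail x)] with y hy
          rw [hy]
      _ ≤ ∫ y, ‖expTail x y‖ := by
          refine integral_mono_of_nonneg (Eventually.of_forall fun y => by positivity)
            (integrable_expTail x).norm (Eventually.of_forall fun y => norm_sq_expTail_le x y)
      _ = 1 := by
          simp_rw [norm_expTail]
          rw [integral_indicator measurableSet_Iic]
          simp_rw [Real.exp_sub, div_eq_mul_inv]
          rw [integral_mul_const, integral_exp_Iic, mul_inv_cancel₀ (Real.exp_ne_zero x)]
  nlinarith [norm_nonneg (toL2 (expTail x))]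

theorem fourier_expTail (x w : ℝ) :
    𝓕 (expTail x) w = Complex.exp (-(2 * Real.pi * w * x * I)) * symB w := by
  rw [Real.fourier_real_eq_integral_exp_smul]
  have h1 : ∀ y : ℝ, Complex.exp (↑(-2 * Real.pi * y * w) * I) • expTail x y =
      (Iic x).indicator (fun y : ℝ => Complex.exp (-x) *
        Complex.exp ((1 - 2 * Real.pi * w * I) * y)) y := by
    intro y
    by_cases hy : y ∈ Iic x
    · simp only [expTail, indicator_of_mem hy, smul_eq_mul]
      push_cast
      rw [← Complex.exp_add, ← Complex.exp_add]
      congr 1; ring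
    · simp [expTail, indicator_of_notMem hy]
  simp_rw [h1]
  rw [integral_indicator measurableSet_Iic, integral_const_mul,
    integral_exp_mul_complex_Iic (by simp), symB, ← mul_div_assoc, ← Complex.exp_add, div_eq_mul_inv]
  congr 2; ring

theorem resA_coe (f : L2) : resA f =ᵐ[volume] fun x => ∫ y, expTail x y * f y := by
  have hm := memLp_mul_bdd continuous_symA norm_symA_le (memLp_coe (𝓕 f : L2))
  have hi : Integrable fun w => symA w * (𝓕 f : L2) w := integrable_mul_L2 memLp_symA (memLp_coe _)
  filter_upwards [fourierInv_toL2_ae hm hi] with x hx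
  rw [resA, FM, hx, Real.fourierInv_eq_fourier_neg, Real.fourier_real_eq_integral_exp_smul]
  have h1 : ∫ y, expTail x y * f y = inner ℂ (toL2 (expTail x)) f := by
    rw [inner_eq_integral]
    refine integral_congr_ae ?_
    filter_upwards [coeFn_toL2 (memLp_expTail x)] with y hy
    rw [hy]
    congr 1
    by_cases hyx : y ∈ Iic x
    · simp only [expTail, indicator_of_mem hyx, Complex.conj_ofReal]
    · simp [expTail, indicator_of_notMem hyx]
  rw [h1, ← Lp.inner_fourier_eq, inner_eq_integral]
  refine integral_congr_ae ?_
  filter_upwards [fourier_toL2_ae (memLp_expTail x) (integrable_expTail x)] with w hw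
  rw [hw, fourier_expTail, map_mul, conj_symB, ← Complex.exp_conj, smul_eq_mul, ← mul_assoc]
  congr 3
  simp only [map_neg, map_mul, Complex.conj_ofReal, Complex.conj_I, map_ofNat]
  push_cast; ring

theorem norm_resA_ae_le (f : L2) : ∀ᵐ x : ℝ, ‖resA f x‖ ≤ ‖f‖ := by
  filter_upwards [resA_coe f] with x hx
  rw [hx]
  simp_rw [mul_comm (expTail x _)]
  refine (norm_integral_mul_le f _ (memLp_expTail x)).trans ?_
  exact mul_le_of_le_one_right (norm_nonneg _) (norm_toL2_expTail_le x)

theorem resA_ae_zero {f : L2} {a : ℝ} (hf : ∀ᵐ x : ℝ, x < a → f x = 0) :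
    ∀ᵐ x : ℝ, x < a → resA f x = 0 := by
  filter_upwards [resA_coe f] with x hx hxa
  rw [hx]
  refine integral_eq_zero_of_ae ?_
  filter_upwards [hf] with y hy
  by_cases h : y ∈ Iic x
  · rw [hy (lt_of_le_of_lt h hxa)]; simp
  · simp [expTail, indicator_of_notMem h]

theorem P_resA_congr {f g : L2} {a : ℝ} (h : P a f = P a g) : P a (resA f) = P a (resA g) := by
  have h1 : ∀ᵐ x : ℝ, x < a → (f - g) x = 0 := by
    filter_upwards [Lp.coeFn_sub f g, P_ae_eq a f, P_ae_eq a g] with x h1 h2 h3 hx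
    rw [h1, Pi.sub_apply, ← h2 hx, ← h3 hx, h, sub_self]
  have h2 := resA_ae_zero h1
  refine P_eq_of_ae ?_
  rw [resA_sub] at h2
  filter_upwards [h2, Lp.coeFn_sub (resA f) (resA g)] with x h3 h4 hx
  have := h3 hx
  rw [h4, Pi.sub_apply] at this
  exact sub_eq_zero.1 this

/-- Beyond `a`, the function `resA (P_a f)` is a multiple of `e^{a - x}`. -/
theorem resA_P_coe (f : L2) (a : ℝ) : ∀ᵐ x : ℝ, a ≤ x →
    resA (P a f) x = Real.exp (a - x) * ∫ y, expTail a y * f y := by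
  filter_upwards [resA_coe (P a f)] with x hx hax
  rw [hx, ← integral_const_mul]
  refine integral_congr_ae ?_
  filter_upwards [P_coe a f, Measure.ae_ne volume a] with y hy hya
  rw [hy]
  by_cases h : y < a
  · have h2 : y ≤ x := h.le.trans hax
    simp only [expTail, indicator, mem_Iic, mem_Iio, h, h.le, h2, if_true]
    rw [← mul_assoc, ← Complex.ofReal_mul, ← Real.exp_add]
    congr 3; ring
  · have h3 : ¬ y ≤ a := fun h4 => h (lt_of_le_of_ne h4 hya)
    simp [expTail, indicator, h, h3]

/-! ### Estimates by the norm in `L¹` -/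

theorem norm_resB_le_of_ae {W r : L2} {a : ℝ} (hr : Integrable r)
    (h : ∀ᵐ x : ℝ, a ≤ x → W x = r x) : ‖resB W - P a (resB W)‖ ≤ ∫ x, ‖r x‖ := by
  set g := resB W - P a (resB W) with hg
  have hg0 : ∀ᵐ x : ℝ, x < a → g x = 0 := by
    filter_upwards [Lp.coeFn_sub (resB W) (P a (resB W)), P_ae_eq a (resB W)] with x h1 h2 hx
    rw [hg, h1, Pi.sub_apply, h2 hx, sub_self]
  have h1 : inner ℂ g (P a (resB W)) = 0 := by
    rw [inner_eq_integral]
    refine integral_eq_zero_of_ae ?_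
    filter_upwards [hg0, P_ae_zero a (resB W)] with x h2 h3
    by_cases hx : x < a
    · rw [h2 hx]; simp
    · rw [h3 (not_lt.1 hx)]; simp
  have h2 : inner ℂ g g = inner ℂ (resA g) W := by
    nth_rewrite 2 [hg]
    rw [inner_sub_right, h1, sub_zero, inner_resA]
  have h3 : ‖g‖ ^ 2 ≤ ‖g‖ * ∫ x, ‖r x‖ := by
    have h4 : ‖g‖ ^ 2 = ‖inner ℂ g g‖ := by
      rw [inner_self_eq_norm_sq_to_K]; simp
    rw [h4, h2, inner_eq_integral, ← integral_const_mul]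
    refine norm_integral_le_of_norm_le (hr.norm.const_mul _) ?_
    filter_upwards [norm_resA_ae_le g, resA_ae_zero hg0, h] with x h5 h6 h7
    rw [norm_mul, RCLike.norm_conj]
    by_cases hx : x < a
    · rw [h6 hx]; simp; positivity
    · rw [h7 (not_lt.1 hx)]
      gcongr
  by_cases h0 : ‖g‖ = 0
  · rw [h0]; exact integral_nonneg fun x => norm_nonneg _
  · have : 0 < ‖g‖ := lt_of_le_of_ne (norm_nonneg _) (Ne.symm h0)
    nlinarith

theorem norm_resB_le {r : L2} (hr : Integrable r) : ‖resB r‖ ≤ ∫ x, ‖r x‖ := by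
  set g := resB r with hg
  have h2 : inner ℂ g g = inner ℂ (resA g) r := by
    nth_rewrite 2 [hg]
    rw [inner_resA]
  have h3 : ‖g‖ ^ 2 ≤ ‖g‖ * ∫ x, ‖r x‖ := by
    have h4 : ‖g‖ ^ 2 = ‖inner ℂ g g‖ := by
      rw [inner_self_eq_norm_sq_to_K]; simp
    rw [h4, h2, inner_eq_integral, ← integral_const_mul]
    refine norm_integral_le_of_norm_le (hr.norm.const_mul _) ?_
    filter_upwards [norm_resA_ae_le g] with x h5
    rw [norm_mul, RCLike.norm_conj]
    gcongr
  by_cases h0 : ‖g‖ = 0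
  · rw [h0]; exact integral_nonneg fun x => norm_nonneg _
  · have : 0 < ‖g‖ := lt_of_le_of_ne (norm_nonneg _) (Ne.symm h0)
    nlinarith

/-! ### Resolvents of Schwartz functions -/

theorem fourier_deriv_schwartz (g : 𝓢(ℝ, ℂ)) (w : ℝ) :
    (𝓕 (SchwartzMap.derivCLM ℂ ℂ g)) w = 2 * Real.pi * I * w * (𝓕 g) w := by
  have h := Real.fourier_deriv (f := g) g.integrable
    (g.smooth 1 |>.differentiable (by norm_num)) ((SchwartzMap.derivCLM ℂ ℂ g).integrable)
  have h2 := congrFun h w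
  rw [smul_eq_mul] at h2
  exact h2

theorem resA_schwartz (g : 𝓢(ℝ, ℂ)) :
    resA ((g + SchwartzMap.derivCLM ℂ ℂ g).toLp 2) = g.toLp 2 := by
  apply fourier_inj
  apply Lp.ext
  filter_upwards [fourier_resA ((g + SchwartzMap.derivCLM ℂ ℂ g).toLp 2),
    (𝓕 (g + SchwartzMap.derivCLM ℂ ℂ g)).coeFn_toLp 2 volume, (𝓕 g).coeFn_toLp 2 volume]
    with w h1 h2 h3
  rw [h1, SchwartzMap.toLp_fourier_eq, SchwartzMap.toLp_fourier_eq, h2, h3,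
    FourierTransform.fourier_add, add_apply, fourier_deriv_schwartz, symA]
  have := symA_ne w
  field_simp

theorem resB_schwartz (g : 𝓢(ℝ, ℂ)) :
    resB ((g - SchwartzMap.derivCLM ℂ ℂ g).toLp 2) = g.toLp 2 := by
  apply fourier_inj
  apply Lp.ext
  filter_upwards [fourier_resB ((g - SchwartzMap.derivCLM ℂ ℂ g).toLp 2),
    (𝓕 (g - SchwartzMap.derivCLM ℂ ℂ g)).coeFn_toLp 2 volume, (𝓕 g).coeFn_toLp 2 volume]
    with w h1 h2 h3
  rw [h1, SchwartzMap.toLp_fourier_eq, SchwartzMap.toLp_fourier_eq, h2, h3,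
    show 𝓕 (g - SchwartzMap.derivCLM ℂ ℂ g) = 𝓕 g - 𝓕 (SchwartzMap.derivCLM ℂ ℂ g) from
      map_sub (FourierTransform.fourierCLM ℂ 𝓢(ℝ, ℂ)) _ _,
    sub_apply, fourier_deriv_schwartz, symB]
  have := symB_ne w
  field_simp

/-- The complex conjugate of a Schwartz function. -/
def conjS (g : 𝓢(ℝ, ℂ)) : 𝓢(ℝ, ℂ) :=
  SchwartzMap.postcompCLM (𝕜 := ℝ) (Complex.conjCLE : ℂ →L[ℝ] ℂ) g

theorem conjS_apply (g : 𝓢(ℝ, ℂ)) (x : ℝ) : conjS g x = conj (g x) := rfl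

theorem integral_mul_schwartz (f : L2) (g : 𝓢(ℝ, ℂ)) :
    ∫ x, f x * g x = inner ℂ ((conjS g).toLp 2) f := by
  rw [integral_mul_eq_inner f g (memLp_schwartz g), ← toL2_schwartz]
  rfl

theorem integral_mul_eq_resB (W : L2) (g : 𝓢(ℝ, ℂ)) : ∫ x, W x * g x =
    inner ℂ ((conjS g + SchwartzMap.derivCLM ℂ ℂ (conjS g)).toLp 2) (resB W) := by
  rw [integral_mul_schwartz, ← inner_resA, resA_schwartz]

theorem integral_mul_eq_resA (V : L2) (g : 𝓢(ℝ, ℂ)) : ∫ x, V x * g x =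
    inner ℂ ((conjS g - SchwartzMap.derivCLM ℂ ℂ (conjS g)).toLp 2) (resA V) := by
  rw [integral_mul_schwartz, ← inner_resB, resB_schwartz]

/-! ### Approximate solutions of the homogeneous equation -/

/-- A sequence of approximate solutions `W_n` of `W = P_t K W`. -/
structure IsKSeq (u : ℝ → ℂ) (t : ℝ) (ε : ℕ → ℝ) (W r : ℕ → L2) : Prop where
  pos : ∀ n, 0 < ε n
  lim : Tendsto ε atTop (𝓝 0)
  supp : ∀ n, ∀ᵐ x : ℝ, ε n < |x - t| → r n x = 0
  small : Tendsto (fun n => ∫ x, ‖r n x‖) atTop (𝓝 0)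
  eq : ∀ n, W n = P (t - ε n) (K u (W n)) + r n

theorem integrable_of_supp {r : L2} {t ε : ℝ} (h : ∀ᵐ x : ℝ, ε < |x - t| → r x = 0) :
    Integrable r := by
  have h1 : Integrable ((Icc (t - ε) (t + ε)).indicator r) :=
    (integrable_indicator_iff measurableSet_Icc).2
      ((L2_locallyIntegrable r).integrableOn_isCompact isCompact_Icc)
  refine h1.congr ?_
  filter_upwards [h] with x hx
  by_cases hm : x ∈ Icc (t - ε) (t + ε)
  · rw [indicator_of_mem hm]
  · rw [indicator_of_notMem hm, hx]
    by_contra hc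
    rw [not_lt, abs_le] at hc
    exact hm ⟨by linarith, by linarith⟩

theorem exists_weak_limit (s : ℕ → L2) (hs : ∀ n, ‖s n‖ ≤ 1) :
    ∃ (a : L2) (φ : ℕ → ℕ), StrictMono φ ∧
      ∀ g : L2, Tendsto (fun n => inner ℂ (s (φ n)) g) atTop (𝓝 (inner ℂ a g)) := by
  have : Fact ((2 : ENNReal) ≠ ⊤) := ⟨by norm_num⟩
  have hc := WeakDual.isSeqCompact_closedBall ℂ L2 (0 : StrongDual ℂ L2) 1
  obtain ⟨ψ, -, φ, hφ, hlim⟩ := hc (x := fun n =>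
    StrongDual.toWeakDual (InnerProductSpace.toDual ℂ L2 (s n))) (fun n => by
      simp only [mem_preimage, Metric.mem_closedBall, dist_zero_right]
      refine le_trans (le_of_eq ?_) (hs n)
      exact (InnerProductSpace.toDual ℂ L2).norm_map (s n))
  refine ⟨(InnerProductSpace.toDual ℂ L2).symm (WeakDual.toStrongDual ψ), φ, hφ, fun g => ?_⟩
  have h1 := ((WeakDual.eval_continuous g).tendsto ψ).comp hlim
  have h2 : inner ℂ ((InnerProductSpace.toDual ℂ L2).symm (WeakDual.toStrongDual ψ)) g = ψ g := by
    rw [InnerProductSpace.toDual_symm_apply]; rfl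
  rw [h2]
  exact h1

theorem norm_le_of_exp_tail {g : L2} {a : ℝ} {c : ℂ} (h0 : ∀ᵐ x : ℝ, x < a → g x = 0)
    (h1 : ∀ᵐ x : ℝ, a ≤ x → g x = Real.exp (a - x) * c) : ‖g‖ ≤ ‖c‖ := by
  have hi : IntegrableOn (fun x => Real.exp (a - x)) (Ioi a) := by
    simp_rw [sub_eq_add_neg, Real.exp_add]
    exact (integrableOn_exp_neg_Ioi a).const_mul _
  have h2 : ‖g‖ ^ 2 ≤ ‖c‖ ^ 2 := by
    rw [norm_sq_eq_integral]
    calc ∫ x, ‖g x‖ ^ 2 ≤ ∫ x, (Ioi a).indicator (fun x => Real.exp (a - x)) x * ‖c‖ ^ 2 := by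
          refine integral_mono_of_nonneg (Eventually.of_forall fun x => by positivity)
            (((integrable_indicator_iff measurableSet_Ioi).2 hi).mul_const _) ?_
          filter_upwards [h0, h1, Measure.ae_ne volume a] with x e0 e1 hne
          rcases lt_or_gt_of_ne hne with hx | hx
          · simp [e0 hx, indicator, not_lt.2 hx.le]
          · rw [e1 hx.le, norm_mul, indicator_of_mem (show x ∈ Ioi a from hx), mul_pow,
              Complex.norm_real, Real.norm_eq_abs, Real.abs_exp]
            gcongr
            have h3 : Real.exp (a - x) ≤ 1 := Real.exp_le_one_iff.2 (by linarith)
            nlinarith [Real.exp_pos (a - x)]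
      _ = ‖c‖ ^ 2 := by
          rw [integral_mul_const, integral_indicator measurableSet_Ioi]
          simp_rw [sub_eq_add_neg, Real.exp_add]
          rw [integral_const_mul, integral_exp_neg_Ioi, ← Real.exp_add]
          simp
  exact le_of_sq_le_sq h2 (norm_nonneg _)

theorem norm_sq_P_add (a : ℝ) (g : L2) : ‖g‖ ^ 2 = ‖P a g‖ ^ 2 + ‖g - P a g‖ ^ 2 := by
  have h : inner ℂ (P a g) (g - P a g) = 0 := by
    rw [inner_eq_integral]
    refine integral_eq_zero_of_ae ?_
    filter_upwards [Lp.coeFn_sub g (P a g), P_coe a g] with x h1 h2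
    rw [h1, Pi.sub_apply, h2]
    by_cases hx : x ∈ Iio a <;> simp [hx]
  have := norm_add_sq_eq_norm_sq_add_norm_sq_of_inner_eq_zero (𝕜 := ℂ) (P a g) (g - P a g) h
  rw [add_sub_cancel] at this
  nlinarith

/-- The value at `a` of `resA s`. -/
def tailVal (a : ℝ) (s : L2) : ℂ := inner ℂ (toL2 (expTail a)) s

theorem tailVal_eq (a : ℝ) (s : L2) : tailVal a s = ∫ y, expTail a y * s y := by
  rw [tailVal, inner_eq_integral]
  refine integral_congr_ae ?_
  filter_upwards [coeFn_toL2 (memLp_expTail a)] with y hy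
  rw [hy]
  congr 1
  by_cases hyx : y ∈ Iic a
  · simp only [expTail, indicator_of_mem hyx, Complex.conj_ofReal]
  · simp [expTail, indicator_of_notMem hyx]

theorem norm_sq_le_reflection (a : ℝ) (s : L2) :
    ‖P a s‖ ^ 2 ≤ ‖P a (-P a s + (2 : ℂ) • resA (P a s))‖ ^ 2 + 4 * ‖tailVal a s‖ ^ 2 := by
  have h := norm_sq_P_add a (-P a s + (2 : ℂ) • resA (P a s))
  rw [norm_reflection] at h
  rw [h]
  have h2 : ‖-P a s + (2 : ℂ) • resA (P a s) - P a (-P a s + (2 : ℂ) • resA (P a s))‖ ≤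
      ‖2 * tailVal a s‖ := by
    have e : -P a s + (2 : ℂ) • resA (P a s) - P a (-P a s + (2 : ℂ) • resA (P a s)) =
        (2 : ℂ) • (resA (P a s) - P a (resA (P a s))) := by
      rw [P_add, P_smul, show P a (-P a s) = -P a s by
        rw [← neg_one_smul ℂ, P_smul, P_P le_rfl], smul_sub]
      abel
    rw [e]
    refine norm_le_of_exp_tail (a := a) ?_ ?_
    · filter_upwards [Lp.coeFn_smul (2 : ℂ) (resA (P a s) - P a (resA (P a s))),
        Lp.coeFn_sub (resA (P a s)) (P a (resA (P a s))), P_ae_eq a (resA (P a s))] with x h1 h2 h3 hx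
      rw [h1, Pi.smul_apply, h2, Pi.sub_apply, h3 hx, sub_self, smul_zero]
    · filter_upwards [Lp.coeFn_smul (2 : ℂ) (resA (P a s) - P a (resA (P a s))),
        Lp.coeFn_sub (resA (P a s)) (P a (resA (P a s))), P_ae_zero a (resA (P a s)),
        resA_P_coe s a] with x h1 h2 h3 h4 hx
      rw [h1, Pi.smul_apply, h2, Pi.sub_apply, h3 hx, sub_zero, h4 hx, ← tailVal_eq, smul_eq_mul]
      ring
  have h3 : ‖-P a s + (2 : ℂ) • resA (P a s) - P a (-P a s + (2 : ℂ) • resA (P a s))‖ ^ 2 ≤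
      ‖2 * tailVal a s‖ ^ 2 := by gcongr
  have h4 : ‖2 * tailVal a s‖ ^ 2 = 4 * ‖tailVal a s‖ ^ 2 := by
    rw [norm_mul, mul_pow]; norm_num
  linarith

theorem tendsto_expTail {t : ℝ} {ε : ℕ → ℝ} (h : Tendsto ε atTop (𝓝 0)) :
    Tendsto (fun n => toL2 (expTail (t - ε n))) atTop (𝓝 (toL2 (expTail t))) := by
  have h1 : ∀ n, toL2 (expTail (t - ε n)) = tr (ε n) (toL2 (expTail t)) := fun n => by
    rw [tr_toL2 (memLp_expTail t)]
    congr 1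
    ext y
    by_cases hy : y ≤ t - ε n
    · have : y + ε n ≤ t := by linarith
      simp only [expTail, indicator, mem_Iic, hy, this, if_true]
      congr 2; ring
    · have : ¬ y + ε n ≤ t := by linarith
      simp [expTail, indicator, hy, this]
  simp_rw [h1]
  have := ((continuous_tr (toL2 (expTail t))).tendsto 0).comp h
  rwa [tr_zero] at this

section
variable {u : ℝ → ℂ} (hu : IsUnimodular u)
include hu

theorem reflection_estimate {κ a : ℝ} (hb : ∀ f : L2, ‖P a (K u (P a f))‖ ≤ κ * ‖P a f‖)
    {W r : L2} (hr : Integrable r) (hr0 : ∀ᵐ x : ℝ, x < a → r x = 0)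
    (h : W = P a (K u W) + r) :
    ‖P a (resB W)‖ ^ 2 ≤ (κ * ‖P a (resB W)‖ + 2 * ∫ x, ‖r x‖) ^ 2 +
      4 * ‖tailVal a (resB W)‖ ^ 2 := by
  set s := resB W with hs
  set ρ := ∫ x, ‖r x‖ with hρ
  have hW : ∀ᵐ x : ℝ, W x = P a (K u W) x + r x := by
    have : W =ᵐ[volume] (P a (K u W) + r : L2) :=
      Eventually.of_forall fun x => congrArg (fun g : L2 => g x) h
    filter_upwards [this, Lp.coeFn_add (P a (K u W)) r] with x h1 h2
    rw [h1, h2, Pi.add_apply]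
  have hd : ‖s - P a s‖ ≤ ρ := by
    refine norm_resB_le_of_ae hr ?_
    filter_upwards [hW, P_ae_zero a (K u W)] with x h1 h2 hx
    rw [h1, h2 hx, zero_add]
  have hPW : P a W = P a (K u W) := P_eq_of_ae (by
    filter_upwards [hW, P_ae_eq a (K u W), hr0] with x h1 h2 h3 hx
    rw [h1, h2 hx, h3 hx, add_zero])
  have h1 : P a (-s + (2 : ℂ) • resA s) = P a (K u s) := by
    rw [hs, ← resA_eq, K_resB hu]
    exact P_resA_congr hPW
  have h2 : ‖P a (-P a s + (2 : ℂ) • resA (P a s))‖ ≤ κ * ‖P a s‖ + 2 * ρ := by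
    have e : P a (-P a s + (2 : ℂ) • resA (P a s)) =
        P a (K u (P a s)) + P a (K u (s - P a s)) -
          P a (-(s - P a s) + (2 : ℂ) • resA (s - P a s)) := by
      rw [← P_add, ← K_add hu, add_sub_cancel, ← h1, ← P_sub, resA_sub, smul_sub]
      congr 1
      abel
    rw [e]
    have e1 := hb s
    have e2 : ‖P a (K u (s - P a s))‖ ≤ ρ := (norm_P_le _ _).trans ((norm_K hu _).le.trans hd)
    have e3 : ‖P a (-(s - P a s) + (2 : ℂ) • resA (s - P a s))‖ ≤ ρ :=
      (norm_P_le _ _).trans ((norm_reflection _).le.trans hd)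
    refine (norm_sub_le _ _).trans ?_
    have := norm_add_le (P a (K u (P a s))) (P a (K u (s - P a s)))
    linarith
  refine (norm_sq_le_reflection a s).trans ?_
  gcongr

omit hu in
theorem eq_zero_of_inner_resolvent {h : L2}
    (H : ∀ g : 𝓢(ℝ, ℂ), inner ℂ ((g - SchwartzMap.derivCLM ℂ ℂ g).toLp 2) h = 0) : h = 0 := by
  have h1 : (fun w : ℝ => (1 + 2 * Real.pi * w * I) * (𝓕 h : L2) w) =ᵐ[volume]
      fun _ => 0 := by
    refine ae_eq_of_schwartz ?_ locallyIntegrable_zero fun φ => ?_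
    · exact (L2_locallyIntegrable (𝓕 h : L2)).continuous_smul
        (g := fun w : ℝ => (1 + 2 * Real.pi * w * I : ℂ)) (by fun_prop)
    · have h2 := H (𝓕⁻ (conjS φ))
      rw [← Lp.inner_fourier_eq, inner_eq_integral] at h2
      simp only [zero_mul, integral_zero]
      rw [← h2]
      refine integral_congr_ae ?_
      filter_upwards [(𝓕 (𝓕⁻ (conjS φ) - SchwartzMap.derivCLM ℂ ℂ (𝓕⁻ (conjS φ)))).coeFn_toLp 2
        volume] with w hw
      rw [SchwartzMap.toLp_fourier_eq, hw,
        show 𝓕 (𝓕⁻ (conjS φ) - SchwartzMap.derivCLM ℂ ℂ (𝓕⁻ (conjS φ))) =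
          𝓕 (𝓕⁻ (conjS φ)) - 𝓕 (SchwartzMap.derivCLM ℂ ℂ (𝓕⁻ (conjS φ))) from
        map_sub (FourierTransform.fourierCLM ℂ 𝓢(ℝ, ℂ)) _ _, sub_apply,
        fourier_deriv_schwartz, FourierTransform.fourier_fourierInv_eq, conjS_apply]
      simp only [map_sub, map_mul, Complex.conj_conj, Complex.conj_ofReal, Complex.conj_I, map_ofNat]
      ring
  apply fourier_inj
  rw [show (𝓕 (0 : L2) : L2) = 0 from (Lp.fourierTransformₗᵢ ℝ ℂ).map_zero]
  apply Lp.ext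
  filter_upwards [h1, Lp.coeFn_zero ℂ 2 (volume : Measure ℝ)] with w hw h0
  rw [h0]
  exact (mul_eq_zero.1 hw).resolve_left (symA_ne w)

omit hu in
theorem deriv_conjS (g : 𝓢(ℝ, ℂ)) :
    SchwartzMap.derivCLM ℂ ℂ (conjS g) = conjS (SchwartzMap.derivCLM ℂ ℂ g) := by
  ext x
  rw [conjS_apply, SchwartzMap.derivCLM_apply, SchwartzMap.derivCLM_apply]
  exact (g.hasDerivAt x).star.deriv

omit hu in
theorem conjS_conjS (g : 𝓢(ℝ, ℂ)) : conjS (conjS g) = g := by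
  ext x; simp [conjS_apply]

theorem IsKSeq.tendsto_resB_of_kernel {t : ℝ} (ht : compressionNorm u t < 1)
    (hker : ∀ Y, IsKernelElement u 1 t Y → Y = 0) {ε : ℕ → ℝ} {W r : ℕ → L2}
    (h : IsKSeq u t ε W r) : Tendsto (fun n => resB (W n)) atTop (𝓝 0) := by
  obtain ⟨κ, hκ0, hκ1, hb⟩ := exists_compression_bound hu ht
  by_contra hcon
  rw [tendsto_zero_iff_norm_tendsto_zero, Metric.tendsto_atTop] at hcon
  push Not at hcon
  obtain ⟨η, hη, hN⟩ := hcon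
  have hfreq : ∃ᶠ n in atTop, η ≤ ‖resB (W n)‖ := by
    rw [frequently_atTop]
    intro N
    obtain ⟨n, hn, h1⟩ := hN N
    refine ⟨n, hn, ?_⟩
    simpa using h1
  obtain ⟨ns, hns, hge⟩ := extraction_of_frequently_atTop hfreq
  set N : ℕ → ℝ := fun n => ‖resB (W (ns n))‖ with hNdef
  have hNpos : ∀ n, 0 < N n := fun n => hη.trans_le (hge n)
  set s : ℕ → L2 := fun n => ((N n)⁻¹ : ℂ) • resB (W (ns n)) with hs
  have hs1 : ∀ n, ‖s n‖ = 1 := fun n => by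
    have : ‖((N n)⁻¹ : ℂ)‖ = (N n)⁻¹ := by
      rw [norm_inv, Complex.norm_real, Real.norm_of_nonneg (hNpos n).le]
    rw [hs, norm_smul, this]
    exact inv_mul_cancel₀ (hNpos n).ne'
  obtain ⟨a, φ, hφ, hlim⟩ := exists_weak_limit s fun n => (hs1 n).le
  set W' : ℕ → L2 := fun n => ((N (φ n))⁻¹ : ℂ) • W (ns (φ n)) with hW'
  set r' : ℕ → L2 := fun n => ((N (φ n))⁻¹ : ℂ) • r (ns (φ n)) with hr'
  set ε' : ℕ → ℝ := fun n => ε (ns (φ n)) with hε'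
  have hsub : Tendsto (fun n => ns (φ n)) atTop atTop := (hns.comp hφ).tendsto_atTop
  have hrn : ∀ n, ∫ x, ‖r' n x‖ = (N (φ n))⁻¹ * ∫ x, ‖r (ns (φ n)) x‖ := fun n => by
    rw [← integral_const_mul]
    refine integral_congr_ae ?_
    filter_upwards [Lp.coeFn_smul ((N (φ n))⁻¹ : ℂ) (r (ns (φ n)))] with x hx
    rw [hr']
    simp only
    rw [hx, Pi.smul_apply, norm_smul, norm_inv, Complex.norm_real,
      Real.norm_of_nonneg (hNpos _).le]
  have hK : IsKSeq u t ε' W' r' := by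
    refine ⟨fun n => h.pos _, h.lim.comp hsub, fun n => ?_, ?_, fun n => ?_⟩
    · filter_upwards [h.supp (ns (φ n)), Lp.coeFn_smul ((N (φ n))⁻¹ : ℂ) (r (ns (φ n)))]
        with x h1 h2 hx
      rw [hr']
      simp only
      rw [h2, Pi.smul_apply, h1 hx, smul_zero]
    · refine squeeze_zero (fun n => integral_nonneg fun x => norm_nonneg _) (fun n => ?_)
        (g := fun n => η⁻¹ * ∫ x, ‖r (ns (φ n)) x‖)
        (by simpa using (h.small.comp hsub).const_mul η⁻¹)
      rw [hrn]
      refine mul_le_mul_of_nonneg_right ?_ (integral_nonneg fun x => norm_nonneg _)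
      exact inv_anti₀ hη (hge _)
    · simp only [hW', hr', hε']
      rw [K_smul hu, P_smul, map_inv₀, Complex.conj_ofReal, ← smul_add, ← h.eq]
  have hsW : ∀ n, resB (W' n) = s (φ n) := fun n => resB_smul _ _
  have hlim' : ∀ g : L2, Tendsto (fun n => inner ℂ g (s (φ n))) atTop (𝓝 (inner ℂ g a)) := fun g => by
    have := (Complex.continuous_conj.tendsto _).comp (hlim g)
    simpa only [Function.comp_def, inner_conj_symm] using this
  -- the weak limit does not vanish
  have hne : a ≠ 0 := by
    intro ha
    have htail : Tendsto (fun n => tailVal (t - ε' n) (s (φ n))) atTop (𝓝 0) := by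
      have h1 := hlim' (toL2 (expTail t))
      rw [ha, inner_zero_right] at h1
      have h2 : Tendsto (fun n => inner ℂ (toL2 (expTail (t - ε' n)) - toL2 (expTail t)) (s (φ n)))
          atTop (𝓝 0) := by
        rw [tendsto_zero_iff_norm_tendsto_zero]
        refine squeeze_zero (fun n => norm_nonneg _) (fun n => norm_inner_le_norm _ _) ?_
        simp_rw [hs1, mul_one]
        exact tendsto_iff_norm_sub_tendsto_zero.1 (tendsto_expTail hK.lim)
      have h3 := h2.add h1
      rw [add_zero] at h3
      refine h3.congr fun n => ?_
      rw [inner_sub_left, sub_add_cancel]; rfl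
    set ρ : ℕ → ℝ := fun n => ∫ x, ‖r' n x‖
    have hρ0 : ∀ n, 0 ≤ ρ n := fun n => integral_nonneg fun x => norm_nonneg _
    have hineq : ∀ n, 1 ≤ (κ + 2 * ρ n) ^ 2 + 4 * ‖tailVal (t - ε' n) (s (φ n))‖ ^ 2 + 2 * ρ n := by
      intro n
      have hr0 : ∀ᵐ x : ℝ, x < t - ε' n → r' n x = 0 := by
        filter_upwards [hK.supp n] with x hx hxt
        refine hx ?_
        rw [lt_abs]; right; linarith
      have h1 := reflection_estimate hu (hb (t - ε' n) (by linarith [hK.pos n]))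
        (integrable_of_supp (hK.supp n)) hr0 (hK.eq n)
      have h2 : ‖resB (W' n) - P (t - ε' n) (resB (W' n))‖ ≤ ρ n := by
        refine norm_resB_le_of_ae (integrable_of_supp (hK.supp n)) ?_
        have : W' n =ᵐ[volume] (P (t - ε' n) (K u (W' n)) + r' n : L2) :=
          Eventually.of_forall fun x => congrArg (fun g : L2 => g x) (hK.eq n)
        filter_upwards [this, Lp.coeFn_add (P (t - ε' n) (K u (W' n))) (r' n),
          P_ae_zero (t - ε' n) (K u (W' n))] with x h1 h2 h3 hx
        rw [h1, h2, Pi.add_apply, h3 hx, zero_add]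
      rw [hsW] at h1 h2
      set p := ‖P (t - ε' n) (s (φ n))‖ with hp
      have h3 : p ≤ 1 := (norm_P_le _ _).trans (hs1 _).le
      have h4 : 1 - ρ n ≤ p := by
        have := norm_sub_norm_le (s (φ n)) (P (t - ε' n) (s (φ n)))
        rw [hs1] at this
        linarith
      have hp0 : 0 ≤ p := norm_nonneg _
      have h5 : (κ * p + 2 * ρ n) ^ 2 ≤ (κ + 2 * ρ n) ^ 2 := by
        have := hρ0 n
        gcongr
        exact mul_le_of_le_one_right hκ0 h3
      have h6 : 1 - 2 * ρ n ≤ p ^ 2 := by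
        by_cases hc : ρ n ≤ 1
        · nlinarith [sq_nonneg (ρ n), sq_nonneg (p - (1 - ρ n))]
        · nlinarith [sq_nonneg p]
      have h1' : p ^ 2 ≤ (κ * p + 2 * ρ n) ^ 2 + 4 * ‖tailVal (t - ε' n) (s (φ n))‖ ^ 2 := h1
      linarith
    have hl : Tendsto (fun n => (κ + 2 * ρ n) ^ 2 + 4 * ‖tailVal (t - ε' n) (s (φ n))‖ ^ 2 + 2 * ρ n)
        atTop (𝓝 ((κ + 2 * 0) ^ 2 + 4 * ‖(0 : ℂ)‖ ^ 2 + 2 * 0)) :=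
      ((((hK.small.const_mul 2).const_add κ).pow 2).add ((htail.norm.pow 2).const_mul 4)).add
        (hK.small.const_mul 2)
    have := ge_of_tendsto' hl hineq
    simp only [mul_zero, add_zero, norm_zero, ne_eq, OfNat.ofNat_ne_zero, not_false_eq_true,
      zero_pow] at this
    nlinarith
  -- a kernel element
  set F : TemperedDistribution ℝ ℂ := Lp.toTemperedDistribution (K u a) with hF
  set Y : TemperedDistribution ℝ ℂ := F + TemperedDistribution.derivCLM ℂ F with hY
  have hYg : ∀ g : 𝓢(ℝ, ℂ), Y g = inner ℂ ((conjS g - SchwartzMap.derivCLM ℂ ℂ (conjS g)).toLp 2)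
      (K u a) := by
    intro g
    have e : conjS g - SchwartzMap.derivCLM ℂ ℂ (conjS g) =
        conjS (g - SchwartzMap.derivCLM ℂ ℂ g) := by
      rw [deriv_conjS]; ext x; simp [conjS_apply]
    rw [e, ← integral_mul_schwartz]
    have e2 : Y g = F (g - SchwartzMap.derivCLM ℂ ℂ g) := by
      rw [hY, map_sub]
      change F g + TemperedDistribution.derivCLM ℂ F g = _
      rw [TemperedDistribution.derivCLM_apply_apply, map_neg, sub_eq_add_neg]
    rw [e2, hF, Lp.toTemperedDistribution_apply]
    simp [mul_comm]
  have hYker : IsKernelElement u 1 t Y := by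
    refine ⟨ε', fun n => K u (W' n), r', hK.pos, hK.lim, hK.supp, hK.small, fun n => ?_, fun g => ?_⟩
    · rw [one_smul, ← hK.eq n]
    · rw [hYg, inner_K' hu]
      simp_rw [integral_mul_eq_resA, ← K_resB hu, hsW, inner_K' hu _ (s _)]
      exact hlim _
  have hY0 := hker Y hYker
  refine hne ?_
  have h1 : K u a = 0 := by
    refine eq_zero_of_inner_resolvent fun g => ?_
    have := hYg (conjS g)
    rw [hY0, conjS_conjS] at this
    rw [← this]; rfl
  rw [← K_K hu a, h1]
  exact (Kl hu).map_zero

theorem IsKSeq.tendsto_of_resB {t : ℝ} {ε : ℕ → ℝ} {W r : ℕ → L2} (_h : IsKSeq u t ε W r)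
    (hR : Tendsto (fun n => resB (W n)) atTop (𝓝 0)) (g : 𝓢(ℝ, ℂ)) :
    Tendsto (fun n => ∫ x, W n x * g x) atTop (𝓝 0) ∧
      Tendsto (fun n => ∫ x, K u (W n) x * g x) atTop (𝓝 0) := by
  constructor
  · simp_rw [integral_mul_eq_resB]
    have hc : Continuous fun s : L2 =>
        inner ℂ ((conjS g + SchwartzMap.derivCLM ℂ ℂ (conjS g)).toLp 2) s :=
      continuous_const.inner continuous_id
    simpa [Function.comp_def] using (hc.tendsto 0).comp hR
  · simp_rw [integral_mul_eq_resA, ← K_resB hu]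
    have hK0 : Tendsto (fun n => K u (resB (W n))) atTop (𝓝 0) := by
      have := ((continuous_K hu).tendsto 0).comp hR
      rwa [show K u 0 = 0 from (Kl hu).map_zero] at this
    have hc : Continuous fun s : L2 =>
        inner ℂ ((conjS g - SchwartzMap.derivCLM ℂ ℂ (conjS g)).toLp 2) s :=
      continuous_const.inner continuous_id
    simpa [Function.comp_def] using (hc.tendsto 0).comp hK0

end

/-! ### The case of a square integrable image of the Dirac distribution -/

theorem fourierS_eq (g : 𝓢(ℝ, ℂ)) (w : ℝ) : fourierS g (2 * Real.pi * w) = (𝓕⁻ g) w := by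
  rw [fourierS_apply, SchwartzMap.fourierInv_coe, Real.fourierInv_eq']
  refine integral_congr_ae (Eventually.of_forall fun x => ?_)
  simp only [smul_eq_mul]
  rw [mul_comm]
  congr 2
  simp only [RCLike.inner_apply, conj_trivial]
  push_cast
  ring

theorem KDelta_eq (u : ℝ → ℂ) (s : ℝ) (g : 𝓢(ℝ, ℂ)) :
    KDelta u s g = ∫ w : ℝ, uw u w * Complex.exp (2 * Real.pi * s * w * I) * (𝓕⁻ g) w := by
  have h := Measure.integral_comp_mul_left
    (fun z : ℝ => u z * Complex.exp (-(I * s * z)) * fourierS g (-z)) (-(2 * Real.pi))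
  have hp : |(-(2 * Real.pi))⁻¹| = (2 * Real.pi)⁻¹ := by
    rw [inv_neg, abs_neg, abs_of_pos (inv_pos.2 Real.two_pi_pos)]
  rw [hp, Complex.real_smul] at h
  rw [KDelta, show ((2 * Real.pi : ℂ)⁻¹) = (((2 * Real.pi)⁻¹ : ℝ) : ℂ) by push_cast; rfl, ← h]
  refine integral_congr_ae (Eventually.of_forall fun w => ?_)
  simp only
  rw [← uw_eq u w, show -(-(2 * Real.pi) * w) = 2 * Real.pi * w by ring, fourierS_eq]
  congr 3
  push_cast
  ring

/-- Translation of Schwartz functions. -/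
def trS (h : ℝ) (g : 𝓢(ℝ, ℂ)) : 𝓢(ℝ, ℂ) := SchwartzMap.compSubConstCLM ℂ (-h) g

theorem trS_apply (h : ℝ) (g : 𝓢(ℝ, ℂ)) (x : ℝ) : trS h g x = g (x + h) := by
  rw [trS, SchwartzMap.compSubConstCLM_apply, sub_neg_eq_add]

theorem fourierInv_trS (h : ℝ) (g : 𝓢(ℝ, ℂ)) (w : ℝ) :
    (𝓕⁻ (trS h g)) w = Complex.exp (-(2 * Real.pi * h * w * I)) * (𝓕⁻ g) w := by
  rw [SchwartzMap.fourierInv_coe, Real.fourierInv_eq', SchwartzMap.fourierInv_coe,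
    Real.fourierInv_eq', ← integral_const_mul]
  rw [← integral_add_right_eq_self _ (-h)]
  refine integral_congr_ae (Eventually.of_forall fun x => ?_)
  simp only [smul_eq_mul, trS_apply, neg_add_cancel_right, RCLike.inner_apply, conj_trivial]
  rw [← mul_assoc (Complex.exp _), ← Complex.exp_add]
  congr 2
  push_cast
  ring

theorem tsupport_trS_subset {h b : ℝ} {g : 𝓢(ℝ, ℂ)} (hg : tsupport g ⊆ Iio b) :
    tsupport (trS h g) ⊆ Iio (b - h) := by
  have h1 : (trS h g : ℝ → ℂ) = g ∘ Homeomorph.addRight h := by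
    ext x; rw [trS_apply]; rfl
  rw [h1, tsupport_comp_eq_preimage]
  intro x hx
  have := hg hx
  simp only [Homeomorph.coe_addRight, mem_Iio] at this ⊢
  linarith

theorem KDelta_trS (u : ℝ → ℂ) (s t : ℝ) (g : 𝓢(ℝ, ℂ)) :
    KDelta u s g = KDelta u t (trS (t - s) g) := by
  rw [KDelta_eq, KDelta_eq]
  refine integral_congr_ae (Eventually.of_forall fun w => ?_)
  simp only
  rw [fourierInv_trS, ← mul_assoc (uw u w * _), mul_assoc (uw u w) (Complex.exp _) (Complex.exp _),
    ← Complex.exp_add]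
  congr 3
  push_cast
  ring

theorem norm_toLp_trS (h : ℝ) (g : 𝓢(ℝ, ℂ)) : ‖toL2 (trS h g)‖ = ‖toL2 g‖ := by
  have h1 : toL2 (trS h g) = tr h (toL2 g) := by
    rw [tr_toL2 (memLp_schwartz g)]
    congr 1
    ext x
    exact trS_apply h g x
  rw [h1, LinearIsometry.norm_map]

theorem mem_closure_schwartz {b : ℝ} {y : L2} (hy : P b y = y) :
    y ∈ closure {f : L2 | ∃ g : 𝓢(ℝ, ℂ), tsupport g ⊆ Iio b ∧ f = g.toLp 2} := by
  set S : Submodule ℂ L2 :=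
    { carrier := {f : L2 | ∃ g : 𝓢(ℝ, ℂ), tsupport g ⊆ Iio b ∧ f = g.toLp 2}
      add_mem' := by
        rintro _ _ ⟨g, hg, rfl⟩ ⟨h, hh, rfl⟩
        refine ⟨g + h, (tsupport_add _ _).trans (union_subset hg hh), ?_⟩
        exact ((SchwartzMap.toLpCLM ℂ ℂ 2 volume).map_add g h).symm
      zero_mem' := by
        refine ⟨0, ?_, ?_⟩
        · intro x hx
          simp at hx
        · exact ((SchwartzMap.toLpCLM ℂ ℂ 2 volume).map_zero).symm
      smul_mem' := by
        rintro c _ ⟨g, hg, rfl⟩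
        refine ⟨c • g, (tsupport_smul_subset_right (fun _ => c) g).trans hg, ?_⟩
        exact ((SchwartzMap.toLpCLM ℂ ℂ 2 volume).map_smul c g).symm } with hS
  have h1 : y ∈ Sᗮᗮ := by
    rw [Submodule.mem_orthogonal]
    intro v hv
    rw [Submodule.mem_orthogonal] at hv
    have hv0 : ∀ᵐ x : ℝ, x ∈ Iio b → v x = 0 := by
      refine isOpen_Iio.ae_eq_zero_of_integral_contDiff_smul_eq_zero
        ((L2_locallyIntegrable v).locallyIntegrableOn _) fun φ h1 h2 h3 => ?_
      have hs : HasCompactSupport (fun x => (φ x : ℂ)) :=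
        h2.comp_left (g := fun x : ℝ => (x : ℂ)) rfl
      set g := hs.toSchwartzMap (Complex.ofRealCLM.contDiff.comp h1)
      have hts : tsupport g ⊆ Iio b := by
        refine subset_trans (closure_mono ?_) h3
        intro x hx
        have hx' : ((φ x : ℝ) : ℂ) ≠ 0 := hx
        exact_mod_cast hx'
      have h4 := hv (g.toLp 2) ⟨g, hts, rfl⟩
      rw [inner_eq_integral] at h4
      rw [← h4]
      refine integral_congr_ae ?_
      filter_upwards [g.coeFn_toLp 2 volume] with x hx
      rw [hx, Complex.real_smul]
      congr 1
      exact (Complex.conj_ofReal _).symm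
    rw [inner_eq_integral]
    refine integral_eq_zero_of_ae ?_
    have hy' := P_ae_zero b y
    rw [hy] at hy'
    filter_upwards [hv0, hy'] with x e1 e2
    rcases lt_or_ge x b with hx | hx
    · simp [e1 hx]
    · simp [e2 hx]
  rw [Submodule.orthogonal_orthogonal_eq_closure] at h1
  exact h1

theorem norm_le_of_inner_schwartz {b C : ℝ} {y : L2} (hy : P b y = y) (hC : 0 ≤ C)
    (h : ∀ g : 𝓢(ℝ, ℂ), tsupport g ⊆ Iio b → ‖inner ℂ (g.toLp 2) y‖ ≤ C * ‖g.toLp 2‖) :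
    ‖y‖ ≤ C := by
  have hcl : IsClosed {f : L2 | ‖inner ℂ f y‖ ≤ C * ‖f‖} :=
    isClosed_le ((continuous_id.inner continuous_const).norm) (continuous_const.mul continuous_norm)
  have h1 : y ∈ {f : L2 | ‖inner ℂ f y‖ ≤ C * ‖f‖} := by
    refine closure_minimal ?_ hcl (mem_closure_schwartz hy)
    rintro _ ⟨g, hg, rfl⟩
    exact h g hg
  have h2 : ‖inner ℂ y y‖ ≤ C * ‖y‖ := h1
  rw [inner_self_eq_norm_sq_to_K] at h2
  simp only [Complex.coe_algebraMap, norm_pow, Complex.norm_real, norm_norm] at h2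
  rcases (norm_nonneg y).eq_or_lt with h0 | h0
  · rwa [← h0]
  · nlinarith

theorem integral_swap_exp {F G : ℝ → ℂ} (hF : Integrable F) (hG : Integrable G) :
    ∫ w : ℝ, ∫ s : ℝ, G s * (F w * Complex.exp (2 * Real.pi * s * w * I)) =
      ∫ s : ℝ, G s * ∫ w : ℝ, F w * Complex.exp (2 * Real.pi * s * w * I) := by
  rw [integral_integral_swap]
  · simp_rw [integral_const_mul]
  · have hb : Integrable (fun p : ℝ × ℝ => F p.1 * G p.2) (volume.prod volume) := hF.mul_prod hG
    have hc : Continuous fun p : ℝ × ℝ => Complex.exp (2 * Real.pi * p.2 * p.1 * I) := by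
      fun_prop
    have := hb.bdd_mul (c := 1) hc.aestronglyMeasurable (Eventually.of_forall fun p => by
      rw [norm_exp_real_mul_I (a := 2 * Real.pi * p.2 * p.1) (by push_cast; ring)])
    refine this.congr (Eventually.of_forall fun p => ?_)
    simp only [Function.uncurry]
    ring

section
variable {u : ℝ → ℂ} (hu : IsUnimodular u)
include hu

theorem integral_K_mul {r : L2} (hr : Integrable r) (g : 𝓢(ℝ, ℂ)) :
    ∫ x, K u r x * g x = ∫ s, conj (r s) * KDelta u s g := by
  have h1 : ∫ x, K u r x * g x = ∫ w, (uw u w * conj ((𝓕 r : L2) w)) * (𝓕⁻ g) w := by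
    rw [K, integral_fourierInv_mul]
    refine integral_congr_ae ?_
    filter_upwards [coeFn_toL2 (memLp_uw_conj hu r)] with w hw
    have hw' : (toL2 fun w : ℝ => u (-(2 * Real.pi * w)) * conj ((𝓕 r : L2) w) : L2) w =
      uw u w * conj ((𝓕 r : L2) w) := hw
    rw [hw']
  have hF : (𝓕 r : L2) =ᵐ[volume] 𝓕 (r : ℝ → ℂ) := by
    have := fourier_toL2_ae (memLp_coe r) hr
    rwa [toL2_coe] at this
  have h2 : ∫ w, (uw u w * conj ((𝓕 r : L2) w)) * (𝓕⁻ g) w =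
      ∫ w, ∫ s, conj (r s) * (uw u w * Complex.exp (2 * Real.pi * s * w * I) *
        (𝓕⁻ g) w) := by
    refine integral_congr_ae ?_
    filter_upwards [hF] with w hw
    rw [hw, Real.fourier_real_eq_integral_exp_smul, ← integral_conj, ← integral_const_mul,
      ← integral_mul_const]
    refine integral_congr_ae (Eventually.of_forall fun s => ?_)
    simp only
    rw [smul_eq_mul, map_mul, ← Complex.exp_conj]
    have : conj ((↑(-2 * Real.pi * s * w) : ℂ) * I) =
        2 * Real.pi * s * w * I := by
      rw [map_mul, Complex.conj_ofReal, Complex.conj_I]; push_cast; ring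
    rw [this]
    ring
  have hi : Integrable fun w => uw u w * (𝓕⁻ g) w :=
    ((𝓕⁻ g).integrable).bdd_mul hu.meas_uw (c := 1) (by
      filter_upwards [hu.norm_uw] with w hw using hw.le)
  have hi' : Integrable fun s => conj (r s) :=
    (Complex.conjLIE.toContinuousLinearEquiv : ℂ →L[ℝ] ℂ).integrable_comp hr
  have h3 := integral_swap_exp hi hi'
  simp_rw [mul_right_comm (uw u _) ((𝓕⁻ g) _)] at h3
  rw [h1, h2, h3]
  refine integral_congr_ae (Eventually.of_forall fun s => ?_)
  simp only
  rw [KDelta_eq]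

theorem norm_P_K_le {t ε : ℝ} {w : L2}
    (hw : ∀ g : 𝓢(ℝ, ℂ), tsupport g ⊆ Iio t → KDelta u t g = ∫ x, w x * g x)
    {r : L2} (hr : ∀ᵐ x : ℝ, ε < |x - t| → r x = 0) :
    ‖P (t - ε) (K u r)‖ ≤ ‖w‖ * ∫ x, ‖r x‖ := by
  have hri := integrable_of_supp hr
  refine norm_le_of_inner_schwartz (b := t - ε) (P_P le_rfl _)
    (mul_nonneg (norm_nonneg _) (integral_nonneg fun _ => norm_nonneg _)) fun g hg => ?_
  have hg' : tsupport (conjS g) ⊆ Iio (t - ε) := by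
    refine subset_trans (closure_mono ?_) hg
    intro x hx hx0
    refine hx ?_
    rw [conjS_apply, hx0, map_zero]
  have h1 : inner ℂ (g.toLp 2) (P (t - ε) (K u r)) = ∫ x, K u r x * conjS g x := by
    rw [inner_eq_integral]
    refine integral_congr_ae ?_
    filter_upwards [g.coeFn_toLp 2 volume, P_coe (t - ε) (K u r)] with x e1 e2
    rw [e1, e2, conjS_apply]
    by_cases hx : x ∈ Iio (t - ε)
    · rw [indicator_of_mem hx, mul_comm]
    · rw [indicator_of_notMem hx, image_eq_zero_of_notMem_tsupport fun h => hx (hg h)]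
      simp
  rw [h1, integral_K_mul hu hri]
  have hn : ‖g.toLp 2 volume‖ = ‖toL2 (conjS g)‖ := by
    rw [← toL2_schwartz, ← norm_toL2_conj _ (memLp_schwartz g)]
    rfl
  have h2 : ‖∫ s, conj (r s) * KDelta u s (conjS g)‖ ≤ ∫ s, ‖r s‖ * (‖w‖ * ‖g.toLp 2 volume‖) := by
    refine norm_integral_le_of_norm_le (hri.norm.mul_const _) ?_
    filter_upwards [hr] with s hs
    by_cases hc : ε < |s - t|
    · simp [hs hc]
    · rw [norm_mul, RCLike.norm_conj]
      refine mul_le_mul_of_nonneg_left ?_ (norm_nonneg _)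
      rw [not_lt, abs_le] at hc
      rw [KDelta_trS u s t, hw _ ((tsupport_trS_subset hg').trans (Iio_subset_Iio (by linarith)))]
      refine (norm_integral_mul_le w _ (memLp_schwartz _)).trans ?_
      rw [norm_toLp_trS, hn]
  refine h2.trans (le_of_eq ?_)
  rw [integral_mul_const]
  ring

theorem IsKSeq.tendsto_resB_of_sqIntegrable {t : ℝ} (ht : compressionNorm u t < 1)
    (hw : KDeltaSqIntegrable u t) {ε : ℕ → ℝ} {W r : ℕ → L2}
    (h : IsKSeq u t ε W r) : Tendsto (fun n => resB (W n)) atTop (𝓝 0) := by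
  obtain ⟨w, hw⟩ := hw
  obtain ⟨κ, hκ0, hκ1, hb⟩ := exists_compression_bound hu ht
  have hP : ∀ n, ‖P (t - ε n) (K u (W n))‖ ≤ (1 - κ)⁻¹ * (‖w‖ * ∫ x, ‖r n x‖) := fun n => by
    set a := t - ε n
    set y := P a (K u (W n))
    have h1 : y = P a (K u (P a y)) + P a (K u (r n)) := by
      rw [show P a y = y from P_P le_rfl _, ← P_add, ← K_add hu, ← h.eq n]
    have h2 : ‖y‖ ≤ κ * ‖y‖ + ‖w‖ * ∫ x, ‖r n x‖ := by
      calc ‖y‖ = ‖P a (K u (P a y)) + P a (K u (r n))‖ := by rw [← h1]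
        _ ≤ κ * ‖P a y‖ + ‖w‖ * ∫ x, ‖r n x‖ := by
          refine (norm_add_le _ _).trans (add_le_add (hb a (by linarith [h.pos n]) y) ?_)
          exact norm_P_K_le hu hw (h.supp n)
        _ = _ := by rw [show P a y = y from P_P le_rfl _]
    rw [inv_mul_eq_div, le_div_iff₀ (by linarith)]
    linarith
  have hadd : ∀ f g : L2, resB (f + g) = resB f + resB g := fun f g => by
    apply ext_inner_left ℂ
    intro v
    rw [inner_add_right, ← inner_resA, ← inner_resA, ← inner_resA, inner_add_right]
  have hle : ∀ f : L2, ‖resB f‖ ≤ ‖f‖ := fun f => by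
    rw [← norm_K hu, K_resB hu, ← norm_K hu f]
    exact norm_resA_le _
  rw [tendsto_zero_iff_norm_tendsto_zero]
  refine squeeze_zero (fun n => norm_nonneg _)
    (g := fun n => (1 - κ)⁻¹ * (‖w‖ * ∫ x, ‖r n x‖) + ∫ x, ‖r n x‖) (fun n => ?_) ?_
  · rw [h.eq n, hadd]
    refine (norm_add_le _ _).trans (add_le_add ((hle _).trans (hP n)) ?_)
    exact norm_resB_le (integrable_of_supp (h.supp n))
  · simpa using ((h.small.const_mul ‖w‖).const_mul (1 - κ)⁻¹).add h.small

/-- Approximate solutions of the homogeneous equation tend to zero as tempered distributions. -/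
theorem IsKSeq.tendsto_zero {t : ℝ} (ht : compressionNorm u t < 1) (h4 : CondK4 u t) {ε : ℕ → ℝ}
    {W r : ℕ → L2} (h : IsKSeq u t ε W r) (g : 𝓢(ℝ, ℂ)) :
    Tendsto (fun n => ∫ x, W n x * g x) atTop (𝓝 0) ∧
      Tendsto (fun n => ∫ x, K u (W n) x * g x) atTop (𝓝 0) := by
  refine h.tendsto_of_resB hu ?_ g
  rcases h4 with h4 | h4
  · exact h.tendsto_resB_of_sqIntegrable hu ht h4
  · exact h.tendsto_resB_of_kernel hu ht h4.1

end

/-! ### Difference quotients -/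

theorem norm_diff_quotient_le (g : 𝓢(ℝ, ℂ)) : ∃ C : ℝ, 0 ≤ C ∧ (∀ h ∈ Ioc (0 : ℝ) 1, ∀ x : ℝ,
    ‖((h : ℂ)⁻¹ * (g (x + -(h / 2)) - g (x + h / 2)))‖ ≤ C * ‖symA x‖) ∧
    ∀ x : ℝ, ‖deriv g x‖ ≤ C * ‖symA x‖ := by
  obtain ⟨C, hC⟩ := schwartz_bound (SchwartzMap.derivCLM ℂ ℂ g) 1
  have hC0 : 0 ≤ C := le_trans (by positivity) (hC 0)
  have hs : ∀ x : ℝ, 1 ≤ 7 * (1 + |x|) * ‖symA x‖ := fun x => by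
    rw [symA, norm_inv, ← div_eq_mul_inv, le_div_iff₀ (norm_pos_iff.2 (symA_ne x)), one_mul]
    refine (norm_add_le _ _).trans ?_
    have : ‖(2 * Real.pi * x * I : ℂ)‖ = 2 * Real.pi * |x| := by
      simp [abs_of_pos Real.pi_pos]
    rw [this, norm_one]
    nlinarith [Real.pi_lt_d2, abs_nonneg x]
  have hd : ∀ y : ℝ, (1 + |y|) * ‖deriv g y‖ ≤ C := fun y => by
    have := hC y
    rwa [pow_one] at this
  have key : ∀ x y : ℝ, |y - x| ≤ 1 / 2 → ‖deriv g y‖ ≤ 14 * C * ‖symA x‖ := fun x y hxy => by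
    have h1 := hd y
    have h2 := hs x
    have h3 : 1 + |x| ≤ 2 * (1 + |y|) := by
      have h4 := abs_sub_abs_le_abs_sub x y
      rw [abs_sub_comm] at h4
      linarith [abs_nonneg y]
    have h5 : 0 ≤ ‖deriv g y‖ := norm_nonneg _
    calc ‖deriv g y‖ = ‖deriv g y‖ * 1 := (mul_one _).symm
      _ ≤ ‖deriv g y‖ * (7 * (1 + |x|) * ‖symA x‖) := by gcongr
      _ ≤ ‖deriv g y‖ * (7 * (2 * (1 + |y|)) * ‖symA x‖) := by gcongr
      _ = 14 * ((1 + |y|) * ‖deriv g y‖) * ‖symA x‖ := by ring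
      _ ≤ 14 * C * ‖symA x‖ := by gcongr
  refine ⟨14 * C, by positivity, fun h hh x => ?_, fun x => key x x (by simp)⟩
  have h0 : 0 < h := hh.1
  have h1 := Convex.norm_image_sub_le_of_norm_deriv_le (𝕜 := ℝ) (f := g)
    (s := Icc (x + -(h / 2)) (x + h / 2)) (C := 14 * C * ‖symA x‖) (x := x + h / 2)
    (y := x + -(h / 2)) (fun y _ => g.differentiableAt) (fun y hy => key x y (by
      rw [abs_le]; constructor <;> linarith [hy.1, hy.2, hh.2])) (convex_Icc _ _)
    (right_mem_Icc.2 (by linarith)) (left_mem_Icc.2 (by linarith))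
  rw [show x + -(h / 2) - (x + h / 2) = -h by ring, norm_neg, Real.norm_of_nonneg h0.le] at h1
  rw [norm_mul, norm_inv, Complex.norm_real, Real.norm_of_nonneg h0.le, inv_mul_eq_div,
    div_le_iff₀ h0]
  exact h1

theorem tendsto_diff_quotient (g : 𝓢(ℝ, ℂ)) {h : ℕ → ℝ} (hh : ∀ n, h n ∈ Ioc (0 : ℝ) 1)
    (h0 : Tendsto h atTop (𝓝 0)) :
    Tendsto (fun n => toL2 fun x => ((h n : ℂ)⁻¹ * (g (x + -(h n / 2)) - g (x + h n / 2)))) atTop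
      (𝓝 (toL2 fun x => -deriv g x)) := by
  obtain ⟨C, hC0, hC, hC'⟩ := norm_diff_quotient_le g
  have hn : ∀ x, ‖(C : ℂ) * symA x‖ = C * ‖symA x‖ := fun x => by
    rw [norm_mul, Complex.norm_real, Real.norm_of_nonneg hC0]
  refine tendsto_toL2_of_dominated (g := fun x => (C : ℂ) * symA x) (memLp_symA.const_mul _)
    (fun n => ?_) ?_ (fun n => Eventually.of_forall fun x => ?_)
    (Eventually.of_forall fun x => ?_) (Eventually.of_forall fun x => ?_)
  · have : Continuous g := g.continuous
    exact (by fun_prop : Continuous fun x => ((h n : ℂ)⁻¹ *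
      (g (x + -(h n / 2)) - g (x + h n / 2)))).aestronglyMeasurable
  · exact (SchwartzMap.derivCLM ℂ ℂ g).continuous.neg.aestronglyMeasurable
  · rw [hn]; exact hC _ (hh n) x
  · rw [norm_neg, hn]; exact hC' x
  · have h1 : HasDerivAt (fun s : ℝ => g (x + s)) (deriv g x) 0 := by
      have := (g.differentiableAt (x := x + 0)).hasDerivAt.comp_const_add x 0
      simpa using this
    have h2 := hasDerivAt_iff_tendsto_slope.1 h1
    have hp : Tendsto (fun n => h n / 2) atTop (𝓝[≠] 0) := by
      refine tendsto_nhdsWithin_iff.2 ⟨by simpa using h0.div_const 2, Eventually.of_forall fun n => ?_⟩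
      exact (half_pos (hh n).1).ne'
    have hm : Tendsto (fun n => -(h n / 2)) atTop (𝓝[≠] 0) := by
      refine tendsto_nhdsWithin_iff.2 ⟨by simpa using (h0.div_const 2).neg,
        Eventually.of_forall fun n => ?_⟩
      exact neg_ne_zero.2 (half_pos (hh n).1).ne'
    have h3 := (((h2.comp hp).add (h2.comp hm)).const_mul (-(1 / 2) : ℂ))
    rw [show (-(1 / 2) : ℂ) * (deriv g x + deriv g x) = -deriv g x by ring] at h3
    refine h3.congr fun n => ?_
    have hne : (h n : ℂ) ≠ 0 := by exact_mod_cast (hh n).1.ne'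
    simp only [Function.comp, slope_def_module, sub_zero, add_zero, Complex.real_smul]
    push_cast
    field_simp
    ring

theorem integral_sub_mul (F G : L2) (g : 𝓢(ℝ, ℂ)) :
    ∫ x, (F - G : L2) x * g x = (∫ x, F x * g x) - ∫ x, G x * g x := by
  simp_rw [integral_mul_schwartz, inner_sub_right]

theorem integral_add_mul (F G : L2) (g : 𝓢(ℝ, ℂ)) :
    ∫ x, (F + G : L2) x * g x = (∫ x, F x * g x) + ∫ x, G x * g x := by
  simp_rw [integral_mul_schwartz, inner_add_right]

theorem integral_smul_mul (a : ℂ) (F : L2) (g : 𝓢(ℝ, ℂ)) :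
    ∫ x, (a • F : L2) x * g x = a * ∫ x, F x * g x := by
  simp_rw [integral_mul_schwartz, inner_smul_right]

theorem integral_tr_mul (a : ℝ) (F : L2) (g : 𝓢(ℝ, ℂ)) :
    ∫ x, tr a F x * g x = ∫ x, F x * g (x + -a) := by
  have h1 : ∫ x, tr a F x * g x = ∫ x, F (x + a) * g x := by
    refine integral_congr_ae ?_
    filter_upwards [tr_coe a F] with x hx
    rw [hx]
  rw [h1, ← integral_add_right_eq_self _ (-a)]
  simp

theorem memLp_diff_quotient (g : 𝓢(ℝ, ℂ)) (h : ℝ) : MemLp (fun x => ((h : ℂ)⁻¹ *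
    (g (x + -(h / 2)) - g (x + h / 2)))) 2 (volume : Measure ℝ) :=
  ((memLp_comp_add (memLp_schwartz g) _).sub (memLp_comp_add (memLp_schwartz g) _)).const_mul _

theorem memLp_deriv (g : 𝓢(ℝ, ℂ)) : MemLp (deriv g) 2 (volume : Measure ℝ) :=
  memLp_schwartz (SchwartzMap.derivCLM ℂ ℂ g)

theorem tendsto_integral_mul_mul {F : ℕ → L2} {f : L2} (hF : Tendsto F atTop (𝓝 f))
    {q : ℕ → ℝ → ℂ} {p : ℝ → ℂ} (hq : ∀ n, MemLp (q n) 2 (volume : Measure ℝ))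
    (hp : MemLp p 2 (volume : Measure ℝ)) (h : Tendsto (fun n => toL2 (q n)) atTop (𝓝 (toL2 p))) :
    Tendsto (fun n => ∫ x, F n x * q n x) atTop (𝓝 (∫ x, f x * p x)) := by
  have key : ∀ (F' : L2) (q' : ℝ → ℂ), MemLp q' 2 (volume : Measure ℝ) →
      ∫ x, F' x * q' x = inner ℂ (toL2 fun x => conj (F' x)) (toL2 q') := fun F' q' hq' => by
    rw [inner_eq_integral]
    refine integral_congr_ae ?_
    have hF' : MemLp (fun x => conj (F' x)) 2 (volume : Measure ℝ) := (memLp_coe F').star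
    filter_upwards [coeFn_toL2 hF', coeFn_toL2 hq'] with x h1 h2
    rw [h1, h2, Complex.conj_conj]
  have hconj : Tendsto (fun n => toL2 fun x => conj (F n x)) atTop
      (𝓝 (toL2 fun x => conj (f x))) := by
    rw [tendsto_iff_norm_sub_tendsto_zero] at hF ⊢
    refine hF.congr fun n => ?_
    rw [← toL2_coe (F n - f), ← norm_toL2_conj _ (memLp_coe _)]
    congr 1
    symm
    apply eq_toL2
    have h1 : MemLp (fun x => conj (F n x)) 2 (volume : Measure ℝ) := (memLp_coe (F n)).star
    have h2 : MemLp (fun x => conj (f x)) 2 (volume : Measure ℝ) := (memLp_coe f).star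
    filter_upwards [Lp.coeFn_sub (toL2 fun x => conj (F n x)) (toL2 fun x => conj (f x)),
      coeFn_toL2 h1, coeFn_toL2 h2, Lp.coeFn_sub (F n) f] with x e1 e2 e3 e4
    rw [e1, Pi.sub_apply, e2, e3, e4, Pi.sub_apply, map_sub]
  simp_rw [key _ _ (hq _), key _ _ hp]
  exact hconj.inner h

theorem tendsto_integral_diff {F : ℕ → L2} {f : L2} (hF : Tendsto F atTop (𝓝 f)) (g : 𝓢(ℝ, ℂ))
    {h : ℕ → ℝ} (hh : ∀ n, h n ∈ Ioc (0 : ℝ) 1) (h0 : Tendsto h atTop (𝓝 0)) :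
    Tendsto (fun n => ((h n : ℂ)⁻¹) * ∫ x, (tr (h n / 2) (F n) - tr (-(h n / 2)) (F n) : L2) x * g x)
      atTop (𝓝 (-∫ x, f x * deriv g x)) := by
  have h1 := tendsto_integral_mul_mul hF (fun n => memLp_diff_quotient g (h n)) (memLp_deriv g).neg
    (tendsto_diff_quotient g hh h0)
  have e : ∫ x, f x * (-deriv (⇑g)) x = -∫ x, f x * deriv g x := by
    rw [← integral_neg]
    refine integral_congr_ae (Eventually.of_forall fun x => ?_)
    simp
  rw [e] at h1
  refine h1.congr fun n => ?_
  have hg := memLp_schwartz g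
  rw [integral_sub_mul, integral_tr_mul, integral_tr_mul, neg_neg, ← integral_sub
    (integrable_mul_L2 (memLp_coe _) (memLp_comp_add hg _))
    (integrable_mul_L2 (memLp_coe _) (memLp_comp_add hg _)), ← integral_const_mul]
  refine integral_congr_ae (Eventually.of_forall fun x => ?_)
  simp only
  ring

theorem integral_ind_mul {a b : ℝ} (hab : a ≤ b) (g : 𝓢(ℝ, ℂ)) :
    ∫ x, ind (Ico a b) x * g x = ∫ x in a..b, g x := by
  rw [← ind_Ioc_eq_Ico, intervalIntegral.integral_of_le hab, ← integral_indicator measurableSet_Ioc]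
  refine integral_congr_ae ?_
  filter_upwards [ind_Ioc_coe a b] with x hx
  rw [hx]
  by_cases hm : x ∈ Ioc a b <;> simp [hm]

theorem tendsto_integral_ind {a b : ℕ → ℝ} {t : ℝ} (hab : ∀ n, a n < b n) (ha : ∀ n, a n ≤ t)
    (hb : ∀ n, t ≤ b n) (hl : Tendsto (fun n => b n - a n) atTop (𝓝 0)) (g : 𝓢(ℝ, ℂ)) :
    Tendsto (fun n => (((b n - a n : ℝ) : ℂ)⁻¹) * ∫ x, ind (Ico (a n) (b n)) x * g x) atTop
      (𝓝 (g t)) := by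
  simp_rw [integral_ind_mul (hab _).le]
  rw [Metric.tendsto_atTop]
  intro ε hε
  obtain ⟨δ, hδ, hg⟩ := Metric.continuousAt_iff.1 (g.continuous.continuousAt (x := t)) (ε / 2)
    (half_pos hε)
  obtain ⟨N, hN⟩ := Metric.tendsto_atTop.1 hl δ hδ
  refine ⟨N, fun n hn => ?_⟩
  have hpos : 0 < b n - a n := sub_pos.2 (hab n)
  have hne : ((b n - a n : ℝ) : ℂ) ≠ 0 := by exact_mod_cast hpos.ne'
  have h1 : b n - a n < δ := by
    have := hN n hn
    rwa [Real.dist_0_eq_abs, abs_of_pos hpos] at this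
  have h2 : ‖∫ x in (a n)..(b n), (g x - g t)‖ ≤ ε / 2 * |b n - a n| := by
    refine intervalIntegral.norm_integral_le_of_norm_le_const fun x hx => ?_
    rw [uIoc_of_le (hab n).le] at hx
    rw [← dist_eq_norm]
    refine (hg ?_).le
    rw [Real.dist_eq, abs_lt]
    constructor <;> linarith [hx.1, hx.2, ha n, hb n]
  rw [intervalIntegral.integral_sub (g.continuous.intervalIntegrable _ _) (by simp),
    intervalIntegral.integral_const, Complex.real_smul] at h2
  rw [dist_eq_norm, show ((b n - a n : ℝ) : ℂ)⁻¹ * (∫ x in (a n)..(b n), g x) - g t =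
    ((b n - a n : ℝ) : ℂ)⁻¹ * ((∫ x in (a n)..(b n), g x) - ((b n - a n : ℝ) : ℂ) * g t) by
      field_simp, norm_mul, norm_inv, Complex.norm_real, Real.norm_of_nonneg hpos.le,
    inv_mul_eq_div, div_lt_iff₀ hpos]
  rw [abs_of_pos hpos] at h2
  nlinarith

/-! ### Difference quotients of solutions as approximate homogeneous solutions -/

/-- Intervals `[a_n, b_n]` that contain `t` and shrink to it. -/
structure IsWindow (t : ℝ) (a b : ℕ → ℝ) : Prop where
  lt : ∀ n, a n < b n
  le : ∀ n, a n ≤ t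
  ge : ∀ n, t ≤ b n
  one : ∀ n, b n - a n ≤ 1
  lim : Tendsto (fun n => b n - a n) atTop (𝓝 0)

theorem IsWindow.tendsto_left {t : ℝ} {a b : ℕ → ℝ} (h : IsWindow t a b) :
    Tendsto a atTop (𝓝 t) := by
  refine tendsto_of_tendsto_of_tendsto_of_le_of_le (g := fun n => t - (b n - a n))
    (h := fun _ => t) (by simpa using h.lim.const_sub t) tendsto_const_nhds (fun n => ?_) h.le
  have := h.ge n
  simp only; linarith

theorem IsWindow.tendsto_right {t : ℝ} {a b : ℕ → ℝ} (h : IsWindow t a b) :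
    Tendsto b atTop (𝓝 t) := by
  have := h.lim.add h.tendsto_left
  simpa using this

theorem IsWindow.tendsto_mid {t : ℝ} {a b : ℕ → ℝ} (h : IsWindow t a b) :
    Tendsto (fun n => (a n + b n) / 2) atTop (𝓝 t) := by
  have := (h.tendsto_left.add h.tendsto_right).div_const 2
  simpa using this

/-- `w_n` solves `w = P_t K w` up to an error that is `d` times the indicator function of
`[a_n, b_n)` to first order in `b_n - a_n`. -/
structure IsQuasi (u : ℝ → ℂ) (t : ℝ) (a b : ℕ → ℝ) (w : ℕ → L2) (d : ℂ) : Prop where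
  right : ∀ n, ∀ᵐ x : ℝ, t + 2 * (b n - a n) < x → w n x = 0
  left : ∀ n, ∀ᵐ x : ℝ, x < t - 2 * (b n - a n) → K u (w n) x = w n x
  mid : Tendsto (fun n => (b n - a n)⁻¹ * ∫ x in (t - 2 * (b n - a n))..(t + 2 * (b n - a n)),
    ‖w n x - (Ico (a n) (b n)).indicator (fun _ => d) x‖) atTop (𝓝 0)

theorem locallyIntegrable_norm {f : ℝ → ℂ} (h : LocallyIntegrable f) :
    LocallyIntegrable fun x => ‖f x‖ := fun x => by
  obtain ⟨s, hs, hi⟩ := h x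
  exact ⟨s, hs, hi.norm⟩

theorem intervalIntegrable_of_locallyIntegrable {E : Type*} [NormedAddCommGroup E] {f : ℝ → E}
    (h : LocallyIntegrable f) {a b : ℝ} : IntervalIntegrable f volume a b :=
  intervalIntegrable_iff.2 ((h.integrableOn_isCompact isCompact_uIcc).mono_set uIoc_subset_uIcc)

theorem locallyIntegrable_comp_add {E : Type*} [NormedAddCommGroup E] {f : ℝ → E}
    (hf : LocallyIntegrable f) (h : ℝ) : LocallyIntegrable fun x => f (x + h) := fun x => by
  obtain ⟨s, hs, hi⟩ := hf (x + h)
  refine ⟨(fun x => x + h) ⁻¹' s, (continuous_add_const h).continuousAt.preimage_mem_nhds hs, ?_⟩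
  exact ((measurePreserving_add_const h).integrableOn_comp_preimage
    (measurableEmbedding_addRight h)).2 hi

theorem intervalIntegrable_norm_L2 (w : L2) (a b α β : ℝ) (d : ℂ) :
    IntervalIntegrable (fun x => ‖w x - (Ico a b).indicator (fun _ => d) x‖) volume α β :=
  intervalIntegrable_of_locallyIntegrable (locallyIntegrable_norm
    ((L2_locallyIntegrable w).sub ((locallyIntegrable_const d).indicator measurableSet_Ico)))

section
variable {u : ℝ → ℂ} (hu : IsUnimodular u)
include hu

theorem IsQuasi.add {t : ℝ} {a b : ℕ → ℝ} (hw : IsWindow t a b) {w v : ℕ → L2} {d e : ℂ}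
    (h1 : IsQuasi u t a b w d) (h2 : IsQuasi u t a b v e) :
    IsQuasi u t a b (fun n => w n + v n) (d + e) := by
  refine ⟨fun n => ?_, fun n => ?_, ?_⟩
  · filter_upwards [h1.right n, h2.right n, Lp.coeFn_add (w n) (v n)] with x e1 e2 e3 hx
    rw [e3, Pi.add_apply, e1 hx, e2 hx, add_zero]
  · filter_upwards [h1.left n, h2.left n, Lp.coeFn_add (w n) (v n),
      Lp.coeFn_add (K u (w n)) (K u (v n))] with x e1 e2 e3 e4 hx
    rw [K_add hu, e3, e4, Pi.add_apply, Pi.add_apply, e1 hx, e2 hx]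
  · have h3 := h1.mid.add h2.mid
    rw [add_zero] at h3
    have hp : ∀ n, 0 < b n - a n := fun n => sub_pos.2 (hw.lt n)
    refine squeeze_zero (fun n => ?_) (fun n => ?_) h3
    · have := hp n
      exact mul_nonneg (by positivity) (intervalIntegral.integral_nonneg (by linarith)
        fun _ _ => norm_nonneg _)
    · rw [← mul_add, ← intervalIntegral.integral_add (intervalIntegrable_norm_L2 _ _ _ _ _ _)
        (intervalIntegrable_norm_L2 _ _ _ _ _ _)]
      refine mul_le_mul_of_nonneg_left ?_ (inv_nonneg.2 (hp n).le)
      refine intervalIntegral.integral_mono_ae (by linarith [hp n])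
        (intervalIntegrable_norm_L2 _ _ _ _ _ _) ((intervalIntegrable_norm_L2 _ _ _ _ _ _).add
          (intervalIntegrable_norm_L2 _ _ _ _ _ _)) ?_
      filter_upwards [Lp.coeFn_add (w n) (v n)] with x hx
      rw [hx, Pi.add_apply]
      refine le_trans (le_of_eq ?_) (norm_add_le _ _)
      congr 1
      by_cases hm : x ∈ Ico (a n) (b n)
      · simp only [indicator_of_mem hm]; ring
      · simp only [indicator_of_notMem hm]; ring

theorem IsQuasi.smul {t : ℝ} {a b : ℕ → ℝ} {w : ℕ → L2} {d : ℂ}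
    (h : IsQuasi u t a b w d) (A : ℝ) : IsQuasi u t a b (fun n => (A : ℂ) • w n) (A * d) := by
  refine ⟨fun n => ?_, fun n => ?_, ?_⟩
  · filter_upwards [h.right n, Lp.coeFn_smul (A : ℂ) (w n)] with x e1 e3 hx
    rw [e3, Pi.smul_apply, e1 hx, smul_zero]
  · filter_upwards [h.left n, Lp.coeFn_smul (A : ℂ) (w n),
      Lp.coeFn_smul (A : ℂ) (K u (w n))] with x e1 e3 e4 hx
    rw [K_smul hu, Complex.conj_ofReal, e3, e4, Pi.smul_apply, Pi.smul_apply, e1 hx]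
  · have h3 := h.mid.const_mul |A|
    rw [mul_zero] at h3
    refine h3.congr fun n => ?_
    rw [mul_left_comm, ← intervalIntegral.integral_const_mul]
    congr 1
    refine intervalIntegral.integral_congr_ae ?_
    filter_upwards [Lp.coeFn_smul (A : ℂ) (w n)] with x hx _
    rw [hx, Pi.smul_apply, smul_eq_mul, ← Real.norm_eq_abs, ← Complex.norm_real, ← norm_mul]
    congr 1
    by_cases hm : x ∈ Ico (a n) (b n)
    · simp only [indicator_of_mem hm]; ring
    · simp only [indicator_of_notMem hm]; ring

theorem IsQuasi.isKSeq {t : ℝ} {a b : ℕ → ℝ} (hw : IsWindow t a b) {w : ℕ → L2}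
    (h : IsQuasi u t a b w 0) :
    ∃ r, IsKSeq u t (fun n => 2 * (b n - a n)) (fun n => (((b n - a n)⁻¹ : ℝ) : ℂ) • w n) r := by
  have hp : ∀ n, 0 < b n - a n := fun n => sub_pos.2 (hw.lt n)
  set r : ℕ → L2 := fun n => (((b n - a n)⁻¹ : ℝ) : ℂ) • w n -
    P (t - 2 * (b n - a n)) (K u ((((b n - a n)⁻¹ : ℝ) : ℂ) • w n)) with hr
  have hrx : ∀ n, ∀ᵐ x : ℝ, r n x = (Icc (t - 2 * (b n - a n)) (t + 2 * (b n - a n))).indicator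
      (fun x => (((b n - a n)⁻¹ : ℝ) : ℂ) * w n x) x := fun n => by
    have hq := h.smul hu (b n - a n)⁻¹
    filter_upwards [hq.right n, hq.left n, Lp.coeFn_sub ((((b n - a n)⁻¹ : ℝ) : ℂ) • w n)
      (P (t - 2 * (b n - a n)) (K u ((((b n - a n)⁻¹ : ℝ) : ℂ) • w n))),
      P_coe (t - 2 * (b n - a n)) (K u ((((b n - a n)⁻¹ : ℝ) : ℂ) • w n)),
      Lp.coeFn_smul (((b n - a n)⁻¹ : ℝ) : ℂ) (w n)] with x e1 e2 e3 e4 e5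
    rw [hr]
    simp only
    rw [e3, Pi.sub_apply, e4]
    rcases lt_or_ge x (t - 2 * (b n - a n)) with hx | hx
    · rw [indicator_of_mem (show x ∈ Iio _ from hx), e2 hx, sub_self, indicator_of_notMem]
      exact fun hm => not_le.2 hx hm.1
    · rw [indicator_of_notMem (by simpa using hx), sub_zero]
      rcases le_or_gt x (t + 2 * (b n - a n)) with hx2 | hx2
      · rw [indicator_of_mem (show x ∈ Icc _ _ from ⟨hx, hx2⟩), e5, Pi.smul_apply, smul_eq_mul]
      · rw [e1 hx2, indicator_of_notMem]
        exact fun hm => not_le.2 hx2 hm.2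
  refine ⟨r, fun n => by linarith [hp n], by simpa using hw.lim.const_mul 2, fun n => ?_, ?_,
    fun n => by rw [hr]; simp⟩
  · filter_upwards [hrx n] with x hx hxt
    rw [hx, indicator_of_notMem]
    intro hm
    rw [← not_le, abs_le] at hxt
    exact hxt ⟨by linarith [hm.1], by linarith [hm.2]⟩
  · refine h.mid.congr fun n => ?_
    have h1 : ∫ x, ‖r n x‖ = ∫ x, (Icc (t - 2 * (b n - a n)) (t + 2 * (b n - a n))).indicator
        (fun x => (b n - a n)⁻¹ * ‖w n x‖) x := by
      refine integral_congr_ae ?_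
      filter_upwards [hrx n] with x hx
      rw [hx, norm_indicator_eq_indicator_norm]
      congr 1
      ext y
      rw [norm_mul, Complex.norm_real, Real.norm_of_nonneg (inv_nonneg.2 (hp n).le)]
    rw [h1, integral_indicator measurableSet_Icc, integral_Icc_eq_integral_Ioc,
      ← intervalIntegral.integral_of_le (by linarith [hp n]), intervalIntegral.integral_const_mul]
    simp

end

/-! ### The two types of difference quotients -/

/-- The increment of `P_t X` in `t`. -/
def incr (e : ℂ) (f : ℝ → L2) (a b : ℝ) : L2 := e • ind (Ico a b) + (f b - f a)

/-- The increment of `P_t X` in the space variable. -/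
def shiftIncr (e : ℂ) (f : ℝ → L2) (a b : ℝ) : L2 :=
  -(e • ind (Ico a b)) +
    (tr ((b - a) / 2) (f ((a + b) / 2)) - tr (-((b - a) / 2)) (f ((a + b) / 2)))

section
variable {u : ℝ → ℂ} (hu : IsUnimodular u) {c : ℂ} {k : L2}

theorem kap_shift (c : ℂ) (k : L2) (t h : ℝ) : (fun x => kap c k t (x + h)) =ᵐ[volume]
    kap c k (t + h) := by
  filter_upwards [ae_comp_add (tr_coe t k) h, tr_coe (t + h) k] with x h1 h2
  rw [kap, kap, h1, h2]
  congr 1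
  · by_cases hx : -t < x + h
    · rw [indicator_of_mem (show x + h ∈ Ioi _ from hx),
        indicator_of_mem (show x ∈ Ioi _ by simp only [mem_Ioi]; linarith)]
    · rw [indicator_of_notMem (show x + h ∉ Ioi _ from hx),
        indicator_of_notMem (show x ∉ Ioi _ by simp only [mem_Ioi]; linarith)]
  · congr 1; ring

theorem kap_sub (c : ℂ) (k : L2) {a b : ℝ} (hab : a ≤ b) : ∀ᵐ x : ℝ,
    (c • ind (Ioc (-b) (-a)) + tr b k - tr a k : L2) x = kap c k b x - kap c k a x := by
  filter_upwards [Lp.coeFn_sub (c • ind (Ioc (-b) (-a)) + tr b k) (tr a k),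
    Lp.coeFn_add (c • ind (Ioc (-b) (-a))) (tr b k), Lp.coeFn_smul c (ind (Ioc (-b) (-a))),
    ind_Ioc_coe (-b) (-a)] with x h1 h2 h3 h4
  rw [h1, Pi.sub_apply, h2, Pi.add_apply, h3, Pi.smul_apply, h4, kap, kap]
  by_cases hxb : -b < x <;> by_cases hxa : -a < x
  · simp [indicator, hxb, hxa]
  · simp [indicator, hxb, hxa, not_lt.1 hxa]
  · exact absurd hxa (by linarith)
  · simp [indicator, hxb, hxa]

include hu in
theorem K_incr (hk : IsKernelPart u c k) (e : ℂ) (f : ℝ → L2) {a b : ℝ} (hab : a ≤ b) : ∀ᵐ x : ℝ,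
    K u (incr e f a b) x = solFun u c k e b (f b) x - solFun u c k e a (f a) x := by
  rw [incr, K_add hu, K_smul hu, K_sub hu, K_ind hu hk hab]
  set κ := (c • ind (Ioc (-b) (-a)) + tr b k - tr a k : L2) with hκ
  filter_upwards [Lp.coeFn_add (conj e • κ) (K u (f b) - K u (f a)), Lp.coeFn_smul (conj e) κ,
    Lp.coeFn_sub (K u (f b)) (K u (f a)), kap_sub c k hab] with x h1 h2 h3 h4
  rw [h1, Pi.add_apply, h2, Pi.smul_apply, h3, Pi.sub_apply, h4, solFun, solFun, smul_eq_mul]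
  ring

include hu in
theorem K_shiftIncr (hk : IsKernelPart u c k) (e : ℂ) (f : ℝ → L2) {a b : ℝ} (hab : a ≤ b) :
    ∀ᵐ x : ℝ, K u (I • shiftIncr e f a b) x =
      I * (solFun u c k e ((a + b) / 2) (f ((a + b) / 2)) (x + (b - a) / 2) -
        solFun u c k e ((a + b) / 2) (f ((a + b) / 2)) (x + -((b - a) / 2))) := by
  set m := (a + b) / 2 with hm
  set h := (b - a) / 2 with hh
  rw [shiftIncr, K_smul hu, K_add hu, K_neg hu, K_smul hu, K_sub hu, K_ind hu hk hab, K_tr hu,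
    K_tr hu, neg_neg, Complex.conj_I]
  set κ := (c • ind (Ioc (-b) (-a)) + tr b k - tr a k : L2) with hκ
  rw [← hm, ← hh]
  have e1 := kap_shift c k m h
  have e2 := kap_shift c k m (-h)
  rw [show m + h = b by rw [hm, hh]; ring] at e1
  rw [show m + -h = a by rw [hm, hh]; ring] at e2
  filter_upwards [Lp.coeFn_smul (-I) (-(conj e • κ) + (tr (-h) (K u (f m)) - tr h (K u (f m)))),
    Lp.coeFn_add (-(conj e • κ)) (tr (-h) (K u (f m)) - tr h (K u (f m))),
    Lp.coeFn_neg (conj e • κ), Lp.coeFn_smul (conj e) κ,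
    Lp.coeFn_sub (tr (-h) (K u (f m))) (tr h (K u (f m))), tr_coe h (K u (f m)),
    tr_coe (-h) (K u (f m)), kap_sub c k hab, e1, e2] with x h1 h2 h3 h4 h5 h6 h7 h8 h9 h10
  rw [h1, Pi.smul_apply, h2, Pi.add_apply, h3, Pi.neg_apply, h4, Pi.smul_apply, h5, Pi.sub_apply,
    h6, h7, h8, solFun, solFun, h9, h10, smul_eq_mul, smul_eq_mul]
  ring

theorem incr_coe {e : ℂ} {f : ℝ → L2} {a b : ℝ} (hab : a ≤ b) (ha : IsPart u c k e a (f a))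
    (hb : IsPart u c k e b (f b)) : ∀ᵐ x : ℝ, incr e f a b x =
      (Iio b).indicator (solFun u c k e b (f b)) x -
        (Iio a).indicator (solFun u c k e a (f a)) x := by
  have ha0 := P_ae_zero a (f a)
  have hb0 := P_ae_zero b (f b)
  rw [ha.P_eq] at ha0
  rw [hb.P_eq] at hb0
  filter_upwards [ha.ae_eq, hb.ae_eq, ha0, hb0, ind_Ico_coe a b,
    Lp.coeFn_add (e • ind (Ico a b)) (f b - f a), Lp.coeFn_smul e (ind (Ico a b)),
    Lp.coeFn_sub (f b) (f a)] with x h1 h2 h3 h4 h5 h6 h7 h8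
  rw [incr, h6, Pi.add_apply, h7, Pi.smul_apply, h8, Pi.sub_apply, h5]
  rcases lt_or_ge x a with hxa | hxa
  · have hxb : x < b := hxa.trans_le hab
    simp [indicator, hxa, hxb, h1 hxa, h2 hxb, not_le.2 hxa]
  · rcases lt_or_ge x b with hxb | hxb
    · simp [indicator, not_lt.2 hxa, hxa, hxb, h2 hxb, h3 hxa]
    · simp [indicator, not_lt.2 hxa, hxa, not_lt.2 hxb, h3 hxa, h4 hxb]

theorem shiftIncr_coe {e : ℂ} {f : ℝ → L2} {a b : ℝ} (hab : a ≤ b)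
    (hm : IsPart u c k e ((a + b) / 2) (f ((a + b) / 2))) : ∀ᵐ x : ℝ, shiftIncr e f a b x =
      (Iio a).indicator (fun x => solFun u c k e ((a + b) / 2) (f ((a + b) / 2)) (x + (b - a) / 2)) x -
        (Iio b).indicator
          (fun x => solFun u c k e ((a + b) / 2) (f ((a + b) / 2)) (x + -((b - a) / 2))) x := by
  rw [shiftIncr]
  set m := (a + b) / 2 with hmd
  set h := (b - a) / 2 with hh
  have h0 := P_ae_zero m (f m)
  rw [hm.P_eq] at h0
  filter_upwards [ae_comp_add hm.ae_eq h, ae_comp_add hm.ae_eq (-h), ae_comp_add h0 h,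
    ae_comp_add h0 (-h), ind_Ico_coe a b,
    Lp.coeFn_add (-(e • ind (Ico a b))) (tr h (f m) - tr (-h) (f m)),
    Lp.coeFn_neg (e • ind (Ico a b)), Lp.coeFn_smul e (ind (Ico a b)),
    Lp.coeFn_sub (tr h (f m)) (tr (-h) (f m)), tr_coe h (f m), tr_coe (-h) (f m)]
    with x h1 h2 h3 h4 h5 h6 h7 h8 h9 h10 h11
  rw [h6, Pi.add_apply, h7, Pi.neg_apply, h8, Pi.smul_apply, h9, Pi.sub_apply, h10, h11, h5]
  rcases lt_or_ge x a with hxa | hxa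
  · have hxb : x < b := hxa.trans_le hab
    have i1 : x + h < m := by rw [hh, hmd]; linarith
    have i2 : x + -h < m := by rw [hh, hmd]; linarith
    simp [indicator, hxa, hxb, h1 i1, h2 i2, not_le.2 hxa]
  · have i1 : m ≤ x + h := by rw [hh, hmd]; linarith
    rcases lt_or_ge x b with hxb | hxb
    · have i2 : x + -h < m := by rw [hh, hmd]; linarith
      simp [indicator, not_lt.2 hxa, hxa, hxb, h2 i2, h3 i1]
      ring
    · have i2 : m ≤ x + -h := by rw [hh, hmd]; linarith
      simp [indicator, not_lt.2 hxa, hxa, not_lt.2 hxb, h3 i1, h4 i2]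

theorem HasDiagValue.tendsto_window {F : ℝ → ℝ → ℂ} {t : ℝ} {d : ℂ} (h : HasDiagValue F t d)
    {s ρ : ℕ → ℝ} (hs : Tendsto s atTop (𝓝 t)) (hρ : ∀ n, 0 < ρ n) (hρ0 : Tendsto ρ atTop (𝓝 0)) :
    Tendsto (fun n => (ρ n)⁻¹ * ∫ x in (s n - 4 * ρ n)..(s n + 4 * ρ n), ‖F (s n) x - d‖) atTop
      (𝓝 0) := by
  have h1 : Tendsto (fun n => (s n, 4 * ρ n)) atTop (𝓝 t ×ˢ 𝓝[>] 0) := by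
    refine hs.prodMk (tendsto_nhdsWithin_iff.2 ⟨by simpa using hρ0.const_mul 4,
      Eventually.of_forall fun n => ?_⟩)
    have := hρ n
    simp only [mem_Ioi]; linarith
  have h2 := (h.comp h1).const_mul 8
  rw [mul_zero] at h2
  refine h2.congr fun n => ?_
  simp only [Function.comp]
  have := (hρ n).ne'
  field_simp
  norm_num

theorem locallyIntegrable_solFun (u : ℝ → ℂ) (c : ℂ) (k : L2) (e : ℂ) (t : ℝ) (f : L2) (d : ℂ) :
    LocallyIntegrable fun x => ‖solFun u c k e t f x - d‖ :=
  locallyIntegrable_norm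
    ((isTempered_solFun u c k e t f).locallyIntegrable.sub (locallyIntegrable_const d))

theorem integral_shift_le {G : ℝ → ℝ} (hG : LocallyIntegrable G) (h0 : ∀ x, 0 ≤ G x)
    {α β α' β' h : ℝ} (h1 : α ≤ β) (h2 : α' ≤ α + h) (h3 : β + h ≤ β') :
    ∫ x in α..β, G (x + h) ≤ ∫ x in α'..β', G x := by
  rw [intervalIntegral.integral_comp_add_right]
  exact intervalIntegral.integral_mono_interval h2 (by linarith) h3
    (Eventually.of_forall h0) (intervalIntegrable_of_locallyIntegrable hG)

/-- The shape of an increment near `t` determines its first order error. -/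
theorem tendsto_of_increment {t : ℝ} {a b : ℕ → ℝ} (hw : IsWindow t a b) {w : ℕ → L2} {d : ℂ}
    {F G : ℕ → ℝ → ℂ} (hF : ∀ n, LocallyIntegrable fun x => ‖F n x - d‖)
    (hG : ∀ n, LocallyIntegrable fun x => ‖G n x - d‖)
    (hwx : ∀ n, ∀ᵐ x : ℝ, w n x = (Iio (b n)).indicator (F n) x - (Iio (a n)).indicator (G n) x)
    (hF0 : Tendsto (fun n => (b n - a n)⁻¹ * ∫ x in (t - 2 * (b n - a n))..(t + 2 * (b n - a n)),
      ‖F n x - d‖) atTop (𝓝 0))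
    (hG0 : Tendsto (fun n => (b n - a n)⁻¹ * ∫ x in (t - 2 * (b n - a n))..(t + 2 * (b n - a n)),
      ‖G n x - d‖) atTop (𝓝 0)) :
    Tendsto (fun n => (b n - a n)⁻¹ * ∫ x in (t - 2 * (b n - a n))..(t + 2 * (b n - a n)),
      ‖w n x - (Ico (a n) (b n)).indicator (fun _ => d) x‖) atTop (𝓝 0) := by
  have hp : ∀ n, 0 < b n - a n := fun n => sub_pos.2 (hw.lt n)
  have h3 := hF0.add hG0
  rw [add_zero] at h3
  refine squeeze_zero (fun n => ?_) (fun n => ?_) h3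
  · have := hp n
    exact mul_nonneg (by positivity) (intervalIntegral.integral_nonneg (by linarith)
      fun _ _ => norm_nonneg _)
  · rw [← mul_add, ← intervalIntegral.integral_add (intervalIntegrable_of_locallyIntegrable (hF n))
      (intervalIntegrable_of_locallyIntegrable (hG n))]
    refine mul_le_mul_of_nonneg_left ?_ (inv_nonneg.2 (hp n).le)
    refine intervalIntegral.integral_mono_ae (by linarith [hp n])
      (intervalIntegrable_norm_L2 _ _ _ _ _ _) ((intervalIntegrable_of_locallyIntegrable (hF n)).add
        (intervalIntegrable_of_locallyIntegrable (hG n))) ?_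
    filter_upwards [hwx n] with x hx
    rw [hx]
    rcases lt_or_ge x (a n) with hxa | hxa
    · have hxb : x < b n := hxa.trans (hw.lt n)
      rw [indicator_of_mem (show x ∈ Iio _ from hxa), indicator_of_mem (show x ∈ Iio _ from hxb),
        indicator_of_notMem (fun hm => not_le.2 hxa hm.1), sub_zero]
      calc ‖F n x - G n x‖ = ‖(F n x - d) - (G n x - d)‖ := by congr 1; ring
        _ ≤ _ := norm_sub_le _ _
    · rw [indicator_of_notMem (show x ∉ Iio (a n) by simpa using hxa)]
      rcases lt_or_ge x (b n) with hxb | hxb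
      · rw [indicator_of_mem (show x ∈ Iio _ from hxb),
          indicator_of_mem (show x ∈ Ico _ _ from ⟨hxa, hxb⟩), sub_zero]
        linarith [norm_nonneg (G n x - d)]
      · rw [indicator_of_notMem (show x ∉ Iio _ by simpa using hxb),
          indicator_of_notMem (fun hm => not_le.2 hm.2 hxb)]
        simp only [sub_zero, norm_zero]
        positivity

include hu in
theorem isQuasi_incr (hk : IsKernelPart u c k) {t : ℝ} {a b : ℕ → ℝ} (hw : IsWindow t a b) {e : ℂ}
    {f : ℝ → L2} (ha : ∀ n, IsPart u c k e (a n) (f (a n)))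
    (hb : ∀ n, IsPart u c k e (b n) (f (b n))) {d : ℂ}
    (hd : HasDiagValue (fun s => solFun u c k e s (f s)) t d) :
    IsQuasi u t a b (fun n => incr e f (a n) (b n)) d := by
  have hp : ∀ n, 0 < b n - a n := fun n => sub_pos.2 (hw.lt n)
  refine ⟨fun n => ?_, fun n => ?_, ?_⟩
  · filter_upwards [incr_coe (hw.lt n).le (ha n) (hb n)] with x hx hxt
    have i1 : b n ≤ x := by linarith [hw.le n, hp n]
    have i2 : a n ≤ x := by linarith [hw.lt n]
    rw [hx, indicator_of_notMem (by simpa using i1), indicator_of_notMem (by simpa using i2),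
      sub_zero]
  · filter_upwards [incr_coe (hw.lt n).le (ha n) (hb n), K_incr hu hk e f (hw.lt n).le]
      with x hx hx2 hxt
    have i2 : x < a n := by linarith [hw.ge n, hp n]
    have i1 : x < b n := by linarith [hw.lt n]
    rw [hx, hx2, indicator_of_mem (show x ∈ Iio _ from i1),
      indicator_of_mem (show x ∈ Iio _ from i2)]
  · refine tendsto_of_increment hw (F := fun n => solFun u c k e (b n) (f (b n)))
      (G := fun n => solFun u c k e (a n) (f (a n)))
      (fun n => locallyIntegrable_solFun _ _ _ _ _ _ _)
      (fun n => locallyIntegrable_solFun _ _ _ _ _ _ _)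
      (fun n => incr_coe (hw.lt n).le (ha n) (hb n)) ?_ ?_
    · refine squeeze_zero (fun n => ?_) (fun n => ?_) (hd.tendsto_window hw.tendsto_right hp hw.lim)
      · have := hp n
        exact mul_nonneg (by positivity) (intervalIntegral.integral_nonneg (by linarith)
          fun _ _ => norm_nonneg _)
      · refine mul_le_mul_of_nonneg_left ?_ (inv_nonneg.2 (hp n).le)
        exact intervalIntegral.integral_mono_interval (by linarith [hw.le n, hp n])
          (by linarith [hp n]) (by linarith [hw.ge n, hp n])
          (Eventually.of_forall fun _ => norm_nonneg _)
          (intervalIntegrable_of_locallyIntegrable (locallyIntegrable_solFun _ _ _ _ _ _ _))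
    · refine squeeze_zero (fun n => ?_) (fun n => ?_) (hd.tendsto_window hw.tendsto_left hp hw.lim)
      · have := hp n
        exact mul_nonneg (by positivity) (intervalIntegral.integral_nonneg (by linarith)
          fun _ _ => norm_nonneg _)
      · refine mul_le_mul_of_nonneg_left ?_ (inv_nonneg.2 (hp n).le)
        exact intervalIntegral.integral_mono_interval (by linarith [hw.le n, hp n])
          (by linarith [hp n]) (by linarith [hw.ge n, hp n])
          (Eventually.of_forall fun _ => norm_nonneg _)
          (intervalIntegrable_of_locallyIntegrable (locallyIntegrable_solFun _ _ _ _ _ _ _))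

include hu in
theorem isQuasi_shiftIncr (hk : IsKernelPart u c k) {t : ℝ} {a b : ℕ → ℝ} (hw : IsWindow t a b)
    {e : ℂ} {f : ℝ → L2} (hm : ∀ n, IsPart u c k e ((a n + b n) / 2) (f ((a n + b n) / 2))) {d : ℂ}
    (hd : HasDiagValue (fun s => solFun u c k e s (f s)) t d) :
    IsQuasi u t a b (fun n => I • shiftIncr e f (a n) (b n)) (-(I * d)) := by
  have hp : ∀ n, 0 < b n - a n := fun n => sub_pos.2 (hw.lt n)
  have hx1 : ∀ n, ∀ᵐ x : ℝ, (I • shiftIncr e f (a n) (b n) : L2) x =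
      I * shiftIncr e f (a n) (b n) x := fun n => by
    filter_upwards [Lp.coeFn_smul I (shiftIncr e f (a n) (b n))] with x hx
    rw [hx, Pi.smul_apply, smul_eq_mul]
  refine ⟨fun n => ?_, fun n => ?_, ?_⟩
  · filter_upwards [shiftIncr_coe (hw.lt n).le (hm n), hx1 n] with x hx hx' hxt
    have i1 : b n ≤ x := by linarith [hw.le n, hp n]
    have i2 : a n ≤ x := by linarith [hw.lt n]
    rw [hx', hx, indicator_of_notMem (by simpa using i2), indicator_of_notMem (by simpa using i1),
      sub_zero, mul_zero]
  · filter_upwards [shiftIncr_coe (hw.lt n).le (hm n), K_shiftIncr hu hk e f (hw.lt n).le, hx1 n]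
      with x hx hx2 hx' hxt
    have i2 : x < a n := by linarith [hw.ge n, hp n]
    have i1 : x < b n := by linarith [hw.lt n]
    rw [hx', hx, hx2, indicator_of_mem (show x ∈ Iio _ from i1),
      indicator_of_mem (show x ∈ Iio _ from i2)]
  · have hli : ∀ n (h : ℝ), LocallyIntegrable fun x =>
        ‖solFun u c k e ((a n + b n) / 2) (f ((a n + b n) / 2)) (x + h) - d‖ := fun n h =>
      locallyIntegrable_comp_add (locallyIntegrable_solFun u c k e _ _ d) h
    have hlim : ∀ (s : ℝ), |s| ≤ 1 → Tendsto (fun n => (b n - a n)⁻¹ *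
        ∫ x in (t - 2 * (b n - a n))..(t + 2 * (b n - a n)),
          ‖solFun u c k e ((a n + b n) / 2) (f ((a n + b n) / 2)) (x + s * ((b n - a n) / 2)) - d‖)
          atTop (𝓝 0) := by
      intro s hs
      rw [abs_le] at hs
      refine squeeze_zero (fun n => ?_) (fun n => ?_) (hd.tendsto_window hw.tendsto_mid hp hw.lim)
      · have := hp n
        exact mul_nonneg (by positivity) (intervalIntegral.integral_nonneg (by linarith)
          fun _ _ => norm_nonneg _)
      · refine mul_le_mul_of_nonneg_left ?_ (inv_nonneg.2 (hp n).le)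
        have := hp n
        refine integral_shift_le (G := fun x => ‖solFun u c k e ((a n + b n) / 2)
          (f ((a n + b n) / 2)) x - d‖) (locallyIntegrable_solFun _ _ _ _ _ _ _)
          (fun _ => norm_nonneg _) (by linarith) ?_ ?_
        · nlinarith [hw.le n, hw.ge n]
        · nlinarith [hw.le n, hw.ge n]
    have key := tendsto_of_increment hw (w := fun n => -shiftIncr e f (a n) (b n)) (d := d)
      (F := fun n x => solFun u c k e ((a n + b n) / 2) (f ((a n + b n) / 2)) (x + -((b n - a n) / 2)))
      (G := fun n x => solFun u c k e ((a n + b n) / 2) (f ((a n + b n) / 2)) (x + (b n - a n) / 2))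
      (fun n => hli n _) (fun n => hli n _) (fun n => by
        filter_upwards [shiftIncr_coe (hw.lt n).le (hm n),
          Lp.coeFn_neg (shiftIncr e f (a n) (b n))] with x h1 h2
        rw [h2, Pi.neg_apply, h1, neg_sub])
      (by simpa [neg_mul] using hlim (-1) (by simp)) (by simpa using hlim 1 (by simp))
    refine key.congr fun n => ?_
    congr 1
    refine intervalIntegral.integral_congr_ae ?_
    filter_upwards [hx1 n, Lp.coeFn_neg (shiftIncr e f (a n) (b n))] with x h1 h2 _
    rw [h1, h2, Pi.neg_apply]
    by_cases hxm : x ∈ Ico (a n) (b n)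
    · simp only [indicator_of_mem hxm]
      rw [sub_neg_eq_add, ← mul_add, norm_mul, Complex.norm_I, one_mul, ← norm_neg]
      congr 1; ring
    · simp only [indicator_of_notMem hxm, sub_zero]
      rw [norm_mul, Complex.norm_I, one_mul, norm_neg]

end

/-! ### The derivatives of the solutions with respect to `t` -/

/-- The tempered distribution `P_t X`. -/
def pairP (e : ℂ) (t : ℝ) (f : L2) (g : 𝓢(ℝ, ℂ)) : ℂ :=
  ∫ x, ((Iio t).indicator (fun _ => e) x + f x) * g x

/-- The tempered distribution `X`. -/
def pairX (u : ℝ → ℂ) (c : ℂ) (k : L2) (e : ℂ) (t : ℝ) (f : L2) (g : 𝓢(ℝ, ℂ)) : ℂ :=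
  ∫ x, solFun u c k e t f x * g x

/-- The derivative of a Schwartz function. -/
abbrev derivS (g : 𝓢(ℝ, ℂ)) : 𝓢(ℝ, ℂ) := SchwartzMap.derivCLM ℂ ℂ g

theorem isTempered_indicator (s : Set ℝ) (hs : MeasurableSet s) (e : ℂ) :
    IsTempered (s.indicator fun _ => e) := by
  refine isTempered_of_bound (C := ‖e‖) (aestronglyMeasurable_const.indicator hs)
    (Eventually.of_forall fun x => ?_)
  by_cases hx : x ∈ s <;> simp [hx]

theorem isTempered_pairP (e : ℂ) (t : ℝ) (f : L2) :
    IsTempered fun x => (Iio t).indicator (fun _ => e) x + f x :=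
  (isTempered_indicator _ measurableSet_Iio e).add (isTempered_L2 f)

theorem tendsto_schwartz_atTop (g : 𝓢(ℝ, ℂ)) : Tendsto g atTop (𝓝 0) :=
  g.tendsto_cocompact.mono_left atTop_le_cocompact

theorem tendsto_schwartz_atBot (g : 𝓢(ℝ, ℂ)) : Tendsto g atBot (𝓝 0) :=
  g.tendsto_cocompact.mono_left atBot_le_cocompact

theorem integral_Iio_deriv (g : 𝓢(ℝ, ℂ)) (t : ℝ) : ∫ x in Iio t, derivS g x = g t := by
  rw [← integral_Iic_eq_integral_Iio]
  have := integral_Iic_of_hasDerivAt_of_tendsto (f := g) (f' := derivS g) (a := t) (m := 0)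
    g.continuous.continuousWithinAt (fun x _ => g.hasDerivAt x) (derivS g).integrable.integrableOn
    (tendsto_schwartz_atBot g)
  rw [this, sub_zero]

theorem integral_Ioi_deriv (g : 𝓢(ℝ, ℂ)) (t : ℝ) : ∫ x in Ioi t, derivS g x = -g t := by
  have := integral_Ioi_of_hasDerivAt_of_tendsto (f := g) (f' := derivS g) (a := t) (m := 0)
    g.continuous.continuousWithinAt (fun x _ => g.hasDerivAt x) (derivS g).integrable.integrableOn
    (tendsto_schwartz_atTop g)
  rw [this, zero_sub]

theorem integral_deriv_eq_zero (g : 𝓢(ℝ, ℂ)) : ∫ x, derivS g x = 0 := by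
  have := integral_of_hasDerivAt_of_tendsto (f := g) (f' := derivS g) (m := 0) (n := 0)
    (fun x => g.hasDerivAt x) (derivS g).integrable (tendsto_schwartz_atBot g)
    (tendsto_schwartz_atTop g)
  rw [this, sub_zero]

theorem integral_indicator_const_mul {s : Set ℝ} (hs : MeasurableSet s) (e : ℂ) (g : 𝓢(ℝ, ℂ)) :
    ∫ x, s.indicator (fun _ => e) x * g x = e * ∫ x in s, g x := by
  rw [← integral_const_mul, ← integral_indicator hs]
  refine integral_congr_ae (Eventually.of_forall fun x => ?_)
  by_cases hx : x ∈ s <;> simp [hx]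

theorem pairP_eq (e : ℂ) (t : ℝ) (f : L2) (g : 𝓢(ℝ, ℂ)) :
    pairP e t f g = e * (∫ x in Iio t, g x) + ∫ x, f x * g x := by
  rw [pairP, ← integral_indicator_const_mul measurableSet_Iio, ← integral_add
    ((isTempered_indicator _ measurableSet_Iio e).integrable_mul g)
    ((isTempered_L2 f).integrable_mul g)]
  simp_rw [add_mul]

theorem pairX_eq (u : ℝ → ℂ) (c : ℂ) (k : L2) (e : ℂ) (t : ℝ) (f : L2) (g : 𝓢(ℝ, ℂ)) :
    pairX u c k e t f g = e * (∫ x, g x) + conj e * (c * (∫ x in Ioi (-t), g x) +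
      ∫ x, tr t k x * g x) + ∫ x, K u f x * g x := by
  rw [pairX, ← integral_indicator_const_mul measurableSet_Ioi, ← integral_add
    ((isTempered_indicator _ measurableSet_Ioi c).integrable_mul g)
    ((isTempered_L2 _).integrable_mul g), ← integral_const_mul, ← integral_const_mul,
    ← integral_add, ← integral_add]
  · refine integral_congr_ae (Eventually.of_forall fun x => ?_)
    simp only [solFun, kap]
    ring
  · refine (g.integrable.const_mul e).add (Integrable.const_mul ?_ _)
    exact ((isTempered_indicator _ measurableSet_Ioi c).integrable_mul g).add
      ((isTempered_L2 _).integrable_mul g)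
  · exact (isTempered_L2 _).integrable_mul g
  · exact g.integrable.const_mul e
  · refine Integrable.const_mul ?_ _
    exact ((isTempered_indicator _ measurableSet_Ioi c).integrable_mul g).add
      ((isTempered_L2 _).integrable_mul g)

theorem integral_incr_mul (e : ℂ) (f : ℝ → L2) {a b : ℝ} (hab : a ≤ b) (g : 𝓢(ℝ, ℂ)) :
    ∫ x, incr e f a b x * g x = pairP e b (f b) g - pairP e a (f a) g := by
  rw [incr, integral_add_mul, integral_smul_mul, integral_sub_mul, pairP_eq, pairP_eq,
    integral_ind_mul hab, ← integral_Iic_eq_integral_Iio, ← integral_Iic_eq_integral_Iio,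
    ← intervalIntegral.integral_Iic_sub_Iic g.integrable.integrableOn g.integrable.integrableOn]
  ring

theorem tendsto_shiftIncr {e : ℂ} {f : ℝ → L2} {t : ℝ} (hf : ContinuousAt f t) {a b : ℕ → ℝ}
    (hw : IsWindow t a b) (g : 𝓢(ℝ, ℂ)) :
    Tendsto (fun n => ((b n - a n : ℝ) : ℂ)⁻¹ * ∫ x, shiftIncr e f (a n) (b n) x * g x) atTop
      (𝓝 (-pairP e t (f t) (derivS g))) := by
  have h1 := (tendsto_integral_ind hw.lt hw.le hw.ge hw.lim g).const_mul (-e)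
  have h2 := tendsto_integral_diff (hf.tendsto.comp hw.tendsto_mid) g
    (fun n => ⟨sub_pos.2 (hw.lt n), hw.one n⟩) hw.lim
  have h3 := h1.add h2
  rw [pairP_eq, integral_Iio_deriv]
  convert h3 using 2
  · rw [shiftIncr, integral_add_mul, ← neg_smul, integral_smul_mul]
    simp only [Function.comp]
    ring
  · simp only [SchwartzMap.derivCLM_apply]
    ring

section
variable {u : ℝ → ℂ} (hu : IsUnimodular u) {c : ℂ} {k : L2} (hk : IsKernelPart u c k)
include hu hk

theorem integral_K_incr_mul (e : ℂ) (f : ℝ → L2) {a b : ℝ} (hab : a ≤ b) (g : 𝓢(ℝ, ℂ)) :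
    ∫ x, K u (incr e f a b) x * g x = pairX u c k e b (f b) g - pairX u c k e a (f a) g := by
  rw [pairX, pairX, ← integral_sub ((isTempered_solFun _ _ _ _ _ _).integrable_mul g)
    ((isTempered_solFun _ _ _ _ _ _).integrable_mul g)]
  refine integral_congr_ae ?_
  filter_upwards [K_incr hu hk e f hab] with x hx
  rw [hx, sub_mul]

theorem tendsto_K_shiftIncr {e : ℂ} {f : ℝ → L2} {t : ℝ} (hf : ContinuousAt f t) {a b : ℕ → ℝ}
    (hw : IsWindow t a b) (g : 𝓢(ℝ, ℂ)) :
    Tendsto (fun n => ((b n - a n : ℝ) : ℂ)⁻¹ *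
      ∫ x, K u (I • shiftIncr e f (a n) (b n)) x * g x) atTop
      (𝓝 (-(I * pairX u c k e t (f t) (derivS g)))) := by
  have h1 := tendsto_integral_ind (a := fun n => -b n) (b := fun n => -a n) (t := -t)
    (fun n => neg_lt_neg (hw.lt n)) (fun n => neg_le_neg (hw.ge n)) (fun n => neg_le_neg (hw.le n))
    (by convert hw.lim using 2; ring) g
  have h2 := tendsto_integral_diff (((continuous_tr k).tendsto t).comp hw.tendsto_mid) g
    (fun n => ⟨sub_pos.2 (hw.lt n), hw.one n⟩) hw.lim
  have h3 := tendsto_integral_diff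
    (((continuous_K hu).tendsto (f t)).comp (hf.tendsto.comp hw.tendsto_mid)) g
    (fun n => ⟨sub_pos.2 (hw.lt n), hw.one n⟩) hw.lim
  have h4 := ((((h1.const_mul c).add h2).const_mul (conj e)).add h3).const_mul I
  rw [pairX_eq, integral_Ioi_deriv, integral_deriv_eq_zero]
  convert h4 using 2 with n
  · rw [shiftIncr, K_smul hu, K_add hu, K_neg hu, K_smul hu, K_sub hu, K_ind hu hk (hw.lt n).le,
      K_tr hu, K_tr hu, neg_neg, Complex.conj_I, ind_Ioc_eq_Ico, integral_smul_mul,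
      integral_add_mul, ← neg_smul, integral_smul_mul, integral_sub_mul, integral_add_mul,
      integral_smul_mul, integral_sub_mul]
    simp only [Function.comp]
    rw [integral_sub_mul, integral_sub_mul, tr_tr, tr_tr,
      show (b n - a n) / 2 + (a n + b n) / 2 = b n by ring,
      show -((b n - a n) / 2) + (a n + b n) / 2 = a n by ring,
      show -a n - -b n = b n - a n by ring]
    ring
  · simp only [SchwartzMap.derivCLM_apply]
    ring

/-- The derivatives of `P_t X` and `X` with respect to `t`. -/
theorem hasDerivAt_pair {T : ℝ} (hT : ∀ t < T, compressionNorm u t < 1) {e e₁ e₂ : ℂ}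
    {f f₁ f₂ : ℝ → L2} (hf : ∀ t < T, IsPart u c k e t (f t))
    (hf₁ : ∀ t < T, IsPart u c k e₁ t (f₁ t)) (hf₂ : ∀ t < T, IsPart u c k e₂ t (f₂ t))
    {t : ℝ} (ht : t < T) (h4 : CondK4 u t) {d d₁ d₂ : ℂ}
    (hd : HasDiagValue (fun s => solFun u c k e s (f s)) t d)
    (hd₁ : HasDiagValue (fun s => solFun u c k e₁ s (f₁ s)) t d₁)
    (hd₂ : HasDiagValue (fun s => solFun u c k e₂ s (f₂ s)) t d₂)
    {A B : ℝ} (hAB : d = I * (A * d₁ + B * d₂)) (g : 𝓢(ℝ, ℂ)) :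
    HasDerivAt (fun s => pairP e s (f s) g) (I * (A * pairP e₁ t (f₁ t) (derivS g) +
      B * pairP e₂ t (f₂ t) (derivS g))) t ∧
    HasDerivAt (fun s => pairX u c k e s (f s) g)
      (I * (A * pairX u c k e₁ t (f₁ t) (derivS g) +
      B * pairX u c k e₂ t (f₂ t) (derivS g))) t := by
  have hf₁c := IsPart.continuousAt hu hk hT hf₁ ht
  have hf₂c := IsPart.continuousAt hu hk hT hf₂ ht
  -- the limits along windows
  have key : ∀ a b : ℕ → ℝ, IsWindow t a b → (∀ n, b n < T) →
      Tendsto (fun n => ((b n - a n : ℝ) : ℂ)⁻¹ * (pairP e (b n) (f (b n)) g -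
        pairP e (a n) (f (a n)) g)) atTop (𝓝 (I * (A * pairP e₁ t (f₁ t) (derivS g) +
      B * pairP e₂ t (f₂ t) (derivS g)))) ∧
      Tendsto (fun n => ((b n - a n : ℝ) : ℂ)⁻¹ * (pairX u c k e (b n) (f (b n)) g -
        pairX u c k e (a n) (f (a n)) g)) atTop
        (𝓝 (I * (A * pairX u c k e₁ t (f₁ t) (derivS g) +
      B * pairX u c k e₂ t (f₂ t) (derivS g)))) := by
    intro a b hw hbT
    have haT : ∀ n, a n < T := fun n => (hw.lt n).trans (hbT n)
    have hmT : ∀ n, (a n + b n) / 2 < T := fun n => by linarith [haT n, hbT n]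
    have q0 := isQuasi_incr hu hk hw (fun n => hf _ (haT n)) (fun n => hf _ (hbT n)) hd
    have q1 := (isQuasi_shiftIncr hu hk hw (fun n => hf₁ _ (hmT n)) hd₁).smul hu A
    have q2 := (isQuasi_shiftIncr hu hk hw (fun n => hf₂ _ (hmT n)) hd₂).smul hu B
    have q := (q0.add hu hw q1).add hu hw q2
    have hz : d + A * -(I * d₁) + B * -(I * d₂) = 0 := by rw [hAB]; ring
    rw [hz] at q
    obtain ⟨r, hr⟩ := q.isKSeq hu hw
    obtain ⟨l1, l2⟩ := hr.tendsto_zero hu (hT t ht) h4 g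
    constructor
    · have s1 := ((tendsto_shiftIncr (e := e₁) hf₁c hw g).const_mul (A * I)).add
        ((tendsto_shiftIncr (e := e₂) hf₂c hw g).const_mul (B * I))
      have s2 := l1.sub s1
      convert s2 using 2 with n
      · rw [integral_smul_mul, integral_add_mul, integral_add_mul, integral_smul_mul,
          integral_smul_mul, integral_smul_mul, integral_smul_mul, integral_incr_mul _ _ (hw.lt n).le]
        push_cast
        ring
      · ring
    · have s1 := ((tendsto_K_shiftIncr hu hk (e := e₁) hf₁c hw g).const_mul (A : ℂ)).add
        ((tendsto_K_shiftIncr hu hk (e := e₂) hf₂c hw g).const_mul (B : ℂ))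
      have s2 := l2.sub s1
      convert s2 using 2 with n
      · rw [K_smul hu, K_add hu, K_add hu, K_smul hu (A : ℂ), K_smul hu (B : ℂ), Complex.conj_ofReal,
          Complex.conj_ofReal, Complex.conj_ofReal, integral_smul_mul, integral_add_mul,
          integral_add_mul, integral_smul_mul, integral_smul_mul,
          integral_K_incr_mul hu hk _ _ (hw.lt n).le]
        push_cast
        ring
      · ring
  have key2 : ∀ (s : ℕ → ℝ), Tendsto s atTop (𝓝[≠] t) → ∀ (F : ℝ → ℂ) (l : ℂ),
      (∀ a b : ℕ → ℝ, IsWindow t a b → (∀ n, b n < T) →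
        Tendsto (fun n => ((b n - a n : ℝ) : ℂ)⁻¹ * (F (b n) - F (a n))) atTop (𝓝 l)) →
      Tendsto (fun n => slope F t (s n)) atTop (𝓝 l) := by
    intro s hs F l hF
    rw [tendsto_nhdsWithin_iff] at hs
    obtain ⟨hs, hne⟩ := hs
    have hev : ∀ᶠ n in atTop, s n ∈ Ioo (t - 1) (min T (t + 1)) ∧ s n ≠ t :=
      (hs.eventually (Ioo_mem_nhds (by linarith) (lt_min ht (by linarith)))).and hne
    obtain ⟨N, hN⟩ := eventually_atTop.1 hev
    rw [← tendsto_add_atTop_iff_nat N]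
    have hs' : Tendsto (fun n => s (n + N)) atTop (𝓝 t) := hs.comp (tendsto_add_atTop_nat N)
    have hw : IsWindow t (fun n => min t (s (n + N))) (fun n => max t (s (n + N))) := by
      refine ⟨fun n => min_lt_max.2 (hN (n + N) (by omega)).2.symm, fun n => min_le_left _ _,
        fun n => le_max_left _ _, fun n => ?_, ?_⟩
      · have h1 := (hN (n + N) (by omega)).1
        have h2 : s (n + N) < t + 1 := lt_of_lt_of_le h1.2 (min_le_right _ _)
        rw [max_sub_min_eq_abs, abs_le]
        constructor <;> linarith [h1.1]
      · simp_rw [max_sub_min_eq_abs]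
        have := (hs'.sub_const t).abs
        simpa using this
    refine (hF _ _ hw fun n => max_lt ht ?_).congr fun n => ?_
    · exact lt_of_lt_of_le (hN (n + N) (by omega)).1.2 (min_le_left _ _)
    · rw [slope_def_module, Complex.real_smul]
      rcases le_total t (s (n + N)) with h | h
      · rw [min_eq_left h, max_eq_right h]
        push_cast
        rfl
      · rw [min_eq_right h, max_eq_left h]
        have : ((s (n + N) - t)⁻¹ : ℝ) = -(t - s (n + N))⁻¹ := by rw [← inv_neg, neg_sub]
        rw [this]
        push_cast
        ring
  constructor
  · rw [hasDerivAt_iff_tendsto_slope]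
    exact tendsto_of_seq_tendsto fun s hs => key2 s hs _ _ fun a b hw hb => (key a b hw hb).1
  · rw [hasDerivAt_iff_tendsto_slope]
    exact tendsto_of_seq_tendsto fun s hs => key2 s hs _ _ fun a b hw hb => (key a b hw hb).2

end

/-! ### Diagonal values -/

theorem norm_mean_sub_le {F : ℝ → ℂ} (hF : LocallyIntegrable F) (s : ℝ) {ε : ℝ} (hε : 0 < ε)
    (d : ℂ) : ‖((2 * ε)⁻¹ : ℝ) • (∫ x in (s - ε)..(s + ε), F x) - d‖ ≤
      (2 * ε)⁻¹ * ∫ x in (s - ε)..(s + ε), ‖F x - d‖ := by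
  have h1 : ((2 * ε)⁻¹ : ℝ) • (∫ x in (s - ε)..(s + ε), F x) - d =
      ((2 * ε)⁻¹ : ℝ) • ∫ x in (s - ε)..(s + ε), (F x - d) := by
    rw [intervalIntegral.integral_sub (intervalIntegrable_of_locallyIntegrable hF) (by simp),
      intervalIntegral.integral_const, smul_sub, smul_smul,
      show (2 * ε)⁻¹ * (s + ε - (s - ε)) = 1 by field_simp; ring, one_smul]
  rw [h1, norm_smul, Real.norm_of_nonneg (by positivity)]
  exact mul_le_mul_of_nonneg_left (intervalIntegral.norm_integral_le_integral_norm (by linarith))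
    (by positivity)

theorem HasDiagValue.tendsto_mean {F : ℝ → ℝ → ℂ} {t : ℝ} {d : ℂ} (h : HasDiagValue F t d)
    (hF : LocallyIntegrable (F t)) :
    Tendsto (fun ε : ℝ => ((2 * ε)⁻¹ : ℝ) • ∫ x in (t - ε)..(t + ε), F t x) (𝓝[>] 0) (𝓝 d) := by
  rw [tendsto_iff_norm_sub_tendsto_zero]
  have h1 : Tendsto (fun ε : ℝ => (t, ε)) (𝓝[>] 0) (𝓝 t ×ˢ 𝓝[>] 0) :=
    tendsto_const_nhds.prodMk tendsto_id
  refine squeeze_zero' (Eventually.of_forall fun ε => norm_nonneg _) ?_ (h.comp h1)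
  filter_upwards [self_mem_nhdsWithin] with ε hε
  exact norm_mean_sub_le hF t hε d

theorem HasDiagValue.diagVal_eq {F : ℝ → ℝ → ℂ} {t : ℝ} {d : ℂ} (h : HasDiagValue F t d)
    (hF : LocallyIntegrable (F t)) : diagVal F t = d :=
  (h.tendsto_mean hF).limUnder_eq

theorem HasDiagValue.congr {F G : ℝ → ℝ → ℂ} {t : ℝ} {d : ℂ} (h : HasDiagValue F t d)
    (hFG : ∀ᶠ s in 𝓝 t, F s =ᵐ[volume] G s) : HasDiagValue G t d := by
  refine Tendsto.congr' ?_ h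
  filter_upwards [hFG.prod_inl (𝓝[>] (0 : ℝ))] with p hp
  congr 1
  refine intervalIntegral.integral_congr_ae ?_
  filter_upwards [hp] with x hx _
  rw [hx]

theorem HasDiagValue.const_mul {F : ℝ → ℝ → ℂ} {t : ℝ} {d : ℂ} (h : HasDiagValue F t d) (a : ℂ) :
    HasDiagValue (fun s x => a * F s x) t (a * d) := by
  have := Tendsto.const_mul ‖a‖ h
  rw [mul_zero] at this
  refine this.congr fun p => ?_
  simp only [← mul_sub, norm_mul, intervalIntegral.integral_const_mul]
  ring

theorem HasDiagValue.conj {F : ℝ → ℝ → ℂ} {t : ℝ} {d : ℂ} (h : HasDiagValue F t d) :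
    HasDiagValue (fun s x => conj (F s x)) t (conj d) := by
  refine Tendsto.congr (fun p => ?_) h
  simp only [← map_sub, RCLike.norm_conj]

theorem HasDiagValue.continuousAt {F : ℝ → ℝ → ℂ} {t : ℝ} {δ : ℝ → ℂ}
    (h : ∀ᶠ s in 𝓝 t, HasDiagValue F s (δ s) ∧ LocallyIntegrable (F s)) : ContinuousAt δ t := by
  have ht := h.self_of_nhds.1
  rw [Metric.continuousAt_iff']
  intro η hη
  have h1 := ht.eventually (Iio_mem_nhds (half_pos hη))
  obtain ⟨p, hp, q, hq, hpq⟩ := eventually_prod_iff.1 h1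
  filter_upwards [h, hp] with s hs hps
  have h2 := (hs.1.tendsto_mean hs.2).sub_const (δ t)
  refine lt_of_le_of_lt ?_ (half_lt_self hη)
  rw [dist_eq_norm]
  refine le_of_tendsto h2.norm ?_
  filter_upwards [hq, self_mem_nhdsWithin] with ε hqε hε
  exact (norm_mean_sub_le hs.2 s hε (δ t)).trans (le_of_lt (hpq hps hqε))

/-! ### Nondegeneracy -/

theorem exists_schwartz_eq_one : ∃ φ : 𝓢(ℝ, ℂ), φ 0 = 1 := by
  let b : ContDiffBump (0 : ℝ) := ⟨1, 2, by norm_num, by norm_num⟩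
  have hs : HasCompactSupport (fun x => (b x : ℂ)) :=
    b.hasCompactSupport.comp_left (g := fun x : ℝ => (x : ℂ)) rfl
  refine ⟨hs.toSchwartzMap (Complex.ofRealCLM.contDiff.comp b.contDiff), ?_⟩
  change ((b 0 : ℝ) : ℂ) = 1
  rw [b.one_of_mem_closedBall (by simp [b])]
  simp

/-- Dilation of Schwartz functions. -/
def dilS (a : ℝ) (ha : a ≠ 0) (g : 𝓢(ℝ, ℂ)) : 𝓢(ℝ, ℂ) :=
  SchwartzMap.compCLMOfContinuousLinearEquiv ℂ
    (ContinuousLinearEquiv.unitsEquivAut ℝ (Units.mk0 a ha)) g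

theorem dilS_apply (a : ℝ) (ha : a ≠ 0) (g : 𝓢(ℝ, ℂ)) (x : ℝ) : dilS a ha g x = g (x * a) := rfl

/-- The derivative of a square integrable function is not a multiple of the Dirac distribution. -/
theorem eq_zero_of_integral_deriv {F : L2} {e : ℂ} {t : ℝ}
    (h : ∀ g : 𝓢(ℝ, ℂ), e * g t + ∫ x, F x * derivS g x = 0) : e = 0 := by
  obtain ⟨φ, hφ⟩ := exists_schwartz_eq_one
  have hn : ∀ n : ℕ, ((n : ℝ) + 1)⁻¹ ≠ 0 := fun n => by positivity
  set g : ℕ → 𝓢(ℝ, ℂ) := fun n => trS (-t) (dilS ((n : ℝ) + 1)⁻¹ (hn n) φ) with hg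
  have hgx : ∀ n x, g n x = φ ((x + -t) * ((n : ℝ) + 1)⁻¹) := fun n x => by
    rw [hg]; simp only [trS_apply, dilS_apply]
  have hd : ∀ n x, derivS (g n) x = ((n : ℝ) + 1)⁻¹ * derivS φ ((x + -t) * ((n : ℝ) + 1)⁻¹) := by
    intro n x
    have h1 : HasDerivAt (fun x : ℝ => φ ((x + -t) * ((n : ℝ) + 1)⁻¹))
        ((((n : ℝ) + 1)⁻¹ : ℝ) • derivS φ ((x + -t) * ((n : ℝ) + 1)⁻¹)) x := by
      have h2 : HasDerivAt (fun x : ℝ => (x + -t) * ((n : ℝ) + 1)⁻¹) (((n : ℝ) + 1)⁻¹) x := by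
        simpa using ((hasDerivAt_id x).add_const (-t)).mul_const (((n : ℝ) + 1)⁻¹)
      exact (φ.hasDerivAt _).scomp x h2
    have h3 : (g n : ℝ → ℂ) = fun x : ℝ => φ ((x + -t) * ((n : ℝ) + 1)⁻¹) := funext (hgx n)
    rw [SchwartzMap.derivCLM_apply, h3, h1.deriv, Complex.real_smul]
  have hnorm : ∀ n, ‖toL2 (derivS (g n))‖ ^ 2 = ((n : ℝ) + 1)⁻¹ * ‖toL2 (derivS φ)‖ ^ 2 := by
    intro n
    have hp : (0 : ℝ) < (n : ℝ) + 1 := by positivity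
    have e1 : ∀ ψ : 𝓢(ℝ, ℂ), ‖toL2 ψ‖ ^ 2 = ∫ x, ‖ψ x‖ ^ 2 := fun ψ => by
      rw [norm_sq_eq_integral]
      refine integral_congr_ae ?_
      filter_upwards [coeFn_toL2 (memLp_schwartz ψ)] with x hx
      rw [hx]
    rw [e1, e1]
    have e2 : ∀ x, ‖derivS (g n) x‖ ^ 2 = (fun y : ℝ => (((n : ℝ) + 1)⁻¹) ^ 2 *
        ‖derivS φ (y * ((n : ℝ) + 1)⁻¹)‖ ^ 2) (x + -t) := fun x => by
      rw [hd, norm_mul, mul_pow, Complex.norm_real, Real.norm_of_nonneg (by positivity)]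
    simp_rw [e2]
    rw [integral_add_right_eq_self (fun y : ℝ => (((n : ℝ) + 1)⁻¹) ^ 2 *
        ‖derivS φ (y * ((n : ℝ) + 1)⁻¹)‖ ^ 2), integral_const_mul,
      Measure.integral_comp_mul_right (fun y => ‖derivS φ y‖ ^ 2), inv_inv, abs_of_pos hp,
      smul_eq_mul]
    field_simp
  have hlim : Tendsto (fun n => ‖toL2 (derivS (g n))‖) atTop (𝓝 0) := by
    have h1 : Tendsto (fun n : ℕ => ((n : ℝ) + 1)⁻¹ * ‖toL2 (derivS φ)‖ ^ 2) atTop (𝓝 0) := by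
      have := (tendsto_one_div_add_atTop_nhds_zero_nat (𝕜 := ℝ)).mul_const (‖toL2 (derivS φ)‖ ^ 2)
      simpa using this
    have h2 := (Real.continuous_sqrt.tendsto 0).comp h1
    rw [Real.sqrt_zero] at h2
    refine h2.congr fun n => ?_
    simp only [Function.comp]
    rw [← hnorm, Real.sqrt_sq (norm_nonneg _)]
  have hle : ∀ n, ‖e‖ ≤ ‖F‖ * ‖toL2 (derivS (g n))‖ := fun n => by
    have h1 := h (g n)
    rw [hgx, add_neg_cancel, zero_mul, hφ, mul_one] at h1
    rw [eq_neg_of_add_eq_zero_left h1, norm_neg]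
    exact norm_integral_mul_le F _ (memLp_schwartz _)
  have h3 := ge_of_tendsto' (hlim.const_mul ‖F‖) hle
  rw [mul_zero] at h3
  exact norm_le_zero_iff.1 h3

section
variable {u : ℝ → ℂ} (hu : IsUnimodular u) {c : ℂ} {k : L2} (hk : IsKernelPart u c k)
include hu hk

/-- The diagonal values of solutions with real-independent constants are real-independent. -/
theorem ne_real_mul_diag {T : ℝ} (hT : ∀ t < T, compressionNorm u t < 1) {e₁ e₂ : ℂ}
    {f₁ f₂ : ℝ → L2} (hf₁ : ∀ t < T, IsPart u c k e₁ t (f₁ t))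
    (hf₂ : ∀ t < T, IsPart u c k e₂ t (f₂ t)) {t : ℝ} (ht : t < T) (h4 : CondK4 u t) {d₁ d₂ : ℂ}
    (hd₁ : HasDiagValue (fun s => solFun u c k e₁ s (f₁ s)) t d₁)
    (hd₂ : HasDiagValue (fun s => solFun u c k e₂ s (f₂ s)) t d₂) (ρ : ℝ) (he : e₂ ≠ ρ * e₁) :
    d₂ ≠ ρ * d₁ := by
  intro hd
  have hf₁c := IsPart.continuousAt hu hk hT hf₁ ht
  have hf₂c := IsPart.continuousAt hu hk hT hf₂ ht
  set b : ℕ → ℝ := fun n => t + min 1 ((T - t) / 2) * (1 / ((n : ℝ) + 1)) with hb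
  have hm : 0 < min 1 ((T - t) / 2) := lt_min one_pos (by linarith)
  have hn : ∀ n : ℕ, 0 < 1 / ((n : ℝ) + 1) := fun n => by positivity
  have hn1 : ∀ n : ℕ, 1 / ((n : ℝ) + 1) ≤ 1 := fun n => by
    rw [div_le_one (by positivity)]
    linarith [(Nat.cast_nonneg n : (0 : ℝ) ≤ n)]
  have hw : IsWindow t (fun _ => t) b := by
    refine ⟨fun n => ?_, fun n => le_rfl, fun n => ?_, fun n => ?_, ?_⟩
    · simp only [hb]; nlinarith [hn n]
    · simp only [hb]; nlinarith [hn n]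
    · simp only [hb]
      nlinarith [hn n, hn1 n, min_le_left 1 ((T - t) / 2)]
    · simp only [hb, add_sub_cancel_left]
      have := (tendsto_one_div_add_atTop_nhds_zero_nat (𝕜 := ℝ)).const_mul (min 1 ((T - t) / 2))
      simpa using this
  have hmT : ∀ n, (t + b n) / 2 < T := fun n => by
    simp only [hb]
    nlinarith [hn n, hn1 n, min_le_right 1 ((T - t) / 2)]
  have q1 := (isQuasi_shiftIncr hu hk hw (fun n => hf₁ _ (hmT n)) hd₁).smul hu (-ρ)
  have q2 := isQuasi_shiftIncr hu hk hw (fun n => hf₂ _ (hmT n)) hd₂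
  have q := q1.add hu hw q2
  have hz : ((-ρ : ℝ) : ℂ) * -(I * d₁) + -(I * d₂) = 0 := by
    rw [hd]; push_cast; ring
  rw [hz] at q
  obtain ⟨r, hr⟩ := q.isKSeq hu hw
  have key : ∀ g : 𝓢(ℝ, ℂ), (e₂ - ρ * e₁) * g t +
      ∫ x, (f₂ t - (ρ : ℂ) • f₁ t : L2) x * derivS g x = 0 := fun g => by
    obtain ⟨l1, -⟩ := hr.tendsto_zero hu (hT t ht) h4 g
    have s1 := ((tendsto_shiftIncr (e := e₁) hf₁c hw g).const_mul (-ρ * I)).add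
      ((tendsto_shiftIncr (e := e₂) hf₂c hw g).const_mul I)
    have s2 := tendsto_nhds_unique l1 (s1.congr fun n => by
      rw [integral_smul_mul, integral_add_mul, integral_smul_mul,
        integral_smul_mul, integral_smul_mul]
      push_cast
      ring)
    rw [pairP_eq, pairP_eq, integral_Iio_deriv] at s2
    rw [integral_sub_mul, integral_smul_mul]
    have h5 : I * ((e₂ - ρ * e₁) * g t + ((∫ x, f₂ t x * derivS g x) -
        ρ * ∫ x, f₁ t x * derivS g x)) = 0 := by
      linear_combination s2
    exact (mul_eq_zero.1 h5).resolve_left Complex.I_ne_zero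
  exact he (sub_eq_zero.1 (eq_zero_of_integral_deriv key))

end

/-! ### Symmetric unimodular functions -/

/-- Complex conjugation on `L²(ℝ)`. -/
def conjL (f : L2) : L2 := toL2 fun x => conj (f x)

theorem memLp_conj {f : ℝ → ℂ} (hf : MemLp f 2 (volume : Measure ℝ)) :
    MemLp (fun x => conj (f x)) 2 (volume : Measure ℝ) := hf.star

theorem conjL_coe (f : L2) : conjL f =ᵐ[volume] fun x => conj (f x) :=
  coeFn_toL2 (memLp_conj (memLp_coe f))

theorem conjL_toL2 {f : ℝ → ℂ} (hf : MemLp f 2 (volume : Measure ℝ)) :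
    conjL (toL2 f) = toL2 fun x => conj (f x) := by
  apply eq_toL2
  filter_upwards [conjL_coe (toL2 f), coeFn_toL2 hf] with x h1 h2
  rw [h1, h2]

theorem fourier_conjS_dilS (φ : 𝓢(ℝ, ℂ)) (x : ℝ) :
    (𝓕 (conjS (dilS (-1) (by norm_num) φ))) x = conj ((𝓕 φ) x) := by
  rw [SchwartzMap.fourier_coe, SchwartzMap.fourier_coe, Real.fourier_real_eq_integral_exp_smul,
    Real.fourier_real_eq_integral_exp_smul, ← integral_conj, ← integral_neg_eq_self]
  refine integral_congr_ae (Eventually.of_forall fun y => ?_)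
  simp only [smul_eq_mul, map_mul, ← Complex.exp_conj, conjS_apply, dilS_apply, Complex.conj_ofReal,
    Complex.conj_I]
  congr 2
  · push_cast; ring
  · congr 1; ring

theorem fourier_conjL (f : L2) :
    (𝓕 (conjL f) : L2) =ᵐ[volume] fun w => conj ((𝓕 f : L2) (-w)) := by
  have hm : MemLp (fun w => conj ((𝓕 f : L2) (-w))) 2 (volume : Measure ℝ) :=
    memLp_conj ((memLp_coe (𝓕 f : L2)).comp_measurePreserving
      (Measure.measurePreserving_neg volume))
  refine ae_eq_of_schwartz (L2_locallyIntegrable _) (hm.locallyIntegrable (by norm_num)) fun φ => ?_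
  rw [integral_fourier_mul]
  have h1 : ∫ x, conjL f x * (𝓕 φ) x =
      conj (∫ x, f x * (𝓕 (conjS (dilS (-1) (by norm_num) φ))) x) := by
    rw [← integral_conj]
    refine integral_congr_ae ?_
    filter_upwards [conjL_coe f] with x hx
    rw [hx, fourier_conjS_dilS, map_mul, Complex.conj_conj]
  rw [h1, ← integral_fourier_mul, ← integral_conj, ← integral_neg_eq_self]
  refine integral_congr_ae (Eventually.of_forall fun w => ?_)
  simp only [map_mul, conjS_apply, dilS_apply, Complex.conj_conj]
  congr 2
  ring

section
variable {u : ℝ → ℂ} (hu : IsUnimodular u)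
include hu

theorem K_conjL (hs : IsSymmetricU u) (f : L2) : K u (conjL f) = conjL (K u f) := by
  apply fourier_inj
  apply Lp.ext
  have hneg : ∀ {p : ℝ → Prop}, (∀ᵐ w : ℝ, p w) → ∀ᵐ w : ℝ, p (-w) := fun hp =>
    (Measure.measurePreserving_neg volume).quasiMeasurePreserving.ae hp
  have hs' : ∀ᵐ w : ℝ, conj (uw u (-w)) = uw u w := by
    filter_upwards [ae_comp_mul hs (a := 2 * Real.pi) Real.two_pi_pos.ne'] with w hw
    rw [uw, uw, ← hw]
    congr 2
    ring
  filter_upwards [fourier_K hu (conjL f), fourier_conjL f, fourier_conjL (K u f),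
    hneg (fourier_K hu f), hs'] with w h1 h2 h3 h4 h5
  rw [h1, h2, h3, h4, map_mul, h5, Complex.conj_conj]

theorem IsSolution.conj (hs : IsSymmetricU u) {σ : ℝ} {t : ℝ} {f : ℝ → ℂ}
    (h : IsSolution u σ t f) : IsSolution u σ t fun x => conj (f x) := by
  obtain ⟨⟨N, hN⟩, h2, h3, ⟨M, hM⟩, h5⟩ := h
  have hind : ∀ R : ℝ, (Icc (-R) R).indicator ((Iio t).indicator fun x => conj (f x)) =
      fun x => conj ((Icc (-R) R).indicator ((Iio t).indicator f) x) := fun R => by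
    ext x
    by_cases h1 : x ∈ Icc (-R) R <;> by_cases h2 : x ∈ Iio t <;>
      simp [h2, indicator_of_mem, indicator_of_notMem, h1]
  have hInt : ∀ {F : ℝ → ℂ}, Integrable F → Integrable fun x => conj (F x) := fun hF =>
    (Complex.conjLIE.toContinuousLinearEquiv : ℂ →L[ℝ] ℂ).integrable_comp hF
  refine ⟨⟨N, ?_⟩, ?_, fun R => ?_, ⟨M, ?_⟩, fun φ => ?_⟩
  · refine (hInt hN).congr (Eventually.of_forall fun x => ?_)
    simp [Complex.real_smul]
  · have := h2.star
    refine this.ae_eq (Eventually.of_forall fun x => ?_)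
    simp
  · rw [hind]; exact memLp_conj (h3 R)
  · refine (hInt hM).congr (Eventually.of_forall fun x => ?_)
    simp [Complex.real_smul]
  · have h6 := (Complex.continuous_conj.tendsto _).comp (h5 (conjS φ))
    have e1 : ∀ R : ℝ, ∫ x, K u (toL2 ((Icc (-R) R).indicator
        ((Iio t).indicator fun x => conj (f x)))) x * φ x =
        conj (∫ x, K u (toL2 ((Icc (-R) R).indicator ((Iio t).indicator f))) x * conjS φ x) := by
      intro R
      rw [hind, ← conjL_toL2 (h3 R), K_conjL hu hs, ← integral_conj]
      refine integral_congr_ae ?_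
      filter_upwards [conjL_coe (K u (toL2 ((Icc (-R) R).indicator ((Iio t).indicator f))))]
        with x hx
      rw [hx, map_mul, conjS_apply, Complex.conj_conj]
    have e2 : ∫ x, (σ : ℂ) * (1 - conj (f x)) * φ x =
        conj (∫ x, (σ : ℂ) * (1 - f x) * conjS φ x) := by
      rw [← integral_conj]
      refine integral_congr_ae (Eventually.of_forall fun x => ?_)
      simp [conjS_apply]
    rw [e2]
    exact h6.congr fun R => (e1 R).symm

theorem HasK.const_mul {f g : ℝ → ℂ} (h : HasK u f g) (a : ℂ) :
    HasK u (fun x => a * f x) (fun x => conj a * g x) := by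
  obtain ⟨h1, h2, h3⟩ := h
  have hind : ∀ R : ℝ, (Icc (-R) R).indicator (fun x => a * f x) =
      fun x => a * (Icc (-R) R).indicator f x := fun R => by
    ext x
    by_cases h1 : x ∈ Icc (-R) R <;> simp [indicator_of_mem, indicator_of_notMem, h1]
  refine ⟨fun R => ?_, h2.const_mul _, fun φ => ?_⟩
  · rw [hind]; exact (h1 R).const_mul a
  · have h4 := (h3 φ).const_mul (conj a)
    have e : ∫ x, conj a * g x * φ x = conj a * ∫ x, g x * φ x := by
      rw [← integral_const_mul]; simp_rw [mul_assoc]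
    rw [e]
    refine h4.congr fun R => ?_
    have e2 : toL2 ((Icc (-R) R).indicator fun x => a * f x) =
        a • toL2 ((Icc (-R) R).indicator f) := by
      symm
      apply eq_toL2
      filter_upwards [Lp.coeFn_smul a (toL2 ((Icc (-R) R).indicator f)), coeFn_toL2 (h1 R)]
        with x e1 e2
      rw [e1, Pi.smul_apply, e2, hind, smul_eq_mul]
    rw [e2, K_smul hu, integral_smul_mul]

omit hu in
theorem isSolution_neg_one {t : ℝ} {f : ℝ → ℂ} : IsSolution u (-1) t f ↔ IsSol u 1 t f := by
  have : (fun x => (-1 : ℂ) * (1 - f x)) = fun x => f x - 1 := by ext x; ring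
  rw [IsSolution, IsSol, this]

theorem isSolution_one {t : ℝ} {f : ℝ → ℂ} :
    IsSolution u 1 t f ↔ IsSol u I t fun x => I * f x := by
  have hI : I * I = -1 := Complex.I_mul_I
  have hind : ∀ (a : ℂ) (g : ℝ → ℂ), (Iio t).indicator (fun x => a * g x) =
      fun x => a * (Iio t).indicator g x := fun a g => by
    ext x
    by_cases h1 : x ∈ Iio t <;> simp [indicator_of_mem, indicator_of_notMem, h1]
  constructor
  · rintro ⟨h1, h2, h3⟩
    refine ⟨h1.const_mul _, ?_, ?_⟩
    · refine (h2.const_mul I).ae_eq (Eventually.of_forall fun x => ?_)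
      simp only; ring
    · have := h3.const_mul hu I
      rw [hind]
      convert this using 2 with x
      rw [Complex.conj_I]
      ring
  · rintro ⟨h1, h2, h3⟩
    have e : f = fun x => -I * (I * f x) := by
      ext x; linear_combination (f x) * hI
    refine ⟨?_, ?_, ?_⟩
    · rw [e]; exact h1.const_mul _
    · refine (h2.const_mul (-I)).ae_eq (Eventually.of_forall fun x => ?_)
      simp only
      linear_combination (1 - f x) * hI
    · have := h3.const_mul hu (-I)
      rw [hind] at this
      convert this using 2 with x
      · linear_combination ((Iio t).indicator f x) * hI
      · rename_i x
        rw [map_neg, Complex.conj_I]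
        linear_combination (1 - f x) * hI

end

/-! ### The two families of solutions -/

/-- The square integrable parts of `Ψ` and `iΦ` for all `t < T`. -/
structure Families (u : ℝ → ℂ) (T : ℝ) (c : ℂ) (k : L2) (f₁ f₂ : ℝ → L2) : Prop where
  unim : IsUnimodular u
  kern : IsKernelPart u c k
  comp : ∀ t < T, compressionNorm u t < 1
  part₁ : ∀ t < T, IsPart u c k 1 t (f₁ t)
  part₂ : ∀ t < T, IsPart u c k I t (f₂ t)

theorem exists_families {u : ℝ → ℂ} {D : Set ℂ} {U : ℂ → ℂ} (hu : IsUloc u D U) {T : ℝ}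
    (hT : ∀ t < T, compressionNorm u t < 1) :
    ∃ (c : ℂ) (k : L2) (f₁ f₂ : ℝ → L2), Families u T c k f₁ f₂ := by
  obtain ⟨c, k, hk⟩ := hu.exists_kernelPart
  have h : ∀ e : ℂ, ∃ f : ℝ → L2, ∀ t < T, IsPart u c k e t (f t) := fun e => by
    have : ∀ t : ℝ, ∃ f : L2, t < T → IsPart u c k e t f := fun t => by
      by_cases ht : t < T
      · obtain ⟨f, hf⟩ := exists_isPart hu.isUnimodular (c := c) (k := k) (hT t ht) e
        exact ⟨f, fun _ => hf⟩
      · exact ⟨0, fun h => absurd h ht⟩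
    choose f hf using this
    exact ⟨f, hf⟩
  obtain ⟨f₁, h₁⟩ := h 1
  obtain ⟨f₂, h₂⟩ := h I
  exact ⟨c, k, f₁, f₂, hu.isUnimodular, hk, hT, h₁, h₂⟩

section
variable {u : ℝ → ℂ} {T : ℝ} {c : ℂ} {k : L2} {f₁ f₂ : ℝ → L2} (F : Families u T c k f₁ f₂)
include F

theorem Families.ae_eq_of_isSol {e : ℂ} {t : ℝ} (ht : t < T) {f : L2} (hf : IsPart u c k e t f)
    {X : ℝ → ℂ} (hX : IsSol u e t X) : X =ᵐ[volume] solFun u c k e t f := by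
  obtain ⟨g, hg, h⟩ := hX.exists_part F.unim F.kern
  rwa [hg.unique F.unim (F.comp t ht) hf] at h

theorem Families.isSolution_psi {t : ℝ} (ht : t < T) : IsSolution u (-1) t (Psi u t) :=
  Classical.epsilon_spec ⟨_, isSolution_neg_one.2 ((F.part₁ t ht).isSol F.unim F.kern)⟩

theorem Families.isSolution_phi {t : ℝ} (ht : t < T) : IsSolution u 1 t (Phi u t) := by
  refine Classical.epsilon_spec (p := IsSolution u 1 t)
    ⟨fun x => -I * solFun u c k I t (f₂ t) x, ?_⟩
  rw [isSolution_one F.unim]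
  have h := (F.part₂ t ht).isSol F.unim F.kern
  convert h using 2 with x
  rw [← mul_assoc, mul_neg, Complex.I_mul_I, neg_neg, one_mul]

theorem Families.psi_eq {t : ℝ} (ht : t < T) {f : ℝ → ℂ} (hf : IsSolution u (-1) t f) :
    f =ᵐ[volume] solFun u c k 1 t (f₁ t) :=
  F.ae_eq_of_isSol ht (F.part₁ t ht) (isSolution_neg_one.1 hf)

theorem Families.phi_eq {t : ℝ} (ht : t < T) {f : ℝ → ℂ} (hf : IsSolution u 1 t f) :
    (fun x => I * f x) =ᵐ[volume] solFun u c k I t (f₂ t) :=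
  F.ae_eq_of_isSol ht (F.part₂ t ht) ((isSolution_one F.unim).1 hf)

theorem Families.phi_unique {t : ℝ} (ht : t < T) {f : ℝ → ℂ} (hf : IsSolution u 1 t f) :
    f =ᵐ[volume] Phi u t := by
  filter_upwards [F.phi_eq ht hf, F.phi_eq ht (F.isSolution_phi ht)] with x h1 h2
  exact mul_left_cancel₀ Complex.I_ne_zero (h1.trans h2.symm)

theorem Families.psi_unique {t : ℝ} (ht : t < T) {f : ℝ → ℂ} (hf : IsSolution u (-1) t f) :
    f =ᵐ[volume] Psi u t :=
  (F.psi_eq ht hf).trans (F.psi_eq ht (F.isSolution_psi ht)).symm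

theorem Families.hasDiagValue_phi {t : ℝ} (ht : t < T) (h3 : CondK3 u t) :
    HasDiagValue (Phi u) t (diagVal (Phi u) t) ∧ diagVal (Phi u) t ≠ 0 := by
  obtain ⟨⟨d, hd, h⟩, -⟩ := h3
  rw [h.diagVal_eq (F.isSolution_phi ht).1.locallyIntegrable]
  exact ⟨h, hd⟩

theorem Families.hasDiagValue_psi {t : ℝ} (ht : t < T) (h3 : CondK3 u t) :
    HasDiagValue (Psi u) t (diagVal (Psi u) t) ∧ diagVal (Psi u) t ≠ 0 := by
  obtain ⟨-, d, hd, h⟩ := h3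
  rw [h.diagVal_eq (F.isSolution_psi ht).1.locallyIntegrable]
  exact ⟨h, hd⟩

theorem Families.hasDiagValue₁ {t : ℝ} (ht : t < T) (h3 : CondK3 u t) :
    HasDiagValue (fun s => solFun u c k 1 s (f₁ s)) t (diagVal (Psi u) t) := by
  refine (F.hasDiagValue_psi ht h3).1.congr ?_
  filter_upwards [Iio_mem_nhds ht] with s hs
  exact F.psi_eq hs (F.isSolution_psi hs)

theorem Families.hasDiagValue₂ {t : ℝ} (ht : t < T) (h3 : CondK3 u t) :
    HasDiagValue (fun s => solFun u c k I s (f₂ s)) t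
      (I * diagVal (Phi u) t) := by
  refine ((F.hasDiagValue_phi ht h3).1.const_mul I).congr ?_
  filter_upwards [Iio_mem_nhds ht] with s hs
  exact F.phi_eq hs (F.isSolution_phi hs)

theorem Families.re_ne_zero {t : ℝ} (ht : t < T) (h3 : CondK3 u t) (h4 : CondK4 u t) :
    (diagVal (Phi u) t * conj (diagVal (Psi u) t)).re ≠ 0 := by
  set φ := diagVal (Phi u) t with hφ
  set ψ := diagVal (Psi u) t with hψ
  have hψ0 : ψ ≠ 0 := (F.hasDiagValue_psi ht h3).2
  intro hre
  have hn : ψ * conj ψ ≠ 0 := by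
    rw [Complex.mul_conj]
    exact_mod_cast (Complex.normSq_pos.2 hψ0).ne'
  refine ne_real_mul_diag F.unim F.kern F.comp F.part₁ F.part₂ ht h4 (F.hasDiagValue₁ ht h3)
    (F.hasDiagValue₂ ht h3) (-(φ * conj ψ).im / Complex.normSq ψ) ?_ ?_
  · intro h
    have := congrArg Complex.im h
    simp at this
  · have h1 : φ * conj ψ = ((φ * conj ψ).im : ℂ) * I := by
      conv_lhs => rw [← Complex.re_add_im (φ * conj ψ), hre]
      simp
    have h2 : (Complex.normSq ψ : ℂ) ≠ 0 := by rwa [Complex.mul_conj] at hn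
    apply mul_right_cancel₀ (b := conj ψ) (by simpa using hψ0)
    push_cast
    rw [mul_assoc, h1, ← hψ, mul_assoc, Complex.mul_conj, div_mul_cancel₀ _ h2, ← mul_assoc,
      mul_comm I, mul_assoc, Complex.I_mul_I]
    simp

theorem Families.ham_isDiag (hs : IsSymmetricU u) {t : ℝ} (ht : t < T) (h3 : CondK3 u t) :
    hamBeta u t = 0 := by
  have key : ∀ {X : ℝ → ℝ → ℂ} {d : ℂ}, LocallyIntegrable (X t) → HasDiagValue X t d →
      (∀ s < T, (fun x => conj (X s x)) =ᵐ[volume] X s) → conj d = d := by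
    intro X d hX hd hc
    have h1 := hd.conj.congr (G := X) (by
      filter_upwards [Iio_mem_nhds ht] with s hs using hc s hs)
    rw [← h1.diagVal_eq hX, hd.diagVal_eq hX]
  have e1 := key (F.isSolution_phi ht).1.locallyIntegrable (F.hasDiagValue_phi ht h3).1 fun s hsT =>
    F.phi_unique hsT (by
      have := IsSolution.conj F.unim hs (σ := 1) (by simpa using F.isSolution_phi hsT)
      simpa using this)
  have e2 := key (F.isSolution_psi ht).1.locallyIntegrable (F.hasDiagValue_psi ht h3).1 fun s hsT =>
    F.psi_unique hsT (by
      have := IsSolution.conj F.unim hs (σ := -1) (by simpa using F.isSolution_psi hsT)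
      simpa using this)
  rw [Complex.conj_eq_iff_im] at e1 e2
  simp [hamBeta, e1, e2]

end

/-! ### The entries of the Hamiltonian -/

section
variable {u : ℝ → ℂ} {t : ℝ}

theorem ham_relations (h : (diagVal (Phi u) t * conj (diagVal (Psi u) t)).re ≠ 0) :
    diagVal (Psi u) t = I * (((-hamBeta u t : ℝ) : ℂ) * diagVal (Psi u) t +
      ((-hamGamma u t : ℝ) : ℂ) * (I * diagVal (Phi u) t)) ∧
    I * diagVal (Phi u) t = I * ((hamAlpha u t : ℂ) * diagVal (Psi u) t +
      (hamBeta u t : ℂ) * (I * diagVal (Phi u) t)) := by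
  unfold hamAlpha hamBeta hamGamma
  set φ := diagVal (Phi u) t
  set ψ := diagVal (Psi u) t
  rw [← Complex.normSq_eq_norm_sq, ← Complex.normSq_eq_norm_sq, Complex.normSq_apply,
    Complex.normSq_apply]
  have e5 : (φ * conj ψ).re = φ.re * ψ.re + φ.im * ψ.im := by simp [Complex.mul_re]
  have e6 : (φ * conj ψ).im = φ.im * ψ.re - φ.re * ψ.im := by simp [Complex.mul_im]; ring
  rw [e5] at h
  rw [e5, e6]
  generalize hα : (φ.re * φ.re + φ.im * φ.im) / (φ.re * ψ.re + φ.im * ψ.im) = α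
  generalize hβ : (φ.im * ψ.re - φ.re * ψ.im) / (φ.re * ψ.re + φ.im * ψ.im) = β
  generalize hγ : (ψ.re * ψ.re + ψ.im * ψ.im) / (φ.re * ψ.re + φ.im * ψ.im) = γ
  rw [div_eq_iff h] at hα hβ hγ
  constructor <;> apply Complex.ext <;> simp <;> apply mul_right_cancel₀ h
  · linear_combination ψ.im * hβ + φ.re * hγ
  · linear_combination -ψ.re * hβ + φ.im * hγ
  · linear_combination -ψ.im * hα - φ.re * hβ
  · linear_combination ψ.re * hα - φ.im * hβ

theorem ham_formulas (h : (diagVal (Phi u) t * conj (diagVal (Psi u) t)).re ≠ 0)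
    (h1 : diagVal (Phi u) t ≠ 0) (h2 : diagVal (Psi u) t ≠ 0) :
    hamAlpha u t = 1 / (diagVal (Psi u) t / diagVal (Phi u) t).re ∧
    hamBeta u t = (diagVal (Phi u) t / diagVal (Psi u) t).im /
      (diagVal (Phi u) t / diagVal (Psi u) t).re ∧
    hamBeta u t = -((diagVal (Psi u) t / diagVal (Phi u) t).im /
      (diagVal (Psi u) t / diagVal (Phi u) t).re) ∧
    hamGamma u t = 1 / (diagVal (Phi u) t / diagVal (Psi u) t).re := by
  unfold hamAlpha hamBeta hamGamma
  set φ := diagVal (Phi u) t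
  set ψ := diagVal (Psi u) t
  rw [← Complex.normSq_eq_norm_sq, ← Complex.normSq_eq_norm_sq]
  have hφ : Complex.normSq φ ≠ 0 := (Complex.normSq_pos.2 h1).ne'
  have hψ : Complex.normSq ψ ≠ 0 := (Complex.normSq_pos.2 h2).ne'
  have h' : φ.re * ψ.re + φ.im * ψ.im ≠ 0 := by
    simpa [Complex.mul_re] using h
  have e1 : (ψ / φ).re = (φ.re * ψ.re + φ.im * ψ.im) / Complex.normSq φ := by
    rw [Complex.div_re]; ring
  have e2 : (φ / ψ).re = (φ.re * ψ.re + φ.im * ψ.im) / Complex.normSq ψ := by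
    rw [Complex.div_re]; ring
  have e3 : (ψ / φ).im = -((φ.im * ψ.re - φ.re * ψ.im) / Complex.normSq φ) := by
    rw [Complex.div_im]; ring
  have e4 : (φ / ψ).im = (φ.im * ψ.re - φ.re * ψ.im) / Complex.normSq ψ := by
    rw [Complex.div_im]; ring
  have e5 : (φ * conj ψ).re = φ.re * ψ.re + φ.im * ψ.im := by simp [Complex.mul_re]
  have e6 : (φ * conj ψ).im = φ.im * ψ.re - φ.re * ψ.im := by simp [Complex.mul_im]; ring
  rw [e1, e2, e3, e4, e5, e6]
  refine ⟨?_, ?_, ?_, ?_⟩ <;> field_simp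

theorem ham_det (h : (diagVal (Phi u) t * conj (diagVal (Psi u) t)).re ≠ 0) :
    (Ham u t).det = 1 := by
  rw [Ham, Matrix.det_fin_two_of]
  unfold hamAlpha hamBeta hamGamma
  set φ := diagVal (Phi u) t
  set ψ := diagVal (Psi u) t
  rw [← Complex.normSq_eq_norm_sq, ← Complex.normSq_eq_norm_sq]
  have e : Complex.normSq φ * Complex.normSq ψ =
      (φ * conj ψ).re ^ 2 + (φ * conj ψ).im ^ 2 := by
    rw [← Complex.normSq_conj ψ, ← Complex.normSq_mul, Complex.normSq_apply]; ring
  field_simp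
  linarith

theorem ham_isSymm : (Ham u t).IsSymm := by
  ext i j
  fin_cases i <;> fin_cases j <;> rfl

end

/-! ### The Fourier transform `∫ f(x) e^{izx} dx` of square integrable functions -/

/-- The Fourier transform `(F f)(z) = ∫ f(x) e^{izx} dx` on `L²(ℝ)`. -/
def FL (f : L2) : L2 := toL2 fun z : ℝ => (𝓕 f : L2) (-(2 * Real.pi)⁻¹ * z)

theorem neg_two_pi_inv_ne : -(2 * Real.pi)⁻¹ ≠ 0 :=
  neg_ne_zero.2 (inv_ne_zero Real.two_pi_pos.ne')

theorem memLp_comp_mul {f : ℝ → ℂ} (hf : MemLp f 2 (volume : Measure ℝ)) {a : ℝ} (ha : a ≠ 0) :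
    MemLp (fun x => f (a * x)) 2 (volume : Measure ℝ) := by
  have hm : AEStronglyMeasurable (fun x => f (a * x)) volume :=
    hf.1.comp_quasiMeasurePreserving (quasiMeasurePreserving_mul ha)
  rw [memLp_two_iff_integrable_sq_norm hm]
  exact ((memLp_two_iff_integrable_sq_norm hf.1).1 hf).comp_mul_left' ha

theorem FL_coe (f : L2) : FL f =ᵐ[volume] fun z : ℝ => (𝓕 f : L2) (-(2 * Real.pi)⁻¹ * z) :=
  coeFn_toL2 (memLp_comp_mul (memLp_coe _) neg_two_pi_inv_ne)

theorem FL_sub (f g : L2) : FL (f - g) = FL f - FL g := by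
  apply Lp.ext
  filter_upwards [FL_coe (f - g), FL_coe f, FL_coe g, Lp.coeFn_sub (FL f) (FL g),
    ae_comp_mul (Lp.coeFn_sub (𝓕 f : L2) (𝓕 g)) neg_two_pi_inv_ne] with z h1 h2 h3 h4 h5
  rw [h1, h4, Pi.sub_apply, h2, h3, fourier_sub', h5, Pi.sub_apply]

theorem norm_FL_sq (f : L2) : ‖FL f‖ ^ 2 = 2 * Real.pi * ‖f‖ ^ 2 := by
  have h1 : ‖(𝓕 f : L2)‖ = ‖f‖ := Lp.norm_fourier_eq f
  rw [norm_sq_eq_integral, ← h1, norm_sq_eq_integral]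
  rw [integral_congr_ae (g := fun z : ℝ => ‖(𝓕 f : L2) (-(2 * Real.pi)⁻¹ * z)‖ ^ 2)
    (by filter_upwards [FL_coe f] with z h; rw [h]),
    Measure.integral_comp_mul_left (fun w => ‖(𝓕 f : L2) w‖ ^ 2) (-(2 * Real.pi)⁻¹),
    inv_neg, inv_inv, abs_neg, abs_of_pos Real.two_pi_pos, smul_eq_mul]

theorem norm_FL (f : L2) : ‖FL f‖ = Real.sqrt (2 * Real.pi) * ‖f‖ := by
  rw [← Real.sqrt_sq (norm_nonneg (FL f)), norm_FL_sq, Real.sqrt_mul Real.two_pi_pos.le,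
    Real.sqrt_sq (norm_nonneg f)]

theorem continuous_FL : Continuous FL := by
  refine (LipschitzWith.of_dist_le_mul (K := ⟨Real.sqrt (2 * Real.pi), Real.sqrt_nonneg _⟩)
    fun f g => ?_).continuous
  rw [dist_eq_norm, dist_eq_norm, ← FL_sub, norm_FL]
  rfl

theorem fourier_dilS (h : 𝓢(ℝ, ℂ)) (x : ℝ) :
    (2 * Real.pi : ℂ) * (𝓕 (dilS (-(2 * Real.pi)) neg_two_pi_ne h)) x = fourierS h x := by
  rw [SchwartzMap.fourier_coe, Real.fourier_real_eq_integral_exp_smul, fourierS_apply]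
  have h1 := Measure.integral_comp_mul_left
    (fun s : ℝ => h s * Complex.exp (I * x * s)) (-(2 * Real.pi))
  rw [inv_neg, abs_neg, abs_of_pos (inv_pos.2 Real.two_pi_pos)] at h1
  have h2 : (∫ s : ℝ, h s * Complex.exp (I * x * s)) = (2 * Real.pi : ℂ) *
      ((2 * Real.pi)⁻¹ : ℝ) • ∫ s : ℝ, h s * Complex.exp (I * x * s) := by
    rw [Complex.real_smul, ← mul_assoc]
    push_cast
    rw [mul_inv_cancel₀ (by simp [Real.pi_ne_zero]), one_mul]
  rw [h2, ← h1]
  congr 1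
  refine integral_congr_ae (Eventually.of_forall fun w => ?_)
  simp only [smul_eq_mul, dilS_apply]
  rw [mul_comm, mul_comm w]
  congr 2
  push_cast
  ring

theorem integral_mul_fourierS (f : L2) (h : 𝓢(ℝ, ℂ)) :
    ∫ x, f x * fourierS h x = ∫ z, FL f z * h z := by
  have h1 : ∫ x, f x * fourierS h x = (2 * Real.pi : ℂ) *
      ∫ x, (𝓕 f : L2) x * dilS (-(2 * Real.pi)) neg_two_pi_ne h x := by
    rw [integral_fourier_mul, ← integral_const_mul]
    refine integral_congr_ae (Eventually.of_forall fun x => ?_)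
    simp only
    rw [← fourier_dilS]
    ring
  have h2 := Measure.integral_comp_mul_left
    (fun x : ℝ => (𝓕 f : L2) x * dilS (-(2 * Real.pi)) neg_two_pi_ne h x) (-(2 * Real.pi)⁻¹)
  rw [inv_neg, inv_inv, abs_neg, abs_of_pos Real.two_pi_pos, Complex.real_smul] at h2
  rw [h1]
  push_cast at h2
  rw [← h2]
  refine integral_congr_ae ?_
  filter_upwards [FL_coe f] with z hz
  rw [hz, dilS_apply]
  have : -(2 * Real.pi)⁻¹ * z * -(2 * Real.pi) = z := by
    have := Real.pi_ne_zero
    field_simp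
  rw [this]

/-! ### Multiplication and differentiation of Schwartz functions -/

theorem mulS_apply {m : ℝ → ℂ} (hm : m.HasTemperateGrowth) (g : 𝓢(ℝ, ℂ)) (x : ℝ) :
    mulS m g x = m x * g x := SchwartzMap.smulLeftCLM_apply_apply hm g x

theorem hasTemperateGrowth_const_mul (b : ℂ) :
    Function.HasTemperateGrowth fun z : ℝ => b * (z : ℂ) := by
  fun_prop

theorem mulS_ofReal (g : 𝓢(ℝ, ℂ)) (x : ℝ) : mulS (fun z : ℝ => (z : ℂ)) g x = x * g x :=
  mulS_apply (by simpa using hasTemperateGrowth_const_mul 1) g x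

theorem mulS_half (g : 𝓢(ℝ, ℂ)) (x : ℝ) :
    mulS (fun z : ℝ => -(I * (z : ℂ) / 2)) g x = -(I * x / 2) * g x := by
  refine mulS_apply ?_ g x
  convert hasTemperateGrowth_const_mul (-I / 2) using 2
  ring

theorem derivS_fourierS (g : 𝓢(ℝ, ℂ)) :
    derivS (fourierS g) = I • fourierS (mulS (fun z : ℝ => (z : ℂ)) g) := by
  ext x
  rw [SchwartzMap.derivCLM_apply]
  have h1 : (fourierS g : ℝ → ℂ) = fun z => (𝓕 (g : ℝ → ℂ)) (z * -(2 * Real.pi)⁻¹) := by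
    ext z
    rw [← SchwartzMap.fourier_coe]
    rfl
  have hi : Integrable fun x : ℝ => x • g x := by
    refine (mulS (fun z : ℝ => (z : ℂ)) g).integrable.congr (Eventually.of_forall fun x => ?_)
    simp only
    rw [mulS_ofReal, Complex.real_smul]
  have h2 := (Real.hasDerivAt_fourier g.integrable hi (x * -(2 * Real.pi)⁻¹)).scomp x
    ((hasDerivAt_id x).mul_const (-(2 * Real.pi)⁻¹))
  have h3 : deriv (fourierS g) x = (1 * -(2 * Real.pi)⁻¹) •
      𝓕 (fun x : ℝ => (-2 * Real.pi * I * x) • g x) (x * -(2 * Real.pi)⁻¹) := by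
    rw [h1]; exact h2.deriv
  rw [h3, Real.fourier_real_eq_integral_exp_smul, smul_apply, fourierS_apply,
    ← integral_smul, ← integral_smul]
  refine integral_congr_ae (Eventually.of_forall fun v => ?_)
  simp only [smul_eq_mul, Complex.real_smul]
  rw [mulS_ofReal]
  have hp : (Real.pi : ℂ) ≠ 0 := by exact_mod_cast Real.pi_ne_zero
  have he : Complex.exp (↑(-2 * Real.pi * v * (x * -(2 * Real.pi)⁻¹)) * I) =
      Complex.exp (I * x * v) := by
    congr 1; push_cast; field_simp
  rw [he]
  push_cast
  field_simp

theorem fourierS_mulS_half (g : 𝓢(ℝ, ℂ)) :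
    fourierS (mulS (fun z : ℝ => -(I * (z : ℂ) / 2)) g) =
      (-(1 / 2 : ℂ)) • derivS (fourierS g) := by
  have : mulS (fun z : ℝ => -(I * (z : ℂ) / 2)) g =
      (-(I / 2)) • mulS (fun z : ℝ => (z : ℂ)) g := by
    ext x
    rw [smul_apply, mulS_half, mulS_ofReal, smul_eq_mul]
    ring
  rw [this, map_smul, derivS_fourierS, smul_smul]
  congr 1
  ring

theorem derivS_fourierS_mulS_half (g : 𝓢(ℝ, ℂ)) :
    derivS (fourierS (mulS (fun z : ℝ => -(I * (z : ℂ) / 2)) g)) =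
      I • fourierS (mulS (fun z : ℝ => -(I * (z : ℂ) / 2))
        (mulS (fun z : ℝ => (z : ℂ)) g)) := by
  rw [derivS_fourierS]
  congr 2
  ext x
  rw [mulS_ofReal, mulS_half, mulS_half, mulS_ofReal]
  ring

/-- The tempered distribution given by a tempered function. -/
theorem IsTempered.exists_distribution {f : ℝ → ℂ} (hf : IsTempered f) :
    ∃ 𝒟 : TemperedDistribution ℝ ℂ, ∀ g : 𝓢(ℝ, ℂ), 𝒟 g = ∫ x, f x * g x := by
  have hi := hf.integrable_mul
  obtain ⟨N, hN⟩ := hf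
  refine ⟨ContinuousLinearMap.toPointwiseConvergenceCLM _ _ _ _
    (SchwartzMap.mkCLMtoNormedSpace (σ := RingHom.id ℂ) (𝕜 := ℂ) (fun g : 𝓢(ℝ, ℂ) => ∫ x, f x * g x)
    (fun g h => ?_) (fun a g => ?_) ⟨Finset.Iic (N, 0), (∫ x, ‖((1 + |x|) ^ N)⁻¹ • f x‖) * 2 ^ N,
      by positivity, fun g => ?_⟩), fun g => rfl⟩
  · rw [← integral_add (hi g) (hi h)]
    simp only [add_apply, mul_add]
  · simp only [smul_apply, smul_eq_mul, RingHom.id_apply]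
    rw [← integral_const_mul]
    simp_rw [mul_left_comm]
  · rw [mul_assoc, ← integral_mul_const]
    refine norm_integral_le_of_norm_le (hN.norm.mul_const _) (Eventually.of_forall fun x => ?_)
    have h1 := SchwartzMap.one_add_le_sup_seminorm_apply (𝕜 := ℂ) (m := (N, 0)) (k := N) (n := 0)
      le_rfl le_rfl g x
    rw [norm_iteratedFDeriv_zero, Real.norm_eq_abs] at h1
    have h2 : (0 : ℝ) < (1 + |x|) ^ N := by positivity
    rw [norm_mul, norm_smul, norm_inv, Real.norm_of_nonneg h2.le]
    calc ‖f x‖ * ‖g x‖ = ((1 + |x|) ^ N)⁻¹ * ‖f x‖ * ((1 + |x|) ^ N * ‖g x‖) := by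
          field_simp
      _ ≤ _ := mul_le_mul_of_nonneg_left h1 (by positivity)

/-! ### The part of a solution on `[t, ∞)` -/

/-- The square integrable part of the restriction of a solution to `[t, ∞)`. -/
def tailPart (u : ℝ → ℂ) (c : ℂ) (k : L2) (e : ℂ) (t : ℝ) (f : L2) : L2 :=
  (conj e * c) • (ind (Ioc (-t) t) - ind (Ioc t (-t))) + conj e • tr t k + K u f - f

theorem solFun_sub_ae {u : ℝ → ℂ} {c : ℂ} {k : L2} {e : ℂ} {t : ℝ} {f : L2} :
    ∀ᵐ x : ℝ, solFun u c k e t f x - f x - (Iio t).indicator (fun _ => e) x =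
      (Ici t).indicator (fun _ => e + conj e * c) x + tailPart u c k e t f x := by
  filter_upwards [Lp.coeFn_sub ((conj e * c) • (ind (Ioc (-t) t) - ind (Ioc t (-t))) +
      conj e • tr t k + K u f) f,
    Lp.coeFn_add ((conj e * c) • (ind (Ioc (-t) t) - ind (Ioc t (-t))) + conj e • tr t k) (K u f),
    Lp.coeFn_add ((conj e * c) • (ind (Ioc (-t) t) - ind (Ioc t (-t)))) (conj e • tr t k),
    Lp.coeFn_smul (conj e * c) (ind (Ioc (-t) t) - ind (Ioc t (-t))),
    Lp.coeFn_smul (conj e) (tr t k), Lp.coeFn_sub (ind (Ioc (-t) t)) (ind (Ioc t (-t))),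
    ind_Ioc_coe (-t) t, ind_Ioc_coe t (-t), Measure.ae_ne volume t, Measure.ae_ne volume (-t)]
    with x h1 h2 h3 h4 h5 h6 h7 h8 h9 h10
  rw [tailPart, h1, Pi.sub_apply, h2, Pi.add_apply, h3, Pi.add_apply, h4, Pi.smul_apply, h5,
    Pi.smul_apply, h6, Pi.sub_apply, h7, h8, solFun, kap]
  simp only [smul_eq_mul]
  rcases lt_or_gt_of_ne h9 with h | h <;> rcases lt_or_gt_of_ne h10 with h' | h' <;>
    simp [indicator, h, h', h.le, h'.le, h.not_gt, h'.not_gt, h.not_ge, h'.not_ge] <;> ring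

section
variable {u : ℝ → ℂ} {c : ℂ} {k : L2} {e : ℂ} {t : ℝ} {f : L2}

theorem IsPart.tail_ae (h : IsPart u c k e t f) :
    (∀ᵐ x : ℝ, x < t → tailPart u c k e t f x = 0) ∧
    ∀ᵐ x : ℝ, t ≤ x → solFun u c k e t f x = e + conj e * c + tailPart u c k e t f x := by
  have h0 : ∀ᵐ x : ℝ, t ≤ x → f x = 0 := by
    have := P_ae_zero t f
    rwa [h.P_eq] at this
  constructor
  · filter_upwards [solFun_sub_ae (u := u) (c := c) (k := k) (e := e) (t := t) (f := f), h.ae_eq]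
      with x h1 h2 hx
    rw [h2 hx, indicator_of_mem (show x ∈ Iio t from hx),
      indicator_of_notMem (show x ∉ Ici t from not_le.2 hx), zero_add] at h1
    rw [← h1]; ring
  · filter_upwards [solFun_sub_ae (u := u) (c := c) (k := k) (e := e) (t := t) (f := f), h0]
      with x h1 h2 hx
    rw [h2 hx, indicator_of_notMem (show x ∉ Iio t from not_lt.2 hx),
      indicator_of_mem (show x ∈ Ici t from hx), sub_zero, sub_zero] at h1
    exact h1

theorem IsPart.integral_tail (h : IsPart u c k e t f) (g : 𝓢(ℝ, ℂ)) :
    ∫ x in Ici t, solFun u c k e t f x * g x =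
      (e + conj e * c) * (∫ x in Ici t, g x) + ∫ x, tailPart u c k e t f x * g x := by
  rw [← integral_indicator_const_mul measurableSet_Ici, ← integral_add
    ((isTempered_indicator _ measurableSet_Ici _).integrable_mul g)
    ((isTempered_L2 _).integrable_mul g), ← integral_indicator measurableSet_Ici]
  refine integral_congr_ae ?_
  filter_upwards [h.tail_ae.1, h.tail_ae.2] with x h1 h2
  by_cases hx : t ≤ x
  · rw [indicator_of_mem (show x ∈ Ici t from hx), indicator_of_mem (show x ∈ Ici t from hx),
      h2 hx]
    ring
  · rw [indicator_of_notMem (show x ∉ Ici t from hx), indicator_of_notMem (show x ∉ Ici t from hx),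
      h1 (not_le.1 hx)]
    ring

theorem IsPart.integral_tail_eq_sub (h : IsPart u c k e t f) (g : 𝓢(ℝ, ℂ)) :
    ∫ x in Ici t, solFun u c k e t f x * g x = pairX u c k e t f g - pairP e t f g := by
  rw [pairX, pairP, ← integral_sub ((isTempered_solFun _ _ _ _ _ _).integrable_mul g)
    ((isTempered_pairP _ _ _).integrable_mul g), ← integral_indicator measurableSet_Ici]
  refine integral_congr_ae ?_
  have h0 : ∀ᵐ x : ℝ, t ≤ x → f x = 0 := by
    have := P_ae_zero t f
    rwa [h.P_eq] at this
  filter_upwards [h.ae_eq, h0] with x h1 h2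
  by_cases hx : t ≤ x
  · rw [indicator_of_mem (show x ∈ Ici t from hx),
      indicator_of_notMem (show x ∉ Iio t from not_lt.2 hx), h2 hx]
    ring
  · rw [indicator_of_notMem (show x ∉ Ici t from hx),
      indicator_of_mem (show x ∈ Iio t from not_le.1 hx), h1 (not_le.1 hx)]
    ring

/-- The boundary values on the real line of `-(iz/2) F(1 - P_t)X`. -/
def density (u : ℝ → ℂ) (c : ℂ) (k : L2) (e : ℂ) (t : ℝ) (f : L2) (x : ℝ) : ℂ :=
  (e + conj e * c) * Complex.exp (I * t * x) / 2 -
    I * x / 2 * FL (tailPart u c k e t f) x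

theorem IsTempered.ofReal_mul {f : ℝ → ℂ} (hf : IsTempered f) :
    IsTempered fun x => (x : ℂ) * f x := by
  obtain ⟨N, hN⟩ := hf
  refine ⟨N + 1, ?_⟩
  have : (fun x : ℝ => ((1 + |x|) ^ (N + 1))⁻¹ • ((x : ℂ) * f x)) =
      fun x => ((1 + |x|)⁻¹ * x) • (((1 + |x|) ^ N)⁻¹ • f x) := by
    ext x
    simp only [Complex.real_smul]
    rw [pow_succ, mul_inv]
    push_cast
    ring
  rw [this]
  have hm : Measurable fun x : ℝ => (1 + |x|)⁻¹ * x := by fun_prop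
  refine hN.norm.mono' (hm.aestronglyMeasurable.smul hN.1) (Eventually.of_forall fun x => ?_)
  rw [norm_smul]
  refine mul_le_of_le_one_left (norm_nonneg _) ?_
  rw [norm_mul, norm_inv, Real.norm_of_nonneg (by positivity : (0 : ℝ) ≤ 1 + |x|),
    Real.norm_eq_abs, inv_mul_le_one₀ (by positivity)]
  linarith

theorem norm_exp_I_mul_mul (t x : ℝ) : ‖Complex.exp (I * t * x)‖ = 1 :=
  norm_exp_real_mul_I (a := t * x) (by push_cast; ring)

theorem isTempered_exp (b : ℂ) (t : ℝ) :
    IsTempered fun x : ℝ => b * Complex.exp (I * t * x) := by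
  refine isTempered_of_bound (C := ‖b‖) (Continuous.aestronglyMeasurable (by fun_prop))
    (Eventually.of_forall fun x => ?_)
  rw [norm_mul, norm_exp_I_mul_mul, mul_one]

theorem isTempered_density : IsTempered (density u c k e t f) := by
  refine ((isTempered_exp ((e + conj e * c) / 2) t).add
    ((isTempered_L2 (FL (tailPart u c k e t f))).ofReal_mul.const_mul (-(I / 2)))).congr
    (Eventually.of_forall fun x => ?_)
  simp only [density]
  ring

theorem IsPart.integral_density (h : IsPart u c k e t f) (g : 𝓢(ℝ, ℂ)) :
    ∫ x in Ici t, solFun u c k e t f x *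
      fourierS (mulS (fun z : ℝ => -(I * (z : ℂ) / 2)) g) x =
      ∫ x, density u c k e t f x * g x := by
  rw [h.integral_tail, integral_mul_fourierS]
  have h1 : ∫ x in Ici t, fourierS (mulS (fun z : ℝ => -(I * (z : ℂ) / 2)) g) x =
      (1 / 2 : ℂ) * ∫ x : ℝ, g x * Complex.exp (I * t * x) := by
    rw [fourierS_mulS_half]
    simp only [smul_apply]
    rw [integral_smul, integral_Ici_eq_integral_Ioi, integral_Ioi_deriv, ← fourierS_apply,
      smul_eq_mul]
    ring
  rw [h1, ← integral_const_mul, ← integral_const_mul, ← integral_add]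
  · refine integral_congr_ae (Eventually.of_forall fun x => ?_)
    simp only
    rw [mulS_half, density]
    ring
  · refine ((isTempered_exp ((e + conj e * c) / 2) t).integrable_mul g).congr
      (Eventually.of_forall fun x => ?_)
    simp only
    ring
  · exact (isTempered_L2 _).integrable_mul _

theorem density_ae (hu : IsUnimodular u) (hk : IsKernelPart u c k) :
    ∀ᵐ x : ℝ, density u c k e t f x = u x * conj (density u c k e t f x) := by
  have hind : ∀ᵐ w : ℝ, (𝓕 (ind (Ioc (-t) t)) : L2) w - (𝓕 (ind (Ioc t (-t))) : L2) w =
      (Complex.exp (2 * Real.pi * t * w * I) -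
        Complex.exp (-(2 * Real.pi * t * w * I))) / (2 * Real.pi * I * w) := by
    have h0 : ∀ s : Set ℝ, s = ∅ → (𝓕 (ind s) : L2) =ᵐ[volume] fun _ => 0 := by
      rintro s rfl
      have : ind ∅ = 0 := by
        apply Lp.ext
        filter_upwards [ind_coe (s := ∅) MeasurableSet.empty (by simp), Lp.coeFn_zero ℂ 2 volume]
          with x h1 h2
        rw [h1, h2]; simp
      rw [this]
      have h : (𝓕 (0 : L2) : L2) = 0 := by
        have := fourier_sub' (0 : L2) 0
        rwa [sub_zero, sub_self] at this
      rw [h]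
      exact Lp.coeFn_zero ℂ 2 volume
    rcases le_total (-t) t with h | h
    · filter_upwards [fourier_ind_Ioc h, h0 (Ioc t (-t)) (Ioc_eq_empty (not_lt.2 h))] with w h1 h2
      rw [h1, h2, sub_zero]
      congr 3
      push_cast
      ring
    · filter_upwards [fourier_ind_Ioc h, h0 (Ioc (-t) t) (Ioc_eq_empty (not_lt.2 h))] with w h1 h2
      rw [h1, h2, zero_sub, ← neg_div, neg_sub]
      congr 3
      push_cast
      ring
  have hfour : ∀ᵐ w : ℝ, (𝓕 (tailPart u c k e t f) : L2) w =
      conj e * c * ((𝓕 (ind (Ioc (-t) t)) : L2) w - (𝓕 (ind (Ioc t (-t))) : L2) w) +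
      conj e * (Complex.exp (2 * Real.pi * t * w * I) *
        ((uw u w - c) / (2 * Real.pi * I * w))) +
      uw u w * conj ((𝓕 f : L2) w) - (𝓕 f : L2) w := by
    have e1 : (𝓕 (tailPart u c k e t f) : L2) = (conj e * c) • ((𝓕 (ind (Ioc (-t) t)) : L2) -
        𝓕 (ind (Ioc t (-t)))) + conj e • 𝓕 (tr t k) + 𝓕 (K u f) - 𝓕 f := by
      rw [tailPart, fourier_sub', FourierTransform.fourier_add, FourierTransform.fourier_add,
        FourierTransform.fourier_smul, FourierTransform.fourier_smul, fourier_sub']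
    rw [e1]
    filter_upwards [Lp.coeFn_sub ((conj e * c) • ((𝓕 (ind (Ioc (-t) t)) : L2) -
        𝓕 (ind (Ioc t (-t)))) + conj e • 𝓕 (tr t k) + 𝓕 (K u f)) (𝓕 f),
      Lp.coeFn_add ((conj e * c) • ((𝓕 (ind (Ioc (-t) t)) : L2) -
        𝓕 (ind (Ioc t (-t)))) + conj e • 𝓕 (tr t k)) (𝓕 (K u f)),
      Lp.coeFn_add ((conj e * c) • ((𝓕 (ind (Ioc (-t) t)) : L2) -
        𝓕 (ind (Ioc t (-t))))) (conj e • 𝓕 (tr t k)),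
      Lp.coeFn_smul (conj e * c) ((𝓕 (ind (Ioc (-t) t)) : L2) - 𝓕 (ind (Ioc t (-t)))),
      Lp.coeFn_smul (conj e) (𝓕 (tr t k) : L2),
      Lp.coeFn_sub (𝓕 (ind (Ioc (-t) t)) : L2) (𝓕 (ind (Ioc t (-t)))),
      fourier_tr t k, fourier_K hu f, hk] with w h1 h2 h3 h4 h5 h6 h7 h8 h9
    rw [h1, Pi.sub_apply, h2, Pi.add_apply, h3, Pi.add_apply, h4, Pi.smul_apply, h5, Pi.smul_apply,
      h6, Pi.sub_apply, h7, h8, h9]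
    rfl
  filter_upwards [FL_coe (tailPart u c k e t f), ae_comp_mul hind neg_two_pi_inv_ne,
    ae_comp_mul hfour neg_two_pi_inv_ne, Measure.ae_ne volume (0 : ℝ), hu.norm] with x h1 h2 h3 h4 h5
  have hx : (x : ℂ) ≠ 0 := by exact_mod_cast h4
  have hp : (Real.pi : ℂ) ≠ 0 := by exact_mod_cast Real.pi_ne_zero
  have hux : uw u (-(2 * Real.pi)⁻¹ * x) = u x := by
    rw [uw]
    congr 1
    have := Real.pi_ne_zero
    field_simp
  have hc : u x * conj (u x) = 1 := by
    rw [Complex.mul_conj, Complex.normSq_eq_norm_sq, h5]; simp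
  rw [h2, hux] at h3
  generalize (𝓕 f : L2) (-(2 * Real.pi)⁻¹ * x) = F at h3
  have ea : 2 * Real.pi * I * ((-(2 * Real.pi)⁻¹ * x : ℝ) : ℂ) = -(I * x) := by
    push_cast; field_simp
  have eb : 2 * Real.pi * t * ((-(2 * Real.pi)⁻¹ * x : ℝ) : ℂ) * I =
      -(I * t * x) := by
    push_cast; field_simp
  rw [ea, eb, neg_neg] at h3
  have hd : density u c k e t f x = (e * Complex.exp (I * t * x) +
      conj e * u x * Complex.exp (-(I * t * x))) / 2 -
      I * x / 2 * (u x * conj F - F) := by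
    rw [density, h1, h3]
    have hI : I ≠ 0 := Complex.I_ne_zero
    field_simp
    ring
  rw [hd]
  simp only [map_sub, map_mul, map_add, map_div₀, ← Complex.exp_conj, map_neg, Complex.conj_I,
    Complex.conj_ofReal, Complex.conj_conj, map_ofNat]
  rw [show -(-I * t * x : ℂ) = I * t * x by ring,
    show -I * t * x = -(I * t * x : ℂ) by ring]
  linear_combination (-(e * Complex.exp (I * t * x)) / 2 - I * x / 2 * F) * hc

end

/-! ### Poisson integrals and their non-tangential limits -/

/-- The Poisson kernel of the upper half-plane, without the factor `1/π`. -/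
def poissonK (z : ℂ) (r : ℝ) : ℝ := z.im / (z.im ^ 2 + (z.re - r) ^ 2)

/-- The Poisson integral. -/
def poissonI (F : ℝ → ℂ) (z : ℂ) : ℂ := (Real.pi : ℂ)⁻¹ * ∫ r, F r * (poissonK z r : ℂ)

theorem continuous_poissonK {z : ℂ} (hz : 0 < z.im) : Continuous (poissonK z) := by
  unfold poissonK
  refine continuous_const.div (by fun_prop) fun r => ?_
  positivity

theorem poissonK_nonneg {z : ℂ} (hz : 0 < z.im) (r : ℝ) : 0 ≤ poissonK z r := by
  unfold poissonK; positivity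

theorem poissonK_eq {z : ℂ} (hz : 0 < z.im) (r : ℝ) :
    poissonK z r = z.im⁻¹ * (1 + ((r - z.re) / z.im) ^ 2)⁻¹ := by
  unfold poissonK
  field_simp
  ring

theorem integrable_poissonK {z : ℂ} (hz : 0 < z.im) : Integrable (poissonK z) := by
  have h := (((integrable_inv_one_add_sq.comp_div hz.ne').comp_sub_right z.re)).const_mul z.im⁻¹
  exact h.congr (Eventually.of_forall fun r => (poissonK_eq hz r).symm)

theorem integral_poissonK {z : ℂ} (hz : 0 < z.im) : ∫ r, poissonK z r = Real.pi := by
  simp_rw [poissonK_eq hz]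
  rw [integral_const_mul, integral_sub_right_eq_self
    (fun r => (1 + (r / z.im) ^ 2)⁻¹) z.re, Measure.integral_comp_div
    (fun r => (1 + r ^ 2)⁻¹), integral_univ_inv_one_add_sq, abs_of_pos hz, smul_eq_mul, ← mul_assoc,
    inv_mul_cancel₀ hz.ne', one_mul]

/-- Integrability against `1 / (1 + r²)`. -/
def PoissonIntegrable (F : ℝ → ℂ) : Prop := Integrable fun r : ℝ => ((1 + r ^ 2)⁻¹ : ℝ) • F r

theorem PoissonIntegrable.aestronglyMeasurable {F : ℝ → ℂ} (hF : PoissonIntegrable F) :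
    AEStronglyMeasurable F volume := by
  have hc : Continuous fun r : ℝ => 1 + r ^ 2 := by fun_prop
  refine (hc.aestronglyMeasurable.smul hF.1).congr (Eventually.of_forall fun r => ?_)
  have : (1 + r ^ 2 : ℝ) ≠ 0 := by positivity
  simp only [Pi.smul_apply', smul_smul, mul_inv_cancel₀ this, one_smul]

theorem PoissonIntegrable.sub_const {F : ℝ → ℂ} (hF : PoissonIntegrable F) (b : ℂ) :
    PoissonIntegrable fun r => F r - b := by
  refine (Integrable.sub hF (integrable_inv_one_add_sq.smul_const b)).congr
    (Eventually.of_forall fun r => ?_)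
  simp only [Pi.sub_apply, smul_sub]

theorem poissonK_le {z : ℂ} (hz : 0 < z.im) :
    ∃ C : ℝ, 0 ≤ C ∧ ∀ r : ℝ, poissonK z r ≤ C * (1 + r ^ 2)⁻¹ := by
  refine ⟨z.im⁻¹ * (1 + 2 * z.re ^ 2) + 2 * z.im, by positivity, fun r => ?_⟩
  unfold poissonK
  rw [← div_eq_mul_inv, div_le_div_iff₀ (by positivity) (by positivity)]
  have h1 : z.im = z.im⁻¹ * z.im ^ 2 := by field_simp
  have h2 : r ^ 2 ≤ 2 * (z.re - r) ^ 2 + 2 * z.re ^ 2 := by nlinarith [sq_nonneg (r - 2 * z.re)]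
  have h3 : 0 ≤ z.im⁻¹ * ((1 + 2 * z.re ^ 2) * (z.re - r) ^ 2) := by positivity
  have h4 : 0 ≤ z.im * z.im ^ 2 := by positivity
  have h5 : z.im * r ^ 2 ≤ z.im * (2 * (z.re - r) ^ 2 + 2 * z.re ^ 2) := by gcongr
  have h6 : z.im⁻¹ * (1 + 2 * z.re ^ 2) * z.im ^ 2 = z.im * (1 + 2 * z.re ^ 2) := by
    field_simp
  nlinarith

theorem PoissonIntegrable.integrable_mul {F : ℝ → ℂ} (hF : PoissonIntegrable F) {z : ℂ}
    (hz : 0 < z.im) : Integrable fun r => F r * (poissonK z r : ℂ) := by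
  obtain ⟨C, hC, h⟩ := poissonK_le hz
  refine (hF.norm.const_mul C).mono' (hF.aestronglyMeasurable.mul
    (Complex.continuous_ofReal.comp (continuous_poissonK hz)).aestronglyMeasurable)
    (Eventually.of_forall fun r => ?_)
  rw [norm_mul, norm_smul, Complex.norm_real, Real.norm_of_nonneg (poissonK_nonneg hz r),
    Real.norm_of_nonneg (by positivity : (0 : ℝ) ≤ (1 + r ^ 2)⁻¹), mul_comm, ← mul_assoc]
  exact mul_le_mul_of_nonneg_right (h r) (norm_nonneg _)

/-- `x` is a Lebesgue point of `F`. -/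
def IsLebesguePt (F : ℝ → ℂ) (x : ℝ) : Prop :=
  ∀ η : ℝ, 0 < η → ∃ δ : ℝ, 0 < δ ∧ ∀ ρ : ℝ, 0 < ρ → ρ ≤ δ →
    ∫⁻ r in closedBall x ρ, ‖F r - F x‖ₑ ≤ ENNReal.ofReal (η * ρ)

theorem ae_isLebesguePt {F : ℝ → ℂ} (hF : LocallyIntegrable F) : ∀ᵐ x : ℝ, IsLebesguePt F x := by
  filter_upwards [IsUnifLocDoublingMeasure.ae_tendsto_average_norm_sub (μ := volume) hF 1]
    with x hx η hη
  have h := hx (l := 𝓝[>] (0 : ℝ)) (fun _ => x) id tendsto_id (by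
    filter_upwards [self_mem_nhdsWithin] with ρ hρ
    exact Metric.mem_closedBall_self (by simpa using (le_of_lt hρ : (0 : ℝ) ≤ ρ)))
  have h2 := h.eventually (gt_mem_nhds (half_pos hη))
  rw [eventually_nhdsWithin_iff, Metric.eventually_nhds_iff] at h2
  obtain ⟨δ, hδ, h3⟩ := h2
  refine ⟨δ / 2, by positivity, fun ρ hρ hρδ => ?_⟩
  have h4 := h3 (y := ρ) (by rw [dist_zero_right, Real.norm_of_nonneg hρ.le]; linarith) hρ
  rw [id, setAverage_eq, Measure.real, Real.volume_closedBall, ENNReal.toReal_ofReal (by positivity),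
    smul_eq_mul, inv_mul_lt_iff₀ (by positivity)] at h4
  have hInt : IntegrableOn (fun r => F r - F x) (closedBall x ρ) :=
    (hF.integrableOn_isCompact (isCompact_closedBall x ρ)).sub
      (integrableOn_const measure_closedBall_lt_top.ne)
  have h5 := ofReal_integral_norm_eq_lintegral_enorm hInt
  rw [← h5]
  exact ENNReal.ofReal_le_ofReal (by linarith)

theorem poissonK_le_tsum {y σ : ℝ} (hy : 0 < y) :
    ENNReal.ofReal (y / (y ^ 2 + σ ^ 2)) ≤
      ∑' n : ℕ, if |σ| ≤ 2 ^ (n + 1) * y then ENNReal.ofReal ((4 ^ n * y)⁻¹) else 0 := by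
  obtain ⟨n, h1, h2⟩ : ∃ n : ℕ, |σ| ≤ 2 ^ (n + 1) * y ∧ (n = 0 ∨ 2 ^ n * y ≤ |σ|) := by
    rcases le_total |σ| y with h | h
    · exact ⟨0, by rw [zero_add, pow_one]; linarith, Or.inl rfl⟩
    · obtain ⟨n, h1, h2⟩ := exists_nat_pow_near (x := |σ| / y) (y := (2 : ℝ))
        (by rwa [le_div_iff₀ hy, one_mul]) (by norm_num)
      rw [le_div_iff₀ hy] at h1
      rw [div_lt_iff₀ hy] at h2
      exact ⟨n, h2.le, Or.inr h1⟩
  refine le_trans ?_ (ENNReal.le_tsum n)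
  rw [if_pos h1]
  apply ENNReal.ofReal_le_ofReal
  rw [div_le_iff₀ (by positivity), inv_mul_eq_div, le_div_iff₀ (by positivity)]
  rcases h2 with rfl | h2
  · simp; nlinarith [sq_nonneg σ]
  · have h3 : (2 ^ n * y) ^ 2 ≤ σ ^ 2 := by
      rw [← sq_abs σ]; gcongr
    have h4 : ((4 : ℝ) ^ n) = (2 ^ n) ^ 2 := by rw [← pow_mul, mul_comm, pow_mul]; norm_num
    rw [h4]
    nlinarith [sq_nonneg y]

theorem lintegral_poisson_le {G : ℝ → ENNReal} (hG : AEMeasurable G volume) {x η δ : ℝ} (hη : 0 ≤ η)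
    (hδ : 0 < δ) (h : ∀ ρ : ℝ, 0 < ρ → ρ ≤ δ →
      ∫⁻ r in closedBall x ρ, G r ≤ ENNReal.ofReal (η * ρ)) {y : ℝ} (hy : 0 < y) :
    ∫⁻ r in closedBall x δ, G r * ENNReal.ofReal (y / (y ^ 2 + (r - x) ^ 2)) ≤
      ENNReal.ofReal (4 * η) := by
  have h1 : ∀ r, G r * ENNReal.ofReal (y / (y ^ 2 + (r - x) ^ 2)) ≤
      ∑' n : ℕ, ENNReal.ofReal ((4 ^ n * y)⁻¹) *
        (closedBall x (2 ^ (n + 1) * y)).indicator G r := fun r => by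
    refine (mul_le_mul_right (poissonK_le_tsum (σ := r - x) hy) (G r)).trans ?_
    rw [← ENNReal.tsum_mul_left]
    refine ENNReal.tsum_le_tsum fun n => ?_
    by_cases hr : |r - x| ≤ 2 ^ (n + 1) * y
    · rw [if_pos hr, indicator_of_mem (by rwa [Metric.mem_closedBall, Real.dist_eq]), mul_comm]
    · rw [if_neg hr, mul_zero]; exact zero_le
  refine (lintegral_mono h1).trans ?_
  rw [lintegral_tsum fun n => ((hG.indicator Metric.isClosed_closedBall.measurableSet).const_mul
    _).restrict]
  have h2 : ∀ n : ℕ, ∫⁻ r in closedBall x δ, ENNReal.ofReal ((4 ^ n * y)⁻¹) *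
      (closedBall x (2 ^ (n + 1) * y)).indicator G r ≤
      ENNReal.ofReal (2 * η * (1 / 2) ^ n) := fun n => by
    rw [lintegral_const_mul' _ _ ENNReal.ofReal_ne_top, ← lintegral_indicator
      Metric.isClosed_closedBall.measurableSet, indicator_indicator,
      lintegral_indicator (Metric.isClosed_closedBall.measurableSet.inter
        Metric.isClosed_closedBall.measurableSet)]
    have h3 : ∫⁻ r in closedBall x δ ∩ closedBall x (2 ^ (n + 1) * y), G r ≤
        ENNReal.ofReal (η * (2 ^ (n + 1) * y)) := by
      refine (lintegral_mono_set (t := closedBall x (min δ (2 ^ (n + 1) * y)))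
        fun r hr => ?_).trans ((h _ (lt_min hδ (by positivity)) (min_le_left _ _)).trans
        (ENNReal.ofReal_le_ofReal (by gcongr; exact min_le_right _ _)))
      rw [Metric.mem_closedBall]
      exact le_min hr.1 hr.2
    refine (mul_le_mul_right h3 _).trans ?_
    rw [← ENNReal.ofReal_mul (by positivity)]
    apply ENNReal.ofReal_le_ofReal
    apply le_of_eq
    have : (4 : ℝ) ^ n = 2 ^ n * 2 ^ n := by rw [← mul_pow]; norm_num
    rw [this, one_div, inv_pow, pow_succ]
    field_simp
  refine (ENNReal.tsum_le_tsum h2).trans ?_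
  rw [← ENNReal.ofReal_tsum_of_nonneg (fun n => by positivity)
    (summable_geometric_two.mul_left _), tsum_mul_left, tsum_geometric_two]
  exact ENNReal.ofReal_le_ofReal (by linarith)

theorem lintegral_poisson_tail_le {F : ℝ → ℂ} (hF : PoissonIntegrable F) (x : ℝ) {δ : ℝ}
    (hδ : 0 < δ) : ∃ C : ℝ, 0 ≤ C ∧ ∀ y : ℝ, 0 < y →
      ∫⁻ r in (closedBall x δ)ᶜ, ‖F r‖ₑ * ENNReal.ofReal (y / (y ^ 2 + (r - x) ^ 2)) ≤
        ENNReal.ofReal (C * y) := by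
  set B : ℝ := (1 + 2 * x ^ 2) / δ ^ 2 + 2
  refine ⟨B * ∫ r, ‖((1 + r ^ 2)⁻¹ : ℝ) • F r‖, by positivity, fun y hy => ?_⟩
  have h1 : ∀ r ∈ (closedBall x δ)ᶜ, ‖F r‖ₑ * ENNReal.ofReal (y / (y ^ 2 + (r - x) ^ 2)) ≤
      ENNReal.ofReal (B * y) * ‖((1 + r ^ 2)⁻¹ : ℝ) • F r‖ₑ := fun r hr => by
    rw [mem_compl_iff, Metric.mem_closedBall, Real.dist_eq, not_le] at hr
    rw [← ofReal_norm, ← ofReal_norm, ← ENNReal.ofReal_mul (norm_nonneg _),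
      ← ENNReal.ofReal_mul (by positivity), norm_smul,
      Real.norm_of_nonneg (by positivity : (0 : ℝ) ≤ (1 + r ^ 2)⁻¹)]
    apply ENNReal.ofReal_le_ofReal
    have h2 : δ ^ 2 ≤ (r - x) ^ 2 := by rw [← sq_abs (r - x)]; gcongr
    have h3 : 1 + r ^ 2 ≤ B * (r - x) ^ 2 := by
      have h4 : (1 + 2 * x ^ 2) ≤ (1 + 2 * x ^ 2) / δ ^ 2 * (r - x) ^ 2 := by
        rw [div_mul_eq_mul_div, le_div_iff₀ (by positivity)]
        gcongr
      nlinarith [sq_nonneg (r - 2 * x)]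
    have h5 : 0 < (r - x) ^ 2 := lt_of_lt_of_le (by positivity) h2
    have h6 : y / (y ^ 2 + (r - x) ^ 2) ≤ B * y * (1 + r ^ 2)⁻¹ := by
      rw [← div_eq_mul_inv, div_le_div_iff₀ (by positivity) (by positivity)]
      have : 0 ≤ B * y * y ^ 2 := by positivity
      nlinarith
    calc ‖F r‖ * (y / (y ^ 2 + (r - x) ^ 2)) ≤ ‖F r‖ * (B * y * (1 + r ^ 2)⁻¹) := by gcongr
      _ = _ := by ring
  refine (setLIntegral_mono' Metric.isClosed_closedBall.measurableSet.compl h1).trans ?_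
  refine (setLIntegral_le_lintegral _ _).trans ?_
  rw [lintegral_const_mul' _ _ ENNReal.ofReal_ne_top, ← ofReal_integral_norm_eq_lintegral_enorm hF,
    ← ENNReal.ofReal_mul (by positivity)]
  exact ENNReal.ofReal_le_ofReal (le_of_eq (by ring))

theorem poissonI_sub_const {F : ℝ → ℂ} (hF : PoissonIntegrable F) (b : ℂ) {z : ℂ} (hz : 0 < z.im) :
    poissonI F z - b = poissonI (fun r => F r - b) z := by
  unfold poissonI
  have hi : Integrable fun r => b * (poissonK z r : ℂ) := (integrable_poissonK hz).ofReal.const_mul b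
  simp_rw [sub_mul]
  rw [integral_sub (hF.integrable_mul hz) hi, integral_const_mul, integral_complex_ofReal,
    integral_poissonK hz, mul_sub, mul_comm b, ← mul_assoc,
    inv_mul_cancel₀ (by exact_mod_cast Real.pi_ne_zero), one_mul]

theorem poissonK_le_of_cone {z : ℂ} {x M : ℝ} (hz : 0 < z.im) (h : |z.re - x| ≤ M * z.im) (r : ℝ) :
    poissonK z r ≤ (2 + 2 * M ^ 2) * (z.im / (z.im ^ 2 + (r - x) ^ 2)) := by
  unfold poissonK
  rw [← mul_div_assoc, div_le_div_iff₀ (by positivity) (by positivity)]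
  have h1 : (z.re - x) ^ 2 ≤ M ^ 2 * z.im ^ 2 := by
    rw [← sq_abs, ← mul_pow]; gcongr
  have h2 : (r - x) ^ 2 ≤ 2 * (z.re - r) ^ 2 + 2 * (z.re - x) ^ 2 := by
    nlinarith [sq_nonneg (2 * z.re - r - x)]
  have h3 : z.im ^ 2 + (r - x) ^ 2 ≤ (2 + 2 * M ^ 2) * (z.im ^ 2 + (z.re - r) ^ 2) := by
    nlinarith [mul_nonneg (sq_nonneg M) (sq_nonneg (z.re - r)), sq_nonneg z.im]
  calc z.im * (z.im ^ 2 + (r - x) ^ 2) ≤ z.im * ((2 + 2 * M ^ 2) * (z.im ^ 2 + (z.re - r) ^ 2)) := by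
        gcongr
    _ = _ := by ring

/-- **Fatou's theorem** for Poisson integrals at a Lebesgue point. -/
theorem tendsto_poissonI {F : ℝ → ℂ} (hF : PoissonIntegrable F) {x : ℝ} (hx : IsLebesguePt F x)
    {M : ℝ} (hM : 0 < M) :
    Tendsto (poissonI F) (𝓝[{w : ℂ | 0 < w.im ∧ |w.re - x| < M * w.im}] (x : ℂ)) (𝓝 (F x)) := by
  rw [Metric.tendsto_nhds]
  intro ε hε
  obtain ⟨C, hCM⟩ : ∃ C : ℝ, C = 2 + 2 * M ^ 2 := ⟨_, rfl⟩
  have hC : 0 < C := by rw [hCM]; positivity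
  obtain ⟨δ, hδ, h1⟩ := hx (ε / (16 * C)) (by positivity)
  obtain ⟨B, hB, h2⟩ := lintegral_poisson_tail_le (hF.sub_const (F x)) x hδ
  have hsmall : ∀ᶠ w : ℂ in 𝓝[{w : ℂ | 0 < w.im ∧ |w.re - x| < M * w.im}] (x : ℂ),
      w.im < ε / (4 * C * (B + 1)) := by
    have : ContinuousAt Complex.im (x : ℂ) := Complex.continuous_im.continuousAt
    exact nhdsWithin_le_nhds (this.eventually (gt_mem_nhds (by
      rw [Complex.ofReal_im]; positivity)))
  filter_upwards [hsmall, self_mem_nhdsWithin] with z hz1 ⟨hz2, hz3⟩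
  rw [dist_eq_norm, poissonI_sub_const hF _ hz2, poissonI, norm_mul, norm_inv, Complex.norm_real,
    Real.norm_of_nonneg Real.pi_pos.le]
  have h3 : ‖∫ r, (F r - F x) * (poissonK z r : ℂ)‖ₑ ≤
      ENNReal.ofReal (C * (4 * (ε / (16 * C)) + B * z.im)) := by
    refine (enorm_integral_le_lintegral_enorm _).trans ?_
    have h4 : ∀ r, ‖(F r - F x) * (poissonK z r : ℂ)‖ₑ ≤ ENNReal.ofReal C *
        (‖F r - F x‖ₑ * ENNReal.ofReal (z.im / (z.im ^ 2 + (r - x) ^ 2))) := fun r => by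
      rw [enorm_mul, mul_left_comm, ← ENNReal.ofReal_mul hC.le]
      gcongr
      rw [← ofReal_norm, Complex.norm_real, Real.norm_of_nonneg (poissonK_nonneg hz2 r)]
      exact ENNReal.ofReal_le_ofReal (hCM ▸ poissonK_le_of_cone hz2 hz3.le r)
    refine (lintegral_mono h4).trans ?_
    rw [lintegral_const_mul' _ _ ENNReal.ofReal_ne_top, ENNReal.ofReal_mul hC.le,
      ENNReal.ofReal_add (by positivity) (by positivity),
      ← lintegral_add_compl _ (Metric.isClosed_closedBall (x := x) (ε := δ)).measurableSet]
    refine mul_le_mul_right (add_le_add ?_ (h2 _ hz2)) _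
    exact lintegral_poisson_le (hF.sub_const (F x)).aestronglyMeasurable.enorm (by positivity) hδ h1
      hz2
  rw [← ofReal_norm, ENNReal.ofReal_le_ofReal_iff (by positivity)] at h3
  have h5 : C * (4 * (ε / (16 * C)) + B * z.im) < ε := by
    have : C * (B * z.im) ≤ ε / 4 := by
      rw [lt_div_iff₀ (by positivity)] at hz1
      nlinarith [mul_nonneg hC.le hz2.le]
    have h6 : C * (4 * (ε / (16 * C))) = ε / 4 := by field_simp; norm_num
    linarith
  have h7 : Real.pi⁻¹ ≤ 1 := inv_le_one_of_one_le₀ (by linarith [Real.pi_gt_three])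
  calc Real.pi⁻¹ * ‖∫ r, (F r - F x) * (poissonK z r : ℂ)‖
      ≤ 1 * ‖∫ r, (F r - F x) * (poissonK z r : ℂ)‖ := by gcongr
    _ < ε := by rw [one_mul]; exact h3.trans_lt h5

theorem poissonIntegrable_L2 (f : L2) : PoissonIntegrable f := by
  have hc : MemLp (fun r : ℝ => (((1 + r ^ 2)⁻¹ : ℝ) : ℂ)) 2 (volume : Measure ℝ) := by
    have hcont : Continuous fun r : ℝ => (((1 + r ^ 2)⁻¹ : ℝ) : ℂ) :=
      Complex.continuous_ofReal.comp
        ((by fun_prop : Continuous fun r : ℝ => 1 + r ^ 2).inv₀ fun r => by positivity)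
    rw [memLp_two_iff_integrable_sq_norm hcont.aestronglyMeasurable]
    refine integrable_inv_one_add_sq.mono' (by fun_prop) (Eventually.of_forall fun r => ?_)
    rw [Complex.norm_real, norm_pow, norm_norm, Real.norm_of_nonneg (by positivity), sq]
    refine mul_le_of_le_one_left (by positivity) (inv_le_one_of_one_le₀ (by nlinarith [sq_nonneg r]))
  exact (integrable_mul_L2 hc (memLp_coe f)).congr (Eventually.of_forall fun r => by simp)

/-! ### Transforms of functions on a half-line -/

/-- The function `e^{izx}` on `[0, ∞)`. -/
def lk (z : ℂ) (x : ℝ) : ℂ := (Ici (0 : ℝ)).indicator (fun x : ℝ => Complex.exp (I * z * x)) x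

theorem norm_exp_I_mul (z : ℂ) (x : ℝ) :
    ‖Complex.exp (I * z * x)‖ = Real.exp (-z.im * x) := by
  rw [Complex.norm_exp]
  simp

theorem norm_lk (z : ℂ) (x : ℝ) :
    ‖lk z x‖ = (Ici (0 : ℝ)).indicator (fun x => Real.exp (-z.im * x)) x := by
  rw [lk, norm_indicator_eq_indicator_norm]
  simp_rw [norm_exp_I_mul]

theorem measurable_lk (z : ℂ) : Measurable (lk z) := by
  unfold lk
  exact Measurable.indicator (by fun_prop) measurableSet_Ici

theorem norm_lk_sq (z : ℂ) (x : ℝ) :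
    ‖lk z x‖ ^ 2 = (Ici (0 : ℝ)).indicator (fun x => Real.exp (-(2 * z.im) * x)) x := by
  rw [norm_lk]
  by_cases hx : x ∈ Ici (0 : ℝ)
  · rw [indicator_of_mem hx, indicator_of_mem hx, ← Real.exp_nat_mul]
    congr 1
    push_cast
    ring
  · rw [indicator_of_notMem hx, indicator_of_notMem hx]
    norm_num

theorem memLp_lk {z : ℂ} (hz : 0 < z.im) : MemLp (lk z) 2 (volume : Measure ℝ) := by
  rw [memLp_two_iff_integrable_sq_norm (measurable_lk z).aestronglyMeasurable]
  simp_rw [norm_lk_sq]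
  rw [integrable_indicator_iff measurableSet_Ici, integrableOn_Ici_iff_integrableOn_Ioi]
  exact integrableOn_exp_mul_Ioi (by linarith) 0

theorem norm_toL2_lk_sq {z : ℂ} (hz : 0 < z.im) : ‖toL2 (lk z)‖ ^ 2 = (2 * z.im)⁻¹ := by
  rw [norm_sq_eq_integral, integral_congr_ae (g := fun x => ‖lk z x‖ ^ 2)
    (by filter_upwards [coeFn_toL2 (memLp_lk hz)] with x hx; rw [hx])]
  simp_rw [norm_lk_sq]
  rw [integral_indicator measurableSet_Ici, integral_Ici_eq_integral_Ioi,
    integral_exp_mul_Ioi (by linarith)]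
  simp only [mul_zero, Real.exp_zero]
  field_simp

/-- The transform `∫_0^∞ m(x) e^{izx} dx`. -/
def LT (m : L2) (z : ℂ) : ℂ := ∫ x, m x * lk z x

theorem integrable_mul_lk (m : L2) {z : ℂ} (hz : 0 < z.im) : Integrable fun x => m x * lk z x :=
  integrable_mul_L2 (memLp_coe m) (memLp_lk hz)

theorem norm_LT_sq_le (m : L2) {z : ℂ} (hz : 0 < z.im) : ‖LT m z‖ ^ 2 ≤ ‖m‖ ^ 2 * (2 * z.im)⁻¹ := by
  rw [← norm_toL2_lk_sq hz, ← mul_pow]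
  gcongr
  exact norm_integral_mul_le m _ (memLp_lk hz)

theorem differentiableAt_LT (m : L2) {z : ℂ} (hz : 0 < z.im) : DifferentiableAt ℂ (LT m) z := by
  have hy : 0 < (I * ((z.im / 4 : ℝ) : ℂ)).im := by
    simpa using hz
  have hF' : Measurable fun x : ℝ => I * x * lk z x :=
    Measurable.mul (by fun_prop) (measurable_lk z)
  have hd : ∀ w : ℂ, ∀ x : ℝ, HasDerivAt (fun w => lk w x) (I * x * lk w x) w := by
    intro w x
    by_cases hx : x ∈ Ici (0 : ℝ)
    · simp only [lk, indicator_of_mem hx]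
      have h1 : HasDerivAt (fun w : ℂ => I * w * x) (I * x) w := by
        simpa using ((hasDerivAt_id w).const_mul I).mul_const (x : ℂ)
      have h2 := h1.cexp
      rwa [mul_comm] at h2
    · simp only [lk, indicator_of_notMem hx, mul_zero]
      exact hasDerivAt_const _ _
  have h := hasDerivAt_integral_of_dominated_loc_of_deriv_le (μ := volume) (𝕜 := ℂ)
    (F := fun w x => m x * lk w x) (F' := fun w x => m x * (I * x * lk w x)) (x₀ := z)
    (s := ball z (z.im / 2))
    (bound := fun x => ‖m x * lk (I * ((z.im / 4 : ℝ) : ℂ)) x‖ * (4 / z.im))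
    (Metric.ball_mem_nhds z (by positivity))
    (Eventually.of_forall fun w => (memLp_coe m).1.mul (measurable_lk w).aestronglyMeasurable)
    (integrable_mul_lk m hz) ((memLp_coe m).1.mul hF'.aestronglyMeasurable)
    (Eventually.of_forall fun x w hw => ?_) ((integrable_mul_lk m hy).norm.mul_const _)
    (Eventually.of_forall fun x w _ => (hd w x).const_mul (m x))
  · exact h.2.differentiableAt
  · rw [norm_mul, norm_mul (m x) (lk _ x), mul_assoc ‖m x‖]
    refine mul_le_mul_of_nonneg_left ?_ (norm_nonneg _)
    rw [norm_mul, norm_mul, Complex.norm_I, one_mul, Complex.norm_real, Real.norm_eq_abs, norm_lk,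
      norm_lk]
    by_cases hx : x ∈ Ici (0 : ℝ)
    · have hx0 : 0 ≤ x := hx
      rw [indicator_of_mem hx, indicator_of_mem hx, abs_of_nonneg hx0]
      have h1 : z.im / 2 ≤ w.im := by
        have := (Complex.abs_im_le_norm (w - z)).trans (mem_ball_iff_norm.1 hw).le
        rw [Complex.sub_im, abs_le] at this
        linarith [this.1]
      have h2 : x * (z.im / 4) ≤ Real.exp (x * (z.im / 4)) := by
        linarith [Real.add_one_le_exp (x * (z.im / 4))]
      have h3 : x ≤ 4 / z.im * Real.exp (x * (z.im / 4)) := by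
        rw [div_mul_eq_mul_div, le_div_iff₀ hz]
        linarith
      have h4 : Real.exp (-w.im * x) ≤ Real.exp (-(z.im / 2) * x) := by
        rw [Real.exp_le_exp]
        nlinarith
      calc x * Real.exp (-w.im * x)
          ≤ 4 / z.im * Real.exp (x * (z.im / 4)) * Real.exp (-(z.im / 2) * x) := by gcongr
        _ = Real.exp (-(I * ((z.im / 4 : ℝ) : ℂ)).im * x) * (4 / z.im) := by
          rw [mul_assoc, ← Real.exp_add, mul_comm]
          congr 2
          simp
          ring
    · rw [indicator_of_notMem hx, indicator_of_notMem hx]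
      simp

/-- `m` vanishes on the negative half-line. -/
def IsCausal (m : L2) : Prop := ∀ᵐ x : ℝ, x < 0 → m x = 0

/-- The function `e^{-y|x| + isx}`, with `z = s + iy`. -/
def expAbs (z : ℂ) (x : ℝ) : ℂ := Complex.exp (((-(z.im * |x|) : ℝ) : ℂ) + I * z.re * x)

theorem norm_expAbs (z : ℂ) (x : ℝ) : ‖expAbs z x‖ = Real.exp (-(z.im * |x|)) := by
  rw [expAbs, Complex.norm_exp]
  simp

theorem continuous_expAbs (z : ℂ) : Continuous (expAbs z) := by
  unfold expAbs
  fun_prop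

theorem integrable_exp_neg_abs {y : ℝ} (hy : 0 < y) : Integrable fun x : ℝ => Real.exp (-(y * |x|)) := by
  rw [← integrableOn_univ, ← Iic_union_Ioi (a := (0 : ℝ)), integrableOn_union]
  constructor
  · refine (integrableOn_exp_mul_Iic hy 0).congr_fun (fun x hx => ?_) measurableSet_Iic
    simp only [abs_of_nonpos (show x ≤ 0 from hx)]
    congr 1; ring
  · refine (integrableOn_exp_mul_Ioi (a := -y) (by linarith) 0).congr_fun (fun x hx => ?_)
      measurableSet_Ioi
    simp only [abs_of_pos (show 0 < x from hx)]
    congr 1; ring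

theorem integrable_expAbs {z : ℂ} (hz : 0 < z.im) : Integrable (expAbs z) := by
  refine (integrable_exp_neg_abs hz).mono' (continuous_expAbs z).aestronglyMeasurable
    (Eventually.of_forall fun x => (norm_expAbs z x).le)

theorem memLp_expAbs {z : ℂ} (hz : 0 < z.im) : MemLp (expAbs z) 2 (volume : Measure ℝ) := by
  rw [memLp_two_iff_integrable_sq_norm (continuous_expAbs z).aestronglyMeasurable]
  refine (integrable_exp_neg_abs (y := 2 * z.im) (by linarith)).congr
    (Eventually.of_forall fun x => ?_)
  simp only [norm_expAbs]
  rw [← Real.exp_nat_mul]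
  congr 1
  push_cast
  ring

theorem IsCausal.LT_eq {m : L2} (hm : IsCausal m) (z : ℂ) : LT m z = ∫ x, m x * expAbs z x := by
  refine integral_congr_ae ?_
  filter_upwards [hm] with x hx
  rcases lt_or_ge x 0 with h | h
  · rw [hx h, zero_mul, zero_mul]
  · rw [lk, indicator_of_mem (show x ∈ Ici (0 : ℝ) from h), expAbs, abs_of_nonneg h]
    congr 2
    apply Complex.ext <;> simp

theorem fourier_conj_expAbs {z : ℂ} (hz : 0 < z.im) (w : ℝ) :
    (𝓕 fun x : ℝ => conj (expAbs z x)) w = ((2 * poissonK z (-(2 * Real.pi * w)) : ℝ) : ℂ) := by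
  rw [Real.fourier_real_eq_integral_exp_smul]
  obtain ⟨ξ, hξ⟩ : ∃ ξ : ℝ, ξ = z.re + 2 * Real.pi * w := ⟨_, rfl⟩
  have h1 : ∀ x : ℝ, Complex.exp (↑(-2 * Real.pi * x * w) * I) • conj (expAbs z x) =
      Complex.exp (((-(z.im * |x|) : ℝ) : ℂ) - I * ξ * x) := fun x => by
    rw [expAbs, ← Complex.exp_conj, smul_eq_mul, ← Complex.exp_add]
    congr 1
    simp only [map_add, map_mul, Complex.conj_ofReal, Complex.conj_I, hξ]
    push_cast
    ring
  simp_rw [h1]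
  have e1 : ∀ x ∈ Iic (0 : ℝ), Complex.exp (((-(z.im * |x|) : ℝ) : ℂ) - I * ξ * x) =
      Complex.exp (((z.im : ℂ) - I * ξ) * x) := fun x hx => by
    rw [abs_of_nonpos hx]; congr 1; push_cast; ring
  have e2 : ∀ x ∈ Ioi (0 : ℝ), Complex.exp (((-(z.im * |x|) : ℝ) : ℂ) - I * ξ * x) =
      Complex.exp ((-(z.im : ℂ) - I * ξ) * x) := fun x hx => by
    rw [abs_of_pos hx]; congr 1; push_cast; ring
  have r1 : 0 < ((z.im : ℂ) - I * ξ).re := by simpa using hz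
  have r2 : (-(z.im : ℂ) - I * ξ).re < 0 := by simpa using hz
  have i1 : IntegrableOn (fun x : ℝ => Complex.exp (((-(z.im * |x|) : ℝ) : ℂ) - I * ξ * x))
      (Iic 0) :=
    (integrableOn_exp_mul_complex_Iic r1 0).congr_fun (fun x hx => (e1 x hx).symm) measurableSet_Iic
  have i2 : IntegrableOn (fun x : ℝ => Complex.exp (((-(z.im * |x|) : ℝ) : ℂ) - I * ξ * x))
      (Ioi 0) :=
    (integrableOn_exp_mul_complex_Ioi r2 0).congr_fun (fun x hx => (e2 x hx).symm) measurableSet_Ioi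
  rw [← setIntegral_univ, ← Iic_union_Ioi (a := (0 : ℝ)),
    setIntegral_union (Iic_disjoint_Ioi le_rfl) measurableSet_Ioi i1 i2,
    setIntegral_congr_fun measurableSet_Iic e1, setIntegral_congr_fun measurableSet_Ioi e2,
    integral_exp_mul_complex_Iic r1, integral_exp_mul_complex_Ioi r2, poissonK]
  have n1 : (z.im : ℂ) - I * ξ ≠ 0 := fun h => by rw [h] at r1; simp at r1
  have n2 : -(z.im : ℂ) - I * ξ ≠ 0 := fun h => by rw [h] at r2; simp at r2
  have n3 : (z.im : ℂ) ^ 2 + (ξ : ℂ) ^ 2 ≠ 0 := by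
    have : 0 < z.im ^ 2 + ξ ^ 2 := by positivity
    exact_mod_cast this.ne'
  rw [show z.re - -(2 * Real.pi * w) = ξ by rw [hξ]; ring]
  push_cast
  rw [mul_zero, mul_zero, Complex.exp_zero]
  field_simp
  linear_combination (-2 * (z.im : ℂ) * ξ ^ 2) * Complex.I_sq

/-- The transform of a function on the half-line is the Poisson integral of its boundary values. -/
theorem IsCausal.LT_eq_poissonI {m : L2} (hm : IsCausal m) {z : ℂ} (hz : 0 < z.im) :
    LT m z = poissonI (FL m) z := by
  have hc : MemLp (fun x => conj (expAbs z x)) 2 (volume : Measure ℝ) := memLp_conj (memLp_expAbs hz)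
  have hi : Integrable fun x => conj (expAbs z x) :=
    (Complex.conjLIE.toContinuousLinearEquiv : ℂ →L[ℝ] ℂ).integrable_comp (integrable_expAbs hz)
  rw [hm.LT_eq, integral_mul_eq_inner m _ (memLp_expAbs hz), ← Lp.inner_fourier_eq,
    inner_eq_integral]
  have h1 : ∫ w, conj ((𝓕 (toL2 fun x => conj (expAbs z x)) : L2) w) * (𝓕 m : L2) w =
      2 * ∫ w : ℝ, (𝓕 m : L2) w * (poissonK z (-(2 * Real.pi * w)) : ℂ) := by
    rw [← integral_const_mul]
    refine integral_congr_ae ?_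
    filter_upwards [fourier_toL2_ae hc hi] with w hw
    rw [hw, fourier_conj_expAbs hz, Complex.conj_ofReal]
    push_cast
    ring
  have h2 := Measure.integral_comp_mul_left
    (fun w : ℝ => (𝓕 m : L2) w * (poissonK z (-(2 * Real.pi * w)) : ℂ)) (-(2 * Real.pi)⁻¹)
  rw [inv_neg, inv_inv, abs_neg, abs_of_pos Real.two_pi_pos, Complex.real_smul] at h2
  have h3 : ∫ r, FL m r * (poissonK z r : ℂ) = ((2 * Real.pi : ℝ) : ℂ) *
      ∫ w : ℝ, (𝓕 m : L2) w * (poissonK z (-(2 * Real.pi * w)) : ℂ) := by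
    rw [← h2]
    refine integral_congr_ae ?_
    filter_upwards [FL_coe m] with r hr
    rw [hr]
    congr 3
    have := Real.pi_ne_zero
    field_simp
  rw [h1, poissonI, h3, ← mul_assoc]
  have hp : (Real.pi : ℂ) ≠ 0 := by exact_mod_cast Real.pi_ne_zero
  congr 1
  push_cast
  field_simp

/-- Almost everywhere non-tangential convergence to the boundary values. -/
theorem IsCausal.ae_tendsto_LT {m : L2} (hm : IsCausal m) : ∀ᵐ x : ℝ, ∀ M : ℝ, 0 < M →
    Tendsto (LT m) (𝓝[{w : ℂ | 0 < w.im ∧ |w.re - x| < M * w.im}] (x : ℂ)) (𝓝 (FL m x)) := by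
  filter_upwards [ae_isLebesguePt (L2_locallyIntegrable (FL m))] with x hx M hM
  refine (tendsto_poissonI (poissonIntegrable_L2 (FL m)) hx hM).congr' ?_
  filter_upwards [self_mem_nhdsWithin] with z hz
  exact (hm.LT_eq_poissonI hz.1).symm

/-- Convergence to the boundary values in `L²`. -/
theorem IsCausal.exists_LT_line {m : L2} (hm : IsCausal m) : ∃ G : ℝ → L2,
    Tendsto G (𝓝[>] 0) (𝓝 (FL m)) ∧
    ∀ y : ℝ, 0 < y → G y =ᵐ[volume] fun x : ℝ => LT m (x + y * I) := by
  set F : ℝ → ℝ → ℂ := fun y x => m x * ((Real.exp (-(|y| * |x|)) : ℝ) : ℂ)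
  have hFm : ∀ y, AEStronglyMeasurable (F y) volume := fun y =>
    (memLp_coe m).1.mul (Continuous.aestronglyMeasurable (by fun_prop))
  have hb : ∀ y, ∀ᵐ x : ℝ, ‖F y x‖ ≤ ‖m x‖ := fun y => Eventually.of_forall fun x => by
    rw [norm_mul, Complex.norm_real, Real.norm_of_nonneg (Real.exp_pos _).le]
    refine mul_le_of_le_one_right (norm_nonneg _) (Real.exp_le_one_iff.2 ?_)
    have : 0 ≤ |y| * |x| := by positivity
    linarith
  have hF2 : ∀ y, MemLp (F y) 2 (volume : Measure ℝ) := fun y => (memLp_coe m).of_le (hFm y) (hb y)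
  refine ⟨fun y => FL (toL2 (F y)), ?_, fun y hy => ?_⟩
  · have h1 : Tendsto (fun y => toL2 (F y)) (𝓝 0) (𝓝 (toL2 m)) := by
      refine tendsto_toL2_of_dominated (memLp_coe m) hFm (memLp_coe m).1 hb
        (Eventually.of_forall fun x => le_rfl) (Eventually.of_forall fun x => ?_)
      have hc : Continuous fun y => F y x := by
        simp only [F]; fun_prop
      have := hc.tendsto 0
      simpa [F] using this
    rw [toL2_coe] at h1
    exact ((continuous_FL.tendsto m).comp h1).mono_left nhdsWithin_le_nhds
  · have hi : Integrable (F y) := by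
      have h1 := integrable_mul_L2 (memLp_coe m) (memLp_expAbs (z := y * I) (by simpa using hy))
      refine h1.congr (Eventually.of_forall fun x => ?_)
      simp only [expAbs, F]
      rw [abs_of_pos hy]
      congr 1
      rw [Complex.ofReal_exp]
      congr 1
      simp
    filter_upwards [FL_coe (toL2 (F y)),
      ae_comp_mul (fourier_toL2_ae (hF2 y) hi) neg_two_pi_inv_ne] with x h1 h2
    rw [h1, h2, Real.fourier_real_eq_integral_exp_smul, hm.LT_eq]
    refine integral_congr_ae (Eventually.of_forall fun v => ?_)
    simp only [F, smul_eq_mul, expAbs]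
    rw [mul_left_comm, abs_of_pos hy, Complex.ofReal_exp, ← Complex.exp_add]
    congr 2
    have hp : (Real.pi : ℂ) ≠ 0 := by exact_mod_cast Real.pi_ne_zero
    simp
    field_simp
    ring

/-! ### Meromorphic functions in normal form -/

theorem nf_bound {f : ℂ → ℂ} {s : Set ℂ} (hf : MeromorphicOn f s) {z c : ℂ} (hz : z ∈ s) {ε : ℝ}
    (h : ∀ᶠ w in 𝓝[≠] z, ‖f w - c‖ ≤ ε) :
    AnalyticAt ℂ (toMeromorphicNFOn f s) z ∧ ‖toMeromorphicNFOn f s z - c‖ ≤ ε := by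
  have hnf := meromorphicNFOn_toMeromorphicNFOn f s hz
  have heq := hf.toMeromorphicNFOn_eq_self_on_nhdsNE hz
  have han : AnalyticAt ℂ (toMeromorphicNFOn f s) z := by
    rw [← hnf.meromorphicOrderAt_nonneg_iff_analyticAt, meromorphicOrderAt_toMeromorphicNFOn hf hz]
    by_contra hneg
    have h1 := tendsto_cobounded_of_meromorphicOrderAt_neg (not_le.1 hneg)
    rw [← tendsto_norm_atTop_iff_cobounded] at h1
    obtain ⟨w, hw1, hw2⟩ := (h.and (h1.eventually (eventually_gt_atTop (ε + ‖c‖)))).exists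
    have := norm_sub_norm_le (f w) c
    linarith
  refine ⟨han, ?_⟩
  have hc : Tendsto (fun w => ‖toMeromorphicNFOn f s w - c‖) (𝓝[≠] z)
      (𝓝 ‖toMeromorphicNFOn f s z - c‖) :=
    ((han.continuousAt.sub continuousAt_const).norm).tendsto.mono_left nhdsWithin_le_nhds
  refine le_of_tendsto hc ?_
  filter_upwards [h, heq] with w h1 h2
  rwa [h2]

theorem eventually_ne_of_eventually {z : ℂ} {p : ℂ → Prop} (h : ∀ᶠ w in 𝓝 z, p w) :
    ∀ᶠ w in 𝓝[≠] z, p w := nhdsWithin_le_nhds h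

/-! ### Domains symmetric about the real line -/

/-- The upper half of a symmetric domain that contains the real line is connected. -/
theorem isPreconnected_inter_upperHP {D : Set ℂ} (ho : IsOpen D) (hc : IsConnected D)
    (hconj : ∀ z ∈ D, conj z ∈ D) : IsPreconnected (D ∩ upperHP) := by
  have hp : IsPathConnected D := (ho.isConnected_iff_isPathConnected).1 hc
  refine isPreconnected_of_forall_pair fun z hz w hw => ?_
  obtain ⟨γ, hγ⟩ := hp.joinedIn z hz.1 w hw.1
  set ρ : ℂ → ℂ := fun v => v.re + |v.im| * I with hρ
  have hρc : Continuous ρ := by fun_prop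
  have hρD : ∀ v ∈ D, ρ v ∈ D := fun v hv => by
    rcases le_total 0 v.im with h | h
    · simpa [hρ, abs_of_nonneg h] using hv
    · convert hconj v hv using 1
      apply Complex.ext <;> simp [hρ, abs_of_nonpos h]
  have hρup : ∀ v ∈ upperHP, ρ v = v := fun v hv => by
    have : 0 < v.im := hv
    simp [hρ, abs_of_pos this]
  have hK : IsCompact (range fun s => ρ (γ s)) :=
    isCompact_range (hρc.comp γ.continuous)
  obtain ⟨δ, hδ, hsub⟩ := hK.exists_thickening_subset_open ho (by
    rintro _ ⟨s, rfl⟩; exact hρD _ (hγ s))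
  have hmem : ∀ v ∈ range (fun s => ρ (γ s)), ∀ τ : ℝ, 0 ≤ τ → τ < δ →
      v + τ * I ∈ D := fun v hv τ h0 h1 => by
    apply hsub
    rw [Metric.mem_thickening_iff]
    refine ⟨v, hv, ?_⟩
    rw [dist_eq_norm]
    simpa [abs_of_nonneg h0] using h1
  have hzr : z ∈ range (fun s => ρ (γ s)) := ⟨0, by simp [hρup z hz.2]⟩
  have hwr : w ∈ range (fun s => ρ (γ s)) := ⟨1, by simp [hρup w hw.2]⟩
  set t₀ : Set ℂ := (fun p : unitInterval × ℝ => ρ (γ p.1) + p.2 * I) ''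
    (univ ×ˢ Ioo 0 δ) with ht₀
  have ht₀c : IsPreconnected t₀ := by
    refine (isPreconnected_univ.prod isPreconnected_Ioo).image _ (Continuous.continuousOn ?_)
    fun_prop
  have seg : ∀ v ∈ range (fun s => ρ (γ s)), v ∈ upperHP →
      ∃ t : Set ℂ, t ⊆ D ∩ upperHP ∧ v ∈ t ∧ IsPreconnected t ∧ v + (δ / 2 : ℝ) * I ∈ t := by
    intro v hv hvu
    have hvu' : 0 < v.im := hvu
    refine ⟨(fun τ : ℝ => v + τ * I) '' Icc 0 (δ / 2), ?_, ⟨0, ⟨le_rfl, by positivity⟩, by simp⟩,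
      isPreconnected_Icc.image _ (Continuous.continuousOn (by fun_prop)),
      ⟨δ / 2, ⟨by positivity, le_rfl⟩, rfl⟩⟩
    rintro _ ⟨τ, hτ, rfl⟩
    refine ⟨hmem v hv τ hτ.1 (by linarith [hτ.2]), ?_⟩
    change 0 < (v + τ * I).im
    simp
    linarith [hτ.1]
  obtain ⟨t₁, h1, h2, h3, h4⟩ := seg z hzr hz.2
  obtain ⟨t₂, k1, k2, k3, k4⟩ := seg w hwr hw.2
  have hz0 : z + (δ / 2 : ℝ) * I ∈ t₀ :=
    ⟨(0, δ / 2), ⟨mem_univ _, by constructor <;> simp <;> linarith⟩, by simp [hρup z hz.2]⟩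
  have hw0 : w + (δ / 2 : ℝ) * I ∈ t₀ :=
    ⟨(1, δ / 2), ⟨mem_univ _, by constructor <;> simp <;> linarith⟩, by simp [hρup w hw.2]⟩
  have ht₀s : t₀ ⊆ D ∩ upperHP := by
    rintro _ ⟨⟨s, τ⟩, ⟨-, hτ⟩, rfl⟩
    refine ⟨hmem _ ⟨s, rfl⟩ τ hτ.1.le hτ.2, ?_⟩
    change 0 < (ρ (γ s) + τ * I).im
    have := hτ.1
    simp [hρ]
    simp at this
    positivity
  have h01 : IsPreconnected (t₁ ∪ t₀) := h3.union _ h4 hz0 ht₀c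
  have h012 : IsPreconnected (t₁ ∪ t₀ ∪ t₂) := h01.union _ (Or.inr hw0) k4 k3
  exact ⟨t₁ ∪ t₀ ∪ t₂, union_subset (union_subset h1 ht₀s) k1, Or.inl (Or.inl h2), Or.inr k2, h012⟩

/-! ### The uniqueness theorem of Lusin and Privalov -/

theorem exists_uniform_set {C : ℕ → ℕ → Set ℝ} (hC : ∀ k n, IsClosed (C k n))
    (hmono : ∀ k, Monotone (C k)) (h : ∀ᵐ x : ℝ, ∀ k, ∃ n, x ∈ C k n) :
    ∃ n : ℕ → ℕ, volume (Icc (0 : ℝ) 1 ∩ ⋂ k, C k (n k)) ≠ 0 := by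
  set μ : Measure ℝ := volume.restrict (Icc 0 1)
  have huniv : μ univ = 1 := by simp [μ]
  obtain ⟨ε, hε, hsum⟩ := ENNReal.exists_pos_sum_of_countable' (ε := 1) one_ne_zero ℕ
  have hlim : ∀ k, ∃ n, μ (C k n)ᶜ < ε k := fun k => by
    have h1 := tendsto_measure_iInter_atTop (μ := μ) (s := fun n => (C k n)ᶜ)
      (fun n => (hC k n).measurableSet.compl.nullMeasurableSet)
      (fun a b hab => compl_subset_compl.2 (hmono k hab)) ⟨0, measure_ne_top _ _⟩
    have h2 : μ (⋂ n, (C k n)ᶜ) = 0 := by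
      have h3 : ∀ᵐ x ∂μ, ∀ k, ∃ n, x ∈ C k n := ae_restrict_of_ae h
      rw [← nonpos_iff_eq_zero, ← mem_ae_iff.1 h3]
      refine measure_mono fun x hx => ?_
      simp only [mem_iInter, mem_compl_iff] at hx
      simp only [mem_compl_iff, mem_ofPred_eq, not_forall, not_exists]
      exact ⟨k, hx⟩
    rw [h2] at h1
    exact (h1.eventually (gt_mem_nhds (hε k))).exists
  choose n hn using hlim
  refine ⟨n, fun h0 => ?_⟩
  have hm : MeasurableSet (⋂ k, C k (n k)) := MeasurableSet.iInter fun k => (hC k _).measurableSet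
  have h1 : μ (⋂ k, C k (n k)) = 0 := by
    rw [Measure.restrict_apply hm, inter_comm]; exact h0
  have h2 : μ (⋂ k, C k (n k))ᶜ < 1 := by
    rw [compl_iInter]
    exact (measure_iUnion_le _).trans_lt ((ENNReal.tsum_le_tsum fun k => (hn k).le).trans_lt hsum)
  have h3 := measure_add_measure_compl (μ := μ) hm
  rw [h1, zero_add, huniv] at h3
  exact h2.ne h3

/-- The Cauchy integral of the indicator function of a set. -/
def cauchyI (E : Set ℝ) (z : ℂ) : ℂ := -I * ∫ s in E, ((s : ℂ) - z)⁻¹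

theorem ofReal_sub_ne {z : ℂ} (hz : 0 < z.im) (s : ℝ) : (s : ℂ) - z ≠ 0 := fun h => by
  have := congrArg Complex.im h
  simp at this
  exact hz.ne' this

theorem im_le_norm_ofReal_sub (z : ℂ) (s : ℝ) : z.im ≤ ‖(s : ℂ) - z‖ := by
  have := Complex.abs_im_le_norm ((s : ℂ) - z)
  simp at this
  exact (le_abs_self _).trans this

theorem continuous_inv_ofReal_sub {z : ℂ} (hz : 0 < z.im) :
    Continuous fun s : ℝ => ((s : ℂ) - z)⁻¹ :=
  (Complex.continuous_ofReal.sub continuous_const).inv₀ (ofReal_sub_ne hz)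

theorem integrableOn_inv_ofReal_sub {E : Set ℝ} (hE : volume E ≠ ⊤) {z : ℂ} (hz : 0 < z.im) :
    IntegrableOn (fun s : ℝ => ((s : ℂ) - z)⁻¹) E := by
  refine Measure.integrableOn_of_bounded (M := z.im⁻¹) hE
    (continuous_inv_ofReal_sub hz).aestronglyMeasurable (Eventually.of_forall fun s => ?_)
  rw [norm_inv]
  exact inv_anti₀ hz (im_le_norm_ofReal_sub z s)

theorem differentiableAt_cauchyI {E : Set ℝ} (hE : volume E ≠ ⊤) {z : ℂ} (hz : 0 < z.im) :
    DifferentiableAt ℂ (cauchyI E) z := by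
  have him : ∀ w ∈ ball z (z.im / 2), z.im / 2 ≤ w.im := fun w hw => by
    have := (Complex.abs_im_le_norm (w - z)).trans (mem_ball_iff_norm.1 hw).le
    rw [Complex.sub_im, abs_le] at this
    linarith [this.1]
  have hfin : IsFiniteMeasure (volume.restrict E) := ⟨by
    rw [Measure.restrict_apply_univ]; exact hE.lt_top⟩
  have hm : Continuous fun s : ℝ => (((s : ℂ) - z) ^ 2)⁻¹ :=
    ((Complex.continuous_ofReal.sub continuous_const).pow 2).inv₀
      fun s => pow_ne_zero 2 (ofReal_sub_ne hz s)
  have hmeas : ∀ᶠ w in 𝓝 z, AEStronglyMeasurable (fun s : ℝ => ((s : ℂ) - w)⁻¹)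
      (volume.restrict E) := by
    filter_upwards [Metric.ball_mem_nhds z (half_pos hz)] with w hw
    exact (continuous_inv_ofReal_sub (by linarith [him w hw])).aestronglyMeasurable
  have hb : ∀ s : ℝ, ∀ w ∈ ball z (z.im / 2),
      ‖(((s : ℂ) - w) ^ 2)⁻¹‖ ≤ ((z.im / 2) ^ 2)⁻¹ := fun s w hw => by
    rw [norm_inv, norm_pow]
    have := him w hw
    have h2 := im_le_norm_ofReal_sub w s
    gcongr
    linarith
  have hd : ∀ s : ℝ, ∀ w ∈ ball z (z.im / 2),
      HasDerivAt (fun w : ℂ => ((s : ℂ) - w)⁻¹) ((((s : ℂ) - w) ^ 2)⁻¹) w := fun s w hw => by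
    have hw0 : 0 < w.im := by linarith [him w hw]
    have h1 : HasDerivAt (fun w : ℂ => (s : ℂ) - w) (-1) w := by
      simpa using (hasDerivAt_id w).const_sub (s : ℂ)
    have h2 := h1.fun_inv (ofReal_sub_ne hw0 s)
    rwa [neg_neg, one_div] at h2
  have h := hasDerivAt_integral_of_dominated_loc_of_deriv_le (μ := volume.restrict E) (𝕜 := ℂ)
    (F := fun w (s : ℝ) => ((s : ℂ) - w)⁻¹) (F' := fun w (s : ℝ) => (((s : ℂ) - w) ^ 2)⁻¹) (x₀ := z)
    (s := ball z (z.im / 2)) (bound := fun _ => ((z.im / 2) ^ 2)⁻¹)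
    (Metric.ball_mem_nhds z (by positivity)) hmeas (integrableOn_inv_ofReal_sub hE hz)
    hm.aestronglyMeasurable (Eventually.of_forall hb) (integrable_const _) (Eventually.of_forall hd)
  exact (h.2.differentiableAt).const_mul (-I)

theorem re_cauchyI {E : Set ℝ} (hE : volume E ≠ ⊤) {z : ℂ} (hz : 0 < z.im) :
    (cauchyI E z).re = ∫ s in E, poissonK z s := by
  have h1 : (cauchyI E z).re = (∫ s in E, ((s : ℂ) - z)⁻¹).im := by simp [cauchyI]
  have h2 := integral_im (integrableOn_inv_ofReal_sub hE hz)
  simp only [RCLike.im_eq_complex_im] at h2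
  rw [h1, ← h2]
  refine integral_congr_ae (Eventually.of_forall fun s => ?_)
  simp only [Complex.inv_im, poissonK, Complex.normSq_apply]
  simp
  congr 1
  ring

theorem setIntegral_poissonK_le {E : Set ℝ} {z : ℂ} (hz : 0 < z.im) :
    ∫ s in E, poissonK z s ≤ Real.pi := by
  rw [← integral_poissonK hz]
  exact setIntegral_le_integral (integrable_poissonK hz)
    (Eventually.of_forall (poissonK_nonneg hz))

theorem setIntegral_poissonK_le_of_disjoint {E : Set ℝ} {z : ℂ}
    (hz : 0 < z.im) (h : ∀ s ∈ E, z.im ≤ |z.re - s|) : ∫ s in E, poissonK z s ≤ Real.pi - 1 := by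
  have h1 : ∫ s in ball z.re z.im, poissonK z s ≥ 1 := by
    have h2 : ∫ s in ball z.re z.im, (2 * z.im)⁻¹ ≤
        ∫ s in ball z.re z.im, poissonK z s := by
      refine setIntegral_mono_on (integrableOn_const measure_ball_lt_top.ne)
        (integrable_poissonK hz).integrableOn Metric.isOpen_ball.measurableSet fun s hs => ?_
      rw [Metric.mem_ball, Real.dist_eq] at hs
      unfold poissonK
      rw [inv_eq_one_div, div_le_div_iff₀ (by positivity) (by positivity)]
      have : (z.re - s) ^ 2 ≤ z.im ^ 2 := by
        rw [← sq_abs, abs_sub_comm]; gcongr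
      nlinarith
    rw [setIntegral_const, Measure.real, Real.volume_ball, ENNReal.toReal_ofReal (by positivity),
      smul_eq_mul, mul_inv_cancel₀ (by positivity)] at h2
    exact h2
  have h3 : ∫ s in E, poissonK z s ≤ ∫ s in (ball z.re z.im)ᶜ, poissonK z s := by
    refine setIntegral_mono_set (integrable_poissonK hz).integrableOn
      (Eventually.of_forall (poissonK_nonneg hz)) (LE.le.eventuallyLE fun s hs => ?_)
    rw [mem_compl_iff, Metric.mem_ball, Real.dist_eq, not_lt, abs_sub_comm]
    exact h s hs
  have h4 := integral_add_compl (μ := volume) (s := ball z.re z.im)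
    Metric.isOpen_ball.measurableSet (integrable_poissonK hz)
  rw [integral_poissonK hz] at h4
  linarith

/-- A point of a set of positive measure towards which the Poisson integral of the indicator
function tends to its maximum. -/
theorem exists_tendsto_setIntegral_poissonK {E : Set ℝ} (hEm : MeasurableSet E)
    (hE : volume E ≠ ⊤) (h0 : volume E ≠ 0) : ∃ x ∈ E,
    Tendsto (fun y : ℝ => ∫ s in E, poissonK (x + y * I) s) (𝓝[>] 0) (𝓝 Real.pi) := by
  set F : ℝ → ℂ := E.indicator fun _ => 1
  have hFi : Integrable F := (integrable_indicator_iff hEm).2 (integrableOn_const hE)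
  have hP : PoissonIntegrable F := by
    have hc : Continuous fun r : ℝ => (1 + r ^ 2)⁻¹ :=
      (by fun_prop : Continuous fun r : ℝ => 1 + r ^ 2).inv₀ fun r => by positivity
    refine hFi.norm.mono' (hc.aestronglyMeasurable.smul hFi.1) (Eventually.of_forall fun r => ?_)
    rw [norm_smul]
    refine mul_le_of_le_one_left (norm_nonneg _) ?_
    rw [Real.norm_of_nonneg (by positivity)]
    exact inv_le_one_of_one_le₀ (by nlinarith [sq_nonneg r])
  obtain ⟨x, hxE, hx⟩ : ∃ x ∈ E, IsLebesguePt F x := by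
    by_contra! hcon
    apply h0
    refine measure_mono_null (fun x hx => ?_) (mem_ae_iff.1 (ae_isLebesguePt hFi.locallyIntegrable))
    exact hcon x hx
  refine ⟨x, hxE, ?_⟩
  have h1 := tendsto_poissonI hP hx one_pos
  have h2 : Tendsto (fun y : ℝ => (x : ℂ) + y * I) (𝓝[>] 0)
      (𝓝[{w : ℂ | 0 < w.im ∧ |w.re - x| < 1 * w.im}] (x : ℂ)) := by
    rw [tendsto_nhdsWithin_iff]
    constructor
    · have hc : Continuous fun y : ℝ => (x : ℂ) + y * I := by fun_prop
      have := hc.tendsto 0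
      simp only [Complex.ofReal_zero, zero_mul, add_zero] at this
      exact this.mono_left nhdsWithin_le_nhds
    · filter_upwards [self_mem_nhdsWithin] with y hy
      have hy' : 0 < y := hy
      simp [hy']
  have h3 := (Complex.continuous_re.tendsto _).comp (h1.comp h2)
  have h4 := h3.const_mul Real.pi
  simp only [F, indicator_of_mem hxE, Complex.one_re, mul_one] at h4
  refine h4.congr fun y => ?_
  simp only [Function.comp, poissonI]
  have h5 : ∀ z : ℂ, (∫ r, E.indicator (fun _ => (1 : ℂ)) r * (poissonK z r : ℂ)) =
      ((∫ s in E, poissonK z s : ℝ) : ℂ) := fun z => by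
    rw [← integral_complex_ofReal, ← integral_indicator hEm]
    refine integral_congr_ae (Eventually.of_forall fun r => ?_)
    by_cases hr : r ∈ E <;> simp [hr]
  rw [h5, ← Complex.ofReal_inv, ← Complex.ofReal_mul, Complex.ofReal_re, ← mul_assoc,
    mul_inv_cancel₀ Real.pi_ne_zero, one_mul]

/-! ### The reflection `F^♯(z) = conj (F(conj z))` -/

/-- The reflection `F^♯` of a function about the real line. -/
def sharp (f : ℂ → ℂ) (z : ℂ) : ℂ := conj (f (conj z))

theorem analyticAt_sharp {f : ℂ → ℂ} {z : ℂ} (h : AnalyticAt ℂ f (conj z)) :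
    AnalyticAt ℂ (sharp f) z := by
  rw [Complex.analyticAt_iff_eventually_differentiableAt] at h ⊢
  filter_upwards [(Complex.continuous_conj.tendsto z).eventually h] with w hw
  have := hw.conj_conj
  rwa [Complex.conj_conj] at this

theorem meromorphicAt_sharp {f : ℂ → ℂ} {z : ℂ} (h : MeromorphicAt f (conj z)) :
    MeromorphicAt (sharp f) z := by
  obtain ⟨n, hn⟩ := h
  refine ⟨n, (analyticAt_sharp hn).congr (Eventually.of_forall fun w => ?_)⟩
  simp [sharp]

theorem tendsto_conj_nhdsNE (z : ℂ) : Tendsto (fun w : ℂ => conj w) (𝓝[≠] z) (𝓝[≠] (conj z)) := by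
  refine tendsto_nhdsWithin_iff.2 ⟨(Complex.continuous_conj.tendsto z).mono_left
    nhdsWithin_le_nhds, ?_⟩
  filter_upwards [self_mem_nhdsWithin] with w hw hcon
  exact hw (star_injective hcon)

/-! ### Uniqueness from boundary values -/

/-- The real points `x` such that `‖W‖ ≤ 1/(k+1)` on the cone of height `1/(n+1)` with vertex `x`,
which is contained in `D`. -/
def coneBoundSet (D : Set ℂ) (W : ℂ → ℂ) (k n : ℕ) : Set ℝ :=
  {x | ∀ z : ℂ, 0 < z.im → z.im < 1 / ((n : ℝ) + 1) → |z.re - x| < 2 * z.im →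
    z ∈ D ∧ ‖W z‖ ≤ 1 / ((k : ℝ) + 1)}

theorem isClosed_coneBoundSet (D : Set ℂ) (W : ℂ → ℂ) (k n : ℕ) :
    IsClosed (coneBoundSet D W k n) := by
  have : coneBoundSet D W k n = ⋂ z : ℂ, ⋂ _ : 0 < z.im ∧ z.im < 1 / ((n : ℝ) + 1) ∧
      ¬(z ∈ D ∧ ‖W z‖ ≤ 1 / ((k : ℝ) + 1)), {x : ℝ | 2 * z.im ≤ |z.re - x|} := by
    ext x
    simp only [coneBoundSet, mem_ofPred_eq, mem_iInter]
    constructor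
    · intro h z hz
      by_contra hcon
      exact hz.2.2 (h z hz.1 hz.2.1 (not_le.1 hcon))
    · intro h z h1 h2 h3
      by_contra hcon
      exact absurd (h z ⟨h1, h2, hcon⟩) (not_le.2 h3)
  rw [this]
  refine isClosed_iInter fun z => isClosed_iInter fun _ => ?_
  exact isClosed_le continuous_const (by fun_prop)

theorem monotone_coneBoundSet (D : Set ℂ) (W : ℂ → ℂ) (k : ℕ) :
    Monotone (coneBoundSet D W k) := by
  intro a b hab x hx z h1 h2 h3
  refine hx z h1 (h2.trans_le ?_) h3
  have : (a : ℝ) ≤ b := by exact_mod_cast hab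
  gcongr

theorem exists_mem_coneBoundSet {D : Set ℂ} (ho : IsOpen D) {W : ℂ → ℂ} {x : ℝ} (hx : (x : ℂ) ∈ D)
    (h : Tendsto W (𝓝[{w : ℂ | 0 < w.im ∧ |w.re - x| < 2 * w.im}] (x : ℂ)) (𝓝 0)) (k : ℕ) :
    ∃ n, x ∈ coneBoundSet D W k n := by
  have h1 : ∀ᶠ w in 𝓝[{w : ℂ | 0 < w.im ∧ |w.re - x| < 2 * w.im}] (x : ℂ),
      w ∈ D ∧ ‖W w‖ ≤ 1 / ((k : ℝ) + 1) := by
    have hD : ∀ᶠ w in 𝓝[{w : ℂ | 0 < w.im ∧ |w.re - x| < 2 * w.im}] (x : ℂ), w ∈ D :=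
      nhdsWithin_le_nhds (ho.mem_nhds hx)
    refine hD.and ?_
    have h2 : Tendsto (fun w => ‖W w‖) _ (𝓝 0) := tendsto_zero_iff_norm_tendsto_zero.1 h
    exact h2.eventually (ge_mem_nhds (by positivity))
  rw [eventually_nhdsWithin_iff, Metric.eventually_nhds_iff] at h1
  obtain ⟨r, hr, h1⟩ := h1
  obtain ⟨n, hn⟩ := exists_nat_one_div_lt (show 0 < r / 3 by positivity)
  refine ⟨n, fun z hz1 hz2 hz3 => h1 ?_ ⟨hz1, hz3⟩⟩
  rw [dist_eq_norm]
  have h3 := Complex.norm_le_abs_re_add_abs_im (z - x)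
  simp only [Complex.sub_re, Complex.ofReal_re, Complex.sub_im, Complex.ofReal_im, sub_zero,
    abs_of_pos hz1] at h3
  linarith

/-- **The uniqueness theorem of Lusin and Privalov**: a meromorphic function with non-tangential
limit `0` almost everywhere on the real line vanishes. -/
theorem meromorphicOrderAt_eq_top_of_ntlim {D : Set ℂ} (ho : IsOpen D)
    (hreal : ∀ x : ℝ, (x : ℂ) ∈ D) (hpre : IsPreconnected (D ∩ upperHP)) {W : ℂ → ℂ}
    (hW : MeromorphicOn W (D ∩ upperHP))
    (hlim : ∀ᵐ x : ℝ,
      Tendsto W (𝓝[{w : ℂ | 0 < w.im ∧ |w.re - x| < 2 * w.im}] (x : ℂ)) (𝓝 0)) :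
    ∀ z ∈ D ∩ upperHP, meromorphicOrderAt W z = ⊤ := by
  obtain ⟨n, hn⟩ := exists_uniform_set (isClosed_coneBoundSet D W) (monotone_coneBoundSet D W) (by
    filter_upwards [hlim] with x hx k
    exact exists_mem_coneBoundSet ho (hreal x) hx k)
  set E : Set ℝ := Icc (0 : ℝ) 1 ∩ ⋂ k, coneBoundSet D W k (n k) with hE
  have hEcl : IsClosed E := isClosed_Icc.inter (isClosed_iInter fun k => isClosed_coneBoundSet _ _ _ _)
  have hEc : IsCompact E := isCompact_Icc.of_isClosed_subset hEcl inter_subset_left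
  have hEfin : volume E ≠ ⊤ := hEc.measure_lt_top.ne
  have hEne : E.Nonempty := nonempty_of_measure_ne_zero hn
  set g := toMeromorphicNFOn W (D ∩ upperHP) with hg
  have hcone : ∀ k, ∀ z : ℂ, 0 < z.im → z.im < 1 / ((n k : ℝ) + 1) → Metric.infDist z.re E ≤ z.im →
      z ∈ D ∩ upperHP ∧ AnalyticAt ℂ g z ∧ ‖g z‖ ≤ 1 / ((k : ℝ) + 1) := by
    intro k z h1 h2 h3
    obtain ⟨x, hxE, hx⟩ := hEc.exists_infDist_eq_dist hEne z.re
    rw [hx, Real.dist_eq] at h3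
    have hxC : x ∈ coneBoundSet D W k (n k) := mem_iInter.1 hxE.2 k
    have hzD : z ∈ D ∩ upperHP := ⟨(hxC z h1 h2 (by linarith)).1, h1⟩
    have hev : ∀ᶠ w : ℂ in 𝓝 z, ‖W w - 0‖ ≤ 1 / ((k : ℝ) + 1) := by
      have c1 : ∀ᶠ w : ℂ in 𝓝 z, 0 < w.im :=
        Complex.continuous_im.continuousAt.eventually (lt_mem_nhds h1)
      have c2 : ∀ᶠ w : ℂ in 𝓝 z, w.im < 1 / ((n k : ℝ) + 1) :=
        Complex.continuous_im.continuousAt.eventually (gt_mem_nhds h2)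
      have c3 : ∀ᶠ w : ℂ in 𝓝 z, |w.re - x| - 2 * w.im < 0 := by
        have : Continuous fun w : ℂ => |w.re - x| - 2 * w.im := by fun_prop
        exact this.continuousAt.eventually (gt_mem_nhds (by linarith))
      filter_upwards [c1, c2, c3] with w d1 d2 d3
      rw [sub_zero]
      exact (hxC w d1 d2 (by linarith)).2
    have := nf_bound hW hzD (eventually_ne_of_eventually hev)
    rw [sub_zero] at this
    exact ⟨hzD, this⟩
  obtain ⟨h, hh⟩ : ∃ h : ℝ, h = 1 / ((n 0 : ℝ) + 1) / 2 := ⟨_, rfl⟩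
  have hn0 : 0 < 1 / ((n 0 : ℝ) + 1) := by positivity
  have hhpos : 0 < h := by rw [hh]; positivity
  have hhlt : h < 1 / ((n 0 : ℝ) + 1) := by rw [hh]; linarith
  set V : ℂ → ℂ := fun z => cauchyI E z - ((Real.pi - 1 : ℝ) : ℂ) + I * z / h with hV
  have hVd : ∀ z : ℂ, 0 < z.im → DifferentiableAt ℂ V z := fun z hz =>
    ((differentiableAt_cauchyI hEfin hz).sub_const _).add
      ((differentiableAt_id.const_mul _).div_const _)
  have hVre : ∀ z : ℂ, 0 < z.im →
      (V z).re = (∫ s in E, poissonK z s) - (Real.pi - 1) - z.im / h := fun z hz => by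
    have e : (I * z / h).re = -(z.im / h) := by
      rw [Complex.div_ofReal_re]; simp [neg_div]
    simp only [hV, Complex.add_re, Complex.sub_re, Complex.ofReal_re]
    rw [re_cauchyI hEfin hz, e]
    ring
  have key : ∀ z : ℂ, 0 < z.im → z.im < h → Metric.infDist z.re E < z.im → ∀ N : ℕ,
      ‖g z‖ * Real.exp (N * (V z).re) ≤ 1 := by
    intro z h1 h2 h3 N
    obtain ⟨k, hk⟩ := exists_nat_gt (Real.exp N)
    set η : ℝ := min z.im (1 / ((n k : ℝ) + 1)) / 2 with hη
    have hη0 : 0 < η := by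
      have : 0 < 1 / ((n k : ℝ) + 1) := by positivity
      have := lt_min h1 this
      positivity
    have hηz : η < z.im := by
      have := min_le_left z.im (1 / ((n k : ℝ) + 1))
      rw [hη]; linarith
    have hηk : η < 1 / ((n k : ℝ) + 1) := by
      have := min_le_right z.im (1 / ((n k : ℝ) + 1))
      have h5 : 0 < 1 / ((n k : ℝ) + 1) := by positivity
      rw [hη]; linarith
    set R : Set ℂ := {w | η < w.im ∧ w.im < h ∧ Metric.infDist w.re E < w.im} with hR
    have hcd : Continuous fun w : ℂ => Metric.infDist w.re E :=
      (Metric.continuous_infDist_pt E).comp Complex.continuous_re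
    have hRo : IsOpen R := (isOpen_lt continuous_const Complex.continuous_im).inter
      ((isOpen_lt Complex.continuous_im continuous_const).inter
        (isOpen_lt hcd Complex.continuous_im))
    have hRcl : closure R ⊆ {w | η ≤ w.im ∧ w.im ≤ h ∧ Metric.infDist w.re E ≤ w.im} := by
      refine closure_minimal (fun w hw => ⟨hw.1.le, hw.2.1.le, hw.2.2.le⟩) ?_
      exact (isClosed_le continuous_const Complex.continuous_im).inter
        ((isClosed_le Complex.continuous_im continuous_const).inter
          (isClosed_le hcd Complex.continuous_im))
    have hRb : Bornology.IsBounded R := by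
      rw [isBounded_iff_forall_norm_le]
      refine ⟨1 + h + h, fun w hw => ?_⟩
      obtain ⟨x, hxE, hx⟩ := hEc.exists_infDist_eq_dist hEne w.re
      have h5 := hw.2.2
      rw [hx, Real.dist_eq] at h5
      have h6 := Complex.norm_le_abs_re_add_abs_im w
      rw [abs_of_pos (hη0.trans hw.1)] at h6
      have h7 : |w.re| ≤ |w.re - x| + |x| := by
        have := abs_add_le (w.re - x) x
        rwa [sub_add_cancel] at this
      have h8 : |x| ≤ 1 := by rw [abs_of_nonneg hxE.1.1]; exact hxE.1.2
      linarith [hw.2.1]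
    have hd : DiffContOnCl ℂ (fun w => g w * Complex.exp (N * V w)) R := by
      refine DifferentiableOn.diffContOnCl fun w hw => ?_
      have hw' := hRcl hw
      have hw0 : 0 < w.im := hη0.trans_le hw'.1
      refine DifferentiableAt.differentiableWithinAt ?_
      exact (hcone 0 w hw0 (hw'.2.1.trans_lt hhlt) hw'.2.2).2.1.differentiableAt.mul
        (((hVd w hw0).const_mul _).cexp)
    have hnorm : ∀ w, ‖g w * Complex.exp (N * V w)‖ = ‖g w‖ * Real.exp (N * (V w).re) := fun w => by
      rw [norm_mul, Complex.norm_exp]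
      simp
    have hfr : ∀ w ∈ frontier R, ‖g w * Complex.exp (N * V w)‖ ≤ 1 := by
      intro w hw
      have hw1 := hRcl (frontier_subset_closure hw)
      have hw2 : w ∉ R := by
        rw [hRo.frontier_eq] at hw; exact hw.2
      have hw0 : 0 < w.im := hη0.trans_le hw1.1
      rw [hnorm]
      have hle := setIntegral_poissonK_le (E := E) hw0
      have hpos : 0 ≤ w.im / h := by positivity
      by_cases hlow : w.im = η
      · have hb := (hcone k w hw0 (by rw [hlow]; exact hηk) hw1.2.2).2.2
        have hv : (V w).re ≤ 1 := by rw [hVre w hw0]; linarith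
        have hN : Real.exp (N * (V w).re) ≤ Real.exp N :=
          Real.exp_le_exp.2 (mul_le_of_le_one_right (Nat.cast_nonneg N) hv)
        calc ‖g w‖ * Real.exp (N * (V w).re) ≤ 1 / ((k : ℝ) + 1) * Real.exp N := by gcongr
          _ ≤ 1 := by
            rw [div_mul_eq_mul_div, one_mul, div_le_one (by positivity)]
            linarith
      · have hb := (hcone 0 w hw0 (hw1.2.1.trans_lt hhlt) hw1.2.2).2.2
        rw [Nat.cast_zero, zero_add, div_one] at hb
        have hv : (V w).re ≤ 0 := by
          rw [hVre w hw0]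
          by_cases htop : w.im = h
          · rw [htop, div_self hhpos.ne']; linarith
          · have hlt1 : η < w.im := lt_of_le_of_ne hw1.1 (Ne.symm hlow)
            have hlt2 : w.im < h := lt_of_le_of_ne hw1.2.1 htop
            have hge : w.im ≤ Metric.infDist w.re E := by
              by_contra hcon
              exact hw2 ⟨hlt1, hlt2, not_le.1 hcon⟩
            have := setIntegral_poissonK_le_of_disjoint (E := E) hw0 fun s hs => by
              have := Metric.infDist_le_dist_of_mem (x := w.re) hs
              rw [Real.dist_eq] at this
              linarith
            linarith
        have hN : Real.exp (N * (V w).re) ≤ 1 :=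
          Real.exp_le_one_iff.2 (mul_nonpos_of_nonneg_of_nonpos (Nat.cast_nonneg N) hv)
        exact mul_le_one₀ hb (Real.exp_pos _).le hN
    have := Complex.norm_le_of_forall_mem_frontier_norm_le hRb hd hfr
      (subset_closure (show z ∈ R from ⟨hηz, h2, h3⟩))
    rwa [hnorm] at this
  -- a region where `g` vanishes
  have hzero : ∀ z : ℂ, 0 < z.im → z.im < h → Metric.infDist z.re E < z.im → 0 < (V z).re →
      g z = 0 := by
    intro z h1 h2 h3 h4
    by_contra hne
    have hpos : 0 < ‖g z‖ := norm_pos_iff.2 hne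
    obtain ⟨N, hN⟩ := exists_nat_gt (1 / (‖g z‖ * (V z).re))
    rw [div_lt_iff₀ (by positivity)] at hN
    have h5 := key z h1 h2 h3 N
    have h6 := Real.add_one_le_exp (N * (V z).re)
    nlinarith
  obtain ⟨x, hxE, hx⟩ := exists_tendsto_setIntegral_poissonK hEcl.measurableSet hEfin hn
  have hsmall : ∀ᶠ y : ℝ in 𝓝[>] 0, Real.pi - 1 / 2 <
      ∫ s in E, poissonK (x + y * I) s :=
    hx.eventually (lt_mem_nhds (by linarith))
  have hsmall2 : ∀ᶠ y : ℝ in 𝓝[>] 0, y < h / 2 :=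
    nhdsWithin_le_nhds (gt_mem_nhds (by positivity))
  obtain ⟨y, hy1, hy2, hy0⟩ := (hsmall.and (hsmall2.and self_mem_nhdsWithin)).exists
  have hy0' : 0 < y := hy0
  set z₀ : ℂ := x + y * I with hz₀
  have hzim : z₀.im = y := by simp [hz₀]
  have hzre : z₀.re = x := by simp [hz₀]
  have hd0 : Metric.infDist z₀.re E = 0 := by rw [hzre]; exact Metric.infDist_zero_of_mem hxE
  have hz₀im : 0 < z₀.im := by rw [hzim]; exact hy0'
  have hVpos : 0 < (V z₀).re := by
    rw [hVre z₀ hz₀im, hzim]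
    have : y / h < 1 / 2 := by rw [div_lt_iff₀ hhpos]; linarith
    linarith
  have hev : ∀ᶠ w in 𝓝 z₀, g w = 0 := by
    have c1 : ∀ᶠ w : ℂ in 𝓝 z₀, 0 < w.im :=
      Complex.continuous_im.continuousAt.eventually (lt_mem_nhds hz₀im)
    have c2 : ∀ᶠ w : ℂ in 𝓝 z₀, w.im < h :=
      Complex.continuous_im.continuousAt.eventually (gt_mem_nhds (by rw [hzim]; linarith))
    have c3 : ∀ᶠ w : ℂ in 𝓝 z₀, Metric.infDist w.re E - w.im < 0 := by
      have : Continuous fun w : ℂ => Metric.infDist w.re E - w.im :=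
        ((Metric.continuous_infDist_pt E).comp Complex.continuous_re).sub Complex.continuous_im
      exact this.continuousAt.eventually (gt_mem_nhds (by simp only [hd0]; linarith))
    have c4 : ∀ᶠ w : ℂ in 𝓝 z₀, 0 < (V w).re :=
      (Complex.continuous_re.continuousAt.comp (hVd z₀ hz₀im).continuousAt).eventually
        (lt_mem_nhds hVpos)
    filter_upwards [c1, c2, c3, c4] with w d1 d2 d3 d4
    exact hzero w d1 d2 (by linarith) d4
  have hz₀D : z₀ ∈ D ∩ upperHP :=
    (hcone 0 z₀ hz₀im (by rw [hzim]; linarith) (by rw [hd0]; exact hz₀im.le)).1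
  have htop : meromorphicOrderAt W z₀ = ⊤ := by
    rw [← meromorphicOrderAt_toMeromorphicNFOn hW hz₀D, meromorphicOrderAt_eq_top_iff]
    exact eventually_ne_of_eventually hev
  intro z hz
  by_contra hne
  exact hW.meromorphicOrderAt_ne_top_of_isPreconnected hpre hz hz₀D hne htop

/-- The functional equation `U U^♯ = 1` of a unimodular function. -/
theorem IsUloc.eventually_mul_conj {u : ℝ → ℂ} {D : Set ℂ} {U : ℂ → ℂ} (hu : IsUloc u D U) {z : ℂ}
    (hz : z ∈ D) (him : z.im ≠ 0) : ∀ᶠ w in 𝓝[≠] z, U w * conj (U (conj w)) = 1 := by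
  have hmer : ∀ z ∈ D ∩ upperHP, MeromorphicAt (fun w => U w * conj (U (conj w)) - 1) z := by
    intro z hz
    have hz' : 0 < z.im := hz.2
    refine ((hu.mero z ⟨hz.1, hz'.ne'⟩).mul (meromorphicAt_sharp (hu.mero _ ⟨hu.conj_mem z hz.1, ?_⟩))).sub
      (MeromorphicAt.const 1 z)
    simpa using hz'.ne'
  have hup : ∀ z ∈ D ∩ upperHP, ∀ᶠ w in 𝓝[≠] z, U w * conj (U (conj w)) = 1 := by
    intro z hz
    have h := meromorphicOrderAt_eq_top_of_ntlim hu.isOpen hu.real_mem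
      (isPreconnected_inter_upperHP hu.isOpen hu.connected hu.conj_mem) hmer ?_ z hz
    · rw [meromorphicOrderAt_eq_top_iff] at h
      filter_upwards [h] with w hw
      exact sub_eq_zero.1 hw
    · filter_upwards [hu.ntlim, hu.unimodular] with x hx h1
      have h2 := hx 2 two_pos
      have h3 : Tendsto U (𝓝[{w : ℂ | 0 < w.im ∧ |w.re - x| < 2 * w.im}] (x : ℂ)) (𝓝 (u x)) := by
        refine h2.mono_left (nhdsWithin_mono _ fun w hw => ?_)
        simp only [mem_ofPred_eq] at hw ⊢
        rw [abs_of_pos hw.1]; exact hw.2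
      have h4 : Tendsto (fun w : ℂ => conj w) (𝓝[{w : ℂ | 0 < w.im ∧ |w.re - x| < 2 * w.im}] (x : ℂ))
          (𝓝[{w : ℂ | |w.re - x| < 2 * |w.im|}] (x : ℂ)) := by
        rw [tendsto_nhdsWithin_iff]
        constructor
        · have := (Complex.continuous_conj.tendsto (x : ℂ))
          rw [Complex.conj_ofReal] at this
          exact this.mono_left nhdsWithin_le_nhds
        · filter_upwards [self_mem_nhdsWithin] with w hw
          simp only [mem_ofPred_eq, Complex.conj_re, Complex.conj_im, abs_neg] at hw ⊢
          rw [abs_of_pos hw.1]; exact hw.2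
      have h5 := (h3.mul ((Complex.continuous_conj.tendsto _).comp (h2.comp h4))).sub_const 1
      rw [Complex.mul_conj, Complex.normSq_eq_norm_sq, h1] at h5
      simpa using h5
  rcases lt_or_gt_of_ne him with h | h
  · have h1 := hup (conj z) ⟨hu.conj_mem z hz, by simpa [upperHP] using h⟩
    filter_upwards [(tendsto_conj_nhdsNE z).eventually h1] with w hw
    have := congrArg conj hw
    simp only [map_mul, Complex.conj_conj, map_one] at this
    rw [mul_comm]
    exact this
  · exact hup z ⟨hz, h⟩

/-! ### Analytic continuation across the real line -/

/-- A continuous function on a disc that is holomorphic off the real line is holomorphic. -/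
theorem differentiableOn_of_off_real {Q : ℂ → ℂ} {c : ℂ} {r : ℝ}
    (hc : ContinuousOn Q (ball c r))
    (hd : ∀ z ∈ ball c r, z.im ≠ 0 → DifferentiableAt ℂ Q z) :
    DifferentiableOn ℂ Q (ball c r) := by
  rw [← Complex.isConservativeOn_and_continuousOn_iff_isDifferentiableOn Metric.isOpen_ball]
  refine ⟨fun z w hzw => ?_, hc⟩
  rw [← add_eq_zero_iff_eq_neg, Complex.wedgeIntegral_add_wedgeIntegral_eq]
  -- rectangles whose interior does not meet the real line
  have base : ∀ z w : ℂ, Complex.Rectangle z w ⊆ ball c r →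
      (∀ y ∈ Ioo (min z.im w.im) (max z.im w.im), y ≠ 0) →
      (∫ x : ℝ in z.re..w.re, Q (x + z.im * I)) -
        (∫ x : ℝ in z.re..w.re, Q (x + w.im * I)) +
        I • (∫ y : ℝ in z.im..w.im, Q (w.re + y * I)) -
        I • (∫ y : ℝ in z.im..w.im, Q (z.re + y * I)) = 0 := by
    intro z w hzw h0
    refine Complex.integral_boundary_rect_eq_zero_of_continuousOn_of_differentiableOn Q z w
      (hc.mono hzw) fun v hv => (hd v (hzw ?_) (h0 _ hv.2)).differentiableWithinAt
    exact ⟨Ioo_subset_Icc_self hv.1, Ioo_subset_Icc_self hv.2⟩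
  by_cases h0 : (0 : ℝ) ∈ uIcc z.im w.im
  · have hsub1 : uIcc z.im 0 ⊆ uIcc z.im w.im := uIcc_subset_uIcc_left h0
    have hsub2 : uIcc 0 w.im ⊆ uIcc z.im w.im := uIcc_subset_uIcc_right h0
    have hne : ∀ a : ℝ, (∀ y ∈ Ioo (min a 0) (max a 0), y ≠ 0) := fun a y hy => by
      rcases le_total a 0 with h | h
      · rw [min_eq_left h, max_eq_right h] at hy; exact hy.2.ne
      · rw [min_eq_right h, max_eq_left h] at hy; exact hy.1.ne'
    have e1 := base z (w.re : ℂ) (by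
      intro v hv
      have hv2 := hv.2
      simp only [Complex.ofReal_im] at hv2
      exact hzw ⟨by simpa using hv.1, hsub1 hv2⟩) (by simpa using hne z.im)
    have e2 := base (z.re : ℂ) w (by
      intro v hv
      have hv2 := hv.2
      simp only [Complex.ofReal_im] at hv2
      exact hzw ⟨by simpa using hv.1, hsub2 hv2⟩) (by simpa [min_comm, max_comm] using hne w.im)
    simp only [Complex.ofReal_re, Complex.ofReal_im, Complex.ofReal_zero, zero_mul, add_zero]
      at e1 e2
    have vert : ∀ a ∈ uIcc z.re w.re, ∀ b₁ b₂ : ℝ, uIcc b₁ b₂ ⊆ uIcc z.im w.im →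
        IntervalIntegrable (fun y : ℝ => Q (a + y * I)) volume b₁ b₂ := by
      intro a ha b₁ b₂ hb
      refine ContinuousOn.intervalIntegrable (hc.comp (by fun_prop) fun y hy => hzw ?_)
      exact ⟨by simpa using ha, by simpa using hb hy⟩
    rw [← intervalIntegral.integral_add_adjacent_intervals (b := 0)
      (vert w.re right_mem_uIcc z.im 0 hsub1) (vert w.re right_mem_uIcc 0 w.im hsub2),
      ← intervalIntegral.integral_add_adjacent_intervals (b := 0)
      (vert z.re left_mem_uIcc z.im 0 hsub1) (vert z.re left_mem_uIcc 0 w.im hsub2), smul_add,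
      smul_add]
    linear_combination e1 + e2
  · refine base z w hzw fun y hy hy0 => h0 ?_
    rw [← hy0]
    exact Ioo_subset_Icc_self hy

theorem hasDerivAt_segment_integral {f : ℂ → ℂ} {Ω : Set ℂ} (hΩ : IsOpen Ω)
    (hf : DifferentiableOn ℂ f Ω) {p : ℝ → ℂ} (hp : Continuous p) {z : ℂ} {r δ : ℝ} (hr : 0 ≤ r)
    (hδ : 0 < δ) (hK : Icc (z.re - δ) (z.re + r + δ) ×ℂ Icc (z.im - δ) (z.im + δ) ⊆ Ω) :
    IntervalIntegrable (fun τ : ℝ => p τ * deriv f (z + τ)) volume 0 r ∧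
    HasDerivAt (fun w => ∫ τ in (0 : ℝ)..r, p τ * f (w + τ))
      (∫ τ in (0 : ℝ)..r, p τ * deriv f (z + τ)) z := by
  set K := Icc (z.re - δ) (z.re + r + δ) ×ℂ Icc (z.im - δ) (z.im + δ)
  have hKc : IsCompact K := isCompact_Icc.reProdIm isCompact_Icc
  have hdc : ContinuousOn (deriv f) Ω := (hf.deriv hΩ).continuousOn
  obtain ⟨C, hC⟩ := hKc.exists_bound_of_continuousOn (hdc.mono hK)
  obtain ⟨B, hB⟩ := (isCompact_Icc (a := (0 : ℝ)) (b := r)).exists_bound_of_continuousOn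
    hp.continuousOn
  have hmem : ∀ w ∈ ball z δ, ∀ τ ∈ Icc (0 : ℝ) r, w + τ ∈ K := by
    intro w hw τ hτ
    have h1 := (Complex.abs_re_le_norm (w - z)).trans (mem_ball_iff_norm.1 hw).le
    have h2 := (Complex.abs_im_le_norm (w - z)).trans (mem_ball_iff_norm.1 hw).le
    rw [Complex.sub_re, abs_le] at h1
    rw [Complex.sub_im, abs_le] at h2
    refine ⟨⟨?_, ?_⟩, ⟨?_, ?_⟩⟩ <;> simp <;> linarith [hτ.1, hτ.2]
  have hIoc : uIoc (0 : ℝ) r = Ioc 0 r := uIoc_of_le hr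
  have hcont : ∀ w ∈ ball z δ, ∀ {g : ℂ → ℂ}, ContinuousOn g Ω →
      ContinuousOn (fun τ : ℝ => p τ * g (w + τ)) (Icc 0 r) := fun w hw g hg =>
    hp.continuousOn.mul (hg.comp (by fun_prop) fun τ hτ => hK (hmem w hw τ hτ))
  have hzb : z ∈ ball z δ := Metric.mem_ball_self hδ
  have hmeas : ∀ w ∈ ball z δ, ∀ {g : ℂ → ℂ}, ContinuousOn g Ω →
      AEStronglyMeasurable (fun τ : ℝ => p τ * g (w + τ)) (volume.restrict (uIoc 0 r)) :=
    fun w hw g hg => by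
      rw [hIoc]
      exact ((hcont w hw hg).mono Ioc_subset_Icc_self).aestronglyMeasurable measurableSet_Ioc
  refine intervalIntegral.hasDerivAt_integral_of_dominated_loc_of_deriv_le (𝕜 := ℂ)
    (F := fun w (τ : ℝ) => p τ * f (w + τ)) (F' := fun w (τ : ℝ) => p τ * deriv f (w + τ))
    (s := ball z δ) (bound := fun _ => B * C) (Metric.ball_mem_nhds z hδ) ?_ ?_ ?_ ?_ ?_ ?_
  · filter_upwards [Metric.ball_mem_nhds z hδ] with w hw
    exact hmeas w hw hf.continuousOn
  · exact ContinuousOn.intervalIntegrable (by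
      rw [uIcc_of_le hr]; exact hcont z hzb hf.continuousOn)
  · exact hmeas z hzb hdc
  · refine Eventually.of_forall fun τ hτ w hw => ?_
    rw [hIoc] at hτ
    have hτ' : τ ∈ Icc 0 r := Ioc_subset_Icc_self hτ
    rw [norm_mul]
    exact mul_le_mul (hB τ hτ') (hC _ (hmem w hw τ hτ')) (norm_nonneg _)
      ((norm_nonneg _).trans (hB τ hτ'))
  · exact intervalIntegrable_const
  · refine Eventually.of_forall fun τ hτ w hw => ?_
    rw [hIoc] at hτ
    have h1 : DifferentiableAt ℂ f (w + τ) :=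
      hf.differentiableAt (hΩ.mem_nhds (hK (hmem w hw τ (Ioc_subset_Icc_self hτ))))
    exact (h1.hasDerivAt.comp_add_const w (τ : ℂ)).const_mul (p τ)

section
variable {f : ℂ → ℂ} {a : ℝ → ℂ} {c r : ℝ}

/-- The values of `f` off the real line, and of `a` on it. -/
def glueFun (f : ℂ → ℂ) (a : ℝ → ℂ) (z : ℂ) : ℂ := if z.im = 0 then a z.re else f z

theorem continuous_window_integral {b : ℝ → ℂ} (hb : LocallyIntegrable b) (r : ℝ) :
    Continuous fun x => ∫ s in x..(x + r), b s := by
  have hi : ∀ x y : ℝ, IntervalIntegrable b volume x y := fun x y =>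
    intervalIntegrable_of_locallyIntegrable hb
  have h1 := intervalIntegral.continuous_primitive hi 0
  have h2 : (fun x => ∫ s in x..(x + r), b s) =
      fun x => (∫ s in (0 : ℝ)..(x + r), b s) - ∫ s in (0 : ℝ)..x, b s := by
    ext x
    rw [intervalIntegral.integral_interval_sub_left (hi _ _) (hi _ _)]
  rw [h2]
  exact (h1.comp (continuous_id.add continuous_const)).sub h1

/-- Weighted horizontal means of a function with integrable boundary values are continuous. -/
theorem tendsto_glueFun_mean (hr : 0 < r) (ha : LocallyIntegrable a)
    (hf : ∀ z : ℂ, |z.re - c| < 3 * r → |z.im| < 3 * r → z.im ≠ 0 → DifferentiableAt ℂ f z)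
    (hlim : Tendsto (fun y : ℝ => ∫ s in (c - 2 * r)..(c + 2 * r), ‖f (s + y * I) - a s‖)
      (𝓝[≠] 0) (𝓝 0)) (α β : ℂ) {x : ℝ} (hx : |x - c| < r) :
    ContinuousAt (fun z : ℂ => ∫ τ in (0 : ℝ)..r, (α - β * τ) * glueFun f a (z + τ)) (x : ℂ) := by
  -- the means of the boundary values
  set q : ℝ → ℂ := fun x => ∫ τ in (0 : ℝ)..r, (α - β * τ) * a (x + τ) with hq
  have hb1 : LocallyIntegrable fun s : ℝ => (s : ℂ) * a s := by
    have := ha.continuous_smul (g := fun s : ℝ => (s : ℂ)) Complex.continuous_ofReal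
    simpa [smul_eq_mul] using this
  have hqc : Continuous q := by
    have h1 : q = fun x : ℝ => (α + β * x) * (∫ s in x..(x + r), a s) -
        β * ∫ s in x..(x + r), (s : ℂ) * a s := by
      ext x
      rw [← intervalIntegral.integral_const_mul, ← intervalIntegral.integral_const_mul,
        ← intervalIntegral.integral_sub
          ((intervalIntegrable_of_locallyIntegrable ha).const_mul _)
          ((intervalIntegrable_of_locallyIntegrable hb1).const_mul _), hq]
      have h2 := intervalIntegral.integral_comp_add_left (a := 0) (b := r)
        (fun s : ℝ => (α + β * x) * a s - β * (s * a s)) x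
      rw [add_zero] at h2
      rw [← h2]
      refine intervalIntegral.integral_congr fun τ _ => ?_
      push_cast
      ring
    rw [h1]
    have h3 := continuous_window_integral ha r
    have h4 := continuous_window_integral hb1 r
    fun_prop
  set ε : ℝ → ℝ := fun y => ∫ s in (c - 2 * r)..(c + 2 * r), ‖glueFun f a (s + y * I) - a s‖
    with hε
  have hε0 : Tendsto ε (𝓝 0) (𝓝 0) := by
    have hzero : ε 0 = 0 := by simp [hε, glueFun]
    have hca : ContinuousAt ε 0 := by
      rw [continuousAt_iff_punctured_nhds, hzero]
      refine hlim.congr' ?_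
      filter_upwards [self_mem_nhdsWithin] with y hy
      refine intervalIntegral.integral_congr fun s _ => ?_
      simp only [glueFun]
      rw [if_neg (by simpa using hy)]
    have := hca.tendsto
    rwa [hzero] at this
  set B : ℝ := ‖α‖ + ‖β‖ * r with hB
  have hclose : ∀ᶠ z : ℂ in 𝓝 (x : ℂ),
      ‖(∫ τ in (0 : ℝ)..r, (α - β * τ) * glueFun f a (z + τ)) - q z.re‖ ≤ B * ε z.im := by
    have c1 : ∀ᶠ z : ℂ in 𝓝 (x : ℂ), |z.re - c| < r := by
      have : Continuous fun z : ℂ => |z.re - c| := by fun_prop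
      exact this.continuousAt.eventually (gt_mem_nhds (by simpa using hx))
    have c2 : ∀ᶠ z : ℂ in 𝓝 (x : ℂ), |z.im| < 3 * r := by
      have : Continuous fun z : ℂ => |z.im| := by fun_prop
      exact this.continuousAt.eventually (gt_mem_nhds (by simp [hr]))
    filter_upwards [c1, c2] with z hz1 hz2
    have hz1' := abs_lt.1 hz1
    have hline : IntervalIntegrable (fun s : ℝ => glueFun f a (s + z.im * I)) volume
        (c - 2 * r) (c + 2 * r) := by
      by_cases hz0 : z.im = 0
      · refine (intervalIntegrable_of_locallyIntegrable ha).congr fun s _ => ?_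
        simp [glueFun, hz0]
      · refine ContinuousOn.intervalIntegrable fun s hs => ?_
        rw [uIcc_of_le (by linarith)] at hs
        have h1 : DifferentiableAt ℂ f (s + z.im * I) := hf _
          (by simp [abs_lt]; constructor <;> linarith [hs.1, hs.2]) (by simpa using hz2)
          (by simpa using hz0)
        have h2 : ContinuousAt (fun s : ℝ => f (s + z.im * I)) s :=
          h1.continuousAt.comp (f := fun s : ℝ => (s : ℂ) + z.im * I)
            (Continuous.continuousAt (by fun_prop))
        refine (h2.congr (Eventually.of_forall fun s => ?_)).continuousWithinAt
        simp [glueFun, hz0]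
    have hzt : ∀ τ : ℝ, z + τ = ((z.re + τ : ℝ) : ℂ) + z.im * I := fun τ => by
      apply Complex.ext <;> simp
    have hsubs : uIcc z.re (z.re + r) ⊆ uIcc (c - 2 * r) (c + 2 * r) := by
      rw [uIcc_of_le (by linarith), uIcc_of_le (by linarith)]
      exact Icc_subset_Icc (by linarith) (by linarith)
    have hline' := hline.mono_set hsubs
    have hpc : Continuous fun s : ℝ => α - β * ((s - z.re : ℝ) : ℂ) := by fun_prop
    have s1 := intervalIntegral.integral_comp_add_left (a := 0) (b := r)
      (fun s : ℝ => (α - β * ((s - z.re : ℝ) : ℂ)) * glueFun f a (s + z.im * I)) z.re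
    have s2 := intervalIntegral.integral_comp_add_left (a := 0) (b := r)
      (fun s : ℝ => (α - β * ((s - z.re : ℝ) : ℂ)) * a s) z.re
    simp only [add_sub_cancel_left, add_zero] at s1 s2
    simp_rw [hzt, hq]
    rw [s1, s2, ← intervalIntegral.integral_sub (hline'.continuousOn_mul hpc.continuousOn)
      ((intervalIntegrable_of_locallyIntegrable ha).continuousOn_mul hpc.continuousOn)]
    have hni : IntervalIntegrable (fun s : ℝ => ‖glueFun f a (s + z.im * I) - a s‖) volume
        (c - 2 * r) (c + 2 * r) :=
      (hline.sub (intervalIntegrable_of_locallyIntegrable ha)).norm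
    calc ‖∫ s in z.re..(z.re + r), (α - β * ((s - z.re : ℝ) : ℂ)) *
            glueFun f a (s + z.im * I) - (α - β * ((s - z.re : ℝ) : ℂ)) * a s‖
        ≤ ∫ s in z.re..(z.re + r), B * ‖glueFun f a (s + z.im * I) - a s‖ := by
          refine intervalIntegral.norm_integral_le_of_norm_le (by linarith)
            (Eventually.of_forall fun s hs => ?_) ((hni.mono_set hsubs).const_mul B)
          rw [← mul_sub, norm_mul]
          refine mul_le_mul_of_nonneg_right ?_ (norm_nonneg _)
          refine (norm_sub_le _ _).trans ?_
          rw [norm_mul, Complex.norm_real, Real.norm_of_nonneg (by linarith [hs.1])]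
          rw [hB]
          gcongr
          linarith [hs.2]
      _ = B * ∫ s in z.re..(z.re + r), ‖glueFun f a (s + z.im * I) - a s‖ :=
          intervalIntegral.integral_const_mul _ _
      _ ≤ B * ε z.im := by
          refine mul_le_mul_of_nonneg_left ?_ (by positivity)
          exact intervalIntegral.integral_mono_interval (by linarith) (by linarith) (by linarith)
            (Eventually.of_forall fun s => norm_nonneg _) hni
  have hval : (∫ τ in (0 : ℝ)..r, (α - β * τ) * glueFun f a ((x : ℂ) + τ)) = q x := by
    simp only [hq]
    refine intervalIntegral.integral_congr fun τ _ => ?_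
    simp [glueFun]
  have hq2 : Tendsto (fun z : ℂ => q z.re) (𝓝 (x : ℂ)) (𝓝 (q x)) := by
    have := (hqc.comp Complex.continuous_re).tendsto (x : ℂ)
    simpa [Function.comp_def] using this
  have hε2 : Tendsto (fun z : ℂ => B * ε z.im) (𝓝 (x : ℂ)) (𝓝 0) := by
    have h1 : Tendsto (fun z : ℂ => z.im) (𝓝 (x : ℂ)) (𝓝 0) := by
      simpa using Complex.continuous_im.tendsto (x : ℂ)
    simpa using (hε0.comp h1).const_mul B
  rw [ContinuousAt, hval]
  have h3 := squeeze_zero_norm' hclose hε2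
  simpa using h3.add hq2

/-- A function that is holomorphic off the real line, and has the same integrable boundary values
from both sides, continues analytically across the real line. -/
theorem exists_continuation (hr : 0 < r) (ha : LocallyIntegrable a)
    (hf : ∀ z : ℂ, |z.re - c| < 3 * r → |z.im| < 3 * r → z.im ≠ 0 → DifferentiableAt ℂ f z)
    (hlim : Tendsto (fun y : ℝ => ∫ s in (c - 2 * r)..(c + 2 * r), ‖f (s + y * I) - a s‖)
      (𝓝[≠] 0) (𝓝 0)) :
    ∃ g : ℂ → ℂ, DifferentiableOn ℂ g (ball (c : ℂ) r) ∧
      ∀ z ∈ ball (c : ℂ) r, z.im ≠ 0 → g z = f z := by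
  set Q : ℂ → ℂ → ℂ → ℂ := fun α β z => ∫ τ in (0 : ℝ)..r, (α - β * τ) * glueFun f a (z + τ) with hQ
  set Ω : Set ℂ := {z | |z.re - c| < 3 * r ∧ |z.im| < 3 * r ∧ z.im ≠ 0} with hΩ
  have hΩo : IsOpen Ω := by
    have c1 : Continuous fun z : ℂ => |z.re - c| := by fun_prop
    have c2 : Continuous fun z : ℂ => |z.im| := by fun_prop
    refine (isOpen_lt c1 continuous_const).inter ((isOpen_lt c2 continuous_const).inter ?_)
    exact isOpen_ne_fun Complex.continuous_im continuous_const
  have hfΩ : DifferentiableOn ℂ f Ω := fun z hz =>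
    (hf z hz.1 hz.2.1 hz.2.2).differentiableWithinAt
  have hball : ∀ z ∈ ball (c : ℂ) r, |z.re - c| < r ∧ |z.im| < r := fun z hz => by
    have h1 := (Complex.abs_re_le_norm (z - c)).trans_lt (mem_ball_iff_norm.1 hz)
    have h2 := (Complex.abs_im_le_norm (z - c)).trans_lt (mem_ball_iff_norm.1 hz)
    simpa using And.intro h1 h2
  have hder : ∀ α β : ℂ, ∀ z ∈ ball (c : ℂ) r, z.im ≠ 0 →
      IntervalIntegrable (fun τ : ℝ => (α - β * τ) * deriv f (z + τ)) volume 0 r ∧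
      HasDerivAt (Q α β) (∫ τ in (0 : ℝ)..r, (α - β * τ) * deriv f (z + τ)) z := by
    intro α β z hz hz0
    obtain ⟨h1, h2⟩ := hball z hz
    have hpos : 0 < |z.im| := abs_pos.2 hz0
    obtain ⟨δ, hδ⟩ : ∃ δ : ℝ, δ = min |z.im| r / 2 := ⟨_, rfl⟩
    have hδ0 : 0 < δ := by rw [hδ]; have := lt_min hpos hr; positivity
    have hδ1 : δ < |z.im| := by rw [hδ]; have := min_le_left |z.im| r; linarith
    have hδ2 : δ < r := by rw [hδ]; have := min_le_right |z.im| r; linarith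
    obtain ⟨i1, i2⟩ := hasDerivAt_segment_integral hΩo hfΩ (p := fun τ : ℝ => α - β * τ)
      (by fun_prop) (z := z) (r := r) (δ := δ) hr.le hδ0 (by
        intro w hw
        obtain ⟨⟨w1, w2⟩, ⟨w3, w4⟩⟩ := hw
        rw [abs_lt] at h1 h2
        refine ⟨?_, ?_, ?_⟩
        · rw [abs_lt]; constructor <;> linarith
        · rw [abs_lt]; constructor <;> linarith
        · intro hw0
          rcases lt_or_gt_of_ne hz0 with h | h
          · rw [abs_of_neg h] at hδ1; linarith
          · rw [abs_of_pos h] at hδ1; linarith)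
    refine ⟨i1, i2.congr_of_eventuallyEq ?_⟩
    have : ∀ᶠ w : ℂ in 𝓝 z, w.im ≠ 0 := Complex.continuous_im.continuousAt.eventually_ne hz0
    filter_upwards [this] with w hw
    simp only [hQ]
    refine intervalIntegral.integral_congr fun τ _ => ?_
    simp only [glueFun]
    rw [if_neg (by simpa using hw)]
  have hQd : ∀ α β : ℂ, DifferentiableOn ℂ (Q α β) (ball (c : ℂ) r) := fun α β => by
    refine differentiableOn_of_off_real (fun z hz => ?_)
      fun z hz hz0 => (hder α β z hz hz0).2.differentiableAt
    by_cases hz0 : z.im = 0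
    · have hzr : z = (z.re : ℂ) := by apply Complex.ext <;> simp [hz0]
      have := tendsto_glueFun_mean hr ha hf hlim α β (x := z.re) (hball z hz).1
      rw [← hzr] at this
      exact this.continuousWithinAt
    · exact (hder α β z hz hz0).2.continuousAt.continuousWithinAt
  refine ⟨fun z => (Q 1 0 z - deriv (Q r 1) z) / r, ?_, fun z hz hz0 => ?_⟩
  · exact ((hQd 1 0).sub ((hQd r 1).deriv Metric.isOpen_ball)).div_const _
  · obtain ⟨i1, i2⟩ := hder r 1 z hz hz0
    obtain ⟨h1, h2⟩ := hball z hz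
    rw [abs_lt] at h1 h2
    have hzΩ : ∀ τ ∈ Icc (0 : ℝ) r, z + τ ∈ Ω := fun τ hτ => by
      refine ⟨?_, ?_, ?_⟩
      · rw [abs_lt]; constructor <;> simp <;> linarith [hτ.1, hτ.2]
      · rw [abs_lt]; constructor <;> simp <;> linarith
      · simpa using hz0
    have hc0 : IntervalIntegrable (fun τ : ℝ => f (z + τ)) volume 0 r := by
      refine ContinuousOn.intervalIntegrable ?_
      rw [uIcc_of_le hr.le]
      exact hfΩ.continuousOn.comp (by fun_prop) hzΩ
    have hparts := intervalIntegral.integral_eq_sub_of_hasDerivAt (a := 0) (b := r)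
      (f := fun τ : ℝ => ((r : ℂ) - 1 * τ) * f (z + τ))
      (f' := fun τ : ℝ => (r - 1 * τ) * deriv f (z + τ) - f (z + τ)) (fun τ hτ => by
        rw [uIcc_of_le hr.le] at hτ
        have d1 : HasDerivAt f (deriv f (z + τ)) (z + τ) :=
          (hfΩ.differentiableAt (hΩo.mem_nhds (hzΩ τ hτ))).hasDerivAt
        have d2 : HasDerivAt (fun τ : ℝ => f (z + τ)) (deriv f (z + τ)) τ := by
          have d3 : HasDerivAt (fun τ : ℝ => z + (τ : ℂ)) 1 τ := by
            simpa using (Complex.ofRealCLM.hasDerivAt (x := τ)).const_add z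
          have := d1.scomp τ d3
          simpa using! this
        have d4 : HasDerivAt (fun τ : ℝ => (r : ℂ) - 1 * τ) (-1) τ := by
          simpa using ((Complex.ofRealCLM.hasDerivAt (x := τ))).const_sub (r : ℂ)
        have d5 := d4.mul d2
        rwa [neg_one_mul, neg_add_eq_sub] at d5) (i1.sub hc0)
    rw [intervalIntegral.integral_sub i1 hc0] at hparts
    simp only [Complex.ofReal_zero, mul_zero, sub_zero, one_mul, sub_self, zero_mul, zero_sub,
      add_zero] at hparts
    have hQ1 : Q 1 0 z = ∫ τ in (0 : ℝ)..r, f (z + τ) := by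
      simp only [hQ]
      refine intervalIntegral.integral_congr fun τ _ => ?_
      simp only [glueFun]
      rw [if_neg (by simpa using hz0)]
      ring
    have hr' : (r : ℂ) ≠ 0 := by exact_mod_cast hr.ne'
    simp only
    rw [i2.deriv, hQ1, div_eq_iff hr']
    simp only [one_mul]
    linear_combination -hparts

end

/-! ### Functions in the upper half-plane and their boundary values -/

/-- The function `e^{itz} (d/2 - (iz/2) ∫_0^∞ m(x) e^{izx} dx)` in the upper half-plane. -/
def upF (t : ℝ) (d : ℂ) (m : L2) (z : ℂ) : ℂ :=
  Complex.exp (I * t * z) * (d / 2 - I * z / 2 * LT m z)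

/-- The boundary values of `upF`. -/
def bdF (t : ℝ) (d : ℂ) (m : L2) (x : ℝ) : ℂ :=
  Complex.exp (I * t * x) * (d / 2 - I * x / 2 * FL m x)

section
variable {t : ℝ} {d : ℂ} {m : L2}

theorem differentiableAt_upF {z : ℂ} (hz : 0 < z.im) : DifferentiableAt ℂ (upF t d m) z := by
  have h := differentiableAt_LT m hz
  unfold upF
  fun_prop

theorem analyticAt_upF {z : ℂ} (hz : 0 < z.im) : AnalyticAt ℂ (upF t d m) z := by
  rw [Complex.analyticAt_iff_eventually_differentiableAt]
  filter_upwards [Complex.continuous_im.continuousAt.eventually (lt_mem_nhds hz)] with w hw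
  exact differentiableAt_upF hw

theorem norm_LT_le (m : L2) {z : ℂ} (hz : 0 < z.im) :
    ‖LT m z‖ ≤ ‖m‖ / Real.sqrt (2 * z.im) := by
  rw [← Real.sqrt_sq (norm_nonneg (LT m z)), ← Real.sqrt_sq (norm_nonneg m), ← Real.sqrt_div
    (sq_nonneg _)]
  exact Real.sqrt_le_sqrt (by rw [div_eq_mul_inv]; exact norm_LT_sq_le m hz)

theorem ae_tendsto_upF (hm : IsCausal m) : ∀ᵐ x : ℝ, ∀ M : ℝ, 0 < M →
    Tendsto (upF t d m) (𝓝[{w : ℂ | 0 < w.im ∧ |w.re - x| < M * w.im}] (x : ℂ))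
      (𝓝 (bdF t d m x)) := by
  filter_upwards [hm.ae_tendsto_LT] with x hx M hM
  have h1 : Tendsto (fun z : ℂ => Complex.exp (I * t * z))
      (𝓝[{w : ℂ | 0 < w.im ∧ |w.re - x| < M * w.im}] (x : ℂ))
      (𝓝 (Complex.exp (I * t * x))) :=
    (Continuous.tendsto (by fun_prop) _).mono_left nhdsWithin_le_nhds
  have h2 : Tendsto (fun z : ℂ => I * z / 2)
      (𝓝[{w : ℂ | 0 < w.im ∧ |w.re - x| < M * w.im}] (x : ℂ)) (𝓝 (I * x / 2)) :=
    (Continuous.tendsto (by fun_prop) _).mono_left nhdsWithin_le_nhds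
  exact h1.mul (tendsto_const_nhds.sub (h2.mul (hx M hM)))

/-- The integral of the absolute value over an interval is bounded by the norm in `L²`. -/
theorem integral_norm_le_L2 (f : L2) {a b : ℝ} (hab : a ≤ b) :
    ∫ x in a..b, ‖f x‖ ≤ Real.sqrt (b - a) * ‖f‖ := by
  have h1 : MemLp (fun x => ‖f x‖) (ENNReal.ofReal 2) (volume.restrict (Ioc a b)) := by
    rw [show ENNReal.ofReal 2 = 2 by simp]
    exact (memLp_coe f).norm.restrict _
  have h2 : MemLp (fun _ : ℝ => (1 : ℝ)) (ENNReal.ofReal 2) (volume.restrict (Ioc a b)) :=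
    memLp_const 1
  have h3 := integral_mul_le_Lp_mul_Lq_of_nonneg Real.HolderConjugate.two_two
    (μ := volume.restrict (Ioc a b)) (Eventually.of_forall fun _ => zero_le_one)
    (Eventually.of_forall fun x => norm_nonneg (f x)) h2 h1
  rw [intervalIntegral.integral_of_le hab]
  simp only [one_mul] at h3
  refine h3.trans ?_
  rw [← Real.sqrt_eq_rpow, ← Real.sqrt_eq_rpow]
  refine mul_le_mul ?_ ?_ (Real.sqrt_nonneg _) (Real.sqrt_nonneg _)
  · apply Real.sqrt_le_sqrt
    simp [hab]
  · rw [← Real.sqrt_sq (norm_nonneg f), norm_sq_eq_integral]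
    apply Real.sqrt_le_sqrt
    simp only [Real.rpow_ofNat]
    exact setIntegral_le_integral ((memLp_two_iff_integrable_sq_norm (memLp_coe f).1).1 (memLp_coe f))
      (Eventually.of_forall fun x => sq_nonneg _)

theorem locallyIntegrable_bdF : LocallyIntegrable (bdF t d m) := by
  have h1 : LocallyIntegrable fun x : ℝ => d / 2 - I * x / 2 * FL m x := by
    have h2 := (L2_locallyIntegrable (FL m)).continuous_smul
      (g := fun x : ℝ => I * x / 2) (by fun_prop)
    exact (locallyIntegrable_const (d / 2)).sub h2
  exact h1.continuous_smul (g := fun x : ℝ => Complex.exp (I * t * x)) (by fun_prop)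

/-- Convergence to the boundary values in the mean. -/
theorem tendsto_integral_upF (hm : IsCausal m) {a b : ℝ} (hab : a ≤ b) :
    Tendsto (fun y : ℝ => ∫ s in a..b, ‖upF t d m (s + y * I) - bdF t d m s‖) (𝓝[>] 0)
      (𝓝 0) := by
  obtain ⟨G, hG, hGe⟩ := hm.exists_LT_line
  set e : ℝ → ℝ → ℂ := fun y s => Complex.exp (I * t * (s + y * I)) with he
  set i : ℝ → ℝ → ℂ := fun y s => I * (s + y * I) / 2 with hi
  -- the terms of the difference
  have hbound : ∃ C : ℝ, 0 ≤ C ∧ ∀ y ∈ Icc (0 : ℝ) 1, ∀ s ∈ Icc a b, ‖e y s * i y s‖ ≤ C := by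
    have hK : IsCompact (Icc (0 : ℝ) 1 ×ˢ Icc a b) := isCompact_Icc.prod isCompact_Icc
    have hc : Continuous fun p : ℝ × ℝ => e p.1 p.2 * i p.1 p.2 := by
      simp only [he, hi]; fun_prop
    obtain ⟨C, hC⟩ := hK.exists_bound_of_continuousOn hc.continuousOn
    exact ⟨max C 0, le_max_right _ _, fun y hy s hs => (hC (y, s) ⟨hy, hs⟩).trans (le_max_left _ _)⟩
  obtain ⟨C, hC0, hC⟩ := hbound
  have hT1 : Tendsto (fun y : ℝ => C * (Real.sqrt (b - a) * ‖G y - FL m‖)) (𝓝[>] 0) (𝓝 0) := by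
    have := ((tendsto_iff_norm_sub_tendsto_zero.1 hG).const_mul (Real.sqrt (b - a))).const_mul C
    simpa using this
  set R : ℝ → ℝ → ℂ := fun y s => (e y s - e 0 s) * (d / 2) - (e y s * i y s - e 0 s * i 0 s) * FL m s
    with hR
  have hT2 : Tendsto (fun y : ℝ => ∫ s in a..b, ‖R y s‖) (𝓝[>] 0) (𝓝 0) := by
    have hK : IsCompact (Icc (0 : ℝ) 1 ×ˢ Icc a b) := isCompact_Icc.prod isCompact_Icc
    have hc : Continuous fun p : ℝ × ℝ => e p.1 p.2 := by simp only [he]; fun_prop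
    obtain ⟨C', hC'⟩ := hK.exists_bound_of_continuousOn hc.continuousOn
    have hz : (∫ s in a..b, ‖R 0 s‖) = 0 := by
      rw [intervalIntegral.integral_congr (g := fun _ => (0 : ℝ)) fun s _ => by simp [hR]]
      simp
    have key : Tendsto (fun y : ℝ => ∫ s in a..b, ‖R y s‖) (𝓝[>] 0) (𝓝 (∫ s in a..b, ‖R 0 s‖)) := by
      have hFLi : IntervalIntegrable (fun s => ‖FL m s‖) volume a b :=
        (intervalIntegrable_of_locallyIntegrable (L2_locallyIntegrable (FL m))).norm
      have hcm : ∀ y, Continuous (e y) := fun y => by simp only [he]; fun_prop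
      have hci : ∀ y, Continuous (i y) := fun y => by simp only [hi]; fun_prop
      refine intervalIntegral.tendsto_integral_filter_of_dominated_convergence
        (fun s => (C' + C') * ‖d / 2‖ + (C + C) * ‖FL m s‖) (Eventually.of_forall fun y => ?_) ?_
        (intervalIntegrable_const.add (hFLi.const_mul _)) (Eventually.of_forall fun s _ => ?_)
      · refine AEStronglyMeasurable.norm (AEStronglyMeasurable.sub ?_ (AEStronglyMeasurable.mul ?_
          (memLp_coe (FL m)).1.restrict))
        · exact (((hcm y).sub (hcm 0)).mul continuous_const).aestronglyMeasurable
        · exact (((hcm y).mul (hci y)).sub ((hcm 0).mul (hci 0))).aestronglyMeasurable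
      · have : ∀ᶠ y : ℝ in 𝓝[>] 0, y < 1 := nhdsWithin_le_nhds (gt_mem_nhds one_pos)
        filter_upwards [this, self_mem_nhdsWithin] with y hy1 hy0
        have hy0' : 0 < y := hy0
        refine Eventually.of_forall fun s hs => ?_
        rw [uIoc_of_le hab] at hs
        have hs' : s ∈ Icc a b := Ioc_subset_Icc_self hs
        have hy : y ∈ Icc (0 : ℝ) 1 := ⟨hy0'.le, hy1.le⟩
        have h0 : (0 : ℝ) ∈ Icc (0 : ℝ) 1 := ⟨le_rfl, zero_le_one⟩
        rw [norm_norm]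
        refine (norm_sub_le _ _).trans ?_
        rw [norm_mul, norm_mul]
        gcongr
        · exact (norm_sub_le _ _).trans (add_le_add (hC' (y, s) ⟨hy, hs'⟩) (hC' (0, s) ⟨h0, hs'⟩))
        · exact (norm_sub_le _ _).trans (add_le_add (hC y hy s hs') (hC 0 h0 s hs'))
      · have hc2 : Continuous fun y : ℝ => ‖R y s‖ := by
          simp only [hR, he, hi]; fun_prop
        exact (hc2.tendsto 0).mono_left nhdsWithin_le_nhds
    rwa [hz] at key
  have hsum := hT1.add hT2
  rw [add_zero] at hsum
  refine squeeze_zero' (Eventually.of_forall fun y =>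
    intervalIntegral.integral_nonneg hab fun s _ => norm_nonneg _) ?_ hsum
  have : ∀ᶠ y : ℝ in 𝓝[>] 0, y < 1 := nhdsWithin_le_nhds (gt_mem_nhds one_pos)
  filter_upwards [this, self_mem_nhdsWithin] with y hy1 hy0
  have hy0' : 0 < y := hy0
  have hRi : IntervalIntegrable (fun s => ‖R y s‖) volume a b := by
    have h1 : LocallyIntegrable (R y) := by
      refine LocallyIntegrable.sub (Continuous.locallyIntegrable ?_) ?_
      · simp only [he]; fun_prop
      · exact (L2_locallyIntegrable (FL m)).continuous_smul
          (g := fun s => e y s * i y s - e 0 s * i 0 s) (by simp only [he, hi]; fun_prop)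
    exact (intervalIntegrable_of_locallyIntegrable h1).norm
  have hDi : IntervalIntegrable (fun s => ‖(G y - FL m : L2) s‖) volume a b :=
    (intervalIntegrable_of_locallyIntegrable (L2_locallyIntegrable _)).norm
  have hle : ∀ᵐ s : ℝ, s ∈ Ioc a b → ‖upF t d m (s + y * I) - bdF t d m s‖ ≤
      C * ‖(G y - FL m : L2) s‖ + ‖R y s‖ := by
    filter_upwards [hGe y hy0', Lp.coeFn_sub (G y) (FL m)] with s h1 h2 hs
    have hs' : s ∈ Icc a b := Ioc_subset_Icc_self hs
    have e1 : upF t d m (s + y * I) - bdF t d m s =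
        -(e y s * i y s * (G y - FL m : L2) s) + R y s := by
      rw [h2, Pi.sub_apply, h1]
      simp only [upF, bdF, hR, he, hi, Complex.ofReal_zero, zero_mul, add_zero]
      ring
    rw [e1]
    refine (norm_add_le _ _).trans ?_
    rw [norm_neg, norm_mul]
    gcongr
    exact hC y ⟨hy0'.le, hy1.le⟩ s hs'
  calc ∫ s in a..b, ‖upF t d m (s + y * I) - bdF t d m s‖
      ≤ ∫ s in a..b, (C * ‖(G y - FL m : L2) s‖ + ‖R y s‖) := by
        refine intervalIntegral.integral_mono_ae_restrict hab ?_
          ((hDi.const_mul C).add hRi) ?_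
        · refine IntervalIntegrable.norm (IntervalIntegrable.sub ?_
            (intervalIntegrable_of_locallyIntegrable locallyIntegrable_bdF))
          refine ContinuousOn.intervalIntegrable fun s _ => ContinuousAt.continuousWithinAt ?_
          exact (differentiableAt_upF (by simpa using hy0')).continuousAt.comp
            (f := fun s : ℝ => (s : ℂ) + y * I) (Continuous.continuousAt (by fun_prop))
        · rw [EventuallyLE, ae_restrict_iff' measurableSet_Icc]
          filter_upwards [hle, Measure.ae_ne volume a] with s h1 h2 h3
          exact h1 ⟨lt_of_le_of_ne h3.1 (Ne.symm h2), h3.2⟩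
    _ = C * (∫ s in a..b, ‖(G y - FL m : L2) s‖) + ∫ s in a..b, ‖R y s‖ := by
        rw [intervalIntegral.integral_add (hDi.const_mul C) hRi, intervalIntegral.integral_const_mul]
    _ ≤ _ := by
        gcongr
        exact integral_norm_le_L2 _ hab

end

/-! ### The tail of a solution -/

section
variable {u : ℝ → ℂ} {c : ℂ} {k : L2} {e : ℂ} {t : ℝ} {f : L2}

/-- The tail of a solution, translated to the half-line `[0, ∞)`. -/
def tailM (u : ℝ → ℂ) (c : ℂ) (k : L2) (e : ℂ) (t : ℝ) (f : L2) : L2 := tr t (tailPart u c k e t f)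

theorem IsPart.isCausal (h : IsPart u c k e t f) : IsCausal (tailM u c k e t f) := by
  filter_upwards [tr_coe t (tailPart u c k e t f), ae_comp_add h.tail_ae.1 t] with x h1 h2 hx
  rw [tailM, h1]
  exact h2 (by linarith)

theorem density_eq_bdF : density u c k e t f =ᵐ[volume]
    bdF t (e + conj e * c) (tailM u c k e t f) := by
  have h0 : tailPart u c k e t f = tr (-t) (tailM u c k e t f) := by
    rw [tailM, tr_tr, neg_add_cancel, tr_zero]
  filter_upwards [FL_coe (tailPart u c k e t f), FL_coe (tailM u c k e t f),
    ae_comp_mul (fourier_tr (-t) (tailM u c k e t f)) neg_two_pi_inv_ne] with x h1 h2 h3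
  rw [density, bdF, h1, h2, h0, h3]
  have hp : (Real.pi : ℂ) ≠ 0 := by exact_mod_cast Real.pi_ne_zero
  have he : Complex.exp (2 * Real.pi * ((-t : ℝ) : ℂ) * ((-(2 * Real.pi)⁻¹ * x : ℝ) : ℂ) *
      I) = Complex.exp (I * t * x) := by
    congr 1
    push_cast
    field_simp
  rw [he]
  ring

theorem IsPart.integrableOn_exp (h : IsPart u c k e t f) {z : ℂ} (hz : 0 < z.im) :
    IntegrableOn (fun x : ℝ => solFun u c k e t f x * Complex.exp (I * z * x)) (Ici t) ∧
    upF t (e + conj e * c) (tailM u c k e t f) z = -(I * z / 2) *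
      ∫ x in Ici t, solFun u c k e t f x * Complex.exp (I * z * x) := by
  have hz0 : z ≠ 0 := fun h0 => by rw [h0] at hz; simp at hz
  have hre : (I * z).re < 0 := by simpa using hz
  have i1 : IntegrableOn (fun x : ℝ => (e + conj e * c) * Complex.exp (I * z * x)) (Ici t) := by
    rw [integrableOn_Ici_iff_integrableOn_Ioi]
    exact (integrableOn_exp_mul_complex_Ioi hre t).const_mul _
  have hshift := integrable_mul_lk (tailM u c k e t f) hz
  -- the translate of the integrand on the half-line
  have e1 : ∀ᵐ x : ℝ, tailPart u c k e t f x * Complex.exp (I * z * x) =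
      Complex.exp (I * t * z) * (tailM u c k e t f (x + -t) * lk z (x + -t)) := by
    filter_upwards [ae_comp_add (tr_coe t (tailPart u c k e t f)) (-t), h.tail_ae.1] with x h1 h2
    rw [tailM, h1, neg_add_cancel_right]
    rcases lt_or_ge x t with hx | hx
    · rw [h2 hx]; ring
    · rw [lk, indicator_of_mem (show x + -t ∈ Ici (0 : ℝ) from by simpa using hx), mul_left_comm,
        ← Complex.exp_add]
      congr 2
      push_cast
      ring
  have i2 : Integrable fun x : ℝ => tailPart u c k e t f x * Complex.exp (I * z * x) := by
    refine Integrable.congr ?_ (e1.mono fun x hx => hx.symm)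
    exact (hshift.comp_add_right (-t)).const_mul _
  have e2 : ∫ x : ℝ, tailPart u c k e t f x * Complex.exp (I * z * x) =
      Complex.exp (I * t * z) * LT (tailM u c k e t f) z := by
    rw [integral_congr_ae e1, integral_const_mul,
      integral_add_right_eq_self (fun x => tailM u c k e t f x * lk z x) (-t), LT]
  have e3 : ∀ᵐ x : ℝ, x ∈ Ici t → solFun u c k e t f x * Complex.exp (I * z * x) =
      (e + conj e * c) * Complex.exp (I * z * x) +
      tailPart u c k e t f x * Complex.exp (I * z * x) := by
    filter_upwards [h.tail_ae.2] with x h1 hx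
    rw [h1 hx]; ring
  have e4 : ∫ x in Ici t, tailPart u c k e t f x * Complex.exp (I * z * x) =
      ∫ x : ℝ, tailPart u c k e t f x * Complex.exp (I * z * x) := by
    rw [← integral_indicator measurableSet_Ici]
    refine integral_congr_ae ?_
    filter_upwards [h.tail_ae.1] with x h1
    by_cases hx : x ∈ Ici t
    · rw [indicator_of_mem hx]
    · rw [indicator_of_notMem hx, h1 (not_le.1 hx), zero_mul]
  constructor
  · refine (i1.add i2.integrableOn).congr ?_
    rw [EventuallyEq, ae_restrict_iff' measurableSet_Ici]
    filter_upwards [e3] with x h1 hx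
    exact (h1 hx).symm
  · rw [setIntegral_congr_ae measurableSet_Ici e3, integral_add i1 i2.integrableOn, e4, e2,
      integral_const_mul, integral_Ici_eq_integral_Ioi, integral_exp_mul_complex_Ioi hre, upF]
    have hI : I ≠ 0 := Complex.I_ne_zero
    rw [show I * z * (t : ℂ) = I * t * z by ring]
    field_simp
    ring

end

/-! ### Extension to the lower half-plane -/

/-- The extension of a function `f` in the upper half-plane by `U f^♯` to the lower half-plane. -/
def extF (U : ℂ → ℂ) (D : Set ℂ) (f : ℂ → ℂ) (z : ℂ) : ℂ :=
  if 0 < z.im then f z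
  else if z.im < 0 then toMeromorphicNFOn (fun w => U w * sharp f w) (D ∩ {w | w.im < 0}) z
  else limUnder (𝓝[upperHP] z) f

/-- `f` is analytic in the upper half-plane and has the boundary values `a`, in the mean and
non-tangentially, with `a = u * conj a`. -/
structure HasBdVal (u : ℝ → ℂ) (f : ℂ → ℂ) (a : ℝ → ℂ) : Prop where
  analytic : ∀ z : ℂ, 0 < z.im → AnalyticAt ℂ f z
  locInt : LocallyIntegrable a
  mean : ∀ p q : ℝ, p ≤ q →
    Tendsto (fun y : ℝ => ∫ s in p..q, ‖f (s + y * I) - a s‖) (𝓝[>] 0) (𝓝 0)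
  ntlim : ∀ᵐ x : ℝ, ∀ M : ℝ, 0 < M →
    Tendsto f (𝓝[{w : ℂ | 0 < w.im ∧ |w.re - x| < M * w.im}] (x : ℂ)) (𝓝 (a x))
  sym : ∀ᵐ x : ℝ, a x = u x * conj (a x)

theorem isOpen_lower : IsOpen {w : ℂ | w.im < 0} := isOpen_lt Complex.continuous_im continuous_const

section
variable {u : ℝ → ℂ} {D : Set ℂ} {U : ℂ → ℂ} {f : ℂ → ℂ} {a : ℝ → ℂ}

theorem extF_eventuallyEq_upper {z : ℂ} (hz : 0 < z.im) : extF U D f =ᶠ[𝓝 z] f := by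
  filter_upwards [Complex.continuous_im.continuousAt.eventually (lt_mem_nhds hz)] with w hw
  exact if_pos hw

theorem HasBdVal.analyticAt_upper (hf : HasBdVal u f a) {z : ℂ} (hz : 0 < z.im) :
    AnalyticAt ℂ (extF U D f) z :=
  (hf.analytic z hz).congr (extF_eventuallyEq_upper hz).symm

theorem HasBdVal.analyticAt_sharp (hf : HasBdVal u f a) {z : ℂ} (hz : z.im < 0) :
    AnalyticAt ℂ (sharp f) z :=
  UniSys.analyticAt_sharp (hf.analytic _ (by simpa using hz))

theorem extF_eventuallyEq_lower {z : ℂ} (hz : z.im < 0) : extF U D f =ᶠ[𝓝 z]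
    toMeromorphicNFOn (fun w => U w * sharp f w) (D ∩ {w | w.im < 0}) := by
  filter_upwards [isOpen_lower.mem_nhds hz] with w hw
  exact (if_neg (not_lt.2 (le_of_lt hw))).trans (if_pos hw)

theorem HasBdVal.meromorphicOn_lower (hf : HasBdVal u f a) (hu : IsUloc u D U) :
    MeromorphicOn (fun w => U w * sharp f w) (D ∩ {w | w.im < 0}) := fun z hz =>
  (hu.mero z ⟨hz.1, ne_of_lt hz.2⟩).mul (hf.analyticAt_sharp hz.2).meromorphicAt

theorem meromorphicNFAt_lower {z : ℂ} (hz : z ∈ D) (hz' : z.im < 0) :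
    MeromorphicNFAt (extF U D f) z :=
  (meromorphicNFAt_congr (extF_eventuallyEq_lower hz')).2
    (meromorphicNFOn_toMeromorphicNFOn _ _ ⟨hz, hz'⟩)

theorem HasBdVal.eventuallyEq_lower (hf : HasBdVal u f a) (hu : IsUloc u D U) {z : ℂ} (hz : z ∈ D)
    (hz' : z.im < 0) : extF U D f =ᶠ[𝓝[≠] z] fun w => U w * sharp f w :=
  ((extF_eventuallyEq_lower hz').filter_mono nhdsWithin_le_nhds).trans
    ((hf.meromorphicOn_lower hu).toMeromorphicNFOn_eq_self_on_nhdsNE ⟨hz, hz'⟩)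

theorem HasBdVal.eventuallyEq_lower_of_analyticAt (hf : HasBdVal u f a) (hu : IsUloc u D U) {z : ℂ}
    (hz : z ∈ D) (hz' : z.im < 0) (hU : AnalyticAt ℂ U z) :
    extF U D f =ᶠ[𝓝 z] fun w => U w * sharp f w :=
  ((meromorphicNFAt_lower hz hz').eventuallyEq_nhdsNE_iff_eventuallyEq_nhds
    (hU.mul (hf.analyticAt_sharp hz')).meromorphicNFAt).1 (hf.eventuallyEq_lower hu hz hz')

theorem HasBdVal.meromorphicNFOn (hf : HasBdVal u f a) :
    MeromorphicNFOn (extF U D f) ((upperHP ∪ D) \ realLine) := by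
  rintro z ⟨hz, hr⟩
  rcases lt_trichotomy z.im 0 with h | h | h
  · exact meromorphicNFAt_lower (hz.resolve_left fun h' => h.not_gt h') h
  · exact absurd h hr
  · exact (hf.analyticAt_upper h).meromorphicNFAt

/-- The functional equation of the extension. -/
theorem HasBdVal.functional_eq (hf : HasBdVal u f a) (hu : IsUloc u D U) {z : ℂ} (hz : z ∈ D)
    (hz' : z.im ≠ 0) (hU : AnalyticAt ℂ U z) (ha : AnalyticAt ℂ (extF U D f) (conj z)) :
    extF U D f z = U z * conj (extF U D f (conj z)) := by
  rcases lt_or_gt_of_ne hz' with h | h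
  · rw [(hf.eventuallyEq_lower_of_analyticAt hu hz h hU).self_of_nhds, (extF_eventuallyEq_upper (show 0 < (conj z).im by simpa using h)).self_of_nhds]
    rfl
  · have hc : (conj z).im < 0 := by simpa using h
    have h1 : Tendsto (extF U D f) (𝓝[≠] z) (𝓝 (extF U D f z)) :=
      (hf.analyticAt_upper h).continuousAt.tendsto.mono_left nhdsWithin_le_nhds
    have h2 : Tendsto (fun w => U w * sharp (extF U D f) w) (𝓝[≠] z)
        (𝓝 (U z * sharp (extF U D f) z)) :=
      (hU.mul (UniSys.analyticAt_sharp ha)).continuousAt.tendsto.mono_left nhdsWithin_le_nhds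
    refine tendsto_nhds_unique h1 (h2.congr' ?_)
    filter_upwards [hu.eventually_mul_conj hz hz', (tendsto_conj_nhdsNE z).eventually
      (hf.eventuallyEq_lower hu (hu.conj_mem z hz) hc),
      eventually_ne_of_eventually (extF_eventuallyEq_upper (U := U) (D := D) (f := f) h)]
      with w e1 e2 e3
    rw [sharp, e2, e3, sharp, Complex.conj_conj, map_mul, Complex.conj_conj, ← mul_assoc, e1, one_mul]

/-- Non-tangential limits of the extension. -/
theorem HasBdVal.ae_ntlim (hf : HasBdVal u f a) (hu : IsUloc u D U) :
    ∀ᵐ x : ℝ, NTLim (extF U D f) x (a x) := by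
  filter_upwards [hf.ntlim, hu.ntlim, hf.sym] with x h1 h2 h3 M hM
  set S₁ : Set ℂ := {w : ℂ | 0 < w.im ∧ |w.re - x| < M * w.im} with hS₁
  set S₂ : Set ℂ := D ∩ {w : ℂ | w.im < 0 ∧ |w.re - x| < M * |w.im|} with hS₂
  have hup : Tendsto (extF U D f) (𝓝[S₁] x) (𝓝 (a x)) := by
    refine (h1 M hM).congr' ?_
    filter_upwards [self_mem_nhdsWithin] with w hw
    exact (if_pos hw.1).symm
  have hprod : Tendsto (fun w => U w * sharp f w) (𝓝[S₂] x) (𝓝 (a x)) := by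
    rw [h3]
    refine ((h2 M hM).mono_left (nhdsWithin_mono _ fun w hw => hw.2.2)).mul ?_
    have hcj : Tendsto (fun w : ℂ => conj w) (𝓝[S₂] (x : ℂ)) (𝓝[S₁] (x : ℂ)) := by
      refine tendsto_nhdsWithin_iff.2 ⟨?_, ?_⟩
      · have := (Complex.continuous_conj.tendsto (x : ℂ)).mono_left
          (nhdsWithin_le_nhds (s := S₂))
        rwa [Complex.conj_ofReal] at this
      · filter_upwards [self_mem_nhdsWithin] with w hw
        have h4 := hw.2.2
        rw [abs_of_neg hw.2.1] at h4
        exact ⟨by simpa using hw.2.1, by simpa using h4⟩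
    exact (Complex.continuous_conj.tendsto _).comp ((h1 M hM).comp hcj)
  have hopen : IsOpen S₂ := hu.isOpen.inter (isOpen_lower.inter
    (isOpen_lt (by fun_prop : Continuous fun w : ℂ => |w.re - x|)
      (by fun_prop : Continuous fun w : ℂ => M * |w.im|)))
  have hlow : Tendsto (extF U D f) (𝓝[S₂] x) (𝓝 (a x)) := by
    rw [Metric.tendsto_nhds]
    intro ε hε
    have h4 := (Metric.tendsto_nhds.1 hprod) (ε / 2) (half_pos hε)
    filter_upwards [eventually_eventually_nhdsWithin.2 h4, self_mem_nhdsWithin] with w hw hwS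
    rw [hopen.nhdsWithin_eq hwS] at hw
    have := (nf_bound (hf.meromorphicOn_lower hu) ⟨hwS.1, hwS.2.1⟩
      (eventually_ne_of_eventually (hw.mono fun v hv => by rw [← dist_eq_norm]; exact hv.le))).2
    rw [dist_eq_norm, (extF_eventuallyEq_lower hwS.2.1).self_of_nhds]
    linarith
  have hD : D ∈ 𝓝 (x : ℂ) := hu.isOpen.mem_nhds (hu.real_mem x)
  refine (hup.sup hlow).mono_left ?_
  rw [← nhdsWithin_union, ← nhdsWithin_inter_of_mem' (nhdsWithin_le_nhds hD)]
  refine nhdsWithin_mono _ fun w hw => ?_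
  have hw' : |w.re - x| < M * |w.im| := hw.1
  rcases lt_trichotomy w.im 0 with h | h | h
  · exact Or.inr ⟨hw.2, h, hw'⟩
  · rw [h, abs_zero, mul_zero] at hw'
    exact absurd hw' (not_lt.2 (abs_nonneg _))
  · rw [abs_of_pos h] at hw'
    exact Or.inl ⟨h, hw'⟩

theorem tendsto_vertical (x : ℝ) : Tendsto (fun y : ℝ => (x : ℂ) + y * I) (𝓝[>] 0)
    (𝓝[{w : ℂ | |w.re - x| < 1 * |w.im|}] (x : ℂ)) := by
  refine tendsto_nhdsWithin_iff.2 ⟨?_, ?_⟩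
  · have : Continuous fun y : ℝ => (x : ℂ) + y * I := by fun_prop
    simpa using (this.tendsto 0).mono_left nhdsWithin_le_nhds
  · filter_upwards [self_mem_nhdsWithin] with y hy
    have hy' : 0 < y := hy
    simp [hy'.ne']

/-- The continuation of `U` to a neighbourhood of a real point agrees with `u` on the real line. -/
theorem ntlim_eq_continuation {V : ℂ → ℂ} {x : ℝ} (hV : ContinuousAt V x)
    (hVU : ∀ᶠ w in 𝓝 (x : ℂ), w.im ≠ 0 → V w = U w) {c : ℂ} (h : NTLim U x c) : V x = c := by
  have h1 := (h 1 one_pos).comp (tendsto_vertical x)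
  have h0 := (tendsto_vertical x).mono_right nhdsWithin_le_nhds
  refine tendsto_nhds_unique ((hV.tendsto.comp h0).congr' ?_) h1
  filter_upwards [h0.eventually hVU, self_mem_nhdsWithin] with y h2 h3
  have h3' : 0 < y := h3
  exact h2 (by simpa using h3'.ne')

theorem ContinuesAt.analyticAt {z : ℂ} (h : ContinuesAt U z) (hz : z.im ≠ 0) : AnalyticAt ℂ U z := by
  obtain ⟨V, hV, hVU⟩ := h
  refine hV.congr ?_
  filter_upwards [hVU, Complex.continuous_im.continuousAt.eventually (isOpen_ne.mem_nhds hz)]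
    with w h1 h2
  exact h1 h2

/-- The extension is analytic at each real point where `U` continues analytically. -/
theorem HasBdVal.analyticAt_real (hf : HasBdVal u f a) (hu : IsUloc u D U) {x : ℝ}
    (hx : ContinuesAt U x) : AnalyticAt ℂ (extF U D f) x := by
  obtain ⟨V, hV, hVU⟩ := hx
  obtain ⟨R, hR, hball⟩ := Metric.eventually_nhds_iff_ball.1
    ((hV.eventually_analyticAt.and (eventually_eventually_nhds.2 hVU)).and
      (hu.isOpen.mem_nhds (hu.real_mem x)))
  set r : ℝ := R / 8 with hr
  have hr0 : 0 < r := by positivity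
  have hsq : ∀ w : ℂ, |w.re - x| < 3 * r → |w.im| < 3 * r → w ∈ closedBall (x : ℂ) (6 * r) := by
    intro w h1 h2
    rw [mem_closedBall_iff_norm]
    have := Complex.norm_le_abs_re_add_abs_im (w - x)
    simp only [Complex.sub_re, Complex.sub_im, Complex.ofReal_re, Complex.ofReal_im, sub_zero] at this
    linarith
  have hcl : closedBall (x : ℂ) (6 * r) ⊆ ball (x : ℂ) R :=
    Metric.closedBall_subset_ball (by rw [hr]; linarith)
  have hUan : ∀ w ∈ ball (x : ℂ) R, w.im ≠ 0 → AnalyticAt ℂ U w := fun w hw him =>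
    ContinuesAt.analyticAt ⟨V, (hball w hw).1.1, (hball w hw).1.2⟩ him
  have hlow : ∀ w ∈ ball (x : ℂ) R, w.im < 0 →
      extF U D f =ᶠ[𝓝 w] fun w => U w * sharp f w := fun w hw him =>
    hf.eventuallyEq_lower_of_analyticAt hu (hball w hw).2 him (hUan w hw him.ne)
  obtain ⟨C, hC⟩ := (isCompact_closedBall (x : ℂ) (6 * r)).exists_bound_of_continuousOn (f := V)
    fun w hw => (hball w (hcl hw)).1.1.continuousAt.continuousWithinAt
  obtain ⟨C', hC'⟩ := (isCompact_closedBall (x : ℂ) (6 * r)).exists_bound_of_continuousOn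
    (f := deriv V) fun w hw => (hball w (hcl hw)).1.1.deriv.continuousAt.continuousWithinAt
  have hlip : ∀ v ∈ closedBall (x : ℂ) (6 * r), ∀ w ∈ closedBall (x : ℂ) (6 * r),
      ‖V w - V v‖ ≤ C' * ‖w - v‖ := fun v hv w hw =>
    Convex.norm_image_sub_le_of_norm_deriv_le
      (fun p hp => (hball p (hcl hp)).1.1.differentiableAt) hC' (convex_closedBall _ _) hv hw
  set p : ℝ := x - 2 * r
  set q : ℝ := x + 2 * r
  have hpq : p ≤ q := by simp only [p, q]; linarith
  have hpm : ∀ s ∈ Ioc p q, ∀ y : ℝ, |y| < r →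
      (s : ℂ) + y * I ∈ closedBall (x : ℂ) (6 * r) := by
    intro s hs y hy
    refine hsq _ ?_ ?_
    · simp only [Complex.add_re, Complex.ofReal_re, Complex.mul_re, Complex.I_re, Complex.I_im,
        Complex.ofReal_im, mul_zero, mul_one, sub_self, add_zero]
      rw [abs_lt]
      constructor <;> linarith [hs.1, hs.2]
    · simp only [Complex.add_im, Complex.ofReal_im, Complex.mul_im, Complex.I_im, Complex.I_re,
        Complex.ofReal_re, mul_one, mul_zero, add_zero, zero_add]
      linarith
  have hup : Tendsto (fun y : ℝ => ∫ s in p..q, ‖extF U D f (s + y * I) - a s‖) (𝓝[>] 0)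
      (𝓝 0) := by
    refine (hf.mean p q hpq).congr' ?_
    filter_upwards [self_mem_nhdsWithin] with y hy
    have hy' : 0 < y := hy
    refine intervalIntegral.integral_congr fun s _ => ?_
    rw [extF, if_pos (by simpa using hy')]
  have hdn : Tendsto (fun y : ℝ => ∫ s in p..q, ‖extF U D f (s + (-y : ℝ) * I) - a s‖)
      (𝓝[>] 0) (𝓝 0) := by
    have hsum : Tendsto (fun y : ℝ => C * (∫ s in p..q, ‖f (s + y * I) - a s‖) +
        C' * y * ∫ s in p..q, ‖a s‖) (𝓝[>] 0) (𝓝 0) := by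
      have h1 : Tendsto (fun y : ℝ => C' * y * ∫ s in p..q, ‖a s‖) (𝓝[>] 0) (𝓝 0) := by
        have : Continuous fun y : ℝ => C' * y * ∫ s in p..q, ‖a s‖ := by fun_prop
        simpa using (this.tendsto 0).mono_left nhdsWithin_le_nhds
      simpa using ((hf.mean p q hpq).const_mul C).add h1
    refine squeeze_zero' (Eventually.of_forall fun y => intervalIntegral.integral_nonneg hpq
      fun s _ => norm_nonneg _) ?_ hsum
    filter_upwards [self_mem_nhdsWithin, nhdsWithin_le_nhds (gt_mem_nhds hr0)] with y hy hyr
    have hy0 : 0 < y := hy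
    have hai : IntervalIntegrable a volume p q := intervalIntegrable_of_locallyIntegrable hf.locInt
    have hfi : IntervalIntegrable (fun s : ℝ => ‖f (s + y * I) - a s‖) volume p q := by
      refine (IntervalIntegrable.sub (ContinuousOn.intervalIntegrable fun s _ =>
        ContinuousAt.continuousWithinAt ?_) hai).norm
      exact (hf.analytic (s + y * I) (by simpa using hy0)).continuousAt.comp
        (f := fun s : ℝ => (s : ℂ) + y * I) (Continuous.continuousAt (by fun_prop))
    rw [← intervalIntegral.integral_const_mul, ← intervalIntegral.integral_const_mul,
      ← intervalIntegral.integral_add (hfi.const_mul C) (hai.norm.const_mul _),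
      intervalIntegral.integral_of_le hpq, intervalIntegral.integral_of_le hpq]
    refine integral_mono_of_nonneg (Eventually.of_forall fun s => norm_nonneg _)
      ((hfi.const_mul C).add (hai.norm.const_mul _)).1 ?_
    rw [EventuallyLE, ae_restrict_iff' measurableSet_Ioc]
    filter_upwards [hu.ntlim, hf.sym] with s hs1 hs2 hs
    have hm := hpm s hs (-y) (by rw [abs_neg, abs_of_pos hy0]; exact hyr)
    have hm0 := hpm s hs 0 (by rwa [abs_zero])
    rw [Complex.ofReal_zero, zero_mul, add_zero] at hm0
    have him : ((s : ℂ) + (-y : ℝ) * I).im = -y := by simp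
    have hVs := ntlim_eq_continuation (hball _ (hcl hm0)).1.1.continuousAt
      (hball _ (hcl hm0)).1.2 hs1
    have e1 : extF U D f (s + (-y : ℝ) * I) =
        V (s + (-y : ℝ) * I) * conj (f (s + y * I)) := by
      rw [(hlow _ (hcl hm) (by rw [him]; linarith)).self_of_nhds,
        (hball _ (hcl hm)).1.2.self_of_nhds (by rw [him]; linarith)]
      change _ * conj (f _) = _
      congr 3
      simp
    have e2 : extF U D f (s + (-y : ℝ) * I) - a s =
        V (s + (-y : ℝ) * I) * conj (f (s + y * I) - a s) +
        (V (s + (-y : ℝ) * I) - V s) * conj (a s) := by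
      rw [e1, hVs, map_sub]
      linear_combination -hs2
    rw [e2]
    refine (norm_add_le _ _).trans ?_
    rw [norm_mul, norm_mul, Complex.norm_conj, Complex.norm_conj]
    refine add_le_add (mul_le_mul_of_nonneg_right (hC _ hm) (norm_nonneg _))
      (mul_le_mul_of_nonneg_right ((hlip _ hm0 _ hm).trans (le_of_eq ?_)) (norm_nonneg _))
    rw [add_sub_cancel_left, norm_mul, Complex.norm_I, mul_one, Complex.norm_real, Real.norm_eq_abs,
      abs_neg, abs_of_pos hy0]
  have hlim : Tendsto (fun y : ℝ => ∫ s in p..q, ‖extF U D f (s + y * I) - a s‖) (𝓝[≠] 0)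
      (𝓝 0) := by
    rw [← nhdsLT_sup_nhdsGT]
    refine Tendsto.sup ?_ hup
    have hneg : Tendsto (fun y : ℝ => -y) (𝓝[<] 0) (𝓝[>] 0) := by
      have := tendsto_neg_nhdsLT (a := (0 : ℝ))
      rwa [neg_zero] at this
    refine (hdn.comp hneg).congr fun y => ?_
    simp only [Function.comp, neg_neg]
  obtain ⟨g, hg, hge⟩ := exists_continuation hr0 hf.locInt (f := extF U D f) (fun w h1 h2 h3 => by
    have hw := hcl (hsq w h1 h2)
    rcases lt_or_gt_of_ne h3 with h | h
    · exact (((hUan w hw h3).mul (hf.analyticAt_sharp h)).congr (hlow w hw h).symm).differentiableAt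
    · exact (hf.analyticAt_upper h).differentiableAt) hlim
  have heq : ∀ w ∈ ball (x : ℂ) r, extF U D f w = g w := by
    intro w hw
    by_cases him : w.im = 0
    · rw [extF, if_neg him.not_gt, if_neg him.not_lt]
      have hne : (𝓝[upperHP] w).NeBot := by
        rw [← mem_closure_iff_nhdsWithin_neBot, upperHP, Complex.closure_setOfPred_lt_im]
        exact him.ge
      have hgc : ContinuousAt g w :=
        (hg.differentiableAt (Metric.isOpen_ball.mem_nhds hw)).continuousAt
      refine (Tendsto.congr' ?_ (hgc.tendsto.mono_left (nhdsWithin_le_nhds (s := upperHP)))).limUnder_eq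
      filter_upwards [self_mem_nhdsWithin, nhdsWithin_le_nhds (Metric.isOpen_ball.mem_nhds hw)]
        with v hv1 hv2
      have hv1' : 0 < v.im := hv1
      rw [hge v hv2 hv1'.ne', extF, if_pos hv1']
    · exact (hge w hw him).symm
  have hmem : ball (x : ℂ) r ∈ 𝓝 (x : ℂ) := Metric.ball_mem_nhds _ hr0
  refine (hg.analyticAt hmem).congr ?_
  filter_upwards [hmem] with w hw
  exact (heq w hw).symm

/-- The extension is analytic where `U` continues analytically. -/
theorem HasBdVal.analyticAt (hf : HasBdVal u f a) (hu : IsUloc u D U) {z : ℂ} (hz : z ∈ D)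
    (h : ContinuesAt U z) : AnalyticAt ℂ (extF U D f) z := by
  rcases lt_trichotomy z.im 0 with h0 | h0 | h0
  · exact ((h.analyticAt h0.ne).mul (hf.analyticAt_sharp h0)).congr
      (hf.eventuallyEq_lower_of_analyticAt hu hz h0 (h.analyticAt h0.ne)).symm
  · have hz0 : z = (z.re : ℂ) := Complex.ext rfl (by simpa using h0)
    rw [hz0] at h ⊢
    exact hf.analyticAt_real hu h
  · exact hf.analyticAt_upper h0

end

theorem IsPart.hasBdVal {u : ℝ → ℂ} {c : ℂ} {k : L2} {e : ℂ} {t : ℝ} {f : L2}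
    (hu : IsUnimodular u) (hk : IsKernelPart u c k) (h : IsPart u c k e t f) :
    HasBdVal u (upF t (e + conj e * c) (tailM u c k e t f))
      (bdF t (e + conj e * c) (tailM u c k e t f)) where
  analytic _ hz := analyticAt_upF hz
  locInt := locallyIntegrable_bdF
  mean _ _ := tendsto_integral_upF h.isCausal
  ntlim := ae_tendsto_upF h.isCausal
  sym := by
    filter_upwards [density_eq_bdF (u := u) (c := c) (k := k) (e := e) (t := t) (f := f),
      density_ae hu hk (e := e) (t := t) (f := f)] with x h1 h2
    rwa [← h1]

/-! ### The first order system in the upper half-plane -/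

theorem iteratedDeriv_cexp_ofReal (c : ℂ) (n : ℕ) :
    iteratedDeriv n (fun x : ℝ => Complex.exp (c * x)) = fun x : ℝ => c ^ n * Complex.exp (c * x) := by
  induction n with
  | zero => simp
  | succ n ih =>
    rw [iteratedDeriv_succ, ih]
    ext x
    have h : HasDerivAt (fun x : ℝ => c * (x : ℂ)) c x := by
      simpa using (Complex.ofRealCLM.hasDerivAt (x := x)).const_mul c
    rw [(h.cexp.const_mul (c ^ n)).deriv]
    ring

/-- The exponential function `e^{izx}` agrees on a half-line with a Schwartz function. -/
theorem exists_schwartz_eq_exp {z : ℂ} (hz : 0 < z.im) (a : ℝ) : ∃ g : 𝓢(ℝ, ℂ),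
    ∀ x > a, g x = Complex.exp (I * z * x) ∧
      derivS g x = I * z * Complex.exp (I * z * x) := by
  set E : ℝ → ℂ := fun x => Complex.exp (I * z * x) with hE
  set h : ℝ → ℂ := fun x => (Real.smoothTransition (x - a + 1) : ℂ) * E x with hh
  have hEs : ContDiff ℝ ((⊤ : ℕ∞) : WithTop ℕ∞) E :=
    Complex.contDiff_exp.comp (contDiff_const.mul Complex.ofRealCLM.contDiff)
  have hs : ContDiff ℝ ((⊤ : ℕ∞) : WithTop ℕ∞) h :=
    (Complex.ofRealCLM.contDiff.comp (Real.smoothTransition.contDiff.comp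
      ((contDiff_id.sub contDiff_const).add contDiff_const))).mul hEs
  have h0 : ∀ x < a - 1, h =ᶠ[𝓝 x] fun _ => 0 := fun x hx => by
    filter_upwards [Iio_mem_nhds hx] with y hy
    have hy' : y < a - 1 := hy
    simp only [hh]
    rw [Real.smoothTransition.zero_of_nonpos (by linarith), Complex.ofReal_zero, zero_mul]
  have h1 : ∀ x > a, h =ᶠ[𝓝 x] E := fun x hx => by
    filter_upwards [Ioi_mem_nhds hx] with y hy
    have hy' : a < y := hy
    simp only [hh]
    rw [Real.smoothTransition.one_of_one_le (by linarith), Complex.ofReal_one, one_mul]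
  have hdecay : ∀ k n : ℕ, ∃ C : ℝ, ∀ x, ‖x‖ ^ k * ‖iteratedFDeriv ℝ n h x‖ ≤ C := by
    intro k n
    have hlim : Tendsto (fun x : ℝ => ‖z‖ ^ n * (x ^ (k : ℝ) * Real.exp (-z.im * x))) atTop (𝓝 0) := by
      simpa using (tendsto_rpow_mul_exp_neg_mul_atTop_nhds_zero k z.im hz).const_mul (‖z‖ ^ n)
    obtain ⟨b, hb⟩ := eventually_atTop.1 (hlim.eventually (gt_mem_nhds one_pos))
    have hc : Continuous fun x : ℝ => ‖x‖ ^ k * ‖iteratedFDeriv ℝ n h x‖ :=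
      (continuous_norm.pow k).mul
        (hs.continuous_iteratedFDeriv (m := n) (by exact_mod_cast le_top)).norm
    obtain ⟨C, hC⟩ := (isCompact_Icc (a := a - 1) (b := max (max a b) 0)).exists_bound_of_continuousOn
      hc.continuousOn
    refine ⟨max C 1, fun x => ?_⟩
    rcases lt_or_ge x (a - 1) with hx | hx
    · rw [norm_iteratedFDeriv_eq_norm_iteratedDeriv, (h0 x hx).iteratedDeriv_eq, iteratedDeriv_const]
      simp
    rcases le_or_gt x (max (max a b) 0) with hx' | hx'
    · exact (le_abs_self _).trans ((hC x ⟨hx, hx'⟩).trans (le_max_left _ _))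
    · have hxa : a < x := (le_max_left a b).trans_lt ((le_max_left _ _).trans_lt hx')
      have hxb : b ≤ x := ((le_max_right a b).trans (le_max_left _ _)).trans hx'.le
      have hx0 : 0 < x := (le_max_right _ _).trans_lt hx'
      have := hb x hxb
      rw [Real.rpow_natCast] at this
      rw [norm_iteratedFDeriv_eq_norm_iteratedDeriv, (h1 x hxa).iteratedDeriv_eq, hE,
        iteratedDeriv_cexp_ofReal, norm_mul, norm_pow, norm_mul, Complex.norm_I, one_mul,
        norm_exp_I_mul, Real.norm_of_nonneg hx0.le]
      refine le_trans (le_of_eq ?_) (this.le.trans (le_max_right C 1))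
      ring
  let g : 𝓢(ℝ, ℂ) := ⟨h, hs, hdecay⟩
  have hg : ∀ x, g x = h x := fun _ => rfl
  refine ⟨g, fun x hx => ⟨(hg x).trans (h1 x hx).self_of_nhds, ?_⟩⟩
  rw [SchwartzMap.derivCLM_apply]
  change deriv h x = _
  rw [(h1 x hx).deriv_eq, ← iteratedDeriv_one, hE, iteratedDeriv_cexp_ofReal, pow_one]

section
variable {u : ℝ → ℂ} {c : ℂ} {k : L2} (hu : IsUnimodular u) (hk : IsKernelPart u c k)
include hu hk

/-- The function in the upper half-plane attached to a solution. -/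
abbrev upPart (u : ℝ → ℂ) (c : ℂ) (k : L2) (e : ℂ) (f : ℝ → L2) (s : ℝ) : ℂ → ℂ :=
  upF s (e + conj e * c) (tailM u c k e s (f s))

section
variable {T : ℝ} (hT : ∀ t < T, compressionNorm u t < 1) {e e₁ e₂ : ℂ}
  {f f₁ f₂ : ℝ → L2} (hf : ∀ t < T, IsPart u c k e t (f t))
  (hf₁ : ∀ t < T, IsPart u c k e₁ t (f₁ t)) (hf₂ : ∀ t < T, IsPart u c k e₂ t (f₂ t))
  {t : ℝ} (ht : t < T) (h4 : CondK4 u t) {d d₁ d₂ : ℂ}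
  (hd : HasDiagValue (fun s => solFun u c k e s (f s)) t d)
  (hd₁ : HasDiagValue (fun s => solFun u c k e₁ s (f₁ s)) t d₁)
  (hd₂ : HasDiagValue (fun s => solFun u c k e₂ s (f₂ s)) t d₂)
  {A B : ℝ} (hAB : d = I * (A * d₁ + B * d₂))
include hT hf hf₁ hf₂ ht h4 hd hd₁ hd₂ hAB

theorem hasDerivAt_upPart {z : ℂ} (hz : 0 < z.im) :
    HasDerivAt (fun s => upPart u c k e f s z)
      (-(z * (A * upPart u c k e₁ f₁ t z + B * upPart u c k e₂ f₂ t z))) t := by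
  obtain ⟨g, hg⟩ := exists_schwartz_eq_exp hz (t - 1)
  have h1 : ∀ {e : ℂ} {s : ℝ} {f : L2}, IsPart u c k e s f → t - 1 < s →
      upF s (e + conj e * c) (tailM u c k e s f) z =
        -(I * z / 2) * (pairX u c k e s f g - pairP e s f g) := by
    intro e s f h hs
    rw [(h.integrableOn_exp hz).2, ← h.integral_tail_eq_sub]
    congr 1
    exact setIntegral_congr_fun measurableSet_Ici fun x hx =>
      congrArg _ (hg x (hs.trans_le hx)).1.symm
  have h2 : ∀ {e : ℂ} {f : L2}, IsPart u c k e t f →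
      pairX u c k e t f (derivS g) - pairP e t f (derivS g) =
        I * z * (pairX u c k e t f g - pairP e t f g) := by
    intro e f h
    rw [← h.integral_tail_eq_sub, ← h.integral_tail_eq_sub, ← integral_const_mul]
    refine setIntegral_congr_fun measurableSet_Ici fun x hx => ?_
    have hx' : t ≤ x := hx
    obtain ⟨e1, e2⟩ := hg x (by linarith)
    change _ * derivS g x = _ * (_ * g x)
    rw [e1, e2]
    ring
  obtain ⟨hP, hX⟩ := hasDerivAt_pair hu hk hT hf hf₁ hf₂ ht h4 hd hd₁ hd₂ hAB g
  have h3 := (hX.sub hP).const_mul (-(I * z / 2))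
  have h5 := h3.congr_of_eventuallyEq (f₁ := fun s => upPart u c k e f s z) (by
    filter_upwards [Ioo_mem_nhds (sub_one_lt t) ht] with s hs
    exact h1 (hf s hs.2) hs.1)
  refine h5.congr_deriv (Eq.symm ?_)
  simp only [upPart]
  rw [h1 (hf₁ t ht) (sub_one_lt t), h1 (hf₂ t ht) (sub_one_lt t)]
  have e1 := h2 (hf₁ t ht)
  have e2 := h2 (hf₂ t ht)
  linear_combination (I * z / 2) * I * (A * e1 + B * e2) + z *
    (A * (I * z / 2) * (pairX u c k e₁ t (f₁ t) g - pairP e₁ t (f₁ t) g) +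
    B * (I * z / 2) * (pairX u c k e₂ t (f₂ t) g - pairP e₂ t (f₂ t) g)) * Complex.I_sq

theorem hasDerivAt_integral_density (g : 𝓢(ℝ, ℂ)) :
    HasDerivAt (fun s => ∫ x, density u c k e s (f s) x * g x)
      (-(A * (∫ x, density u c k e₁ t (f₁ t) x * mulS (fun z => (z : ℂ)) g x) +
        B * ∫ x, density u c k e₂ t (f₂ t) x * mulS (fun z => (z : ℂ)) g x)) t := by
  obtain ⟨hP, hX⟩ := hasDerivAt_pair hu hk hT hf hf₁ hf₂ ht h4 hd hd₁ hd₂ hAB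
    (fourierS (mulS (fun z => -(I * z / 2)) g))
  have h1 : ∀ {e : ℂ} {f : L2}, IsPart u c k e t f →
      pairX u c k e t f (derivS (fourierS (mulS (fun z => -(I * z / 2)) g))) -
      pairP e t f (derivS (fourierS (mulS (fun z => -(I * z / 2)) g))) =
        I * ∫ x, density u c k e t f x * mulS (fun z => (z : ℂ)) g x := by
    intro e f h
    rw [← h.integral_density, derivS_fourierS_mulS_half, ← h.integral_tail_eq_sub,
      ← integral_const_mul]
    refine integral_congr_ae (Eventually.of_forall fun x => ?_)
    change _ * (I * _) = _
    ring
  refine ((hX.sub hP).congr_of_eventuallyEq ?_).congr_deriv ?_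
  · filter_upwards [Iio_mem_nhds ht] with s hs
    rw [← (hf s hs).integral_density, (hf s hs).integral_tail_eq_sub]
    rfl
  · linear_combination I * (A * h1 (hf₁ t ht) + B * h1 (hf₂ t ht)) +
      (A * (∫ x, density u c k e₁ t (f₁ t) x * mulS (fun z => (z : ℂ)) g x) +
        B * ∫ x, density u c k e₂ t (f₂ t) x * mulS (fun z => (z : ℂ)) g x) * Complex.I_sq

end

theorem exists_norm_tailM_le {T : ℝ} (hT : ∀ t < T, compressionNorm u t < 1) {e : ℂ} {f : ℝ → L2}
    (hf : ∀ t < T, IsPart u c k e t (f t)) {t : ℝ} (ht : t < T) :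
    ∃ M : ℝ, ∀ᶠ s in 𝓝 t, ‖tailM u c k e s (f s)‖ ≤ M := by
  set N := ‖ind (Ioc (-(|t| + 1)) (|t| + 1))‖
  have hN : ∀ a b : ℝ, |a| ≤ |t| + 1 → |b| ≤ |t| + 1 → ‖ind (Ioc a b)‖ ≤ N := by
    intro a b ha hb
    refine Lp.norm_le_norm_of_ae_le ?_
    filter_upwards [ind_Ioc_coe a b, ind_Ioc_coe (-(|t| + 1)) (|t| + 1)] with x h1 h2
    rw [h1, h2]
    by_cases hx : x ∈ Ioc a b
    · rw [indicator_of_mem hx, indicator_of_mem]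
      exact ⟨(abs_le.1 ha).1.trans_lt hx.1, hx.2.trans (abs_le.1 hb).2⟩
    · rw [indicator_of_notMem hx, norm_zero]
      exact norm_nonneg _
  have hc := (IsPart.continuousAt hu hk hT hf ht).norm.eventually (gt_mem_nhds (lt_add_one ‖f t‖))
  refine ⟨‖conj e * c‖ * (N + N) + ‖conj e‖ * ‖k‖ + (‖f t‖ + 1) + (‖f t‖ + 1), ?_⟩
  filter_upwards [hc, Ioo_mem_nhds (sub_one_lt t) (lt_add_one t)] with s h1 h2
  have hs : |s| ≤ |t| + 1 := by
    rw [abs_le]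
    constructor <;> linarith [neg_abs_le t, le_abs_self t, h2.1, h2.2]
  rw [tailM, LinearIsometry.norm_map, tailPart]
  refine (norm_sub_le _ _).trans (add_le_add ((norm_add_le _ _).trans (add_le_add
    ((norm_add_le _ _).trans (add_le_add ?_ ?_)) ?_)) h1.le)
  · rw [norm_smul]
    exact mul_le_mul_of_nonneg_left ((norm_sub_le _ _).trans (add_le_add (hN _ _ (by rwa [abs_neg]) hs)
      (hN _ _ hs (by rwa [abs_neg])))) (norm_nonneg _)
  · rw [norm_smul, LinearIsometry.norm_map]
  · rw [norm_K hu]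
    exact h1.le

theorem exists_upPart_bound {T : ℝ} (hT : ∀ t < T, compressionNorm u t < 1) {e : ℂ} {f : ℝ → L2}
    (hf : ∀ t < T, IsPart u c k e t (f t)) {t : ℝ} (ht : t < T) {R : ℝ} (hR : 0 ≤ R) :
    ∃ C : ℝ, ∀ᶠ s in 𝓝 t, ∀ w : ℂ, 0 < w.im → ‖w‖ ≤ R → ‖upPart u c k e f s w‖ * w.im ≤ C := by
  obtain ⟨M, hM⟩ := exists_norm_tailM_le hu hk hT hf ht
  refine ⟨Real.exp ((|t| + 1) * R) * (‖(e + conj e * c) / 2‖ * R + R * (M * (1 + R))), ?_⟩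
  filter_upwards [hM, Ioo_mem_nhds (sub_one_lt t) (lt_add_one t)] with s h1 h2 w hw hwR
  have hs : |s| ≤ |t| + 1 := by
    rw [abs_le]
    constructor <;> linarith [neg_abs_le t, le_abs_self t, h2.1, h2.2]
  have him : w.im ≤ R := ((le_abs_self _).trans (Complex.abs_im_le_norm w)).trans hwR
  have hM0 : 0 ≤ M := (norm_nonneg _).trans h1
  have e1 : ‖Complex.exp (I * s * w)‖ ≤ Real.exp ((|t| + 1) * R) := by
    rw [Complex.norm_exp]
    refine Real.exp_le_exp.2 ((Complex.re_le_norm _).trans ?_)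
    rw [norm_mul, norm_mul, Complex.norm_I, one_mul, Complex.norm_real, Real.norm_eq_abs]
    exact mul_le_mul hs hwR (norm_nonneg _) (by positivity)
  have e2 : ‖LT (tailM u c k e s (f s)) w‖ * w.im ≤ M * (1 + R) := by
    have h3 := norm_LT_le (tailM u c k e s (f s)) hw
    have h4 : 0 < Real.sqrt (2 * w.im) := Real.sqrt_pos.2 (by linarith)
    have h5 : w.im ≤ Real.sqrt (2 * w.im) * (1 + R) := by
      have h6 := Real.sq_sqrt (show 0 ≤ 2 * w.im by linarith)
      rcases le_or_gt (Real.sqrt (2 * w.im)) 1 with h7 | h7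
      · nlinarith
      · nlinarith
    calc _ ≤ M / Real.sqrt (2 * w.im) * w.im :=
          mul_le_mul_of_nonneg_right (h3.trans (div_le_div_of_nonneg_right h1 h4.le)) hw.le
      _ = M * (w.im / Real.sqrt (2 * w.im)) := by ring
      _ ≤ _ := mul_le_mul_of_nonneg_left ((div_le_iff₀ h4).2 (by linarith)) hM0
  have e3 : ‖(e + conj e * c) / 2 - I * w / 2 * LT (tailM u c k e s (f s)) w‖ * w.im ≤
      ‖(e + conj e * c) / 2‖ * R + R * (M * (1 + R)) := by
    refine (mul_le_mul_of_nonneg_right (norm_sub_le _ _) hw.le).trans ?_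
    rw [add_mul, norm_mul, mul_assoc]
    refine add_le_add (mul_le_mul_of_nonneg_left him (norm_nonneg _)) (mul_le_mul ?_ e2
      (by positivity) hR)
    rw [norm_div, norm_mul, Complex.norm_I, one_mul, Complex.norm_ofNat]
    linarith [norm_nonneg w]
  rw [upPart, upF, norm_mul, mul_assoc]
  exact mul_le_mul e1 e3 (by positivity) (Real.exp_pos _).le

end

/-! ### The first order system at the other points -/

/-- Convergence at the centre of a circle, for analytic functions with a singular bound
where the circle meets the real line. -/
theorem tendsto_of_circle {F : ℝ → ℂ → ℂ} {G : ℂ → ℂ} {l : Filter ℝ} [l.IsCountablyGenerated]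
    {z : ℂ} {ρ C : ℝ} (hρ : 0 < ρ)
    (hF : ∀ᶠ s in l, ∀ w ∈ closedBall z ρ, DifferentiableAt ℂ (F s) w)
    (hG : ∀ w ∈ closedBall z ρ, DifferentiableAt ℂ G w) {C' : ℝ}
    (hq : ∀ w ∈ sphere z ρ, ‖(w - z) ^ 2 - ρ ^ 2‖ ≤ C' * |w.im|)
    (hb : ∀ᶠ s in l, ∀ w ∈ sphere z ρ, w.im ≠ 0 → ‖F s w‖ * |w.im| ≤ C)
    (hl : ∀ w ∈ sphere z ρ, w.im ≠ 0 → Tendsto (fun s => F s w) l (𝓝 (G w))) :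
    Tendsto (fun s => F s z) l (𝓝 (G z)) := by
  have habs : |ρ| = ρ := abs_of_pos hρ
  have hcont : ∀ H : ℂ → ℂ, (∀ w ∈ closedBall z ρ, DifferentiableAt ℂ H w) →
      ∀ w ∈ closedBall z ρ, DifferentiableAt ℂ (fun w => ((w - z) ^ 2 - ρ ^ 2) * H w) w :=
    fun H hH w hw => by have := hH w hw; fun_prop
  have hmean : ∀ H : ℂ → ℂ, (∀ w ∈ closedBall z ρ, DifferentiableAt ℂ H w) →
      H z = -((ρ : ℂ) ^ 2)⁻¹ * Real.circleAverage (fun w => ((w - z) ^ 2 - ρ ^ 2) * H w) z ρ := by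
    intro H hH
    rw [circleAverage_of_differentiable_on_off_countable (s := ∅) countable_empty]
    · have : (ρ : ℂ) ≠ 0 := by exact_mod_cast hρ.ne'
      field_simp
      ring
    · rw [habs]
      exact fun w hw => (hcont H hH w hw).continuousAt.continuousWithinAt
    · rw [habs]
      exact fun w hw => hcont H hH w (Metric.ball_subset_closedBall hw.1)
  have hmem : ∀ θ : ℝ, circleMap z ρ θ ∈ sphere z ρ := circleMap_mem_sphere z hρ.le
  have hzero : ∀ w ∈ sphere z ρ, w.im = 0 → (w - z) ^ 2 - ρ ^ 2 = 0 := fun w hw h0 =>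
    norm_le_zero_iff.1 (by simpa [h0] using hq w hw)
  have hlim : Tendsto (fun s => Real.circleAverage (fun w => ((w - z) ^ 2 - ρ ^ 2) * F s w) z ρ) l
      (𝓝 (Real.circleAverage (fun w => ((w - z) ^ 2 - ρ ^ 2) * G w) z ρ)) := by
    refine Tendsto.const_smul ?_ _
    refine intervalIntegral.tendsto_integral_filter_of_dominated_convergence (fun _ => |C'| * |C|) ?_ ?_
      intervalIntegrable_const (Eventually.of_forall fun θ _ => ?_)
    · filter_upwards [hF] with s hs
      refine Continuous.aestronglyMeasurable (continuous_iff_continuousAt.2 fun θ => ?_)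
      exact (hcont _ hs _ (Metric.sphere_subset_closedBall (hmem θ))).continuousAt.comp
        (f := circleMap z ρ) (continuous_circleMap z ρ).continuousAt
    · filter_upwards [hb] with s hs
      refine Eventually.of_forall fun θ _ => ?_
      by_cases h0 : (circleMap z ρ θ).im = 0
      · rw [hzero _ (hmem θ) h0, zero_mul, norm_zero]
        positivity
      · rw [norm_mul]
        calc _ ≤ |C'| * |(circleMap z ρ θ).im| * ‖F s (circleMap z ρ θ)‖ :=
              mul_le_mul_of_nonneg_right ((hq _ (hmem θ)).trans
                (mul_le_mul_of_nonneg_right (le_abs_self _) (abs_nonneg _))) (norm_nonneg _)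
          _ = |C'| * (‖F s (circleMap z ρ θ)‖ * |(circleMap z ρ θ).im|) := by ring
          _ ≤ _ := mul_le_mul_of_nonneg_left ((hs _ (hmem θ) h0).trans (le_abs_self _)) (abs_nonneg _)
    · by_cases h0 : (circleMap z ρ θ).im = 0
      · simp only [hzero _ (hmem θ) h0, zero_mul]
        exact tendsto_const_nhds
      · exact (hl _ (hmem θ) h0).const_mul _
  rw [hmean G hG]
  refine (hlim.const_mul _).congr' ?_
  filter_upwards [hF] with s hs
  exact (hmean _ hs).symm

/-- A family of functions in the upper half-plane with boundary values and locally uniform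
bounds. -/
structure IsFam (u : ℝ → ℂ) (T : ℝ) (f : ℝ → ℂ → ℂ) (a : ℝ → ℝ → ℂ) : Prop where
  bd : ∀ s < T, HasBdVal u (f s) (a s)
  bound : ∀ t < T, ∀ R : ℝ, 0 ≤ R → ∃ C : ℝ, ∀ᶠ s in 𝓝 t, ∀ w : ℂ, 0 < w.im → ‖w‖ ≤ R →
    ‖f s w‖ * w.im ≤ C

theorem exists_bound_of_isCompact {U : ℂ → ℂ} {S : Set ℂ} (hS : IsCompact S) (hSc : ∀ w ∈ S, ContinuesAt U w) :
    ∃ C : ℝ, 0 ≤ C ∧ ∀ w ∈ S, w.im ≠ 0 → ‖U w‖ ≤ C := by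
  refine hS.induction_on (p := fun S => ∃ C : ℝ, 0 ≤ C ∧ ∀ w ∈ S, w.im ≠ 0 → ‖U w‖ ≤ C)
    ⟨0, le_rfl, by simp⟩ (fun A B hAB ⟨C, h0, hC⟩ => ⟨C, h0, fun w hw => hC w (hAB hw)⟩)
    (fun A B ⟨C, h0, hC⟩ ⟨C', _, hC'⟩ => ⟨max C C', h0.trans (le_max_left _ _), fun w hw him =>
      hw.elim (fun h => (hC w h him).trans (le_max_left _ _))
        fun h => (hC' w h him).trans (le_max_right _ _)⟩) fun w hw => ?_
  obtain ⟨V, hV, hVU⟩ := hSc w hw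
  refine ⟨_, nhdsWithin_le_nhds (hVU.and (hV.continuousAt.norm.eventually
    (gt_mem_nhds (lt_add_one ‖V w‖)))), ‖V w‖ + 1, by positivity, fun v hv him => ?_⟩
  rw [← hv.1 him]
  exact hv.2.le

section
variable {u : ℝ → ℂ} {D : Set ℂ} {U : ℂ → ℂ} (hu : IsUloc u D U) {T t : ℝ} (ht : t < T)
  {f f₁ f₂ : ℝ → ℂ → ℂ} {a a₁ a₂ : ℝ → ℝ → ℂ}
include hu

theorem HasBdVal.extF_lower {f : ℂ → ℂ} {a : ℝ → ℂ} (hf : HasBdVal u f a) {w : ℂ} (hw : w ∈ D)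
    (him : w.im < 0) (h : ContinuesAt U w) : extF U D f w = U w * conj (f (conj w)) :=
  (hf.eventuallyEq_lower_of_analyticAt hu hw him (h.analyticAt him.ne)).self_of_nhds

theorem exists_radius {z : ℂ} (hz : z ∈ D) (h : z.im = 0 → ContinuesAt U z) :
    ∃ ρ > 0, closedBall z ρ ⊆ D ∧ (∀ w ∈ closedBall z ρ, w ≠ z → ContinuesAt U w) ∧
      ∃ C : ℝ, ∀ w ∈ sphere z ρ, ‖(w - z) ^ 2 - ρ ^ 2‖ ≤ C * |w.im| := by
  have hD : ∀ᶠ w in 𝓝 z, w ∈ D := hu.isOpen.mem_nhds hz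
  by_cases h0 : z.im = 0
  · obtain ⟨V, hV, hVU⟩ := h h0
    obtain ⟨ρ, hρ, hball⟩ := Metric.nhds_basis_closedBall.eventually_iff.1
      (hD.and (hV.eventually_analyticAt.and (eventually_eventually_nhds.2 hVU)))
    refine ⟨ρ, hρ, fun w hw => (hball hw).1, fun w hw _ => ⟨V, (hball hw).2⟩, 2 * ρ, fun w hw => ?_⟩
    have hn : ‖w - z‖ = ρ := by rw [← dist_eq_norm]; exact hw
    have hsq : (ρ : ℂ) ^ 2 = (w - z) * conj (w - z) := by
      rw [Complex.mul_conj, Complex.normSq_eq_norm_sq, hn]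
      push_cast; rfl
    rw [hsq, show (w - z) ^ 2 - (w - z) * conj (w - z) = (w - z) * ((w - z) - conj (w - z)) by ring,
      Complex.sub_conj, norm_mul, hn]
    refine le_of_eq ?_
    simp [h0]
    ring
  · have h1 : ∀ᶠ w in 𝓝 z, w ≠ z → ContinuesAt U w := by
      filter_upwards [eventually_nhdsWithin_iff.1 (hu.mero z ⟨hz, h0⟩).eventually_analyticAt]
        with w hw hne
      exact ⟨U, hw hne, Eventually.of_forall fun _ _ => rfl⟩
    have h2 : ∀ᶠ w in 𝓝 z, |z.im| / 2 < |w.im| :=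
      Complex.continuous_im.abs.continuousAt.eventually (lt_mem_nhds (half_lt_self (abs_pos.2 h0)))
    obtain ⟨ρ, hρ, hball⟩ := Metric.nhds_basis_closedBall.eventually_iff.1 (hD.and (h1.and h2))
    refine ⟨ρ, hρ, fun w hw => (hball hw).1, fun w hw => (hball hw).2.1, 4 * ρ ^ 2 / |z.im|,
      fun w hw => ?_⟩
    have hn : ‖w - z‖ = ρ := by rw [← dist_eq_norm]; exact hw
    have h3 : |z.im| / 2 < |w.im| := (hball (Metric.sphere_subset_closedBall hw)).2.2
    have h4 : ‖(w - z) ^ 2 - (ρ : ℂ) ^ 2‖ ≤ ρ ^ 2 + ρ ^ 2 := by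
      refine (norm_sub_le _ _).trans (le_of_eq ?_)
      rw [norm_pow, norm_pow, hn, Complex.norm_real, Real.norm_of_nonneg hρ.le]
    refine h4.trans ?_
    rw [div_mul_eq_mul_div, le_div_iff₀ (abs_pos.2 h0)]
    nlinarith [sq_nonneg ρ]

include ht

theorem IsFam.exists_bound (hF : IsFam u T f a) {S : Set ℂ} (hS : IsCompact S) (hSD : S ⊆ D)
    (hSc : ∀ w ∈ S, ContinuesAt U w) : ∃ C : ℝ, ∀ᶠ s in 𝓝 t, ∀ w ∈ S, w.im ≠ 0 →
      ‖extF U D (f s) w‖ * |w.im| ≤ C := by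
  obtain ⟨R, hR⟩ := hS.isBounded.exists_norm_le
  obtain ⟨C, hC⟩ := hF.bound t ht |R| (abs_nonneg R)
  obtain ⟨C', h0, hC'⟩ := exists_bound_of_isCompact hS hSc
  refine ⟨max C (C' * C), ?_⟩
  filter_upwards [hC, Iio_mem_nhds ht] with s hs hsT w hw him
  have hwR : ‖w‖ ≤ |R| := (hR w hw).trans (le_abs_self R)
  rcases lt_or_gt_of_ne him with h | h
  · rw [(hF.bd s hsT).extF_lower hu (hSD hw) h (hSc w hw), norm_mul, Complex.norm_conj, mul_assoc]
    refine le_trans (mul_le_mul (hC' w hw him) ?_ (by positivity) h0) (le_max_right _ _)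
    have := hs (conj w) (by simpa using h) (by rwa [Complex.norm_conj])
    rwa [Complex.conj_im, ← abs_of_neg h] at this
  · rw [extF, if_pos h, abs_of_pos h]
    exact (hs w h hwR).trans (le_max_left _ _)

theorem IsFam.eventually_differentiableAt (hF : IsFam u T f a) {z : ℂ} {ρ : ℝ}
    (hD : closedBall z ρ ⊆ D) (hc : ∀ w ∈ closedBall z ρ, w ≠ z → ContinuesAt U w)
    (hn : NonSingular U (fun s => extF U D (f s)) t z) :
    ∀ᶠ s in 𝓝 t, ∀ w ∈ closedBall z ρ, DifferentiableAt ℂ (extF U D (f s)) w := by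
  rcases hn with ⟨-, hn⟩ | ⟨-, hn⟩
  · filter_upwards [hn, Iio_mem_nhds ht] with s hs hsT w hw
    by_cases hwz : w = z
    · exact (hwz ▸ hs).differentiableAt
    · exact ((hF.bd s hsT).analyticAt hu (hD hw) (hc w hw hwz)).differentiableAt
  · filter_upwards [Iio_mem_nhds ht] with s hsT w hw
    by_cases hwz : w = z
    · exact ((hF.bd s hsT).analyticAt hu (hD hw) (hwz ▸ hn)).differentiableAt
    · exact ((hF.bd s hsT).analyticAt hu (hD hw) (hc w hw hwz)).differentiableAt

/-- Continuity of the extensions in the parameter. -/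
theorem IsFam.continuousAt (hF : IsFam u T f a)
    (hc : ∀ w : ℂ, 0 < w.im → ContinuousAt (fun s => f s w) t) {z : ℂ} (hz : z ∈ upperHP ∪ D)
    (hn : NonSingular U (fun s => extF U D (f s)) t z) :
    ContinuousAt (fun s => extF U D (f s) z) t := by
  by_cases hz0 : 0 < z.im
  · simpa only [extF, if_pos hz0] using hc z hz0
  have hzD : z ∈ D := hz.resolve_left hz0
  obtain ⟨ρ, hρ, hD, hcont, C, hq⟩ := exists_radius hu hzD
    fun h0 => (hn.resolve_left fun h => h.1 h0).2
  have hsc : ∀ w ∈ sphere z ρ, ContinuesAt U w := fun w hw =>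
    hcont w (Metric.sphere_subset_closedBall hw) (Metric.ne_of_mem_sphere hw hρ.ne')
  have hsD := Metric.sphere_subset_closedBall.trans hD
  obtain ⟨C', hb⟩ := hF.exists_bound hu ht (isCompact_sphere z ρ) hsD hsc
  have hd := hF.eventually_differentiableAt hu ht hD hcont hn
  refine tendsto_of_circle hρ hd hd.self_of_nhds hq hb fun w hw him => ?_
  rcases lt_or_gt_of_ne him with h | h
  · have h1 := ((hc (conj w) (by simpa using h)).star).const_mul (U w)
    refine ContinuousAt.congr h1 ?_
    filter_upwards [Iio_mem_nhds ht] with s hs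
    exact ((hF.bd s hs).extF_lower hu (hsD hw) h (hsc w hw)).symm
  · simpa only [extF, if_pos h] using (hc w h).tendsto

theorem IsFam.hasDerivAt_off_real (hF : IsFam u T f a) (hF₁ : IsFam u T f₁ a₁)
    (hF₂ : IsFam u T f₂ a₂) {p q : ℝ} (hode : ∀ w : ℂ, 0 < w.im →
      HasDerivAt (fun s => f s w) (-(w * (p * f₁ t w + q * f₂ t w))) t) {w : ℂ} (hw : w ∈ D)
    (hc : ContinuesAt U w) (him : w.im ≠ 0) : HasDerivAt (fun s => extF U D (f s) w)
      (-(w * (p * extF U D (f₁ t) w + q * extF U D (f₂ t) w))) t := by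
  rcases lt_or_gt_of_ne him with h | h
  · have h1 := ((hode (conj w) (by simpa using h)).star).const_mul (U w)
    rw [(hF₁.bd t ht).extF_lower hu hw h hc, (hF₂.bd t ht).extF_lower hu hw h hc]
    refine (h1.congr_of_eventuallyEq (f₁ := fun s => extF U D (f s) w) ?_).congr_deriv ?_
    · filter_upwards [Iio_mem_nhds ht] with s hs
      exact (hF.bd s hs).extF_lower hu hw h hc
    · change U w * conj _ = _
      simp only [map_neg, map_mul, map_add, Complex.conj_conj, Complex.conj_ofReal]
      ring
  · simpa only [extF, if_pos h] using hode w h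

/-- The first order system for the extensions. -/
theorem IsFam.hasDerivAt (hF : IsFam u T f a) (hF₁ : IsFam u T f₁ a₁) (hF₂ : IsFam u T f₂ a₂)
    {p q : ℝ → ℝ} (hp : ContinuousAt p t) (hq : ContinuousAt q t) (hode : ∀ s < T, ∀ w : ℂ, 0 < w.im →
      HasDerivAt (fun s => f s w) (-(w * (p s * f₁ s w + q s * f₂ s w))) s) {z : ℂ}
    (hz : z ∈ upperHP ∪ D) (hn : NonSingular U (fun s => extF U D (f s)) t z)
    (hn₁ : NonSingular U (fun s => extF U D (f₁ s)) t z)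
    (hn₂ : NonSingular U (fun s => extF U D (f₂ s)) t z) :
    HasDerivAt (fun s => extF U D (f s) z)
      (-(z * (p t * extF U D (f₁ t) z + q t * extF U D (f₂ t) z))) t := by
  by_cases hz0 : 0 < z.im
  · simpa only [extF, if_pos hz0] using hode t ht z hz0
  have hzD : z ∈ D := hz.resolve_left hz0
  obtain ⟨ρ, hρ, hD, hcont, C, hqC⟩ := exists_radius hu hzD
    fun h0 => (hn.resolve_left fun h => h.1 h0).2
  have hsc : ∀ w ∈ sphere z ρ, ContinuesAt U w := fun w hw =>
    hcont w (Metric.sphere_subset_closedBall hw) (Metric.ne_of_mem_sphere hw hρ.ne')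
  have hsD := Metric.sphere_subset_closedBall.trans hD
  obtain ⟨R, hR⟩ := (isCompact_sphere z ρ).isBounded.exists_norm_le
  obtain ⟨C₁, hb₁⟩ := hF₁.exists_bound hu ht (isCompact_sphere z ρ) hsD hsc
  obtain ⟨C₂, hb₂⟩ := hF₂.exists_bound hu ht (isCompact_sphere z ρ) hsD hsc
  have hd := hF.eventually_differentiableAt hu ht hD hcont hn
  have hd₁ := (hF₁.eventually_differentiableAt hu ht hD hcont hn₁).self_of_nhds
  have hd₂ := (hF₂.eventually_differentiableAt hu ht hD hcont hn₂).self_of_nhds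
  have hder : ∀ s < T, ∀ w ∈ sphere z ρ, w.im ≠ 0 → HasDerivAt (fun s => extF U D (f s) w)
      (-(w * (p s * extF U D (f₁ s) w + q s * extF U D (f₂ s) w))) s := fun s hs w hw him =>
    hF.hasDerivAt_off_real hu hs hF₁ hF₂ (hode s hs) (hsD hw) (hsc w hw) him
  obtain ⟨δ, hδ, hball⟩ := Metric.eventually_nhds_iff_ball.1
    ((hb₁.and hb₂).and (((hp.norm.eventually (gt_mem_nhds (lt_add_one ‖p t‖))).and
      (hq.norm.eventually (gt_mem_nhds (lt_add_one ‖q t‖)))).and (Iio_mem_nhds ht)))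
  set K := |R| * ((‖p t‖ + 1) * |C₁| + (‖q t‖ + 1) * |C₂|) with hK
  have hbd : ∀ᶠ s in 𝓝[≠] t, ∀ w ∈ sphere z ρ, w.im ≠ 0 →
      ‖((s - t : ℝ) : ℂ)⁻¹ * (extF U D (f s) w - extF U D (f t) w)‖ * |w.im| ≤ K := by
    filter_upwards [nhdsWithin_le_nhds (Metric.ball_mem_nhds t hδ), self_mem_nhdsWithin]
      with s hs hst w hw him
    have hst' : 0 < ‖s - t‖ := norm_pos_iff.2 (sub_ne_zero.2 hst)
    have hi : 0 < |w.im| := abs_pos.2 him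
    have hmv := Convex.norm_image_sub_le_of_norm_hasDerivWithin_le (C := K / |w.im|)
      (fun r hr => (hder r (hball r hr).2.2 w hw him).hasDerivWithinAt) (fun r hr => ?_)
      (convex_ball t δ) (Metric.mem_ball_self hδ) hs
    · rw [norm_mul, norm_inv, Complex.norm_real, inv_mul_eq_div, ← le_div_iff₀ hi,
        div_le_iff₀ hst']
      exact hmv
    · obtain ⟨⟨e1, e2⟩, ⟨e3, e4⟩, -⟩ := hball r hr
      rw [le_div_iff₀ hi, norm_neg, norm_mul, mul_assoc]
      refine mul_le_mul ((hR w hw).trans (le_abs_self R)) ?_ (by positivity) (abs_nonneg R)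
      refine (mul_le_mul_of_nonneg_right (norm_add_le _ _) hi.le).trans ?_
      rw [add_mul, norm_mul, norm_mul, Complex.norm_real, Complex.norm_real, mul_assoc, mul_assoc]
      exact add_le_add
        (mul_le_mul e3.le ((e1 w hw him).trans (le_abs_self _)) (by positivity) (by positivity))
        (mul_le_mul e4.le ((e2 w hw him).trans (le_abs_self _)) (by positivity) (by positivity))
  rw [hasDerivAt_iff_tendsto_slope]
  have hsl : ∀ w, slope (fun s => extF U D (f s) w) t =
      fun s => ((s - t : ℝ) : ℂ)⁻¹ * (extF U D (f s) w - extF U D (f t) w) := fun w => by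
    ext s
    rw [slope_def_module, Complex.real_smul, Complex.ofReal_inv]
  rw [hsl]
  refine tendsto_of_circle (F := fun s w => ((s - t : ℝ) : ℂ)⁻¹ *
      (extF U D (f s) w - extF U D (f t) w))
    (G := fun w => -(w * (p t * extF U D (f₁ t) w + q t * extF U D (f₂ t) w))) hρ ?_ ?_ hqC hbd
    fun w hw him => ?_
  · filter_upwards [nhdsWithin_le_nhds hd] with s hs w hw
    exact ((hs w hw).sub (hd.self_of_nhds w hw)).const_mul _
  · intro w hw
    have h1 := hd₁ w hw
    have h2 := hd₂ w hw
    fun_prop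
  · have := hasDerivAt_iff_tendsto_slope.1 (hder t ht w hw him)
    rwa [hsl] at this

end

/-! ### The two families -/

section
variable {u : ℝ → ℂ} {T : ℝ} {c : ℂ} {k : L2} {f₁ f₂ : ℝ → L2} (F : Families u T c k f₁ f₂)
include F

theorem Families.isFam {e : ℂ} {f : ℝ → L2} (hf : ∀ t < T, IsPart u c k e t (f t)) :
    IsFam u T (upPart u c k e f) fun s => bdF s (e + conj e * c) (tailM u c k e s (f s)) where
  bd s hs := (hf s hs).hasBdVal F.unim F.kern
  bound _ ht _ := exists_upPart_bound F.unim F.kern F.comp hf ht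

theorem Families.continuousAt_ham (h3 : ∀ t < T, CondK3 u t) (h4 : ∀ t < T, CondK4 u t) {t : ℝ}
    (ht : t < T) : ContinuousAt (hamAlpha u) t ∧ ContinuousAt (hamBeta u) t ∧
      ContinuousAt (hamGamma u) t := by
  have h1 : ContinuousAt (diagVal (Phi u)) t := HasDiagValue.continuousAt (by
    filter_upwards [Iio_mem_nhds ht] with s hs
    exact ⟨(F.hasDiagValue_phi hs (h3 s hs)).1, (F.isSolution_phi hs).1.locallyIntegrable⟩)
  have h2 : ContinuousAt (diagVal (Psi u)) t := HasDiagValue.continuousAt (by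
    filter_upwards [Iio_mem_nhds ht] with s hs
    exact ⟨(F.hasDiagValue_psi hs (h3 s hs)).1, (F.isSolution_psi hs).1.locallyIntegrable⟩)
  have hm := h1.mul (Complex.continuous_conj.continuousAt.comp h2)
  have hre := Complex.continuous_re.continuousAt.comp hm
  have hne := F.re_ne_zero ht (h3 t ht) (h4 t ht)
  exact ⟨(h1.norm.pow 2).div hre hne, (Complex.continuous_im.continuousAt.comp hm).div hre hne,
    (h2.norm.pow 2).div hre hne⟩

theorem Families.integral_psi {t : ℝ} (ht : t < T) (h : ℝ → ℂ) :
    (fun x => Psi u t x * h x) =ᵐ[volume] fun x => solFun u c k 1 t (f₁ t) x * h x := by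
  filter_upwards [F.psi_eq ht (F.isSolution_psi ht)] with x hx
  rw [hx]

theorem Families.integral_phi {t : ℝ} (ht : t < T) (h : ℝ → ℂ) : (fun x => Phi u t x * h x) =ᵐ[volume]
    fun x => -I * (solFun u c k I t (f₂ t) x * h x) := by
  filter_upwards [F.phi_eq ht (F.isSolution_phi ht)] with x hx
  rw [← hx]
  linear_combination Phi u t x * h x * Complex.I_sq

end

theorem coeffMat_mulVec (u : ℝ → ℂ) (t : ℝ) (v w : ℂ) : (coeffMat u t).mulVec ![v, w] =
    ![((-hamBeta u t : ℝ) : ℂ) * v + ((-hamGamma u t : ℝ) : ℂ) * w,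
      (hamAlpha u t : ℂ) * v + (hamBeta u t : ℂ) * w] := by
  ext i
  fin_cases i <;> simp [coeffMat, Ham, Matrix.mulVec, dotProduct, Fin.sum_univ_two, Matrix.mul_apply,
    add_comm]

theorem hasDerivAt_vec {f g : ℝ → ℂ} {a b : ℂ} {t : ℝ} (hf : HasDerivAt f a t)
    (hg : HasDerivAt g b t) : HasDerivAt (fun s => ![f s, g s]) ![a, b] t := by
  refine hasDerivAt_pi.2 fun i => ?_
  fin_cases i
  exacts [hf, hg]

end UniSys

end

/-- `𝒜 t`, `ℬ t` are the tempered distributions on the real line, `a t`, `b t` their densities, and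
`A t`, `B t` their meromorphic extensions (in normal form, so that values at removable
singularities are the analytic ones). -/
theorem theorem2p1 (u : ℝ → ℂ) (D : Set ℂ) (U : ℂ → ℂ) (hu : IsUloc u D U)
    (T : ℝ) (hK1 : ∀ t < T, compressionNorm u t < 1)
    (hK2 : ∀ t < T, CondK2 u t) (hK3 : ∀ t < T, CondK3 u t) (hK4 : ∀ t < T, CondK4 u t) :
    -- the functions `Φ` and `Ψ` are well defined
    (∀ t < T, IsSolution u 1 t (Phi u t) ∧ IsSolution u (-1) t (Psi u t) ∧
      (∀ f, IsSolution u 1 t f → f =ᵐ[volume] Phi u t) ∧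
      (∀ f, IsSolution u (-1) t f → f =ᵐ[volume] Psi u t)) ∧
    (∃ (𝒜 ℬ : ℝ → TemperedDistribution ℝ ℂ) (a b : ℝ → ℝ → ℂ) (A B : ℝ → ℂ → ℂ),
      -- (1) tempered distributions `𝒜 = -(iz/2) F(1 - P_t)Ψ` and `-iℬ = -(iz/2) F(1 - P_t)Φ`
      (∀ t < T, ∀ g : 𝓢(ℝ, ℂ),
        𝒜 t g = ∫ x in Ici t, Psi u t x * fourierS (mulS (fun z => -(Complex.I * z / 2)) g) x ∧
        -Complex.I * ℬ t g =
          ∫ x in Ici t, Phi u t x * fourierS (mulS (fun z => -(Complex.I * z / 2)) g) x) ∧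
      -- they are given by functions on the real line
      (∀ t < T, IsTempered (a t) ∧ IsTempered (b t) ∧
        ∀ g : 𝓢(ℝ, ℂ), 𝒜 t g = ∫ x, a t x * g x ∧ ℬ t g = ∫ x, b t x * g x) ∧
      -- (2) meromorphic extensions, holomorphic in the upper half-plane
      (∀ t < T, MeromorphicNFOn (A t) ((upperHP ∪ D) \ realLine) ∧
        MeromorphicNFOn (B t) ((upperHP ∪ D) \ realLine) ∧
        DifferentiableOn ℂ (A t) upperHP ∧ DifferentiableOn ℂ (B t) upperHP ∧
        (∀ z ∈ upperHP,
          IntegrableOn (fun x : ℝ => Psi u t x * Complex.exp (Complex.I * z * x)) (Ici t) ∧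
          IntegrableOn (fun x : ℝ => Phi u t x * Complex.exp (Complex.I * z * x)) (Ici t) ∧
          A t z = -(Complex.I * z / 2) *
            ∫ x in Ici t, Psi u t x * Complex.exp (Complex.I * z * x) ∧
          -Complex.I * B t z = -(Complex.I * z / 2) *
            ∫ x in Ici t, Phi u t x * Complex.exp (Complex.I * z * x)) ∧
        (∀ x : ℝ, ContinuesAt U x → AnalyticAt ℂ (A t) x ∧ AnalyticAt ℂ (B t) x)) ∧
      -- (3) non-tangential boundary values from both half-planes
      (∀ t < T, ∀ᵐ x : ℝ, NTLim (A t) x (a t x) ∧ NTLim (B t) x (b t x)) ∧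
      -- (4) functional equations, off the real line and on it
      (∀ t < T,
        (∀ z ∈ D \ realLine, AnalyticAt ℂ U z →
          (AnalyticAt ℂ (A t) (conj z) → A t z = U z * conj (A t (conj z))) ∧
          (AnalyticAt ℂ (B t) (conj z) → B t z = U z * conj (B t (conj z)))) ∧
        ∀ᵐ x : ℝ, a t x = u x * conj (a t x) ∧ b t x = u x * conj (b t x)) ∧
      -- (5) continuity in `t`, pointwise and as tempered distributions on the real line
      (∀ t < T,
        (∀ z ∈ upperHP ∪ D,
          (NonSingular U A t z → ContinuousAt (fun s => A s z) t) ∧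
          (NonSingular U B t z → ContinuousAt (fun s => B s z) t)) ∧
        ∀ g : 𝓢(ℝ, ℂ), ContinuousAt (fun s => 𝒜 s g) t ∧ ContinuousAt (fun s => ℬ s g) t) ∧
      -- (6) the first order system, pointwise and as tempered distributions on the real line
      (∀ t < T,
        (∀ z ∈ upperHP ∪ D, NonSingular U A t z → NonSingular U B t z →
          HasDerivAt (fun s => ![A s z, B s z])
            (-(z • (coeffMat u t).mulVec ![A t z, B t z])) t) ∧
        ∀ g : 𝓢(ℝ, ℂ),
          HasDerivAt (fun s => ![𝒜 s g, ℬ s g])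
            (-((coeffMat u t).mulVec
              ![𝒜 t (mulS (fun z => (z : ℂ)) g), ℬ t (mulS (fun z => (z : ℂ)) g)])) t)) ∧
    -- the formulas for the entries of the Hamiltonian
    (∀ t < T,
      HasDiagValue (Phi u) t (diagVal (Phi u) t) ∧ HasDiagValue (Psi u) t (diagVal (Psi u) t) ∧
      (diagVal (Phi u) t * conj (diagVal (Psi u) t)).re ≠ 0 ∧
      hamAlpha u t = 1 / (diagVal (Psi u) t / diagVal (Phi u) t).re ∧
      hamBeta u t = (diagVal (Phi u) t / diagVal (Psi u) t).im /
        (diagVal (Phi u) t / diagVal (Psi u) t).re ∧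
      hamBeta u t = -((diagVal (Psi u) t / diagVal (Phi u) t).im /
        (diagVal (Psi u) t / diagVal (Phi u) t).re) ∧
      hamGamma u t = 1 / (diagVal (Phi u) t / diagVal (Psi u) t).re) ∧
    -- (7) the Hamiltonian is symmetric of determinant one, and diagonal if `u` is symmetric
    (∀ t < T, (Ham u t).det = 1 ∧ (Ham u t).IsSymm ∧ (IsSymmetricU u → (Ham u t).IsDiag)) := by
  obtain ⟨c, k, f₁, f₂, F⟩ := exists_families hu hK1
  have hre : ∀ t < T, _ := fun t ht => F.re_ne_zero ht (hK3 t ht) (hK4 t ht)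
  refine ⟨fun t ht => ⟨F.isSolution_phi ht, F.isSolution_psi ht, fun f hf => F.phi_unique ht hf,
    fun f hf => F.psi_unique ht hf⟩, ?_, fun t ht => ⟨(F.hasDiagValue_phi ht (hK3 t ht)).1,
    (F.hasDiagValue_psi ht (hK3 t ht)).1, hre t ht, ham_formulas (hre t ht)
      (F.hasDiagValue_phi ht (hK3 t ht)).2 (F.hasDiagValue_psi ht (hK3 t ht)).2⟩,
    fun t ht => ⟨ham_det (hre t ht), ham_isSymm, fun hs => ?_⟩⟩
  swap
  · have h0 := F.ham_isDiag hs ht (hK3 t ht)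
    intro i j hij
    fin_cases i <;> fin_cases j <;> simp_all [Ham]
  have hfam₁ := F.isFam F.part₁
  have hfam₂ := F.isFam F.part₂
  choose 𝒜 h𝒜 using fun t =>
    (isTempered_density (u := u) (c := c) (k := k) (e := 1) (t := t) (f := f₁ t)).exists_distribution
  choose ℬ hℬ using fun t => (isTempered_density (u := u) (c := c) (k := k) (e := Complex.I) (t := t)
    (f := f₂ t)).exists_distribution
  have hode₁ := fun s hs (w : ℂ) hw => hasDerivAt_upPart F.unim F.kern F.comp F.part₁ F.part₁ F.part₂ hs
    (hK4 s hs) (F.hasDiagValue₁ hs (hK3 s hs)) (F.hasDiagValue₁ hs (hK3 s hs))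
    (F.hasDiagValue₂ hs (hK3 s hs)) (ham_relations (hre s hs)).1 (z := w) hw
  have hode₂ := fun s hs (w : ℂ) hw => hasDerivAt_upPart F.unim F.kern F.comp F.part₂ F.part₁ F.part₂ hs
    (hK4 s hs) (F.hasDiagValue₂ hs (hK3 s hs)) (F.hasDiagValue₁ hs (hK3 s hs))
    (F.hasDiagValue₂ hs (hK3 s hs)) (ham_relations (hre s hs)).2 (z := w) hw
  have hdist : ∀ t < T, ∀ g : 𝓢(ℝ, ℂ), _ ∧ _ := fun t ht g =>
    ⟨hasDerivAt_integral_density F.unim F.kern F.comp F.part₁ F.part₁ F.part₂ ht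
      (hK4 t ht) (F.hasDiagValue₁ ht (hK3 t ht)) (F.hasDiagValue₁ ht (hK3 t ht))
      (F.hasDiagValue₂ ht (hK3 t ht)) (ham_relations (hre t ht)).1 g,
    hasDerivAt_integral_density F.unim F.kern F.comp F.part₂ F.part₁ F.part₂ ht
      (hK4 t ht) (F.hasDiagValue₂ ht (hK3 t ht)) (F.hasDiagValue₁ ht (hK3 t ht))
      (F.hasDiagValue₂ ht (hK3 t ht)) (ham_relations (hre t ht)).2 g⟩
  simp only [← h𝒜, ← hℬ] at hdist
  refine ⟨𝒜, ℬ, fun t => density u c k 1 t (f₁ t), fun t => density u c k Complex.I t (f₂ t),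
    fun t => extF U D (upPart u c k 1 f₁ t), fun t => extF U D (upPart u c k Complex.I f₂ t),
    fun t ht g => ⟨?_, ?_⟩, fun t _ => ⟨isTempered_density, isTempered_density, fun g => ⟨h𝒜 t g, hℬ t g⟩⟩,
    fun t ht => ⟨(hfam₁.bd t ht).meromorphicNFOn, (hfam₂.bd t ht).meromorphicNFOn,
      fun z hz => ((hfam₁.bd t ht).analyticAt_upper hz).differentiableAt.differentiableWithinAt,
      fun z hz => ((hfam₂.bd t ht).analyticAt_upper hz).differentiableAt.differentiableWithinAt,
      fun z hz => ?_, fun x hx => ⟨(hfam₁.bd t ht).analyticAt_real hu hx,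
        (hfam₂.bd t ht).analyticAt_real hu hx⟩⟩, fun t ht => ?_,
    fun t ht => ⟨fun z hz hU => ⟨(hfam₁.bd t ht).functional_eq hu hz.1 hz.2 hU,
      (hfam₂.bd t ht).functional_eq hu hz.1 hz.2 hU⟩, ?_⟩,
    fun t ht => ⟨fun z hz => ⟨hfam₁.continuousAt hu ht (fun w hw => (hode₁ t ht w hw).continuousAt) hz,
      hfam₂.continuousAt hu ht (fun w hw => (hode₂ t ht w hw).continuousAt) hz⟩,
      fun g => ⟨(hdist t ht g).1.continuousAt, (hdist t ht g).2.continuousAt⟩⟩,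
    fun t ht => ⟨fun z hz hA hB => ?_, fun g => ?_⟩⟩
  · rw [h𝒜, ← (F.part₁ t ht).integral_density]
    exact (integral_congr_ae (ae_restrict_of_ae (F.integral_psi ht _))).symm
  · rw [hℬ, ← (F.part₂ t ht).integral_density, ← integral_const_mul]
    exact (integral_congr_ae (ae_restrict_of_ae (F.integral_phi ht _))).symm
  · have e1 := ae_restrict_of_ae (s := Ici t)
      (F.integral_psi ht fun x => Complex.exp (Complex.I * z * x))
    have e2 := ae_restrict_of_ae (s := Ici t)
      (F.integral_phi ht fun x => Complex.exp (Complex.I * z * x))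
    obtain ⟨i1, v1⟩ := (F.part₁ t ht).integrableOn_exp hz
    obtain ⟨i2, v2⟩ := (F.part₂ t ht).integrableOn_exp hz
    have hz' : 0 < z.im := hz
    refine ⟨i1.congr (EventuallyEq.symm e1), (i2.const_mul _).congr (EventuallyEq.symm e2), ?_, ?_⟩
    · beta_reduce
      rw [integral_congr_ae e1, extF, if_pos hz', ← v1]
    · beta_reduce
      rw [integral_congr_ae e2, integral_const_mul, extF, if_pos hz']
      linear_combination -Complex.I * v2
  · filter_upwards [(hfam₁.bd t ht).ae_ntlim hu, (hfam₂.bd t ht).ae_ntlim hu,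
      density_eq_bdF (u := u) (c := c) (k := k) (e := 1) (t := t) (f := f₁ t),
      density_eq_bdF (u := u) (c := c) (k := k) (e := Complex.I) (t := t) (f := f₂ t)] with x h1 h2 h3 h4
    rw [h3, h4]
    exact ⟨h1, h2⟩
  · filter_upwards [density_ae F.unim F.kern (e := 1) (t := t) (f := f₁ t),
      density_ae F.unim F.kern (e := Complex.I) (t := t) (f := f₂ t)] with x h1 h2
    exact ⟨h1, h2⟩
  · obtain ⟨hα, hβ, hγ⟩ := F.continuousAt_ham hK3 hK4 ht
    rw [coeffMat_mulVec]
    convert hasDerivAt_vec (hfam₁.hasDerivAt hu ht hfam₁ hfam₂ hβ.neg hγ.neg hode₁ hz hA hA hB)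
      (hfam₂.hasDerivAt hu ht hfam₁ hfam₂ hα hβ hode₂ hz hB hA hB) using 1
    ext i
    fin_cases i <;> simp
  · rw [coeffMat_mulVec]
    convert hasDerivAt_vec (hdist t ht g).1 (hdist t ht g).2 using 1
    ext i
    fin_cases i <;> simp
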